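/- **Setting.** Let $\rho>0$, let $K\ge 3$ be an integer, $0\le\nu<\tfrac12$, $s>\tfrac12$, $0<\gamma\le1$, and let $\phi,\psi:\mathbb R\to\mathbb R$ be bounded even filter functions with $\phi(0)=\psi(0)=1$ and $\psi(\xi)=\operatorname{sinc}(\xi)\phi(\xi)$. For an integer $M\ge K$ write $\equiv$ for congruence modulo $2M$; indices $j\in\{-M,\dots,M-1\}$ are taken modulo $2M$ (so that index $M$ means index $-M$), and $|j|$ always refers to the representative in this range. Put $\omega_j=\sqrt{j^2+\rho}$, $\sigma_j=\max(|j|,1)^{2s}$, $e(0)=2$, $e(j)=|j|$ for $0<|j|<K$, $e(j)=K$ for $|j|\ge K$. For $\mathbf k=(k_0,\dots,k_M)\in\mathbb Z^{M+1}$ put $\mathbf k\cdot\boldsymbol\omega=\sum_{l=0}^M k_l\omega_l$, $\mu(\mathbf k)=\sum_{l=0}^M|k_l|e(l)$, $m(j,\mathbf k)=\max(e(j),\max_{l:k_l\ne0}e(l))$; let $\langle j\rangle$ be the $|j|$-th unit vector of $\mathbb Z^{M+1}$, and $$\mathcal K=\{(j,\mathbf k):\max(|j|,\mu(\mathbf k))<2K,\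 k_l=0\text{ for all } l\ge K\}\cup\{(j,\pm\langle (j-r)\bmod 2M\rangle+\mathbf k): |(j-r)\bmod 2M|\ge K,\ |r|<K,\ \mu(\mathbf k)<K\},$$ $\mathcal K_j=\{\mathbf k:(j,\mathbf k)\in\mathcal K\}$. *Method.* For a step-size $\tau>0$, put $t_n=n\tau$. Given $\mathbf u^0,\dot{\mathbf u}^0\in\mathbb C^{2M}$ that are real-valued in the sense $u^0_{-j}=\overline{u^0_j}$, $\dot u^0_{-j}=\overline{\dot u^0_j}$, let $g_j(\mathbf u)=\sum_{j_1+j_2\equiv j}\phi(\tau\omega_{j_1})u_{j_1}\phi(\tau\omega_{j_2})u_{j_2}$ and let $\mathbf u^n,\dot{\mathbf u}^n$ be the numerical solution of $\partial_{tt}u-\partial_{xx}u+\rho u=u^2$ given by $$u_j^{n+1}-2\cos(\tau\omega_j)u_j^n+u_j^{n-1}=\tau^2\psi(\tau\omega_j)g_j(\mathbf u^n)\quad (n\ge 1),$$ $$u_j^1=\cos(\tau\omega_j)u_j^0+\tau\operatorname{sinc}(\tau\omega_j)\dot u_j^0+\tfrac12\tau^2\psi(\tau\omega_j)g_j(\mathbf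 u^0),\qquad 2\tau\operatorname{sinc}(\tau\omega_j)\dot u_j^n=u_j^{n+1}-u_j^{n-1}\quad(n\ge1).$$ The mode energies are $E_j^n=\tfrac12|\omega_ju_j^n|^2+\tfrac12|\dot u_j^n|^2$. *Non-resonance condition (for $\varepsilon>0$).* For both signs, $|\sin(\tfrac12\tau(\omega_j\pm\mathbf k\cdot\boldsymbol\omega))|\ge\gamma\tau\varepsilon^{\nu/2}$ for all $(j,\mathbf k)\in\mathcal K$ with $\mathbf k\ne\mp\langle j\rangle$, and $|\sin(\tfrac12\tau(\omega_j\pm\mathbf k\cdot\boldsymbol\omega))|\ge\gamma\tau$ for all $(j,\mathbf k)\in\mathcal K$ with $\mathbf k\ne\langle j\rangle$, $\mathbf k\ne-\langle j\rangle$, $|j|\le K$. *Modulation functions.* Let $\delta=\varepsilon^{1/2}$. For $(j,\mathbf k)\in\mathcal K$ let $z_{j,m}^{\mathbf k}$, $m\le 2K-1$, be the polynomials that vanish for $m<m(j,\mathbf k)$ and are determined recursively in $m$ by the following equations. For $m(j,\mathbf k)\le m\le2K-1$ and all $x$, $$\mathrm e^{\mathrm i(\mathbf k\cdot\boldsymbol\omega)\tau}z_{j,m}^{\mathbf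 k}(x+\delta^\nu\tau)-2\cos(\tau\omega_j)z_{j,m}^{\mathbf k}(x)+\mathrm e^{-\mathrm i(\mathbf k\cdot\boldsymbol\omega)\tau}z_{j,m}^{\mathbf k}(x-\delta^\nu\tau)$$ $$=\tau^2\psi(\tau\omega_j)\sum_{j_1+j_2\equiv j}\ \sum_{\mathbf k^1+\mathbf k^2=\mathbf k}\delta^{2(m(j_1,\mathbf k^1)+m(j_2,\mathbf k^2)-m(j,\mathbf k))\nu}\sum_{m_1+m_2=m}\phi(\tau\omega_{j_1})z_{j_1,m_1}^{\mathbf k^1}(x)\,\phi(\tau\omega_{j_2})z_{j_2,m_2}^{\mathbf k^2}(x)$$ (with $\mathbf k^i\in\mathcal K_{j_i}$), and, for $e(j)\le m\le2K-1$, $$\sum_{\mathbf k\in\mathcal K_j}\delta^{2(m(j,\mathbf k)-e(j))\nu}z_{j,m}^{\mathbf k}(0)=\delta^{-e(j)}u_j^0,$$ $$\sum_{\mathbf k\in\mathcal K_j}\delta^{2(m(j,\mathbf k)-e(j))\nu}\bigl(\mathrm e^{\mathrm i(\mathbf k\cdot\boldsymbol\omega)\tau}z_{j,m}^{\mathbf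 k}(\delta^\nu\tau)-\mathrm e^{-\mathrm i(\mathbf k\cdot\boldsymbol\omega)\tau}z_{j,m}^{\mathbf k}(-\delta^\nu\tau)\bigr)=2\tau\operatorname{sinc}(\tau\omega_j)\delta^{-e(j)}\dot u_j^0$$ if $m=e(j)$, and the same two equations with right-hand sides $0$ if $m>e(j)$. Put $z_j^{\mathbf k}=\delta^{m(j,\mathbf k)}\sum_{m=m(j,\mathbf k)}^{2K-1}\delta^{(m-m(j,\mathbf k))(1-2\nu)}z_{j,m}^{\mathbf k}$. The almost-invariant energies are, for $l=0,\dots,M$, $$\mathcal E_l(t)=-\frac{\mathrm i}2\sum_{j=-M}^{M-1}\sum_{\mathbf k\in\mathcal K_j}\frac{k_l\omega_l}{\tau\operatorname{sinc}(\tau\omega_j)}\,z_{-j}^{-\mathbf k}(\varepsilon^{\nu/2}t)\,\mathrm e^{\mathrm i(\mathbf k\cdot\boldsymbol\omega)\tau}z_j^{\mathbf k}(\varepsilon^{\nu/2}(t+\tau)).$$ **Theorem.** For every $\mathcal C_0$ there is a constant $\mathcal C>0$ (depending only on $\mathcal C_0$, $K$, $\nu$, $s$, $\gamma$, $\rho$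 and the filter functions) such that for every $C_0$ there is $\eta>0$ (depending in addition on $C_0$) with the following property. Let $M\ge K$, $\tau>0$ and $\varepsilon>0$ satisfy $\varepsilon^{1-2\nu}\le\eta$ and the non-resonance condition, and let the real-valued initial data satisfy $\sum_{l=0}^M\sigma_l\varepsilon^{-e(l)}E_l^0\le C_0$. If $$\sum_{l=0}^M\sigma_l\varepsilon^{-e(l)}|\mathcal E_l(t_n)|\le\mathcal C_0\qquad\text{for all } 0\le t_n=n\tau\le1,$$ then, for all $0\le t_n=n\tau\le1$, $$\sum_{l=0}^M\sigma_l\varepsilon^{-e(l)}E_l^n\le\mathcal C\qquad\text{and}\qquad \varepsilon^{-e(1)}\,|E_1^n-\mathcal E_1(t_n)|\le\mathcal C\,\varepsilon^{1-2\nu}\qquad(e(1)=1).$$ In particular $\mathcal C$ is independent of $C_0$, $\varepsilon$, $\tau$ and $M$ once $\varepsilon^{1-2\nu}$ is sufficiently small. -/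

import Mathlib

open scoped Polynomial

noncomputable section

namespace TrigInt

/-! Spatial indices `j ∈ {-M, …, M-1}` are taken modulo `2M`, so they are elements of
`ZMod (2 * M)`; the classes of `M` and `-M` agree.  The integer vectors
`k = (k_0, …, k_M)` are functions `Fin (M + 1) → ℤ`. -/

/-- `|j|`, for the representative of `j` of smallest absolute value; it lies in `{0, …, M}`. -/
def idx {M : ℕ} (j : ZMod (2 * M)) : ℕ := j.valMinAbs.natAbs

/-- The frequencies `ω_j = √(j² + ρ)`, as a function of `|j|`. -/
def freq (ρ : ℝ) (n : ℕ) : ℝ := Real.sqrt ((n : ℝ) ^ 2 + ρ)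

/-- The energy profile `e(j)`, as a function of `|j|`. -/
def profile (K n : ℕ) : ℕ := if n = 0 then 2 else if n < K then n else K

/-- The weights `σ_j = max(|j|, 1)^{2s}`, as a function of `|j|`. -/
def weight (s : ℝ) (n : ℕ) : ℝ := (max (n : ℝ) 1) ^ (2 * s)

/-- `k · ω = ∑_{l=0}^M k_l ω_l`. -/
def kdot {M : ℕ} (ρ : ℝ) (k : Fin (M + 1) → ℤ) : ℝ := ∑ l, (k l : ℝ) * freq ρ l

/-- `μ(k) = ∑_{l=0}^M |k_l| e(l)`. -/
def mu {M : ℕ} (K : ℕ) (k : Fin (M + 1) → ℤ) : ℕ := ∑ l, (k l).natAbs * profile K l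

/-- `⟨j⟩`, the `|j|`-th unit vector. -/
def unitVec {M : ℕ} (j : ZMod (2 * M)) : Fin (M + 1) → ℤ :=
  fun l => if (l : ℕ) = idx j then 1 else 0

/-- The index set `𝒦` (as a relation between `j` and `k`). -/
def InK {M : ℕ} (K : ℕ) (j : ZMod (2 * M)) (k : Fin (M + 1) → ℤ) : Prop :=
  (max (idx j) (mu K k) < 2 * K ∧ ∀ l : Fin (M + 1), K ≤ (l : ℕ) → k l = 0) ∨
  ∃ (r : ℤ) (k' : Fin (M + 1) → ℤ), |r| < (K : ℤ) ∧ K ≤ idx (j - (r : ZMod (2 * M))) ∧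
    mu K k' < K ∧ (k = unitVec (j - (r : ZMod (2 * M))) + k' ∨
      k = -unitVec (j - (r : ZMod (2 * M))) + k')

open Classical in
/-- `𝒦_j = {k : (j, k) ∈ 𝒦}` as a finite set; the restriction to the box `|k_l| ≤ 2K` is no
restriction, see `mem_setK`. -/
def setK {M : ℕ} (K : ℕ) (j : ZMod (2 * M)) : Finset (Fin (M + 1) → ℤ) :=
  (Fintype.piFinset fun _ => Finset.Icc (-(2 * K : ℤ)) (2 * K)).filter (InK K j)

theorem natAbs_le_mu {M K : ℕ} (hK : 0 < K) (k : Fin (M + 1) → ℤ) (l : Fin (M + 1)) :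
    (k l).natAbs ≤ mu K k := by
  have h1 : 1 ≤ profile K l := by unfold profile; split_ifs <;> omega
  calc (k l).natAbs ≤ (k l).natAbs * profile K l := Nat.le_mul_of_pos_right _ h1
    _ ≤ mu K k := Finset.single_le_sum (f := fun l : Fin (M + 1) => (k l).natAbs * profile K l)
        (fun _ _ => Nat.zero_le _) (Finset.mem_univ l)

theorem mem_setK {M K : ℕ} (j : ZMod (2 * M)) (k : Fin (M + 1) → ℤ) :
    k ∈ setK K j ↔ InK K j k := by
  classical
  unfold setK
  rw [Finset.mem_filter, Fintype.mem_piFinset]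
  refine ⟨fun h => h.2, fun h => ⟨fun l => ?_, h⟩⟩
  rw [Finset.mem_Icc]
  rcases h with ⟨h, -⟩ | ⟨r, k', -, -, h, h' | h'⟩
  · have := natAbs_le_mu (K := K) (by omega) k l
    omega
  all_goals
    have h2 := natAbs_le_mu (K := K) (by omega) k' l
    have h3 : unitVec (j - (r : ZMod (2 * M))) l = 0 ∨
        unitVec (j - (r : ZMod (2 * M))) l = 1 := by
      unfold unitVec; split_ifs <;> simp
    rw [h']
    simp only [Pi.add_apply, Pi.neg_apply]
    omega

/-- The non-resonance condition, with constants `ν` and `γ`; the first two conjuncts are the two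
signs of the weak condition, the last one is the strong condition with its two signs. -/
def NonResonant (M K : ℕ) (ρ τ ε ν γ : ℝ) : Prop :=
  ∀ (j : ZMod (2 * M)) (k : Fin (M + 1) → ℤ), InK K j k →
    (k ≠ -unitVec j →
      γ * τ * ε ^ (ν / 2) ≤ |Real.sin (τ * (freq ρ (idx j) + kdot ρ k) / 2)|) ∧
    (k ≠ unitVec j →
      γ * τ * ε ^ (ν / 2) ≤ |Real.sin (τ * (freq ρ (idx j) - kdot ρ k) / 2)|) ∧
    (k ≠ unitVec j → k ≠ -unitVec j → idx j ≤ K →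
      γ * τ ≤ |Real.sin (τ * (freq ρ (idx j) + kdot ρ k) / 2)| ∧
      γ * τ ≤ |Real.sin (τ * (freq ρ (idx j) - kdot ρ k) / 2)|)

/-- Filter functions of a symplectic trigonometric integrator. -/
structure IsSymplecticFilter (φ ψ : ℝ → ℝ) : Prop where
  bounded_phi : ∃ B : ℝ, ∀ x, |φ x| ≤ B
  bounded_psi : ∃ B : ℝ, ∀ x, |ψ x| ≤ B
  even_phi : ∀ x, φ (-x) = φ x
  even_psi : ∀ x, ψ (-x) = ψ x
  phi_zero : φ 0 = 1
  psi_zero : ψ 0 = 1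
  symplectic : ∀ x, ψ x = Real.sinc x * φ x

/-- Fourier coefficients of a trigonometric polynomial with real values in the collocation
points. -/
def IsRealValued {M : ℕ} (v : ZMod (2 * M) → ℂ) : Prop :=
  ∀ j, v (-j) = (starRingEnd ℂ) (v j)

/-- The nonlinearity `(Φ u) ∗ (Φ u)`, where `∗` is the discrete convolution modulo `2M`. -/
def nonlin {M : ℕ} [NeZero M] (ρ τ : ℝ) (φ : ℝ → ℝ) (u : ZMod (2 * M) → ℂ) (j : ZMod (2 * M)) : ℂ :=
  ∑ i : ZMod (2 * M), ((φ (τ * freq ρ (idx i)) : ℂ) * u i) *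
    ((φ (τ * freq ρ (idx (j - i))) : ℂ) * u (j - i))

/-- The numerical solution `u_j^n` of the trigonometric integrator with initial values
`u_j^0`, `v_j^0` (`v` for the velocity). -/
def sol {M : ℕ} [NeZero M] (ρ τ : ℝ) (φ ψ : ℝ → ℝ) (u₀ v₀ : ZMod (2 * M) → ℂ) :
    ℕ → ZMod (2 * M) → ℂ
  | 0 => u₀
  | 1 => fun j => (Real.cos (τ * freq ρ (idx j)) : ℂ) * u₀ j
      + (τ : ℂ) * (Real.sinc (τ * freq ρ (idx j)) : ℂ) * v₀ j
      + 1 / 2 * (τ : ℂ) ^ 2 * (ψ (τ * freq ρ (idx j)) : ℂ) * nonlin ρ τ φ u₀ j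
  | n + 2 => fun j => 2 * (Real.cos (τ * freq ρ (idx j)) : ℂ) * sol ρ τ φ ψ u₀ v₀ (n + 1) j
      - sol ρ τ φ ψ u₀ v₀ n j
      + (τ : ℂ) ^ 2 * (ψ (τ * freq ρ (idx j)) : ℂ) * nonlin ρ τ φ (sol ρ τ φ ψ u₀ v₀ (n + 1)) j

/-- The velocity approximation of the numerical solution. -/
def vel {M : ℕ} [NeZero M] (ρ τ : ℝ) (φ ψ : ℝ → ℝ) (u₀ v₀ : ZMod (2 * M) → ℂ) :
    ℕ → ZMod (2 * M) → ℂ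
  | 0 => v₀
  | n + 1 => fun j => (sol ρ τ φ ψ u₀ v₀ (n + 2) j - sol ρ τ φ ψ u₀ v₀ n j) /
      (2 * (τ : ℂ) * (Real.sinc (τ * freq ρ (idx j)) : ℂ))

/-- The mode energies `E_j^n`. -/
def modeEnergy {M : ℕ} [NeZero M] (ρ τ : ℝ) (φ ψ : ℝ → ℝ) (u₀ v₀ : ZMod (2 * M) → ℂ)
    (n : ℕ) (j : ZMod (2 * M)) : ℝ :=
  1 / 2 * ‖(freq ρ (idx j) : ℂ) * sol ρ τ φ ψ u₀ v₀ n j‖ ^ 2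
    + 1 / 2 * ‖vel ρ τ φ ψ u₀ v₀ n j‖ ^ 2

/-- `∑_{l=0}^M σ_l ε^{-e(l)} E_l^n`. -/
def weightedEnergy {M : ℕ} [NeZero M] (K : ℕ) (ρ τ ε s : ℝ) (φ ψ : ℝ → ℝ)
    (u₀ v₀ : ZMod (2 * M) → ℂ) (n : ℕ) : ℝ :=
  ∑ l : Fin (M + 1), weight s l * ε ^ (-(profile K l : ℝ)) *
    modeEnergy ρ τ φ ψ u₀ v₀ n ((l : ℕ) : ZMod (2 * M))

/-- `m(j, k) = max(e(j), max_{l : k_l ≠ 0} e(l))`. -/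
def order {M : ℕ} (K : ℕ) (j : ZMod (2 * M)) (k : Fin (M + 1) → ℤ) : ℕ :=
  max (profile K (idx j)) ((Finset.univ.filter fun l => k l ≠ 0).sup fun l => profile K (l : ℕ))

/-- The construction of the modulation coefficient functions: the polynomials
`z j k m = z_{j,m}^k`, `(j, k) ∈ 𝒦`, `m ≤ 2K - 1`, vanish for `m < m(j, k)` and solve, with
`δ = √ε`, the modulation system and the initial conditions at order `m` in powers of
`δ^{1-2ν}`.  The shifts by `± δ^ν τ = ± ε^{ν/2} τ` are the sums of the (finite) Taylor expansions of the
polynomials.  Under the non-resonance condition these equations determine the polynomials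
recursively in `m`; see `exists_isModulation` for the existence of a solution. -/
structure IsModulation {M : ℕ} [NeZero M] (K : ℕ) (ρ τ ε ν : ℝ) (φ ψ : ℝ → ℝ)
    (u₀ v₀ : ZMod (2 * M) → ℂ) (z : ZMod (2 * M) → (Fin (M + 1) → ℤ) → ℕ → ℂ[X]) : Prop where
  zero_of_lt : ∀ j, ∀ k ∈ setK K j, ∀ m < order K j k, z j k m = 0
  system : ∀ j, ∀ k ∈ setK K j, ∀ m, order K j k ≤ m → m < 2 * K → ∀ x : ℝ,
    Complex.exp (Complex.I * kdot ρ k * τ) * (z j k m).eval ((x + ε ^ (ν / 2) * τ : ℝ) : ℂ)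
      - 2 * (Real.cos (τ * freq ρ (idx j)) : ℂ) * (z j k m).eval (x : ℂ)
      + Complex.exp (-(Complex.I * kdot ρ k * τ)) * (z j k m).eval ((x - ε ^ (ν / 2) * τ : ℝ) : ℂ)
    = (τ : ℂ) ^ 2 * (ψ (τ * freq ρ (idx j)) : ℂ) *
      ∑ j₁ : ZMod (2 * M), ∑ k₁ ∈ setK K j₁, ∑ k₂ ∈ setK K (j - j₁) with k₁ + k₂ = k,
        ((√ε ^ (2 * ((order K j₁ k₁ : ℝ) + order K (j - j₁) k₂ - order K j k) * ν) : ℝ) : ℂ) *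
          ∑ p ∈ Finset.HasAntidiagonal.antidiagonal m,
            ((φ (τ * freq ρ (idx j₁)) : ℂ) * (z j₁ k₁ p.1).eval (x : ℂ)) *
            ((φ (τ * freq ρ (idx (j - j₁))) : ℂ) * (z (j - j₁) k₂ p.2).eval (x : ℂ))
  init_position : ∀ j : ZMod (2 * M), ∀ m, profile K (idx j) ≤ m → m < 2 * K →
    ∑ k ∈ setK K j, ((√ε ^ (2 * ((order K j k : ℝ) - profile K (idx j)) * ν) : ℝ) : ℂ) *
        (z j k m).eval 0
      = if m = profile K (idx j) then
          ((√ε ^ (-(profile K (idx j) : ℝ)) : ℝ) : ℂ) * u₀ j else 0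
  init_velocity : ∀ j : ZMod (2 * M), ∀ m, profile K (idx j) ≤ m → m < 2 * K →
    ∑ k ∈ setK K j, ((√ε ^ (2 * ((order K j k : ℝ) - profile K (idx j)) * ν) : ℝ) : ℂ) *
        (Complex.exp (Complex.I * kdot ρ k * τ) * (z j k m).eval ((ε ^ (ν / 2) * τ : ℝ) : ℂ)
          - Complex.exp (-(Complex.I * kdot ρ k * τ)) *
            (z j k m).eval ((-(ε ^ (ν / 2) * τ) : ℝ) : ℂ))
      = if m = profile K (idx j) then
          2 * (τ : ℂ) * (Real.sinc (τ * freq ρ (idx j)) : ℂ) *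
            ((√ε ^ (-(profile K (idx j) : ℝ)) : ℝ) : ℂ) * v₀ j else 0

/-- The modulation functions `z_j^k`, assembled from their coefficient functions:
`z_j^k = δ^{m(j,k)} ∑_{m = m(j,k)}^{2K-1} δ^{(m - m(j,k))(1-2ν)} z_{j,m}^k` with `δ = √ε`. -/
def modFun {M : ℕ} (K : ℕ) (ε ν : ℝ) (z : ZMod (2 * M) → (Fin (M + 1) → ℤ) → ℕ → ℂ[X])
    (j : ZMod (2 * M)) (k : Fin (M + 1) → ℤ) : ℂ[X] :=
  Polynomial.C (((√ε ^ order K j k : ℝ)) : ℂ) *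
    ∑ m ∈ Finset.Ico (order K j k) (2 * K),
      Polynomial.C ((√ε ^ (((m : ℝ) - order K j k) * (1 - 2 * ν)) : ℝ) : ℂ) * z j k m

/-- The almost-invariant energies `𝓔_l(t)`. -/
def almostInv {M : ℕ} [NeZero M] (K : ℕ) (ρ τ ε ν : ℝ)
    (z : ZMod (2 * M) → (Fin (M + 1) → ℤ) → ℕ → ℂ[X]) (l : Fin (M + 1)) (t : ℝ) : ℂ :=
  -(Complex.I / 2) * ∑ j : ZMod (2 * M), ∑ k ∈ setK K j,
    ((k l : ℂ) * (freq ρ l : ℂ) / ((τ : ℂ) * (Real.sinc (τ * freq ρ (idx j)) : ℂ))) *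
      (modFun K ε ν z (-j) (-k)).eval ((ε ^ (ν / 2) * t : ℝ) : ℂ) *
      Complex.exp (Complex.I * kdot ρ k * τ) *
      (modFun K ε ν z j k).eval ((ε ^ (ν / 2) * (t + τ) : ℝ) : ℂ)

/-! The construction can be carried out: existence of the modulation coefficient functions. -/

open Polynomial

/-- The difference operator on the left-hand side of the modulation system. -/
def diffOp (a b c h : ℂ) : ℂ[X] →ₗ[ℂ] ℂ[X] :=
  a • (taylor h) - b • LinearMap.id + c • (taylor (-h))

theorem diffOp_eval (a b c h : ℂ) (p : ℂ[X]) (x : ℂ) :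
    (diffOp a b c h p).eval x = a * p.eval (x + h) - b * p.eval x + c * p.eval (x - h) := by
  simp [diffOp, taylor_eval, sub_eq_add_neg]

theorem diffOp_coeff (a b c h : ℂ) (n i : ℕ) :
    (diffOp a b c h (X ^ n)).coeff i =
      (a * h ^ (n - i) + c * (-h) ^ (n - i)) * n.choose i - if i = n then b else 0 := by
  simp only [diffOp, LinearMap.add_apply, LinearMap.sub_apply, LinearMap.smul_apply,
    LinearMap.id_apply, coeff_add, coeff_sub, coeff_smul, smul_eq_mul, coeff_X_pow]
  simp only [taylor_apply, X_pow_comp, coeff_X_add_C_pow]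
  split_ifs <;> ring

theorem surj_of_degree (L : ℂ[X] →ₗ[ℂ] ℂ[X])
    (h : ∀ n : ℕ, ∃ q, (L q).coeff n ≠ 0 ∧ ∀ i, n < i → (L q).coeff i = 0) (p : ℂ[X]) :
    ∃ q, L q = p := by
  suffices H : ∀ n : ℕ, ∀ p : ℂ[X], (∀ i, n ≤ i → p.coeff i = 0) → ∃ q, L q = p from
    H (p.natDegree + 1) p fun i hi => coeff_eq_zero_of_natDegree_lt (by omega)
  intro n
  induction n with
  | zero => exact fun p hp => ⟨0, by ext i; simp [hp i]⟩
  | succ n ih =>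
    intro p hp
    obtain ⟨q, hq, hq'⟩ := h n
    obtain ⟨r, hr⟩ := ih (p - (p.coeff n / (L q).coeff n) • L q) (by
      intro i hi
      rcases hi.eq_or_lt with rfl | hi
      · simp [hq]
      · simp [hq' i hi, hp i hi])
    exact ⟨r + (p.coeff n / (L q).coeff n) • q, by simp [hr]⟩

theorem diffOp_surj (a b c h : ℂ) (hyp : a + c ≠ b ∨ (a + c = b ∧ (a - c) * h ≠ 0)) (p : ℂ[X]) :
    ∃ q, diffOp a b c h q = p := by
  refine surj_of_degree _ (fun n => ?_) p
  rcases hyp with h1 | ⟨h1, h2⟩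
  · refine ⟨X ^ n, ?_, fun i hi => ?_⟩
    · rw [diffOp_coeff]; simpa [sub_eq_zero] using h1
    · rw [diffOp_coeff, Nat.choose_eq_zero_of_lt hi, if_neg (by omega)]; simp
  · refine ⟨X ^ (n + 1), ?_, fun i hi => ?_⟩
    · rw [diffOp_coeff, if_neg (by omega), Nat.choose_succ_self_right]
      have : (a * h ^ (n + 1 - n) + c * (-h) ^ (n + 1 - n)) = (a - c) * h := by
        rw [Nat.add_sub_cancel_left]; ring
      rw [this, sub_zero]
      exact mul_ne_zero h2 (by exact_mod_cast Nat.succ_ne_zero n)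
    · rw [diffOp_coeff]
      rcases (Nat.succ_le_of_lt hi).eq_or_lt with h3 | h3
      · subst h3; simp [h1]
      · rw [Nat.choose_eq_zero_of_lt h3, if_neg (by omega)]; simp

theorem sum_unitVec {M : ℕ} [NeZero M] (j : ZMod (2 * M)) :
    ∃ l : Fin (M + 1), (l : ℕ) = idx j ∧ unitVec j = Pi.single l 1 := by
  have h : idx j ≤ M := by
    have := ZMod.natAbs_valMinAbs_le j
    unfold idx; omega
  refine ⟨⟨idx j, by omega⟩, rfl, ?_⟩
  funext l
  simp only [unitVec, Pi.single_apply, Fin.ext_iff]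

theorem kdot_unitVec {M : ℕ} [NeZero M] (ρ : ℝ) (j : ZMod (2 * M)) :
    kdot ρ (unitVec j) = freq ρ (idx j) := by
  obtain ⟨l, hl, h⟩ := sum_unitVec j
  rw [h, ← hl]
  simp [kdot, Pi.single_apply]

theorem kdot_neg {M : ℕ} (ρ : ℝ) (k : Fin (M + 1) → ℤ) : kdot ρ (-k) = -kdot ρ k := by
  simp [kdot]

theorem order_unitVec {M K : ℕ} [NeZero M] (j : ZMod (2 * M)) :
    order K j (unitVec j) = profile K (idx j) ∧ order K j (-unitVec j) = profile K (idx j) := by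
  obtain ⟨l, hl, h⟩ := sum_unitVec j
  rw [h, ← hl]
  constructor <;>
  · unfold order
    rw [← hl, max_eq_left]
    refine Finset.sup_le fun i hi => ?_
    simp only [Finset.mem_filter, Pi.neg_apply, Pi.single_apply] at hi
    split_ifs at hi with h3
    · rw [h3]
    · simp at hi

theorem one_le_profile {K : ℕ} (hK : 0 < K) (n : ℕ) : 1 ≤ profile K n := by
  unfold profile; split_ifs <;> omega

theorem mem_unitVec {M K : ℕ} [NeZero M] (hK : 2 ≤ K) (j : ZMod (2 * M)) :
    unitVec j ∈ setK K j ∧ -unitVec j ∈ setK K j := by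
  rw [mem_setK, mem_setK]
  rcases lt_or_ge (idx j) K with h | h
  · obtain ⟨l, hl, h1⟩ := sum_unitVec j
    have hp : profile K l < 2 * K := by unfold profile; split_ifs <;> omega
    have hmu : ∀ k : Fin (M + 1) → ℤ, k = Pi.single l 1 ∨ k = -Pi.single l 1 →
        mu K k = profile K l := by
      intro k hk
      unfold mu
      rw [Finset.sum_eq_single l]
      · rcases hk with rfl | rfl <;> simp
      · intro i _ hi; rcases hk with rfl | rfl <;> simp [hi]
      · simp
    rw [h1]
    refine ⟨Or.inl ⟨?_, fun i hi => ?_⟩, Or.inl ⟨?_, fun i hi => ?_⟩⟩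
    · rw [hmu _ (Or.inl rfl)]; omega
    · have : i ≠ l := by rintro rfl; omega
      simp [this]
    · rw [hmu _ (Or.inr rfl)]; omega
    · have : i ≠ l := by rintro rfl; omega
      simp [this]
  · have h0 : mu K (0 : Fin (M + 1) → ℤ) < K := by simp [mu]; omega
    refine ⟨Or.inr ⟨0, 0, ?_, ?_, h0, ?_⟩, Or.inr ⟨0, 0, ?_, ?_, h0, ?_⟩⟩ <;> simp <;> omega

/-- Recursion over all smaller indices. -/
def build {α : Type} [Zero α] (S : ℕ → (ℕ → α) → α) : ℕ → α
  | m => S m fun m' => if _h : m' < m then build S m' else 0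

/-- The right-hand side of the modulation system, as a polynomial. -/
def rhs {M : ℕ} [NeZero M] (K : ℕ) (ρ τ ε ν : ℝ) (φ ψ : ℝ → ℝ)
    (z : ℕ → ZMod (2 * M) → (Fin (M + 1) → ℤ) → ℂ[X]) (j : ZMod (2 * M))
    (k : Fin (M + 1) → ℤ) (m : ℕ) : ℂ[X] :=
  C ((τ : ℂ) ^ 2 * (ψ (τ * freq ρ (idx j)) : ℂ)) *
      ∑ j₁ : ZMod (2 * M), ∑ k₁ ∈ setK K j₁, ∑ k₂ ∈ setK K (j - j₁) with k₁ + k₂ = k,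
        C ((√ε ^ (2 * ((order K j₁ k₁ : ℝ) + order K (j - j₁) k₂ - order K j k) * ν) : ℝ) : ℂ) *
          ∑ p ∈ Finset.HasAntidiagonal.antidiagonal m,
            (C (φ (τ * freq ρ (idx j₁)) : ℂ) * z p.1 j₁ k₁) *
            (C (φ (τ * freq ρ (idx (j - j₁))) : ℂ) * z p.2 (j - j₁) k₂)

theorem step {M K : ℕ} [NeZero M] (hK : 2 ≤ K) {ρ τ ε ν γ : ℝ} (hτ : 0 < τ)
    (hε : 0 < ε) (hγ : 0 < γ) (hres : NonResonant M K ρ τ ε ν γ)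
    (p : ZMod (2 * M) → (Fin (M + 1) → ℤ) → ℂ[X]) (X Y : ZMod (2 * M) → ℂ) (m : ℕ) :
    ∃ g : ZMod (2 * M) → (Fin (M + 1) → ℤ) → ℂ[X],
      (∀ j, ∀ k ∈ setK K j, m < order K j k → g j k = 0) ∧
      (∀ j, ∀ k ∈ setK K j, order K j k ≤ m →
        diffOp (Complex.exp (Complex.I * kdot ρ k * τ)) (2 * (Real.cos (τ * freq ρ (idx j)) : ℂ))
          (Complex.exp (-(Complex.I * kdot ρ k * τ))) ((ε ^ (ν / 2) * τ : ℝ) : ℂ) (g j k)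
          = p j k) ∧
      (∀ j : ZMod (2 * M), profile K (idx j) ≤ m →
        ∑ k ∈ setK K j, ((√ε ^ (2 * ((order K j k : ℝ) - profile K (idx j)) * ν) : ℝ) : ℂ) *
          (g j k).eval 0 = X j) ∧
      (∀ j : ZMod (2 * M), profile K (idx j) ≤ m →
        ∑ k ∈ setK K j, ((√ε ^ (2 * ((order K j k : ℝ) - profile K (idx j)) * ν) : ℝ) : ℂ) *
        (Complex.exp (Complex.I * kdot ρ k * τ) * (g j k).eval ((ε ^ (ν / 2) * τ : ℝ) : ℂ)
          - Complex.exp (-(Complex.I * kdot ρ k * τ)) *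
            (g j k).eval ((-(ε ^ (ν / 2) * τ) : ℝ) : ℂ)) = Y j) := by
  have hεν : 0 < ε ^ (ν / 2) := Real.rpow_pos_of_pos hε _
  have hlow : 0 < γ * τ * ε ^ (ν / 2) := by positivity
  have hh : ((ε ^ (ν / 2) * τ : ℝ) : ℂ) ≠ 0 := by
    exact_mod_cast (mul_pos hεν hτ).ne'
  -- the exponentials through sines and cosines
  have hsum : ∀ k : Fin (M + 1) → ℤ, Complex.exp (Complex.I * kdot ρ k * τ) +
      Complex.exp (-(Complex.I * kdot ρ k * τ)) = ((2 * Real.cos (τ * kdot ρ k) : ℝ) : ℂ) := by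
    intro k
    push_cast
    rw [Complex.two_cos]; congr 2 <;> ring
  have hdif : ∀ k : Fin (M + 1) → ℤ, Complex.exp (Complex.I * kdot ρ k * τ) -
      Complex.exp (-(Complex.I * kdot ρ k * τ)) =
        2 * Complex.I * ((Real.sin (τ * kdot ρ k) : ℝ) : ℂ) := by
    intro k
    push_cast
    have := Complex.two_sin ((τ : ℂ) * kdot ρ k)
    rw [show 2 * Complex.I * Complex.sin ((τ : ℂ) * kdot ρ k) =
      Complex.I * (2 * Complex.sin ((τ : ℂ) * kdot ρ k)) by ring, this]
    rw [show -((τ : ℂ) * kdot ρ k) * Complex.I = -(Complex.I * kdot ρ k * τ) by ring,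
      show ((τ : ℂ) * kdot ρ k) * Complex.I = (Complex.I * kdot ρ k * τ) by ring]
    linear_combination (Complex.exp (Complex.I * kdot ρ k * τ) -
      Complex.exp (-(Complex.I * kdot ρ k * τ))) * Complex.I_mul_I
  have hsin : ∀ j : ZMod (2 * M), Real.sin (τ * freq ρ (idx j)) ≠ 0 := by
    intro j h0
    have h1 := (hres j (unitVec j) ((mem_setK _ _).1 (mem_unitVec hK j).1)).1 (by
      intro h
      obtain ⟨l, -, hl⟩ := sum_unitVec j
      have := congrFun h l
      rw [hl] at this
      simp at this)
    rw [kdot_unitVec, show τ * (freq ρ (idx j) + freq ρ (idx j)) / 2 = τ * freq ρ (idx j) by ring,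
      h0, abs_zero] at h1
    linarith
  have hsolve : ∀ (j : ZMod (2 * M)) (k : Fin (M + 1) → ℤ), ∃ w : ℂ[X], k ∈ setK K j →
      (m < order K j k → w = 0) ∧ (order K j k ≤ m →
        diffOp (Complex.exp (Complex.I * kdot ρ k * τ)) (2 * (Real.cos (τ * freq ρ (idx j)) : ℂ))
          (Complex.exp (-(Complex.I * kdot ρ k * τ))) ((ε ^ (ν / 2) * τ : ℝ) : ℂ) w = p j k) := by
    intro j k
    by_cases hk : k ∈ setK K j
    swap
    · exact ⟨0, fun h => absurd h hk⟩
    rcases lt_or_ge m (order K j k) with hm | hm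
    · exact ⟨0, fun _ => ⟨fun _ => rfl, fun h => absurd h (by omega)⟩⟩
    obtain ⟨w, hw⟩ := diffOp_surj (Complex.exp (Complex.I * kdot ρ k * τ))
      (2 * (Real.cos (τ * freq ρ (idx j)) : ℂ)) (Complex.exp (-(Complex.I * kdot ρ k * τ)))
      ((ε ^ (ν / 2) * τ : ℝ) : ℂ) (by
        by_cases hd : k = unitVec j ∨ k = -unitVec j
        · refine Or.inr ⟨?_, mul_ne_zero ?_ hh⟩
          · rw [hsum]
            rcases hd with rfl | rfl
            · rw [kdot_unitVec]; push_cast; rfl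
            · rw [kdot_neg, kdot_unitVec, mul_neg, Real.cos_neg]; push_cast; rfl
          · rw [hdif]
            refine mul_ne_zero (by simp) ?_
            rcases hd with rfl | rfl
            · rw [kdot_unitVec]; exact_mod_cast hsin j
            · rw [kdot_neg, kdot_unitVec, mul_neg, Real.sin_neg]
              exact_mod_cast neg_ne_zero.2 (hsin j)
        · push Not at hd
          left
          rw [hsum]
          intro h
          have h' : 2 * Real.cos (τ * kdot ρ k) = 2 * Real.cos (τ * freq ρ (idx j)) := by
            exact_mod_cast h
          have h1 := (hres j k ((mem_setK _ _).1 hk)).1 hd.2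
          have h2 := (hres j k ((mem_setK _ _).1 hk)).2.1 hd.1
          have h3 := Real.cos_sub_cos (τ * kdot ρ k) (τ * freq ρ (idx j))
          rw [show (τ * kdot ρ k + τ * freq ρ (idx j)) / 2 =
              τ * (freq ρ (idx j) + kdot ρ k) / 2 by ring,
            show (τ * kdot ρ k - τ * freq ρ (idx j)) / 2 =
              -(τ * (freq ρ (idx j) - kdot ρ k) / 2) by ring, Real.sin_neg] at h3
          have h4 : Real.sin (τ * (freq ρ (idx j) + kdot ρ k) / 2) *
              Real.sin (τ * (freq ρ (idx j) - kdot ρ k) / 2) = 0 := by linarith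
          rcases mul_eq_zero.1 h4 with h5 | h5
          · rw [h5, abs_zero] at h1; linarith
          · rw [h5, abs_zero] at h2; linarith) (p j k)
    exact ⟨w, fun _ => ⟨fun h => absurd h (by omega), fun _ => hw⟩⟩
  choose w hw using hsolve
  have hone : ∀ j : ZMod (2 * M), unitVec j ≠ -unitVec j := by
    intro j h
    obtain ⟨l, -, hl⟩ := sum_unitVec j
    have := congrFun h l
    rw [hl] at this
    simp at this
  -- constants added to the diagonal functions
  have hconst : ∀ j : ZMod (2 * M), ∃ a b : ℂ, (m < profile K (idx j) → a = 0 ∧ b = 0) ∧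
      (profile K (idx j) ≤ m →
        ∑ k ∈ setK K j, ((√ε ^ (2 * ((order K j k : ℝ) - profile K (idx j)) * ν) : ℝ) : ℂ) *
          (w j k).eval 0 + (a + b) = X j ∧
        ∑ k ∈ setK K j, ((√ε ^ (2 * ((order K j k : ℝ) - profile K (idx j)) * ν) : ℝ) : ℂ) *
        (Complex.exp (Complex.I * kdot ρ k * τ) * (w j k).eval ((ε ^ (ν / 2) * τ : ℝ) : ℂ)
          - Complex.exp (-(Complex.I * kdot ρ k * τ)) *
            (w j k).eval ((-(ε ^ (ν / 2) * τ) : ℝ) : ℂ)) +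
          2 * Complex.I * (Real.sin (τ * freq ρ (idx j)) : ℂ) * (a - b) = Y j) := by
    intro j
    rcases lt_or_ge m (profile K (idx j)) with hm | hm
    · exact ⟨0, 0, fun _ => ⟨rfl, rfl⟩, fun h => absurd h (by omega)⟩
    generalize (∑ k ∈ setK K j,
      ((√ε ^ (2 * ((order K j k : ℝ) - profile K (idx j)) * ν) : ℝ) : ℂ) * (w j k).eval 0) = A
    generalize (∑ k ∈ setK K j,
      ((√ε ^ (2 * ((order K j k : ℝ) - profile K (idx j)) * ν) : ℝ) : ℂ) *
        (Complex.exp (Complex.I * kdot ρ k * τ) * (w j k).eval ((ε ^ (ν / 2) * τ : ℝ) : ℂ)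
          - Complex.exp (-(Complex.I * kdot ρ k * τ)) *
            (w j k).eval ((-(ε ^ (ν / 2) * τ) : ℝ) : ℂ))) = B
    have hs : 2 * Complex.I * (Real.sin (τ * freq ρ (idx j)) : ℂ) ≠ 0 :=
      mul_ne_zero (by simp) (by exact_mod_cast hsin j)
    refine ⟨((X j - A) + (Y j - B) / (2 * Complex.I * (Real.sin (τ * freq ρ (idx j)) : ℂ))) / 2,
      ((X j - A) - (Y j - B) / (2 * Complex.I * (Real.sin (τ * freq ρ (idx j)) : ℂ))) / 2,
      fun h => absurd h (by omega), fun _ => ⟨by ring, ?_⟩⟩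
    generalize 2 * Complex.I * (Real.sin (τ * freq ρ (idx j)) : ℂ) = S at *
    field_simp
    ring
  choose a b hab0 hab using hconst
  refine ⟨fun j k => w j k + C (if k = unitVec j then a j else if k = -unitVec j then b j else 0),
    ?_, ?_, ?_, ?_⟩
  · intro j k hk hm
    beta_reduce
    rw [((hw j k) hk).1 hm]
    have ho := order_unitVec (K := K) j
    split_ifs with h1 h2
    · subst h1; rw [(hab0 j (by omega)).1]; simp
    · subst h2; rw [(hab0 j (by omega)).2]; simp
    · simp
  · intro j k hk hm
    rw [map_add, ((hw j k) hk).2 hm]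
    have hC : ∀ c : ℂ, k = unitVec j ∨ k = -unitVec j →
        diffOp (Complex.exp (Complex.I * kdot ρ k * τ)) (2 * (Real.cos (τ * freq ρ (idx j)) : ℂ))
          (Complex.exp (-(Complex.I * kdot ρ k * τ))) ((ε ^ (ν / 2) * τ : ℝ) : ℂ) (C c) = 0 := by
      intro c hd
      refine Polynomial.funext fun x => ?_
      rw [diffOp_eval]
      simp only [eval_C, eval_zero]
      have : Complex.exp (Complex.I * kdot ρ k * τ) +
          Complex.exp (-(Complex.I * kdot ρ k * τ)) = 2 * (Real.cos (τ * freq ρ (idx j)) : ℂ) := by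
        rw [hsum]
        rcases hd with rfl | rfl
        · rw [kdot_unitVec]; push_cast; rfl
        · rw [kdot_neg, kdot_unitVec, mul_neg, Real.cos_neg]; push_cast; rfl
      linear_combination c * this
    split_ifs with h1 h2
    · rw [hC _ (Or.inl h1), add_zero]
    · rw [hC _ (Or.inr h2), add_zero]
    · simp
  all_goals
    intro j hm
    have ho := order_unitVec (K := K) j
    have hmem := mem_unitVec hK j
    have hsplit : ∀ F : (Fin (M + 1) → ℤ) → ℂ → ℂ, (∀ k, F k 0 = 0) →
        ∑ k ∈ setK K j, F k (if k = unitVec j then a j else if k = -unitVec j then b j else 0)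
          = F (unitVec j) (a j) + F (-unitVec j) (b j) := by
      intro F hF
      rw [← Finset.sum_subset (s₁ := {unitVec j, -unitVec j})]
      · rw [Finset.sum_pair (hone j)]
        simp [(hone j).symm]
      · intro k hk
        simp only [Finset.mem_insert, Finset.mem_singleton] at hk
        rcases hk with rfl | rfl
        exacts [hmem.1, hmem.2]
      · intro k _ hk
        simp only [Finset.mem_insert, Finset.mem_singleton, not_or] at hk
        rw [if_neg hk.1, if_neg hk.2, hF]
  · rw [← (hab j hm).1]
    simp only [eval_add, eval_C, mul_add, Finset.sum_add_distrib]
    rw [hsplit (fun k c => ((√ε ^ (2 * ((order K j k : ℝ) - profile K (idx j)) * ν) : ℝ) : ℂ) * c)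
      (by simp)]
    simp [ho.1, ho.2]
  · rw [← (hab j hm).2]
    have := hsplit (fun k c =>
      ((√ε ^ (2 * ((order K j k : ℝ) - profile K (idx j)) * ν) : ℝ) : ℂ) *
        (Complex.exp (Complex.I * kdot ρ k * τ) * c
          - Complex.exp (-(Complex.I * kdot ρ k * τ)) * c)) (by simp)
    simp only [eval_add, eval_C]
    rw [show ∀ A B S : ℂ, A + S * B = A + B * S by intros; ring]
    have h2 : 2 * Complex.I * (Real.sin (τ * freq ρ (idx j)) : ℂ) * (a j - b j) = ∑ k ∈ setK K j,
        ((√ε ^ (2 * ((order K j k : ℝ) - profile K (idx j)) * ν) : ℝ) : ℂ) *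
        (Complex.exp (Complex.I * kdot ρ k * τ) *
            (if k = unitVec j then a j else if k = -unitVec j then b j else 0)
          - Complex.exp (-(Complex.I * kdot ρ k * τ)) *
            (if k = unitVec j then a j else if k = -unitVec j then b j else 0)) := by
      rw [this, ho.1, ho.2]
      simp only [← sub_mul, hdif]
      rw [kdot_neg, kdot_unitVec, mul_neg, Real.sin_neg]
      simp
      ring
    rw [mul_comm (a j - b j), h2, ← Finset.sum_add_distrib]
    refine Finset.sum_congr rfl fun k _ => ?_
    ring

/-- Under the non-resonance condition the construction of the modulation coefficient functions
can be carried out. -/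
theorem exists_isModulation {M K : ℕ} [NeZero M] (hK : 2 ≤ K) {ρ τ ε ν γ : ℝ}
    (hτ : 0 < τ) (hε : 0 < ε) (hγ : 0 < γ) (hres : NonResonant M K ρ τ ε ν γ) (φ ψ : ℝ → ℝ)
    (u₀ v₀ : ZMod (2 * M) → ℂ) : ∃ z, IsModulation K ρ τ ε ν φ ψ u₀ v₀ z := by
  have h := fun (m : ℕ) (f : ℕ → ZMod (2 * M) → (Fin (M + 1) → ℤ) → ℂ[X]) =>
    step hK hτ hε hγ hres (fun j k => rhs K ρ τ ε ν φ ψ f j k m)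
      (fun j => if m = profile K (idx j) then
          ((√ε ^ (-(profile K (idx j) : ℝ)) : ℝ) : ℂ) * u₀ j else 0)
      (fun j => if m = profile K (idx j) then
          2 * (τ : ℂ) * (Real.sinc (τ * freq ρ (idx j)) : ℂ) *
            ((√ε ^ (-(profile K (idx j) : ℝ)) : ℝ) : ℂ) * v₀ j else 0) m
  choose S h1 h2 h3 h4 using h
  have hz : ∀ m, build S m = S m fun m' => if _h : m' < m then build S m' else 0 := by
    intro m
    conv_lhs => rw [build]
  have hord : ∀ (j : ZMod (2 * M)) (k : Fin (M + 1) → ℤ), 1 ≤ order K j k := fun j k =>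
    le_max_of_le_left (one_le_profile (by omega) _)
  refine ⟨fun j k m => build S m j k, ⟨?_, ?_, ?_, ?_⟩⟩
  · intro j k hk m hm
    rw [hz]
    exact h1 _ _ _ _ hk hm
  · intro j k hk m hm _ x
    have h5 := congrArg (eval (x : ℂ))
      (h2 m (fun m' => if _h : m' < m then build S m' else 0) j k hk hm)
    rw [← hz, diffOp_eval] at h5
    rw [Complex.ofReal_add, Complex.ofReal_sub]
    refine h5.trans ?_
    simp only [rhs, eval_mul, eval_finsetSum, eval_C]
    refine congrArg₂ (fun a b : ℂ => a * b) rfl ?_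
    refine Finset.sum_congr rfl fun j₁ _ => Finset.sum_congr rfl fun k₁ hk₁ =>
      Finset.sum_congr rfl fun k₂ hk₂ => ?_
    refine congrArg₂ (fun a b : ℂ => a * b) rfl ?_
    refine Finset.sum_congr rfl fun q hq => ?_
    have hq' : q.1 + q.2 = m := by simpa using hq
    have hk₂' := (Finset.mem_filter.1 hk₂).1
    have hzero : ∀ j, ∀ k ∈ setK K j, build S 0 j k = 0 := by
      intro j k hk
      rw [hz]
      exact h1 _ _ _ _ hk (hord j k)
    rcases Nat.eq_zero_or_pos q.1 with h6 | h6
    · have : (0 : ℕ) < m := lt_of_lt_of_le (hord j k) hm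
      rw [h6]
      simp [hzero _ _ hk₁, this]
    · rcases Nat.eq_zero_or_pos q.2 with h7 | h7
      · have : (0 : ℕ) < m := lt_of_lt_of_le (hord j k) hm
        rw [h7]
        simp [hzero _ _ hk₂', this]
      · rw [dif_pos (by omega : q.1 < m), dif_pos (by omega : q.2 < m)]
  · intro j m hm _
    simp only [hz m]
    exact h3 _ _ _ hm
  · intro j m hm _
    simp only [hz m]
    exact h4 _ _ _ hm

end TrigInt

end

/-! The numerical solution is compared with its modulated Fourier expansion, whose coefficients are
polynomials in slow time. The point is to bound these coefficients twice: once crudely, with a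
constant depending on `C₀`, and once sharply, with a constant depending only on `𝒞₀`. In the sharp
estimates the crude bound enters only multiplied by a positive power of `δ^(1-2ν)`, which a small
`ε^(1-2ν)` makes harmless.

Crude bound. At each order the modulation system is a linear difference equation for one polynomial,
with a quadratic right-hand side in lower orders. Off the diagonal `k = ±⟨j⟩` the multiplier `2 cos
α - 2 cos β` is nonzero by non-resonance, and a Taylor expansion inverts the operator
(`coeffNorm_le_of_modOp`). On the diagonal the multiplier vanishes and only the derivative is
determined (`coeffNorm_derivative_le_of_modOp`); the value at `0` comes from the initial data
(`diag_const_le`). The weak non-resonance condition loses `δ^ν` on the diagonal and for `|j| > K`.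
In exactly these cases the orders `m(j,k)` are strictly subadditive (`order_lt_of_diag`,
`order_lt_of_idx`), which gains `δ^(2ν)` and pays for the loss. Summation over `j` uses that the
weighted `ℓ²` space is a convolution algebra, uniformly in `M` (`wnorm_conv_le`); the result is
`exists_wnorm_Y_le`.

Independence of `C₀`. By uniqueness the coefficients inherit a conjugation symmetry from the data
(`conj_y`), so the almost-invariant energies are real. Off-diagonal functions, and derivatives of
diagonal ones, start one order later than the diagonal functions; hence the almost-invariant
energies are the energies of the diagonal functions up to `δ^(1-2ν)` (`sum_almostInv_sub_le`). At
time `0` this bounds the diagonal functions by `𝒞₀` (`wnorm_diagVal_sq_le`). The leading coefficient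
functions are generated by leading ones only (`sum_lead_off_le`), so all of them are bounded in
terms of `𝒞₀` (`exists_wnorm_Lead_le`), and with them the whole expansion, up to a small remainder.

Error of the expansion. Products of total order below `2K` never leave the index set (`trunc_eq`),
so the defect contains only orders `≥ 2K` and is `O(δ^(K(1-2ν)))` after rescaling
(`norm_defect_le`). In the variables `(ω u, u̇)` the integrator is a rotation plus a kick, and a
discrete Gronwall argument on the unit interval turns the defect into an error bound
(`wnorm_errE_le`). Expansion plus error gives the bound on the mode energies.

First mode. Two modes of index `±1` cannot produce index `±1`, so for `|j| = 1` the right-hand side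
vanishes through order `2` and at order `3` involves leading functions only. Up to `δ^(1+2(1-2ν))`
the mode therefore performs two harmonic oscillations whose energy is the diagonal energy, and both
the mode energy and the almost-invariant energy deviate from it by `O(δ^(2+2(1-2ν))) = O(ε
ε^(1-2ν))` (`modeEnergy_sub_le`, `almostInv_one_sub_le`). -/

noncomputable section

namespace TrigInt
open Polynomial

/-! ### The coefficient norm of a polynomial -/

/-- The sum of the absolute values of the coefficients. -/
def coeffNorm (p : ℂ[X]) : ℝ := p.sum fun _ c => ‖c‖

theorem coeffNorm_eq_sum_range {p : ℂ[X]} {n : ℕ} (h : p.natDegree < n) :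
    coeffNorm p = ∑ i ∈ Finset.range n, ‖p.coeff i‖ :=
  p.sum_over_range' (by simp) n h

theorem coeffNorm_nonneg (p : ℂ[X]) : 0 ≤ coeffNorm p :=
  Finset.sum_nonneg fun _ _ => norm_nonneg _

@[simp] theorem coeffNorm_zero : coeffNorm 0 = 0 := by simp [coeffNorm]

theorem coeffNorm_add (p q : ℂ[X]) : coeffNorm (p + q) ≤ coeffNorm p + coeffNorm q := by
  set n := max (p + q).natDegree (max p.natDegree q.natDegree) + 1
  rw [coeffNorm_eq_sum_range (n := n) (by omega), coeffNorm_eq_sum_range (n := n) (by omega),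
    coeffNorm_eq_sum_range (n := n) (by omega), ← Finset.sum_add_distrib]
  exact Finset.sum_le_sum fun i _ => by rw [coeff_add]; exact norm_add_le _ _

theorem coeffNorm_C_mul (c : ℂ) (p : ℂ[X]) : coeffNorm (C c * p) = ‖c‖ * coeffNorm p := by
  rw [coeffNorm_eq_sum_range (n := p.natDegree + 1)
      (Nat.lt_succ_of_le (natDegree_C_mul_le c p)),
    coeffNorm_eq_sum_range (n := p.natDegree + 1) (by omega), Finset.mul_sum]
  exact Finset.sum_congr rfl fun i _ => by rw [coeff_C_mul, norm_mul]

@[simp] theorem coeffNorm_neg (p : ℂ[X]) : coeffNorm (-p) = coeffNorm p := by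
  have := coeffNorm_C_mul (-1) p
  simpa using this

theorem coeffNorm_sub (p q : ℂ[X]) : coeffNorm (p - q) ≤ coeffNorm p + coeffNorm q := by
  rw [sub_eq_add_neg, ← coeffNorm_neg q]
  exact coeffNorm_add _ _

theorem coeffNorm_sum {α : Type*} (s : Finset α) (f : α → ℂ[X]) :
    coeffNorm (∑ i ∈ s, f i) ≤ ∑ i ∈ s, coeffNorm (f i) := by
  classical
  induction s using Finset.induction_on with
  | empty => simp
  | insert a s ha ih =>
    rw [Finset.sum_insert ha, Finset.sum_insert ha]
    exact (coeffNorm_add _ _).trans (by gcongr)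

theorem coeffNorm_X_mul (p : ℂ[X]) : coeffNorm (X * p) = coeffNorm p := by
  rw [coeffNorm_eq_sum_range (n := p.natDegree + 1 + 1) (by
    have := natDegree_mul_le (p := X) (q := p)
    have := natDegree_X (R := ℂ)
    omega), Finset.sum_range_succ', coeffNorm_eq_sum_range (n := p.natDegree + 1) (by omega)]
  simp [coeff_X_mul]

theorem coeffNorm_X_pow_mul (n : ℕ) (p : ℂ[X]) : coeffNorm (X ^ n * p) = coeffNorm p := by
  induction n with
  | zero => simp
  | succ n ih => rw [pow_succ', mul_assoc, coeffNorm_X_mul, ih]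

theorem coeffNorm_C (c : ℂ) : coeffNorm (C c) = ‖c‖ := by
  rw [coeffNorm_eq_sum_range (n := 1) (by simp)]
  simp

theorem coeffNorm_X_pow (n : ℕ) : coeffNorm (X ^ n) = 1 := by
  have := coeffNorm_X_pow_mul n (C 1)
  rw [coeffNorm_C] at this
  simpa using this

/-- A linear map is bounded by its values on the monomials. -/
theorem coeffNorm_linearMap_le (L : ℂ[X] →ₗ[ℂ] ℂ[X]) (p : ℂ[X]) (c : ℕ → ℝ)
    (h : ∀ i ≤ p.natDegree, coeffNorm (L (X ^ i)) ≤ c i) :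
    coeffNorm (L p) ≤ ∑ i ∈ Finset.range (p.natDegree + 1), ‖p.coeff i‖ * c i := by
  conv_lhs => rw [p.as_sum_range_C_mul_X_pow, map_sum]
  refine (coeffNorm_sum _ _).trans (Finset.sum_le_sum fun i hi => ?_)
  rw [← smul_eq_C_mul, map_smul, smul_eq_C_mul, coeffNorm_C_mul]
  exact mul_le_mul_of_nonneg_left (h i (by simpa [Nat.lt_succ_iff] using hi)) (norm_nonneg _)

/-- Multiplying a monomial by `q` only shifts the coefficients of `q`, so the bound for linear maps
through their values on monomials applies to multiplication by `q`. -/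
theorem coeffNorm_mul (p q : ℂ[X]) : coeffNorm (p * q) ≤ coeffNorm p * coeffNorm q := by
  refine (coeffNorm_linearMap_le (LinearMap.mulRight ℂ q) p (fun _ => coeffNorm q)
    fun i _ => ?_).trans_eq ?_
  · rw [LinearMap.mulRight_apply, coeffNorm_X_pow_mul]
  · rw [coeffNorm_eq_sum_range (p := p) (n := p.natDegree + 1) (by omega), Finset.sum_mul]

theorem coeffNorm_eq_zero {p : ℂ[X]} (h : coeffNorm p ≤ 0) : p = 0 := by
  ext i
  by_contra hi
  have h1 : i ∈ p.support := mem_support_iff.2 hi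
  have h2 : ‖p.coeff i‖ ≤ coeffNorm p :=
    Finset.single_le_sum (f := fun i => ‖p.coeff i‖) (fun _ _ => norm_nonneg _) h1
  exact hi (norm_le_zero_iff.1 (h2.trans h))

/-- The exact weights `i`, and `i (i - 1)` for the second derivative, allow Taylor remainders to be
compared with derivatives coefficient by coefficient. -/
theorem coeffNorm_derivative (p : ℂ[X]) :
    coeffNorm (derivative p) = ∑ i ∈ Finset.range (p.natDegree + 1), ‖p.coeff i‖ * i := by
  rw [Finset.sum_range_succ']
  rw [coeffNorm_eq_sum_range (n := p.natDegree + 1)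
    (by have := natDegree_derivative_le p; omega), Finset.sum_range_succ]
  have h0 : p.coeff (p.natDegree + 1) = 0 := coeff_eq_zero_of_natDegree_lt (by omega)
  simp only [coeff_derivative, h0, norm_mul]
  simp only [Nat.cast_zero, mul_zero, add_zero, zero_mul, norm_zero]
  refine Finset.sum_congr rfl fun i _ => ?_
  rw [← Nat.cast_add_one, Complex.norm_natCast]

theorem coeffNorm_derivative_le {p : ℂ[X]} {n : ℕ} (h : p.natDegree ≤ n) :
    coeffNorm (derivative p) ≤ n * coeffNorm p := by
  rw [coeffNorm_derivative, coeffNorm_eq_sum_range (p := p) (n := p.natDegree + 1) (by omega),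
    Finset.mul_sum]
  refine Finset.sum_le_sum fun i hi => ?_
  rw [mul_comm]
  have : i ≤ n := by rw [Finset.mem_range] at hi; omega
  gcongr

theorem coeffNorm_derivative_derivative (p : ℂ[X]) :
    coeffNorm (derivative (derivative p)) =
      ∑ i ∈ Finset.range (p.natDegree + 1), ‖p.coeff i‖ * (i * (i - 1)) := by
  rw [coeffNorm_derivative, natDegree_derivative, Finset.sum_range_succ']
  rcases Nat.eq_zero_or_pos p.natDegree with h | h
  · simp [h]
  · obtain ⟨n, hn⟩ := Nat.exists_eq_add_of_lt h
    rw [zero_add] at hn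
    rw [hn, Nat.add_sub_cancel, Finset.sum_range_succ' _ (n + 1), Finset.sum_range_succ' _ n]
    simp only [coeff_derivative, norm_mul, ← Nat.cast_add_one, Complex.norm_natCast]
    simp only [Nat.cast_add, Nat.cast_one, Nat.cast_zero, mul_zero, zero_mul, add_zero, zero_add,
      sub_self]
    exact Finset.sum_congr rfl fun i _ => by ring

theorem norm_eval_le {p : ℂ[X]} {n : ℕ} (h : p.natDegree ≤ n) {x : ℂ} {R : ℝ} (hR : 1 ≤ R)
    (hx : ‖x‖ ≤ R) : ‖p.eval x‖ ≤ R ^ n * coeffNorm p := by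
  rw [eval_eq_sum_range, coeffNorm_eq_sum_range (p := p) (n := p.natDegree + 1) (by omega),
    Finset.mul_sum]
  refine (norm_sum_le _ _).trans (Finset.sum_le_sum fun i hi => ?_)
  rw [norm_mul, norm_pow, mul_comm]
  have : i ≤ n := by rw [Finset.mem_range] at hi; omega
  gcongr
  exact (pow_le_pow_left₀ (norm_nonneg _) hx i).trans (pow_le_pow_right₀ hR this)

/-! ### Taylor remainders -/

/-- The remainder `p(x + h) - p(x) - h p'(x)`. -/
def taylorRem (h : ℂ) : ℂ[X] →ₗ[ℂ] ℂ[X] :=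
  taylor h - LinearMap.id - h • derivative

theorem taylor_eq (h : ℂ) (p : ℂ[X]) :
    taylor h p = p + C h * derivative p + taylorRem h p := by
  simp [taylorRem, smul_eq_C_mul]

/-- Induction through the recursion `R(X^(i+1)) = (X + h) R(X^i) + h² (X^i)'` for the remainder `R`.
The weight `i (i - 1)` is that of the second derivative and vanishes on affine polynomials, as the
remainder does. -/
theorem taylorRem_X_pow (h : ℂ) {H : ℝ} (hH : ‖h‖ ≤ H) (i : ℕ) :
    coeffNorm (taylorRem h (X ^ i)) ≤ (1 + H) ^ i * ‖h‖ ^ 2 * (i * (i - 1)) := by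
  have hH0 : 0 ≤ H := (norm_nonneg h).trans hH
  induction i with
  | zero => simp [taylorRem]
  | succ i ih =>
    have key : taylorRem h (X ^ (i + 1)) =
        (X + C h) * taylorRem h (X ^ i) + C (h ^ 2) * derivative (X ^ i) := by
      simp only [taylorRem, LinearMap.sub_apply, LinearMap.smul_apply, LinearMap.id_apply,
        taylor_X_pow, smul_eq_C_mul, C_pow]
      rw [pow_succ X i, derivative_mul, derivative_X]
      ring
    rw [key]
    refine (coeffNorm_add _ _).trans ?_
    rw [coeffNorm_C_mul, norm_pow]
    have h1 : coeffNorm (derivative (X ^ i : ℂ[X])) ≤ i := by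
      have := coeffNorm_derivative_le (p := X ^ i) (n := i) (natDegree_X_pow_le i)
      rwa [coeffNorm_X_pow, mul_one] at this
    have h2 : coeffNorm (X + C h) ≤ 1 + H := by
      refine (coeffNorm_add _ _).trans ?_
      have := coeffNorm_X_pow 1
      rw [pow_one] at this
      rw [this, coeffNorm_C]
      gcongr
    have h3 := (coeffNorm_mul (X + C h) (taylorRem h (X ^ i))).trans
      (mul_le_mul h2 ih (coeffNorm_nonneg _) (by positivity))
    have h4 : (1 : ℝ) ≤ (1 + H) ^ (i + 1) := one_le_pow₀ (by linarith)
    calc _ ≤ (1 + H) * ((1 + H) ^ i * ‖h‖ ^ 2 * (i * (i - 1))) + ‖h‖ ^ 2 * i := by gcongr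
      -- The weight grows by `(i + 1) i - i (i - 1) = 2 i`, which is where the factor `2` comes
      -- from.
      _ ≤ (1 + H) ^ (i + 1) * ‖h‖ ^ 2 * (i * (i - 1))
          + 2 * ((1 + H) ^ (i + 1) * (‖h‖ ^ 2 * i)) := by
        have : ‖h‖ ^ 2 * i ≤ (1 + H) ^ (i + 1) * (‖h‖ ^ 2 * i) :=
          le_mul_of_one_le_left (by positivity) h4
        have h5 : 0 ≤ ‖h‖ ^ 2 * (i : ℝ) := by positivity
        have h6 : (1 + H) * ((1 + H) ^ i * ‖h‖ ^ 2 * (i * (i - 1))) =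
          (1 + H) ^ (i + 1) * ‖h‖ ^ 2 * (i * (i - 1)) := by ring
        linarith
      _ = _ := by push_cast; ring

/-- Having the second derivative on the right, and not `p`, is essential: the remainder is then of
lower degree type and can be handled by induction on the degree when the difference operator is
inverted. -/
theorem coeffNorm_taylorRem {h : ℂ} {H : ℝ} (hH : ‖h‖ ≤ H) {p : ℂ[X]} {n : ℕ}
    (hp : p.natDegree ≤ n) : coeffNorm (taylorRem h p) ≤
      (1 + H) ^ n * ‖h‖ ^ 2 * coeffNorm (derivative (derivative p)) := by
  have hH0 : 0 ≤ H := (norm_nonneg h).trans hH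
  rw [coeffNorm_derivative_derivative, Finset.mul_sum]
  refine (coeffNorm_linearMap_le _ p _ fun i _ => taylorRem_X_pow h hH i).trans
    (Finset.sum_le_sum fun i hi => ?_)
  have hi' : i ≤ n := by rw [Finset.mem_range] at hi; omega
  have h1 : (1 + H) ^ i ≤ (1 + H) ^ n := pow_le_pow_right₀ (by linarith) hi'
  have h2 : (0 : ℝ) ≤ i * (i - 1) := by
    rcases Nat.eq_zero_or_pos i with rfl | h
    · simp
    · have : (1 : ℝ) ≤ i := by exact_mod_cast h
      exact mul_nonneg (by positivity) (by linarith)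
  have h3 : 0 ≤ ‖h‖ ^ 2 * (‖p.coeff i‖ * ((i : ℝ) * (i - 1))) := by positivity
  calc _ = (1 + H) ^ i * (‖h‖ ^ 2 * (‖p.coeff i‖ * ((i : ℝ) * (i - 1)))) := by ring
    _ ≤ (1 + H) ^ n * (‖h‖ ^ 2 * (‖p.coeff i‖ * ((i : ℝ) * (i - 1)))) :=
        mul_le_mul_of_nonneg_right h1 h3
    _ = _ := by ring

theorem derivative_taylorRem (h : ℂ) (p : ℂ[X]) :
    derivative (taylorRem h p) = taylorRem h (derivative p) := by
  simp [taylorRem, taylor_apply, derivative_comp]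

/-- First-order bound for `p(x + h) - p(x)`. -/
theorem coeffNorm_taylor_sub {h : ℂ} {H : ℝ} (hH : ‖h‖ ≤ H) {p : ℂ[X]} {n : ℕ}
    (hp : p.natDegree ≤ n) : coeffNorm (taylor h p - p) ≤
      (1 + (1 + H) ^ n * H * n) * ‖h‖ * coeffNorm (derivative p) := by
  have hH0 : 0 ≤ H := (norm_nonneg h).trans hH
  rw [taylor_eq, show p + C h * derivative p + taylorRem h p - p =
    C h * derivative p + taylorRem h p by ring]
  refine (coeffNorm_add _ _).trans ?_
  rw [coeffNorm_C_mul]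
  have h1 := coeffNorm_taylorRem hH hp
  have h2 : coeffNorm (derivative (derivative p)) ≤ n * coeffNorm (derivative p) :=
    coeffNorm_derivative_le ((natDegree_derivative_le p).trans (by omega))
  have h3 := coeffNorm_nonneg (derivative p)
  have h4 := coeffNorm_nonneg (derivative (derivative p))
  calc _ ≤ ‖h‖ * coeffNorm (derivative p) +
        (1 + H) ^ n * (H * ‖h‖) * (n * coeffNorm (derivative p)) := by
        refine add_le_add le_rfl (h1.trans ?_)
        rw [sq]
        gcongr
    _ = _ := by ring

/-! ### The difference operator of the modulation system -/

/-- The operator `e^{iα} p(x + h) - 2 cos β p(x) + e^{-iα} p(x - h)`. -/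
def modOp (α β h : ℝ) : ℂ[X] →ₗ[ℂ] ℂ[X] :=
  diffOp (Complex.exp (Complex.I * α)) (2 * (Real.cos β : ℂ)) (Complex.exp (-(Complex.I * α))) h

theorem exp_add_exp_neg (α : ℝ) : Complex.exp (Complex.I * α) + Complex.exp (-(Complex.I * α)) =
    2 * (Real.cos α : ℂ) := by
  push_cast
  rw [Complex.two_cos]
  congr 2 <;> ring

theorem exp_sub_exp_neg (α : ℝ) : Complex.exp (Complex.I * α) - Complex.exp (-(Complex.I * α)) =
    2 * Complex.I * (Real.sin α : ℂ) := by
  push_cast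
  have := Complex.two_sin (α : ℂ)
  rw [show 2 * Complex.I * Complex.sin (α : ℂ) = Complex.I * (2 * Complex.sin (α : ℂ)) by ring,
    this, show -(α : ℂ) * Complex.I = -(Complex.I * α) by ring,
    show (α : ℂ) * Complex.I = Complex.I * α by ring]
  linear_combination (Complex.exp (Complex.I * α) -
    Complex.exp (-(Complex.I * α))) * Complex.I_mul_I

theorem norm_exp_I_mul (α : ℝ) : ‖Complex.exp (Complex.I * α)‖ = 1 := by
  rw [mul_comm]; exact Complex.norm_exp_ofReal_mul_I α

theorem norm_exp_neg_I_mul (α : ℝ) : ‖Complex.exp (-(Complex.I * α))‖ = 1 := by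
  have := norm_exp_I_mul (-α)
  rwa [Complex.ofReal_neg, mul_neg] at this

/-- Expansion of both shifts to first order. Off the diagonal the scalar multiplier is the leading
part; on the diagonal it is zero and the term with the first derivative leads. -/
theorem modOp_eq (α β h : ℝ) (p : ℂ[X]) :
    modOp α β h p = C ((2 * Real.cos α - 2 * Real.cos β : ℝ) : ℂ) * p +
      (C (2 * Complex.I * (Real.sin α : ℂ) * h) * derivative p +
      (C (Complex.exp (Complex.I * α)) * taylorRem h p +
        C (Complex.exp (-(Complex.I * α))) * taylorRem (-h) p)) := by
  have h1 := exp_add_exp_neg α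
  rw [← exp_sub_exp_neg]
  have h2 : ((2 * Real.cos α - 2 * Real.cos β : ℝ) : ℂ) = Complex.exp (Complex.I * α) +
    Complex.exp (-(Complex.I * α)) - 2 * (Real.cos β : ℂ) := by rw [h1]; push_cast; ring
  rw [h2]
  simp only [modOp, diffOp, LinearMap.add_apply, LinearMap.sub_apply, LinearMap.smul_apply,
    LinearMap.id_apply, smul_eq_C_mul, taylor_eq, C_sub, C_add, C_mul, C_neg]
  ring

/-- The operator has constant coefficients. Commutation with the derivative lets an estimate for `p`
be fed by the same estimate for `p'`. -/
theorem derivative_modOp (α β h : ℝ) (p : ℂ[X]) :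
    derivative (modOp α β h p) = modOp α β h (derivative p) := by
  simp [modOp_eq, derivative_mul, derivative_taylorRem]

theorem natDegree_modOp_le (α β h : ℝ) (p : ℂ[X]) :
    (modOp α β h p).natDegree ≤ p.natDegree := by
  simp only [modOp, diffOp, LinearMap.add_apply, LinearMap.sub_apply, LinearMap.smul_apply,
    LinearMap.id_apply]
  refine (natDegree_add_le _ _).trans (max_le ((natDegree_sub_le _ _).trans (max_le ?_ ?_)) ?_)
  · exact (natDegree_smul_le _ _).trans (by simp)
  · exact natDegree_smul_le _ _
  · exact (natDegree_smul_le _ _).trans (by simp)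

theorem coeffNorm_second_order (α h : ℝ) {H : ℝ} (hH : |h| ≤ H) {p : ℂ[X]} {n : ℕ}
    (hp : p.natDegree ≤ n) :
    coeffNorm (C (Complex.exp (Complex.I * α)) * taylorRem h p +
        C (Complex.exp (-(Complex.I * α))) * taylorRem (-h) p) ≤
      2 * (1 + H) ^ n * h ^ 2 * coeffNorm (derivative (derivative p)) := by
  have h1 : ‖(h : ℂ)‖ = |h| := by simp
  have h2 := coeffNorm_taylorRem (h := h) (H := H) (by rwa [h1]) hp
  have h3 := coeffNorm_taylorRem (h := -h) (H := H) (by rwa [norm_neg, h1]) hp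
  refine (coeffNorm_add _ _).trans ?_
  rw [coeffNorm_C_mul, coeffNorm_C_mul, norm_exp_I_mul, norm_exp_neg_I_mul]
  rw [h1, sq_abs] at h2
  rw [norm_neg, h1, sq_abs] at h3
  linarith

/-- The constant in the bound of the inverse of the difference operator. -/
def invConst (c H : ℝ) : ℕ → ℝ
  | 0 => 1
  | n + 1 => 1 + (2 * c + 2 * (1 + H) ^ (n + 2) * c * (n + 1)) * invConst c H n * (n + 2)

theorem invConst_nonneg {c H : ℝ} (hc : 0 ≤ c) (hH : 0 ≤ H) (n : ℕ) : 0 ≤ invConst c H n := by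
  induction n with
  | zero => simp [invConst]
  | succ n ih => unfold invConst; positivity

/-- The off-diagonal case: inversion of the difference operator. -/
theorem coeffNorm_le_of_modOp {α β h c H : ℝ} (hc : 0 ≤ c) (hh : 0 ≤ h) (hH : h ≤ H)
    (hd : 2 * Real.cos α - 2 * Real.cos β ≠ 0)
    (h1 : |Real.sin α| * h ≤ c * |2 * Real.cos α - 2 * Real.cos β|)
    (h2 : h ^ 2 ≤ c * |2 * Real.cos α - 2 * Real.cos β|) (n : ℕ) :
    ∀ p : ℂ[X], p.natDegree ≤ n →
      |2 * Real.cos α - 2 * Real.cos β| * coeffNorm p ≤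
        invConst c H n * coeffNorm (modOp α β h p) := by
  have hH0 : 0 ≤ H := hh.trans hH
  set d := 2 * Real.cos α - 2 * Real.cos β
  have hd' : 0 < |d| := abs_pos.2 hd
  -- the estimate in terms of the derivative
  have base : ∀ (n : ℕ) (p : ℂ[X]), p.natDegree ≤ n → |d| * coeffNorm p ≤
      coeffNorm (modOp α β h p) + (2 * c + 2 * (1 + H) ^ n * c * (n - 1 : ℕ)) * |d| *
        coeffNorm (derivative p) := by
    intro n p hp
    have e := modOp_eq α β h p
    have e' : C ((d : ℝ) : ℂ) * p = modOp α β h p -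
      (C (2 * Complex.I * (Real.sin α : ℂ) * h) * derivative p +
      (C (Complex.exp (Complex.I * α)) * taylorRem h p +
        C (Complex.exp (-(Complex.I * α))) * taylorRem (-h) p)) := by rw [e]; ring
    have e2 := congrArg coeffNorm e'
    rw [coeffNorm_C_mul, Complex.norm_real, Real.norm_eq_abs] at e2
    rw [e2]
    refine (coeffNorm_sub _ _).trans (add_le_add le_rfl ((coeffNorm_add _ _).trans ?_))
    rw [coeffNorm_C_mul]
    have e3 := coeffNorm_second_order α h (H := H) (by rwa [abs_of_nonneg hh]) hp
    have e4 : coeffNorm (derivative (derivative p)) ≤ (n - 1 : ℕ) * coeffNorm (derivative p) :=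
      coeffNorm_derivative_le ((natDegree_derivative_le p).trans (by omega))
    have e5 : ‖2 * Complex.I * (Real.sin α : ℂ) * h‖ = 2 * (|Real.sin α| * h) := by
      simp only [norm_mul, Complex.norm_I, Complex.norm_real, Real.norm_eq_abs, abs_of_nonneg hh]
      simp; ring
    have e6 := coeffNorm_nonneg (derivative p)
    have e7 := coeffNorm_nonneg (derivative (derivative p))
    rw [e5]
    calc _ ≤ 2 * (c * |d|) * coeffNorm (derivative p) + 2 * (1 + H) ^ n * (c * |d|) *
          ((n - 1 : ℕ) * coeffNorm (derivative p)) := by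
          refine add_le_add (by gcongr) (e3.trans (by gcongr))
      _ = _ := by ring
  -- `p'` has lower degree and solves the differentiated equation, whose right-hand side is
  -- controlled by that for `p` because degrees are bounded. The estimate for `p'` is inserted into
  -- `base`.
  induction n with
  | zero =>
    intro p hp
    have h3 := base 0 p hp
    rw [natDegree_eq_zero.1 (Nat.le_zero.1 hp) |>.choose_spec.symm] at h3 ⊢
    simpa [invConst] using h3
  | succ n ih =>
    intro p hp
    have h3 := base (n + 1) p hp
    have hp' : (derivative p).natDegree ≤ n := (natDegree_derivative_le p).trans (by omega)
    have h4 := ih (derivative p) hp'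
    rw [← derivative_modOp] at h4
    have h5 : coeffNorm (derivative (modOp α β h p)) ≤ (n + 1 : ℕ) * coeffNorm (modOp α β h p) :=
      coeffNorm_derivative_le ((natDegree_modOp_le _ _ _ _).trans hp)
    have h6 := invConst_nonneg hc hH0 n
    rw [invConst]
    simp only [Nat.add_sub_cancel] at h3
    calc _ ≤ _ := h3
      _ = coeffNorm (modOp α β h p) + (2 * c + 2 * (1 + H) ^ (n + 1) * c * n) *
        (|d| * coeffNorm (derivative p)) := by ring
      _ ≤ coeffNorm (modOp α β h p) + (2 * c + 2 * (1 + H) ^ (n + 2) * c * (n + 1)) *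
        (invConst c H n * ((n + 2) * coeffNorm (modOp α β h p))) := by
          have h8 := coeffNorm_nonneg (modOp α β h p)
          have h9 : (1 + H) ^ (n + 1) ≤ (1 + H) ^ (n + 2) :=
            pow_le_pow_right₀ (by linarith) (by omega)
          refine add_le_add le_rfl (mul_le_mul ?_ (h4.trans ?_) ?_ (by positivity))
          · gcongr
            linarith
          · gcongr
            refine h5.trans (mul_le_mul_of_nonneg_right ?_ h8)
            push_cast; linarith
          · exact mul_nonneg hd'.le (coeffNorm_nonneg _)
      _ = _ := by ring

/-- The diagonal case: only the derivative is controlled. -/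
theorem coeffNorm_derivative_le_of_modOp {α β h c H : ℝ} (hc : 0 ≤ c) (hh : 0 ≤ h) (hH : h ≤ H)
    (hd : 2 * Real.cos α - 2 * Real.cos β = 0) (h1 : h ≤ c * |Real.sin α|) (n : ℕ) :
    ∀ p : ℂ[X], p.natDegree ≤ n + 1 →
      |Real.sin α| * h * coeffNorm (derivative p) ≤
        invConst c H n * coeffNorm (modOp α β h p) := by
  have hH0 : 0 ≤ H := hh.trans hH
  have base : ∀ (n : ℕ) (p : ℂ[X]), p.natDegree ≤ n + 1 →
      2 * (|Real.sin α| * h) * coeffNorm (derivative p) ≤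
      coeffNorm (modOp α β h p) + 2 * (1 + H) ^ (n + 1) * c * (|Real.sin α| * h) *
        coeffNorm (derivative (derivative p)) := by
    intro n p hp
    have e := modOp_eq α β h p
    rw [hd, Complex.ofReal_zero, C_0, zero_mul, zero_add] at e
    have e' : C (2 * Complex.I * (Real.sin α : ℂ) * h) * derivative p = modOp α β h p -
      (C (Complex.exp (Complex.I * α)) * taylorRem h p +
        C (Complex.exp (-(Complex.I * α))) * taylorRem (-h) p) := by rw [e]; ring
    have e2 := congrArg coeffNorm e'
    have e5 : ‖2 * Complex.I * (Real.sin α : ℂ) * h‖ = 2 * (|Real.sin α| * h) := by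
      simp only [norm_mul, Complex.norm_I, Complex.norm_real, Real.norm_eq_abs, abs_of_nonneg hh]
      simp; ring
    rw [coeffNorm_C_mul, e5] at e2
    rw [e2]
    refine (coeffNorm_sub _ _).trans (add_le_add le_rfl ?_)
    have e3 := coeffNorm_second_order α h (H := H) (by rwa [abs_of_nonneg hh]) hp
    have e6 := coeffNorm_nonneg (derivative (derivative p))
    -- One factor `h` is traded for `c |sin α|`, so that the second-order remainder carries the same
    -- prefactor `|sin α| h` as the leading term.
    have e7 : h ^ 2 ≤ c * (|Real.sin α| * h) := by rw [sq]; nlinarith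
    calc _ ≤ _ := e3
      _ ≤ 2 * (1 + H) ^ (n + 1) * (c * (|Real.sin α| * h)) *
        coeffNorm (derivative (derivative p)) := by gcongr
      _ = _ := by ring
  induction n with
  | zero =>
    intro p hp
    have h3 := base 0 p hp
    have h4 : derivative (derivative p) = 0 := by
      have : (derivative p).natDegree = 0 := by
        have := natDegree_derivative_le p; omega
      rw [natDegree_eq_zero.1 this |>.choose_spec.symm, derivative_C]
    rw [h4, coeffNorm_zero, mul_zero, add_zero] at h3
    simp only [invConst, one_mul]
    have := coeffNorm_nonneg (derivative p)
    have : 0 ≤ |Real.sin α| * h * coeffNorm (derivative p) := by positivity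
    linarith
  | succ n ih =>
    intro p hp
    have h3 := base (n + 1) p hp
    have hp' : (derivative p).natDegree ≤ n + 1 := (natDegree_derivative_le p).trans (by omega)
    have h4 := ih (derivative p) hp'
    rw [← derivative_modOp] at h4
    have h5 : coeffNorm (derivative (modOp α β h p)) ≤
        (n + 1 + 1 : ℕ) * coeffNorm (modOp α β h p) :=
      coeffNorm_derivative_le ((natDegree_modOp_le _ _ _ _).trans hp)
    have h6 := invConst_nonneg hc hH0 n
    have h7 := coeffNorm_nonneg (derivative p)
    have h8 := coeffNorm_nonneg (modOp α β h p)
    have h9 : 0 ≤ |Real.sin α| * h * coeffNorm (derivative p) := by positivity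
    rw [invConst]
    have h10 : 0 ≤ 2 * c * (invConst c H n * ((n + 2) * coeffNorm (modOp α β h p))) := by
      positivity
    calc |Real.sin α| * h * coeffNorm (derivative p)
        ≤ 2 * (|Real.sin α| * h) * coeffNorm (derivative p) := by linarith
      _ ≤ _ := h3
      _ = coeffNorm (modOp α β h p) + (2 * (1 + H) ^ (n + 2) * c) *
        (|Real.sin α| * h * coeffNorm (derivative (derivative p))) := by ring
      _ ≤ coeffNorm (modOp α β h p) + (2 * (1 + H) ^ (n + 2) * c * (n + 1)) *
        (invConst c H n * ((n + 2) * coeffNorm (modOp α β h p))) := by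
          refine add_le_add le_rfl (mul_le_mul ?_ (h4.trans ?_) ?_ (by positivity))
          · refine le_mul_of_one_le_right (by positivity) ?_
            have : (0 : ℝ) ≤ n := by positivity
            linarith
          · gcongr
            refine h5.trans (mul_le_mul_of_nonneg_right ?_ h8)
            push_cast; linarith
          · exact mul_nonneg (mul_nonneg (abs_nonneg _) hh) (coeffNorm_nonneg _)
      _ ≤ _ := by
        rw [add_mul, add_mul, add_mul]
        nlinarith

end TrigInt

/-! ### Injectivity of the difference operator, degrees of solutions, values at shifted points -/

namespace TrigInt
open Polynomial

theorem natDegree_le_of_iterate_derivative {p : ℂ[X]} {n : ℕ} (h : derivative^[n + 1] p = 0) :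
    p.natDegree ≤ n := by
  induction n generalizing p with
  | zero => exact (derivative_eq_zero.1 (by simpa using h)).le
  | succ n ih =>
    have := ih (p := derivative p) (by rwa [Function.iterate_succ_apply] at h)
    rw [natDegree_derivative] at this
    omega

theorem iterate_derivative_modOp (α β h : ℝ) (p : ℂ[X]) (n : ℕ) :
    derivative^[n] (modOp α β h p) = modOp α β h (derivative^[n] p) := by
  induction n with
  | zero => rfl
  | succ n ih => rw [Function.iterate_succ_apply', ih, derivative_modOp,
      Function.iterate_succ_apply']

/-- The inversion estimate with zero right-hand side, taken at `H = h`. This uniqueness gives the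
degree bounds and the conjugation symmetry. -/
theorem eq_zero_of_modOp {α β h c : ℝ} (hc : 0 ≤ c) (hh : 0 ≤ h)
    (hd : 2 * Real.cos α - 2 * Real.cos β ≠ 0)
    (h1 : |Real.sin α| * h ≤ c * |2 * Real.cos α - 2 * Real.cos β|)
    (h2 : h ^ 2 ≤ c * |2 * Real.cos α - 2 * Real.cos β|) {p : ℂ[X]} (hp : modOp α β h p = 0) :
    p = 0 := by
  have := coeffNorm_le_of_modOp hc hh le_rfl hd h1 h2 p.natDegree p le_rfl
  rw [hp, coeffNorm_zero, mul_zero] at this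
  exact coeffNorm_eq_zero (nonpos_of_mul_nonpos_right this (abs_pos.2 hd))

theorem derivative_eq_zero_of_modOp {α β h c : ℝ} (hc : 0 ≤ c) (hh : 0 < h)
    (hd : 2 * Real.cos α - 2 * Real.cos β = 0) (h1 : h ≤ c * |Real.sin α|) {p : ℂ[X]}
    (hp : modOp α β h p = 0) : derivative p = 0 := by
  have := coeffNorm_derivative_le_of_modOp hc hh.le le_rfl hd h1 p.natDegree p (by omega)
  rw [hp, coeffNorm_zero, mul_zero] at this
  have h0 : 0 < |Real.sin α| := by
    by_contra h0
    have := abs_nonneg (Real.sin α)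
    have : |Real.sin α| = 0 := by linarith
    rw [this] at h1; linarith
  exact coeffNorm_eq_zero (nonpos_of_mul_nonpos_right this (mul_pos h0 hh))

/-- Differentiating the equation `n + 1` times annihilates the right-hand side; by injectivity the
same derivative of `p` is zero. -/
theorem natDegree_le_of_modOp {α β h c : ℝ} (hc : 0 ≤ c) (hh : 0 ≤ h)
    (hd : 2 * Real.cos α - 2 * Real.cos β ≠ 0)
    (h1 : |Real.sin α| * h ≤ c * |2 * Real.cos α - 2 * Real.cos β|)
    (h2 : h ^ 2 ≤ c * |2 * Real.cos α - 2 * Real.cos β|) {p : ℂ[X]} {n : ℕ}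
    (hp : (modOp α β h p).natDegree ≤ n) : p.natDegree ≤ n := by
  refine natDegree_le_of_iterate_derivative (eq_zero_of_modOp hc hh hd h1 h2 ?_)
  rw [← iterate_derivative_modOp]
  exact iterate_derivative_eq_zero (by omega)

/-- On the diagonal the kernel consists of constants, so one more differentiation is needed and the
degree may grow by one. -/
theorem natDegree_le_succ_of_modOp {α β h c : ℝ} (hc : 0 ≤ c) (hh : 0 < h)
    (hd : 2 * Real.cos α - 2 * Real.cos β = 0) (h1 : h ≤ c * |Real.sin α|) {p : ℂ[X]} {n : ℕ}
    (hp : (modOp α β h p).natDegree ≤ n) : p.natDegree ≤ n + 1 := by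
  refine natDegree_le_of_iterate_derivative ?_
  rw [Function.iterate_succ_apply']
  refine derivative_eq_zero_of_modOp hc hh hd h1 ?_
  rw [← iterate_derivative_modOp]
  exact iterate_derivative_eq_zero (by omega)

/-- The constant in the first-order Taylor estimate on `|x| ≤ R`. -/
def evalConst (R H : ℝ) (n : ℕ) : ℝ := R ^ n * (1 + (1 + H) ^ n * H * n)

theorem evalConst_nonneg {R H : ℝ} (hR : 0 ≤ R) (hH : 0 ≤ H) (n : ℕ) : 0 ≤ evalConst R H n := by
  unfold evalConst; positivity

theorem norm_eval_add_sub_le {p : ℂ[X]} {n : ℕ} (hp : p.natDegree ≤ n) {x h : ℂ} {R H : ℝ}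
    (hR : 1 ≤ R) (hx : ‖x‖ ≤ R) (hH : ‖h‖ ≤ H) :
    ‖p.eval (x + h) - p.eval x‖ ≤ evalConst R H n * ‖h‖ * coeffNorm (derivative p) := by
  have h1 : p.eval (x + h) - p.eval x = (taylor h p - p).eval x := by simp [taylor_eval]
  rw [h1]
  have h2 : (taylor h p - p).natDegree ≤ n :=
    (natDegree_sub_le _ _).trans (max_le (by simpa using hp) hp)
  refine (norm_eval_le h2 hR hx).trans ?_
  unfold evalConst
  have := coeffNorm_taylor_sub hH hp
  have hR0 : 0 ≤ R ^ n := by positivity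
  nlinarith [mul_le_mul_of_nonneg_left this hR0]

/-- Since `e^{iα} - e^{-iα} = 2i sin α`, what remains is two first-order Taylor differences. Divided
by `2 τ sinc`, the symmetric difference is the velocity of one oscillation. -/
theorem norm_symm_diff_sub_le {p : ℂ[X]} {n : ℕ} (hp : p.natDegree ≤ n) {x h α : ℝ} {R H : ℝ}
    (hR : 1 ≤ R) (hx : |x| ≤ R) (hh : 0 ≤ h) (hH : h ≤ H) :
    ‖Complex.exp (Complex.I * α) * p.eval ((x + h : ℝ) : ℂ)
      - Complex.exp (-(Complex.I * α)) * p.eval ((x - h : ℝ) : ℂ)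
      - 2 * Complex.I * (Real.sin α : ℂ) * p.eval (x : ℂ)‖ ≤
      2 * (evalConst R H n * h * coeffNorm (derivative p)) := by
  rw [← exp_sub_exp_neg]
  have hx' : ‖(x : ℂ)‖ ≤ R := by simpa using hx
  have hn : ‖(h : ℂ)‖ = h := by simp [abs_of_nonneg hh]
  have h1 := norm_eval_add_sub_le hp (h := h) (H := H) hR hx' (by rw [hn]; exact hH)
  have h2 := norm_eval_add_sub_le hp (h := -h) (H := H) hR hx' (by rw [norm_neg, hn]; exact hH)
  rw [norm_neg] at h2
  rw [hn] at h1 h2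
  rw [Complex.ofReal_add, Complex.ofReal_sub, sub_eq_add_neg (x : ℂ) (h : ℂ)]
  calc _ = ‖Complex.exp (Complex.I * α) * (p.eval ((x : ℂ) + h) - p.eval (x : ℂ)) -
      Complex.exp (-(Complex.I * α)) * (p.eval ((x : ℂ) + -h) - p.eval (x : ℂ))‖ := by
        congr 1; ring
    _ ≤ _ := by
        refine (norm_sub_le _ _).trans ?_
        rw [norm_mul, norm_mul, norm_exp_I_mul, norm_exp_neg_I_mul]
        linarith

theorem norm_symm_diff_le {p : ℂ[X]} {n : ℕ} (hp : p.natDegree ≤ n) {x h α : ℝ} {R H : ℝ}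
    (hR : 1 ≤ R) (hx : |x| ≤ R) (hh : 0 ≤ h) (hH : h ≤ H) :
    ‖Complex.exp (Complex.I * α) * p.eval ((x + h : ℝ) : ℂ)
      - Complex.exp (-(Complex.I * α)) * p.eval ((x - h : ℝ) : ℂ)‖ ≤
      2 * (R ^ n * |Real.sin α| + evalConst R H n * n * h) * coeffNorm p := by
  have h1 := norm_symm_diff_sub_le hp (α := α) hR hx hh hH
  have hx' : ‖(x : ℂ)‖ ≤ R := by simpa using hx
  have h2 := norm_eval_le hp hR hx'
  have h3 := coeffNorm_derivative_le hp
  have h4 := evalConst_nonneg (by linarith : 0 ≤ R) (hh.trans hH) n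
  have h5 : ‖2 * Complex.I * (Real.sin α : ℂ) * p.eval (x : ℂ)‖ ≤
      2 * |Real.sin α| * (R ^ n * coeffNorm p) := by
    rw [norm_mul, norm_mul, norm_mul, Complex.norm_I, Complex.norm_real, Real.norm_eq_abs]
    simp only [Complex.norm_ofNat, mul_one]
    gcongr
  have h6 : evalConst R H n * h * coeffNorm (derivative p) ≤
      evalConst R H n * h * (n * coeffNorm p) := by gcongr
  have h7 := norm_le_norm_add_norm_sub' (Complex.exp (Complex.I * α) * p.eval ((x + h : ℝ) : ℂ)
      - Complex.exp (-(Complex.I * α)) * p.eval ((x - h : ℝ) : ℂ))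
      (2 * Complex.I * (Real.sin α : ℂ) * p.eval (x : ℂ))
  nlinarith

end TrigInt

namespace TrigInt

/-! ### Indices, weights and the weighted `ℓ²` norm -/

theorem idx_neg {M : ℕ} (j : ZMod (2 * M)) : idx (-j) = idx j := ZMod.natAbs_valMinAbs_neg j

theorem idx_add_le {M : ℕ} [NeZero M] (i j : ZMod (2 * M)) : idx (i + j) ≤ idx i + idx j :=
  (ZMod.natAbs_valMinAbs_add_le i j).trans (Int.natAbs_add_le _ _)

theorem idx_le_add_sub {M : ℕ} [NeZero M] (i j : ZMod (2 * M)) : idx j ≤ idx i + idx (j - i) := by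
  have := idx_add_le i (j - i)
  rwa [add_sub_cancel] at this

theorem idx_le {M : ℕ} [NeZero M] (j : ZMod (2 * M)) : idx j ≤ M := by
  have := ZMod.natAbs_valMinAbs_le j
  unfold idx; omega

theorem idx_intCast_le {M : ℕ} [NeZero M] (r : ℤ) : idx (r : ZMod (2 * M)) ≤ r.natAbs :=
  ZMod.natAbs_min_of_le_div_two (2 * M) _ r (by rw [ZMod.coe_valMinAbs])
    (by simpa using ZMod.natAbs_valMinAbs_le (r : ZMod (2 * M)))

theorem idx_natCast {M : ℕ} [NeZero M] {l : ℕ} (hl : l ≤ M) : idx (l : ZMod (2 * M)) = l := by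
  unfold idx
  rw [ZMod.valMinAbs_natCast_of_le_half (by omega)]
  rfl

theorem eq_or_eq_neg_of_idx_eq {M : ℕ} [NeZero M] {i j : ZMod (2 * M)} (h : idx i = idx j) :
    i = j ∨ i = -j := by
  rcases Int.natAbs_eq_natAbs_iff.1 h with h | h
  · left; rw [← ZMod.coe_valMinAbs i, h, ZMod.coe_valMinAbs]
  · right; rw [← ZMod.coe_valMinAbs i, h, Int.cast_neg, ZMod.coe_valMinAbs]

theorem weight_pos (s : ℝ) (n : ℕ) : 0 < weight s n := by
  unfold weight; positivity

theorem weight_mono {s : ℝ} (hs : 0 ≤ s) {m n : ℕ} (h : m ≤ n) : weight s m ≤ weight s n := by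
  unfold weight; gcongr

theorem weight_le_of_le_mul {s : ℝ} (hs : 0 ≤ s) {m n c : ℕ} (hc : 1 ≤ c)
    (h : m ≤ c * max n 1) : weight s m ≤ (c : ℝ) ^ (2 * s) * weight s n := by
  unfold weight
  rw [← Real.mul_rpow (by positivity) (by positivity)]
  gcongr
  have h1 : max m 1 ≤ c * max n 1 := max_le h (Nat.mul_pos hc (by positivity))
  exact_mod_cast h1

/-- The larger of two indices is at least half of their sum. This is what makes the weighted space
an algebra. -/
theorem weight_le_add {s : ℝ} (hs : 0 ≤ s) {n m₁ m₂ : ℕ} (h : n ≤ m₁ + m₂) :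
    weight s n ≤ 2 ^ (2 * s) * (weight s m₁ + weight s m₂) := by
  have h1 := (weight_pos s m₁).le
  have h2 := (weight_pos s m₂).le
  have h3 : (0 : ℝ) ≤ 2 ^ (2 * s) := by positivity
  rcases le_total m₁ m₂ with h4 | h4
  · refine (weight_le_of_le_mul hs (c := 2) (by norm_num) (n := m₂) ?_).trans ?_
    · omega
    · push_cast; nlinarith
  · refine (weight_le_of_le_mul hs (c := 2) (by norm_num) (n := m₁) ?_).trans ?_
    · omega
    · push_cast; nlinarith

/-- Bound of `∑_j 1 / σ_j`. -/
def weightSum (s : ℝ) : ℝ := ∑' n : ℤ, (max |(n : ℝ)| 1) ^ (-(2 * s))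

theorem summable_weight {s : ℝ} (hs : 1 / 2 < s) :
    Summable fun n : ℤ => (max |(n : ℝ)| 1) ^ (-(2 * s)) := by
  have h1 : Summable fun n : ℤ => |(n : ℝ)| ^ (-(2 * s)) :=
    Real.summable_abs_int_rpow (by linarith)
  have h2 : Summable fun n : ℤ => if n = 0 then (1 : ℝ) else 0 :=
    (hasSum_ite_eq 0 (1 : ℝ)).summable
  refine Summable.of_nonneg_of_le (fun n => by positivity) (fun n => ?_) (h1.add h2)
  rcases eq_or_ne n 0 with rfl | h
  · simp; positivity
  · have : (1 : ℝ) ≤ |(n : ℝ)| := by exact_mod_cast Int.one_le_abs h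
    rw [max_eq_left this, if_neg h, add_zero]

/-- Representatives of smallest absolute value embed the residues into `ℤ`, so one convergent series
bounds the sums for all `M` at once. -/
theorem sum_inv_weight_le {M : ℕ} [NeZero M] {s : ℝ} (hs : 1 / 2 < s) :
    ∑ j : ZMod (2 * M), (weight s (idx j))⁻¹ ≤ weightSum s := by
  classical
  have h1 : ∀ j : ZMod (2 * M), (weight s (idx j))⁻¹ =
      (max |((j.valMinAbs : ℤ) : ℝ)| 1) ^ (-(2 * s)) := by
    intro j
    unfold weight idx
    rw [Real.rpow_neg (by positivity), Nat.cast_natAbs, Int.cast_abs]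
  simp only [h1]
  have hinj : Function.Injective (ZMod.valMinAbs : ZMod (2 * M) → ℤ) := by
    intro i j h
    rw [← ZMod.coe_valMinAbs i, h, ZMod.coe_valMinAbs]
  rw [← Finset.sum_image (s := Finset.univ) (g := fun j : ZMod (2 * M) => j.valMinAbs)
    (f := fun n : ℤ => (max |(n : ℝ)| 1) ^ (-(2 * s))) (fun i _ j _ h => hinj h)]
  exact (summable_weight hs).sum_le_tsum _ fun n _ => by positivity

theorem weightSum_nonneg (s : ℝ) : 0 ≤ weightSum s :=
  tsum_nonneg fun _ => by positivity

variable {M : ℕ} [NeZero M]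

/-- The norm `(∑_j σ_j f_j²)^{1/2}`. -/
def wnorm (s : ℝ) (f : ZMod (2 * M) → ℝ) : ℝ := √(∑ j, weight s (idx j) * f j ^ 2)

theorem wnorm_nonneg (s : ℝ) (f : ZMod (2 * M) → ℝ) : 0 ≤ wnorm s f := Real.sqrt_nonneg _

theorem wnorm_sq (s : ℝ) (f : ZMod (2 * M) → ℝ) :
    wnorm s f ^ 2 = ∑ j, weight s (idx j) * f j ^ 2 :=
  Real.sq_sqrt (Finset.sum_nonneg fun _ _ => mul_nonneg (weight_pos s _).le (sq_nonneg _))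

theorem wnorm_eq_norm (s : ℝ) (f : ZMod (2 * M) → ℝ) :
    wnorm s f = ‖WithLp.toLp 2 (fun j => √(weight s (idx j)) * f j)‖ := by
  rw [EuclideanSpace.norm_eq, wnorm]
  congr 1
  refine Finset.sum_congr rfl fun j _ => ?_
  rw [norm_mul, mul_pow, Real.norm_eq_abs, Real.norm_eq_abs, sq_abs, sq_abs,
    Real.sq_sqrt (weight_pos s _).le]

theorem wnorm_mono {s : ℝ} {f g : ZMod (2 * M) → ℝ} (h : ∀ j, |f j| ≤ g j) :
    wnorm s f ≤ wnorm s g := by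
  refine Real.sqrt_le_sqrt (Finset.sum_le_sum fun j _ => ?_)
  have := (weight_pos s (idx j)).le
  have h1 : f j ^ 2 ≤ g j ^ 2 := sq_le_sq' (by linarith [neg_abs_le (f j), h j])
    ((le_abs_self _).trans (h j))
  gcongr

theorem wnorm_add_le (s : ℝ) (f g : ZMod (2 * M) → ℝ) :
    wnorm s (fun j => f j + g j) ≤ wnorm s f + wnorm s g := by
  simp only [wnorm_eq_norm]
  refine le_trans (le_of_eq ?_) (norm_add_le _ _)
  congr 1
  ext j
  simp [mul_add]

theorem wnorm_const_mul (s : ℝ) {c : ℝ} (hc : 0 ≤ c) (f : ZMod (2 * M) → ℝ) :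
    wnorm s (fun j => c * f j) = c * wnorm s f := by
  unfold wnorm
  rw [← Real.sqrt_sq hc, ← Real.sqrt_mul (sq_nonneg _), Real.sqrt_sq hc, Finset.mul_sum]
  congr 1
  exact Finset.sum_congr rfl fun j _ => by ring

theorem wnorm_zero (s : ℝ) : wnorm s (fun _ : ZMod (2 * M) => (0 : ℝ)) = 0 := by simp [wnorm]

theorem wnorm_sum_le {α : Type*} (s : ℝ) (t : Finset α) (f : α → ZMod (2 * M) → ℝ) :
    wnorm s (fun j => ∑ i ∈ t, f i j) ≤ ∑ i ∈ t, wnorm s (f i) := by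
  classical
  induction t using Finset.induction_on with
  | empty => simp [wnorm_zero]
  | insert a t ha ih =>
    simp only [Finset.sum_insert ha]
    exact (wnorm_add_le s _ _).trans (by gcongr)

theorem le_wnorm {s : ℝ} (hs : 0 ≤ s) (f : ZMod (2 * M) → ℝ) (j : ZMod (2 * M)) :
    |f j| ≤ wnorm s f := by
  refine Real.abs_le_sqrt ?_
  have h1 : (1 : ℝ) ≤ weight s (idx j) := by
    unfold weight
    exact Real.one_le_rpow (le_max_right _ _) (by linarith)
  calc f j ^ 2 ≤ weight s (idx j) * f j ^ 2 := le_mul_of_one_le_left (sq_nonneg _) h1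
    _ ≤ _ := Finset.single_le_sum (f := fun j => weight s (idx j) * f j ^ 2)
      (fun j _ => mul_nonneg (weight_pos s _).le (sq_nonneg _)) (Finset.mem_univ j)

/-- The constant in the bound of the discrete convolution. -/
def convConst (s : ℝ) : ℝ := √(2 * 2 ^ (2 * s) * weightSum s)

theorem convConst_nonneg (s : ℝ) : 0 ≤ convConst s := Real.sqrt_nonneg _

/-- Cauchy–Schwarz with the weights `σ_i σ_{j-i}`. The quotient `σ_j / (σ_i σ_{j-i})` is at most
`2^(2s) (1/σ_i + 1/σ_{j-i})`, which is summable over `i` because `s > 1/2`. -/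
theorem wnorm_conv_le {s : ℝ} (hs : 1 / 2 < s) (f g : ZMod (2 * M) → ℝ) :
    wnorm s (fun j => ∑ i, f i * g (j - i)) ≤ convConst s * (wnorm s f * wnorm s g) := by
  have hw := fun n => weight_pos s n
  have hkey : ∀ j : ZMod (2 * M), weight s (idx j) * (∑ i, f i * g (j - i)) ^ 2 ≤
      2 * 2 ^ (2 * s) * weightSum s *
        ∑ i, (weight s (idx i) * f i ^ 2) * (weight s (idx (j - i)) * g (j - i) ^ 2) := by
    intro j
    have h1 := Finset.sum_mul_sq_le_sq_mul_sq Finset.univ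
      (fun i : ZMod (2 * M) => √((weight s (idx i))⁻¹ * (weight s (idx (j - i)))⁻¹))
      (fun i => √(weight s (idx i) * weight s (idx (j - i))) * (f i * g (j - i)))
    have e1 : ∀ i : ZMod (2 * M), √((weight s (idx i))⁻¹ * (weight s (idx (j - i)))⁻¹) *
        (√(weight s (idx i) * weight s (idx (j - i))) * (f i * g (j - i))) = f i * g (j - i) := by
      intro i
      rw [← mul_assoc, ← Real.sqrt_mul (mul_nonneg (inv_nonneg.2 (hw _).le)
        (inv_nonneg.2 (hw _).le)), ← mul_inv, inv_mul_cancel₀ (mul_pos (hw _) (hw _)).ne',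
        Real.sqrt_one, one_mul]
    have e2 : ∀ i : ZMod (2 * M), (√(weight s (idx i) * weight s (idx (j - i))) *
        (f i * g (j - i))) ^ 2 =
        (weight s (idx i) * f i ^ 2) * (weight s (idx (j - i)) * g (j - i) ^ 2) := by
      intro i
      rw [mul_pow, Real.sq_sqrt (mul_pos (hw _) (hw _)).le]; ring
    have e3 : ∀ i : ZMod (2 * M), √((weight s (idx i))⁻¹ * (weight s (idx (j - i)))⁻¹) ^ 2 =
        (weight s (idx i))⁻¹ * (weight s (idx (j - i)))⁻¹ := fun i =>
      Real.sq_sqrt (mul_nonneg (inv_nonneg.2 (hw _).le) (inv_nonneg.2 (hw _).le))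
    simp only [e1, e2, e3] at h1
    have h2 : weight s (idx j) * ∑ i, (weight s (idx i))⁻¹ * (weight s (idx (j - i)))⁻¹ ≤
        2 * 2 ^ (2 * s) * weightSum s := by
      have h3 : ∀ i : ZMod (2 * M), weight s (idx j) * ((weight s (idx i))⁻¹ *
          (weight s (idx (j - i)))⁻¹) ≤
          2 ^ (2 * s) * ((weight s (idx (j - i)))⁻¹ + (weight s (idx i))⁻¹) := by
        intro i
        have h4 := weight_le_add (by linarith : 0 ≤ s) (idx_le_add_sub i j)
        have h5 := mul_le_mul_of_nonneg_right h4
          (mul_nonneg (inv_nonneg.2 (hw (idx i)).le) (inv_nonneg.2 (hw (idx (j - i))).le))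
        refine h5.trans_eq ?_
        have h6 := (hw (idx i)).ne'
        have h7 := (hw (idx (j - i))).ne'
        field_simp
      rw [Finset.mul_sum]
      refine (Finset.sum_le_sum fun i _ => h3 i).trans ?_
      rw [← Finset.mul_sum, Finset.sum_add_distrib]
      have h8 := sum_inv_weight_le (M := M) hs
      have h9 : ∑ i : ZMod (2 * M), (weight s (idx (j - i)))⁻¹ =
          ∑ i : ZMod (2 * M), (weight s (idx i))⁻¹ :=
        Fintype.sum_equiv (Equiv.subLeft j) _ _ fun i => rfl
      rw [h9]
      have : (0 : ℝ) ≤ 2 ^ (2 * s) := by positivity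
      nlinarith
    calc _ ≤ weight s (idx j) * ((∑ i, (weight s (idx i))⁻¹ * (weight s (idx (j - i)))⁻¹) *
          ∑ i, (weight s (idx i) * f i ^ 2) * (weight s (idx (j - i)) * g (j - i) ^ 2)) :=
          mul_le_mul_of_nonneg_left h1 (hw _).le
      _ = (weight s (idx j) * (∑ i, (weight s (idx i))⁻¹ * (weight s (idx (j - i)))⁻¹)) *
          ∑ i, (weight s (idx i) * f i ^ 2) * (weight s (idx (j - i)) * g (j - i) ^ 2) := by ring
      _ ≤ _ := by
          refine mul_le_mul_of_nonneg_right h2 (Finset.sum_nonneg fun i _ => ?_)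
          exact mul_nonneg (mul_nonneg (hw _).le (sq_nonneg _))
            (mul_nonneg (hw _).le (sq_nonneg _))
  have hsum : ∑ j : ZMod (2 * M), ∑ i, (weight s (idx i) * f i ^ 2) *
      (weight s (idx (j - i)) * g (j - i) ^ 2) = wnorm s f ^ 2 * wnorm s g ^ 2 := by
    rw [Finset.sum_comm, wnorm_sq, wnorm_sq, Finset.sum_mul]
    refine Finset.sum_congr rfl fun i _ => ?_
    rw [← Finset.mul_sum]
    congr 1
    exact Fintype.sum_equiv (Equiv.subRight i) _ _ fun j => rfl
  have h0 : 0 ≤ 2 * 2 ^ (2 * s) * weightSum s := mul_nonneg (by positivity) (weightSum_nonneg s)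
  refine (le_abs_self _).trans (abs_le_of_sq_le_sq ?_ (mul_nonneg (convConst_nonneg s)
    (mul_nonneg (wnorm_nonneg s f) (wnorm_nonneg s g))))
  rw [wnorm_sq, mul_pow, mul_pow, convConst, Real.sq_sqrt h0, ← hsum, Finset.mul_sum]
  exact Finset.sum_le_sum fun j _ => hkey j

end TrigInt

namespace TrigInt

/-! ### Combinatorics of the index set -/

theorem profile_le {K : ℕ} (hK : 3 ≤ K) (n : ℕ) : profile K n ≤ K := by
  unfold profile; split_ifs <;> omega

theorem profile_pos {K : ℕ} (hK : 3 ≤ K) (n : ℕ) : 1 ≤ profile K n :=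
  one_le_profile (by omega) n

theorem le_profile {K n : ℕ} (h : n ≤ K) : n ≤ profile K n := by
  unfold profile; split_ifs <;> omega

theorem profile_of_le {K n : ℕ} (hK : 3 ≤ K) (h : K ≤ n) : profile K n = K := by
  unfold profile; split_ifs <;> omega

/-- Truncation at `K` keeps the absolute value subadditive, and the value `2` at index `0` is
admissible because any two profiles add up to at least `2`. -/
theorem profile_le_add {K : ℕ} (hK : 3 ≤ K) {n m₁ m₂ : ℕ} (h : n ≤ m₁ + m₂) :
    profile K n ≤ profile K m₁ + profile K m₂ := by
  unfold profile; split_ifs <;> omega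

section

variable {M K : ℕ}

theorem profile_le_order (j : ZMod (2 * M)) (k : Fin (M + 1) → ℤ) :
    profile K (idx j) ≤ order K j k := le_max_left _ _

theorem profile_le_order_of_ne (j : ZMod (2 * M)) {k : Fin (M + 1) → ℤ} {l : Fin (M + 1)}
    (h : k l ≠ 0) : profile K l ≤ order K j k :=
  le_max_of_le_right (Finset.le_sup (f := fun l : Fin (M + 1) => profile K (l : ℕ))
    (by simpa using h))

theorem order_le_iff {j : ZMod (2 * M)} {k : Fin (M + 1) → ℤ} {n : ℕ} :
    order K j k ≤ n ↔ profile K (idx j) ≤ n ∧ ∀ l, k l ≠ 0 → profile K (l : ℕ) ≤ n := by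
  simp [order, Finset.sup_le_iff]

theorem order_le (hK : 3 ≤ K) (j : ZMod (2 * M)) (k : Fin (M + 1) → ℤ) : order K j k ≤ K :=
  order_le_iff.2 ⟨profile_le hK _, fun _ _ => profile_le hK _⟩

theorem order_pos (hK : 3 ≤ K) (j : ZMod (2 * M)) (k : Fin (M + 1) → ℤ) : 1 ≤ order K j k :=
  (profile_pos hK _).trans (profile_le_order j k)

/-- A coordinate in which `k₁ + k₂` is nonzero is already nonzero in `k₁` or in `k₂`. Consequently
products of terms of size `δ^m(j₁,k₁)` and `δ^m(j₂,k₂)` are no larger than `δ^m(j,k)`. -/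
theorem order_add_le [NeZero M] (hK : 3 ≤ K) {j j₁ : ZMod (2 * M)} {k k₁ k₂ : Fin (M + 1) → ℤ}
    (h : k₁ + k₂ = k) : order K j k ≤ order K j₁ k₁ + order K (j - j₁) k₂ := by
  subst h
  refine order_le_iff.2 ⟨?_, fun l hl => ?_⟩
  · exact (profile_le_add hK (idx_le_add_sub j₁ j)).trans
      (add_le_add (profile_le_order _ _) (profile_le_order _ _))
  · have h1 : k₁ l ≠ 0 ∨ k₂ l ≠ 0 := by
      by_contra! h
      exact hl (by simp [h.1, h.2])
    rcases h1 with h1 | h1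
    · exact (profile_le_order_of_ne j₁ h1).trans (Nat.le_add_right _ _)
    · exact (profile_le_order_of_ne (j - j₁) h1).trans (Nat.le_add_left _ _)

/-- One factor carries the index `l` and thus has order at least `e(l)`; the other still has order
at least `1`. -/
theorem profile_lt_order_add [NeZero M] (hK : 3 ≤ K) {j₁ j₂ : ZMod (2 * M)}
    {k₁ k₂ : Fin (M + 1) → ℤ} {l : Fin (M + 1)} (h : (k₁ + k₂) l ≠ 0) :
    profile K l + 1 ≤ order K j₁ k₁ + order K j₂ k₂ := by
  have h1 : k₁ l ≠ 0 ∨ k₂ l ≠ 0 := by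
    by_contra! h'
    exact h (by simp [h'.1, h'.2])
  have h2 := order_pos hK j₁ k₁
  have h3 := order_pos hK j₂ k₂
  rcases h1 with h1 | h1
  · have := profile_le_order_of_ne (K := K) j₁ h1; omega
  · have := profile_le_order_of_ne (K := K) j₂ h1; omega

/-- The diagonal `k = ± ⟨j⟩`. -/
def IsDiag (j : ZMod (2 * M)) (k : Fin (M + 1) → ℤ) : Prop := k = unitVec j ∨ k = -unitVec j

theorem unitVec_neg (j : ZMod (2 * M)) : unitVec (-j) = unitVec j := by
  unfold unitVec; rw [idx_neg]

theorem unitVec_ne_neg [NeZero M] (j : ZMod (2 * M)) : unitVec j ≠ -unitVec j := by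
  intro h
  obtain ⟨l, -, hl⟩ := sum_unitVec j
  have := congrFun h l
  rw [hl] at this
  simp at this

theorem IsDiag.order_eq [NeZero M] {j : ZMod (2 * M)} {k : Fin (M + 1) → ℤ} (h : IsDiag j k) :
    order K j k = profile K (idx j) := by
  rcases h with rfl | rfl
  exacts [(order_unitVec j).1, (order_unitVec j).2]

theorem IsDiag.mem [NeZero M] (hK : 3 ≤ K) {j : ZMod (2 * M)} {k : Fin (M + 1) → ℤ}
    (h : IsDiag j k) : k ∈ setK K j := by
  rcases h with rfl | rfl
  exacts [(mem_unitVec (by omega) j).1, (mem_unitVec (by omega) j).2]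

/-- On the diagonal `m(j,k) = e(l)` for an index `l` with `k_l ≠ 0`, so the strict inequality for
such indices applies. The extra order yields the factor `δ^(2ν)` in `gain`. -/
theorem order_lt_of_diag [NeZero M] (hK : 3 ≤ K) {j j₁ : ZMod (2 * M)}
    {k k₁ k₂ : Fin (M + 1) → ℤ} (h : k₁ + k₂ = k) (hd : IsDiag j k) :
    order K j k + 1 ≤ order K j₁ k₁ + order K (j - j₁) k₂ := by
  obtain ⟨l, hl, hu⟩ := sum_unitVec j
  rw [hd.order_eq, ← hl]
  refine profile_lt_order_add hK ?_
  rw [h]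
  rcases hd with rfl | rfl <;> simp [hu]

/-- Either one factor has an index `≥ K` and uses up order `K` alone, or both indices are below `K`
and equal at most their profiles, while their sum exceeds `K`. -/
theorem order_lt_of_idx [NeZero M] (hK : 3 ≤ K) {j : ZMod (2 * M)} (j₁ : ZMod (2 * M))
    (k k₁ k₂ : Fin (M + 1) → ℤ) (hj : K < idx j) :
    order K j k + 1 ≤ order K j₁ k₁ + order K (j - j₁) k₂ := by
  have h1 := order_le hK j k
  have h2 := profile_le_order (K := K) j₁ k₁
  have h3 := profile_le_order (K := K) (j - j₁) k₂
  have h4 := idx_le_add_sub j₁ j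
  have h5 := order_pos hK j₁ k₁
  have h6 := order_pos hK (j - j₁) k₂
  rcases le_or_gt K (idx j₁) with h7 | h7
  · rw [profile_of_le hK h7] at h2; omega
  · rcases le_or_gt K (idx (j - j₁)) with h8 | h8
    · rw [profile_of_le hK h8] at h3; omega
    · have := le_profile h7.le
      have := le_profile h8.le
      omega

theorem mu_neg (k : Fin (M + 1) → ℤ) : mu K (-k) = mu K k := by simp [mu]

theorem mu_add_le (k₁ k₂ : Fin (M + 1) → ℤ) : mu K (k₁ + k₂) ≤ mu K k₁ + mu K k₂ := by
  unfold mu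
  rw [← Finset.sum_add_distrib]
  refine Finset.sum_le_sum fun l _ => ?_
  rw [← add_mul]
  exact Nat.mul_le_mul_right _ (Int.natAbs_add_le _ _)

theorem inK_neg {j : ZMod (2 * M)} {k : Fin (M + 1) → ℤ} (h : InK K j k) :
    InK K (-j) (-k) := by
  rcases h with ⟨h1, h2⟩ | ⟨r, k', hr, hi, hm, hk⟩
  · exact Or.inl ⟨by rwa [idx_neg, mu_neg], fun l hl => by simp [h2 l hl]⟩
  · have e : -j - ((-r : ℤ) : ZMod (2 * M)) = -(j - (r : ZMod (2 * M))) := by push_cast; ring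
    refine Or.inr ⟨-r, -k', by rwa [abs_neg], by rwa [e, idx_neg], by rwa [mu_neg], ?_⟩
    rw [e, unitVec_neg]
    rcases hk with rfl | rfl
    · right; abel
    · left; abel

theorem neg_mem_setK {j : ZMod (2 * M)} {k : Fin (M + 1) → ℤ} :
    -k ∈ setK K (-j) ↔ k ∈ setK K j := by
  rw [mem_setK, mem_setK]
  refine ⟨fun h => ?_, inK_neg⟩
  have := inK_neg h
  rwa [neg_neg, neg_neg] at this

/-- Sums over `𝒦_{-j}` and over `𝒦_j`. -/
theorem sum_setK_neg {β : Type*} [AddCommMonoid β] (j : ZMod (2 * M))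
    (f : (Fin (M + 1) → ℤ) → β) :
    ∑ k ∈ setK K (-j), f k = ∑ k ∈ setK K j, f (-k) := by
  refine (Finset.sum_nbij' (fun k => -k) (fun k => -k) ?_ ?_ ?_ ?_ ?_).symm
  · exact fun k hk => neg_mem_setK.2 hk
  · intro k hk
    have := (neg_mem_setK (K := K) (j := j) (k := -k))
    rw [neg_neg] at this
    exact this.1 hk
  all_goals simp

/-- The pairs `(j, k)` that are reached at order `m`. -/
def Reached (K : ℕ) (j : ZMod (2 * M)) (k : Fin (M + 1) → ℤ) (m : ℕ) : Prop :=
  (idx j ≤ m ∧ mu K k ≤ m ∧ ∀ l : Fin (M + 1), K ≤ (l : ℕ) → k l = 0) ∨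
  ∃ (r : ℤ) (k' : Fin (M + 1) → ℤ), r.natAbs + K ≤ m ∧ K ≤ idx (j - (r : ZMod (2 * M))) ∧
    mu K k' + K ≤ m ∧ (k = unitVec (j - (r : ZMod (2 * M))) + k' ∨
      k = -unitVec (j - (r : ZMod (2 * M))) + k')

theorem Reached.inK {j : ZMod (2 * M)} {k : Fin (M + 1) → ℤ} {m : ℕ} (h : Reached K j k m)
    (hm : m < 2 * K) : InK K j k := by
  rcases h with ⟨h1, h2, h3⟩ | ⟨r, k', hr, hi, hk', hk⟩
  · exact Or.inl ⟨by omega, h3⟩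
  · exact Or.inr ⟨r, k', by rw [Int.abs_eq_natAbs]; omega, hi, by omega, hk⟩

theorem reached_of_isDiag [NeZero M] (hK : 3 ≤ K) {j : ZMod (2 * M)} {k : Fin (M + 1) → ℤ}
    (hd : IsDiag j k) {m : ℕ} (hm : profile K (idx j) ≤ m) : Reached K j k m := by
  rcases lt_or_ge (idx j) K with h | h
  · left
    obtain ⟨l, hl, hu⟩ := sum_unitVec j
    have h2 : mu K (unitVec j) = profile K (idx j) := by
      rw [hu, ← hl]
      unfold mu
      rw [Finset.sum_eq_single l] <;> simp +contextual
    have h3 : mu K k = profile K (idx j) := by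
      rcases hd with rfl | rfl
      · exact h2
      · rw [mu_neg, h2]
    refine ⟨(le_profile h.le).trans hm, h3.trans_le hm, fun i hi => ?_⟩
    have h4 : unitVec j i = 0 := by unfold unitVec; rw [if_neg (by omega)]
    rcases hd with rfl | rfl
    · exact h4
    · simp [h4]
  · right
    rw [profile_of_le hK h] at hm
    refine ⟨0, 0, by simpa, by simpa, by simpa [mu], ?_⟩
    simpa [IsDiag] using hd

/-- A low factor is absorbed into a high one: `j₁` joins the shift `r` and `k₁` joins the remainder
`k'`, while the high unit vector stays the same. -/
theorem Reached.add_aux [NeZero M] {j₁ j₂ : ZMod (2 * M)} {k₁ k₂ : Fin (M + 1) → ℤ}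
    {m₁ m₂ : ℕ} (h1 : idx j₁ ≤ m₁) (h2 : mu K k₁ ≤ m₁)
    (h : ∃ (r : ℤ) (k' : Fin (M + 1) → ℤ), r.natAbs + K ≤ m₂ ∧
      K ≤ idx (j₂ - (r : ZMod (2 * M))) ∧ mu K k' + K ≤ m₂ ∧
      (k₂ = unitVec (j₂ - (r : ZMod (2 * M))) + k' ∨
        k₂ = -unitVec (j₂ - (r : ZMod (2 * M))) + k')) :
    ∃ (r : ℤ) (k' : Fin (M + 1) → ℤ), r.natAbs + K ≤ m₁ + m₂ ∧
      K ≤ idx (j₁ + j₂ - (r : ZMod (2 * M))) ∧ mu K k' + K ≤ m₁ + m₂ ∧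
      (k₁ + k₂ = unitVec (j₁ + j₂ - (r : ZMod (2 * M))) + k' ∨
        k₁ + k₂ = -unitVec (j₁ + j₂ - (r : ZMod (2 * M))) + k') := by
  obtain ⟨r, k', hr, hi, hk', hk⟩ := h
  have e : j₁ + j₂ - ((r + j₁.valMinAbs : ℤ) : ZMod (2 * M)) = j₂ - (r : ZMod (2 * M)) := by
    rw [Int.cast_add, ZMod.coe_valMinAbs]; ring
  refine ⟨r + j₁.valMinAbs, k₁ + k', ?_, by rwa [e], ?_, ?_⟩
  · have := Int.natAbs_add_le r j₁.valMinAbs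
    unfold idx at h1
    omega
  · have := mu_add_le (K := K) k₁ k'; omega
  · rw [e]
    rcases hk with rfl | rfl
    · left; abel
    · right; abel

/-- A high mode costs order `K`, so below total order `2K` at most one factor can contain one. This
closure under products is what makes the truncated index set harmless. -/
theorem Reached.add [NeZero M] {j₁ j₂ : ZMod (2 * M)} {k₁ k₂ : Fin (M + 1) → ℤ} {m₁ m₂ : ℕ}
    (h1 : Reached K j₁ k₁ m₁) (h2 : Reached K j₂ k₂ m₂) (hm : m₁ + m₂ < 2 * K) :
    Reached K (j₁ + j₂) (k₁ + k₂) (m₁ + m₂) := by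
  rcases h1 with ⟨h1, h1', h1''⟩ | h1
  · rcases h2 with ⟨h2, h2', h2''⟩ | h2
    · refine Or.inl ⟨(idx_add_le _ _).trans (by omega), (mu_add_le _ _).trans (by omega),
        fun l hl => ?_⟩
      simp [h1'' l hl, h2'' l hl]
    · exact Or.inr (Reached.add_aux h1 h1' h2)
  · rcases h2 with ⟨h2, h2', -⟩ | h2
    · have := Reached.add_aux h2 h2' h1
      rw [add_comm j₁, add_comm k₁, add_comm m₁]
      exact Or.inr this
    · obtain ⟨r, k', hr, -⟩ := h1
      obtain ⟨r', k'', hr', -⟩ := h2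
      omega

theorem freq_pos {ρ : ℝ} (hρ : 0 < ρ) (n : ℕ) : 0 < freq ρ n := by
  unfold freq; positivity

theorem sqrt_le_freq (ρ : ℝ) (n : ℕ) : √ρ ≤ freq ρ n :=
  Real.sqrt_le_sqrt (by nlinarith [sq_nonneg (n : ℝ)])

theorem freq_mono (ρ : ℝ) {m n : ℕ} (h : m ≤ n) : freq ρ m ≤ freq ρ n := by
  unfold freq; gcongr

theorem freq_add_le {ρ : ℝ} (hρ : 0 < ρ) (m n : ℕ) : freq ρ (m + n) ≤ freq ρ m + n := by
  have h1 : (m : ℝ) ≤ freq ρ m := Real.le_sqrt_of_sq_le (by linarith)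
  refine Real.sqrt_le_iff.2 ⟨by have := freq_pos hρ m; positivity, ?_⟩
  have h2 : freq ρ m ^ 2 = (m : ℝ) ^ 2 + ρ := Real.sq_sqrt (by positivity)
  have : (0 : ℝ) ≤ n := by positivity
  push_cast
  nlinarith

theorem one_le_weight {s : ℝ} (hs : 0 ≤ s) (n : ℕ) : 1 ≤ weight s n := by
  unfold weight
  exact Real.one_le_rpow (le_max_right _ _) (by linarith)

theorem sum_abs_mul_le_of_low (hK : 3 ≤ K) {k : Fin (M + 1) → ℤ}
    (h : ∀ l : Fin (M + 1), K ≤ (l : ℕ) → k l = 0) {f : ℕ → ℝ} (hf : Monotone f)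
    (hf0 : ∀ n, 0 ≤ f n) : ∑ l, |(k l : ℝ)| * f l ≤ mu K k * f K := by
  unfold mu
  rw [Nat.cast_sum, Finset.sum_mul]
  refine Finset.sum_le_sum fun l _ => ?_
  rcases lt_or_ge (l : ℕ) K with hl | hl
  · have h1 : |(k l : ℝ)| ≤ ((k l).natAbs * profile K l : ℕ) := by
      have h2 : ((k l).natAbs : ℝ) = |(k l : ℝ)| := by rw [Nat.cast_natAbs, Int.cast_abs]
      have h3 : (1 : ℝ) ≤ profile K (l : ℕ) := by exact_mod_cast profile_pos hK _
      push_cast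
      rw [h2]
      exact le_mul_of_one_le_right (abs_nonneg _) h3
    exact mul_le_mul h1 (hf hl.le) (hf0 _) (by positivity)
  · have h4 := hf0 K
    rw [h l hl]
    simp

/-- The constant in `sum_weight_freq_le`. -/
def couplingConst (K : ℕ) (s ρ : ℝ) : ℝ :=
  2 * K * (freq ρ K / √ρ) * weight s K + (1 + K / √ρ) * (K : ℝ) ^ (2 * s)

theorem couplingConst_nonneg (K : ℕ) {s ρ : ℝ} (hρ : 0 < ρ) : 0 ≤ couplingConst K s ρ := by
  have := weight_pos s K
  have := freq_pos hρ K
  unfold couplingConst; positivity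

/-- The weights that occur in the sum over `l` of the almost-invariant energies. -/
theorem sum_weight_freq_le [NeZero M] (hK : 3 ≤ K) {s ρ : ℝ} (hs : 0 ≤ s) (hρ : 0 < ρ)
    {j : ZMod (2 * M)} {k : Fin (M + 1) → ℤ} (hk : k ∈ setK K j) :
    ∑ l : Fin (M + 1), |(k l : ℝ)| * (freq ρ l * weight s l) ≤
      couplingConst K s ρ * (freq ρ (idx j) * weight s (idx j)) := by
  have hmono : Monotone fun n => freq ρ n * weight s n := fun m n h =>
    mul_le_mul (freq_mono ρ h) (weight_mono hs h) (weight_pos s _).le (freq_pos hρ _).le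
  have hpos : ∀ n, 0 ≤ freq ρ n * weight s n := fun n =>
    mul_nonneg (freq_pos hρ n).le (weight_pos s n).le
  have hρ' : 0 < √ρ := Real.sqrt_pos.2 hρ
  have hω := sqrt_le_freq ρ (idx j)
  have hσ := one_le_weight hs (idx j)
  have hσK := weight_pos s K
  have hωK := freq_pos hρ K
  have hωj := freq_pos hρ (idx j)
  have hK0 : freq ρ K * weight s K ≤
      (freq ρ K / √ρ) * weight s K * (freq ρ (idx j) * weight s (idx j)) := by
    have h1 : √ρ * 1 ≤ freq ρ (idx j) * weight s (idx j) := by gcongr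
    calc freq ρ K * weight s K = (freq ρ K / √ρ) * weight s K * (√ρ * 1) := by field_simp
      _ ≤ _ := by gcongr
  have hP := hpos (idx j)
  have hlow : ∀ k : Fin (M + 1) → ℤ, mu K k < 2 * K →
      (∀ l : Fin (M + 1), K ≤ (l : ℕ) → k l = 0) →
      ∑ l : Fin (M + 1), |(k l : ℝ)| * (freq ρ l * weight s l) ≤
        2 * K * (freq ρ K / √ρ) * weight s K * (freq ρ (idx j) * weight s (idx j)) := by
    intro k hk h0
    refine (sum_abs_mul_le_of_low hK h0 hmono hpos).trans ?_
    have h1 : (mu K k : ℝ) ≤ 2 * K := by exact_mod_cast hk.le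
    calc _ ≤ 2 * K * (freq ρ K * weight s K) := by
            exact mul_le_mul_of_nonneg_right h1 (hpos K)
      _ ≤ 2 * K * ((freq ρ K / √ρ) * weight s K * (freq ρ (idx j) * weight s (idx j))) := by
            gcongr
      _ = _ := by ring
  unfold couplingConst
  rw [add_mul]
  rcases (mem_setK j k).1 hk with ⟨h1, h2⟩ | ⟨r, k', hr, hi, hm, hk'⟩
  · refine (hlow k (by omega) h2).trans (le_add_of_nonneg_right ?_)
    positivity
  -- Every index `l ≥ K` costs `K` in `μ`, but `μ(k') < K`.
  · have h0 : ∀ l : Fin (M + 1), K ≤ (l : ℕ) → k' l = 0 := by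
      intro l hl
      by_contra h
      have h3 : (k' l).natAbs * profile K l ≤ mu K k' :=
        Finset.single_le_sum (f := fun l : Fin (M + 1) => (k' l).natAbs * profile K l)
          (fun _ _ => Nat.zero_le _) (Finset.mem_univ l)
      rw [profile_of_le hK hl] at h3
      have h4 : 1 ≤ (k' l).natAbs := Int.natAbs_pos.2 h
      nlinarith
    obtain ⟨i, hi', hu⟩ := sum_unitVec (j - (r : ZMod (2 * M)))
    have h5 : ∀ l, |(k l : ℝ)| ≤ |(k' l : ℝ)| + if l = i then 1 else 0 := by
      intro l
      have h6 : |(k l)| ≤ |k' l| + if l = i then 1 else 0 := by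
        rcases hk' with rfl | rfl
        · rw [hu, Pi.add_apply, Pi.single_apply, add_comm]
          refine (abs_add_le _ _).trans (add_le_add le_rfl ?_)
          split_ifs <;> simp
        · rw [hu, Pi.add_apply, Pi.neg_apply, Pi.single_apply, add_comm]
          refine (abs_add_le _ _).trans (add_le_add le_rfl ?_)
          split_ifs <;> simp
      exact_mod_cast h6
    have h7 : (i : ℕ) ≤ idx j + K := by
      rw [hi', sub_eq_add_neg, ← Int.cast_neg]
      refine (idx_add_le _ _).trans (add_le_add le_rfl ((idx_intCast_le _).trans ?_))
      rw [Int.natAbs_neg]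
      rw [Int.abs_eq_natAbs] at hr
      omega
    -- The strict inequality `|r| < K` matters: `|j| + K - 1 ≤ K |j|` holds for all `|j| ≥ 1`,
    -- whereas `|j| + K ≤ K |j|` fails for `|j| = 1`.
    have h7' : (i : ℕ) + 1 ≤ idx j + K := by
      rw [hi', sub_eq_add_neg, ← Int.cast_neg]
      have := idx_add_le j ((-r : ℤ) : ZMod (2 * M))
      have h8 := idx_intCast_le (M := M) (-r)
      rw [Int.natAbs_neg] at h8
      rw [Int.abs_eq_natAbs] at hr
      omega
    calc ∑ l : Fin (M + 1), |(k l : ℝ)| * (freq ρ l * weight s l)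
        ≤ ∑ l : Fin (M + 1), (|(k' l : ℝ)| * (freq ρ l * weight s l) +
            if l = i then freq ρ l * weight s l else 0) := by
          refine Finset.sum_le_sum fun l _ => ?_
          refine (mul_le_mul_of_nonneg_right (h5 l) (hpos _)).trans_eq ?_
          rw [add_mul, ite_mul, one_mul, zero_mul]
      _ = ∑ l : Fin (M + 1), |(k' l : ℝ)| * (freq ρ l * weight s l) +
          freq ρ i * weight s i := by
          rw [Finset.sum_add_distrib, Finset.sum_ite_eq' Finset.univ i, if_pos (Finset.mem_univ _)]
      _ ≤ _ := by
          refine add_le_add (hlow k' (by omega) h0) ?_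
          have h9 : freq ρ i ≤ (1 + K / √ρ) * freq ρ (idx j) := by
            refine (freq_mono ρ h7).trans ((freq_add_le hρ _ _).trans ?_)
            have : (K : ℝ) = K / √ρ * √ρ := by field_simp
            have h10 : (K : ℝ) / √ρ * √ρ ≤ K / √ρ * freq ρ (idx j) := by gcongr
            linarith
          have h11 : weight s i ≤ (K : ℝ) ^ (2 * s) * weight s (idx j) := by
            refine weight_le_of_le_mul hs (by omega) ?_
            rcases Nat.eq_zero_or_pos (idx j) with h | h
            · rw [h]; simp; omega
            · rw [max_eq_left h]
              nlinarith
          calc _ ≤ (1 + K / √ρ) * freq ρ (idx j) * ((K : ℝ) ^ (2 * s) * weight s (idx j)) := by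
                exact mul_le_mul h9 h11 (weight_pos s _).le (by positivity)
            _ = _ := by ring

end

end TrigInt

namespace TrigInt
open Polynomial

/-! ### The rescaled modulation coefficient functions -/

/-- The data and the hypotheses of the theorem, without the bounds on initial data and on
almost-invariant energies. -/
structure Setting (K : ℕ) (ν s γ ρ B : ℝ) where
  M : ℕ
  neZero : NeZero M
  τ : ℝ
  ε : ℝ
  φ : ℝ → ℝ
  ψ : ℝ → ℝ
  u₀ : ZMod (2 * M) → ℂ
  v₀ : ZMod (2 * M) → ℂ
  z : ZMod (2 * M) → (Fin (M + 1) → ℤ) → ℕ → ℂ[X]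
  hK : 3 ≤ K
  hν : 0 ≤ ν
  hν' : ν < 1 / 2
  hs : 1 / 2 < s
  hγ : 0 < γ
  hρ : 0 < ρ
  hKM : K ≤ M
  hτ : 0 < τ
  hε : 0 < ε
  hε1 : ε ≤ 1
  hφ : ∀ x, |φ x| ≤ B
  hψ : ∀ x, ψ x = Real.sinc x * φ x
  resonance : NonResonant M K ρ τ ε ν γ
  hu₀ : IsRealValued u₀
  hv₀ : IsRealValued v₀
  modulation : IsModulation K ρ τ ε ν φ ψ u₀ v₀ z

namespace Setting

attribute [instance] Setting.neZero

variable {K : ℕ} {ν s γ ρ B : ℝ} (S : Setting K ν s γ ρ B)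

/-- Spatial indices. -/
abbrev J : Type := ZMod (2 * S.M)

/-- Integer vectors. -/
abbrev V : Type := Fin (S.M + 1) → ℤ

/-- The small parameter `δ = √ε`. -/
def δ : ℝ := √S.ε

/-- The step-size `δ^ν τ` on the slow time scale. -/
def h : ℝ := S.ε ^ (ν / 2) * S.τ

/-- The frequency `ω_j`. -/
def ω (j : S.J) : ℝ := freq ρ (idx j)

/-- The exponent `e(j)`. -/
def e (j : S.J) : ℕ := profile K (idx j)

/-- The exponent `m(j, k)`. -/
def o (j : S.J) (k : S.V) : ℕ := order K j k

/-- The angle `(k · ω) τ`. -/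
def α (k : S.V) : ℝ := kdot ρ k * S.τ

/-- The angle `τ ω_j`. -/
def β (j : S.J) : ℝ := S.τ * freq ρ (idx j)

/-- The scaling factor `δ^{m(1-2ν) + 2ν m(j, k)}`. -/
def amp (j : S.J) (k : S.V) (m : ℕ) : ℝ := S.δ ^ ((m : ℝ) * (1 - 2 * ν) + 2 * ν * S.o j k)

/-- The rescaled coefficient functions. -/
def y (j : S.J) (k : S.V) (m : ℕ) : ℂ[X] := C (S.amp j k m : ℂ) * S.z j k m

/-- The filtered coefficient functions. -/
def fy (j : S.J) (k : S.V) (m : ℕ) : ℂ[X] := C (S.φ (S.β j) : ℂ) * S.y j k m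

/-- The quadratic right-hand side of the modulation system. -/
def F (j : S.J) (k : S.V) (m : ℕ) : ℂ[X] :=
  ∑ j₁ : S.J, ∑ k₁ ∈ setK K j₁, ∑ k₂ ∈ setK K (j - j₁) with k₁ + k₂ = k,
    ∑ p ∈ Finset.HasAntidiagonal.antidiagonal m, S.fy j₁ k₁ p.1 * S.fy (j - j₁) k₂ p.2

theorem δ_pos : 0 < S.δ := Real.sqrt_pos.2 S.hε

theorem δ_le_one : S.δ ≤ 1 := Real.sqrt_le_one.2 S.hε1

theorem δ_sq : S.δ ^ 2 = S.ε := Real.sq_sqrt S.hε.le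

theorem ε_rpow (x : ℝ) : S.ε ^ x = S.δ ^ (2 * x) := by
  rw [← S.δ_sq, ← Real.rpow_natCast, ← Real.rpow_mul S.δ_pos.le]
  norm_num

theorem h_eq : S.h = S.δ ^ ν * S.τ := by
  rw [h, S.ε_rpow]
  congr 2; ring

theorem h_pos : 0 < S.h := mul_pos (Real.rpow_pos_of_pos S.hε _) S.hτ

theorem θ_pos (S : Setting K ν s γ ρ B) : 0 < 1 - 2 * ν := by linarith [S.hν']

theorem amp_pos (j : S.J) (k : S.V) (m : ℕ) : 0 < S.amp j k m := Real.rpow_pos_of_pos S.δ_pos _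

theorem ω_pos (j : S.J) : 0 < S.ω j := freq_pos S.hρ _

theorem sqrt_le_ω (j : S.J) : √ρ ≤ S.ω j := sqrt_le_freq ρ _

theorem β_eq (j : S.J) : S.β j = S.τ * S.ω j := rfl

theorem β_pos (j : S.J) : 0 < S.β j := mul_pos S.hτ (S.ω_pos j)

theorem ω_neg (j : S.J) : S.ω (-j) = S.ω j := by unfold ω; rw [idx_neg]

theorem e_neg (j : S.J) : S.e (-j) = S.e j := by unfold e; rw [idx_neg]

theorem β_neg (j : S.J) : S.β (-j) = S.β j := by unfold β; rw [idx_neg]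

theorem α_neg (k : S.V) : S.α (-k) = -S.α k := by unfold α; rw [kdot_neg, neg_mul]

theorem e_le_o (j : S.J) (k : S.V) : S.e j ≤ S.o j k := profile_le_order j k

theorem e_pos (j : S.J) : 1 ≤ S.e j := profile_pos S.hK _

theorem e_le (j : S.J) : S.e j ≤ K := profile_le S.hK _

theorem o_le (j : S.J) (k : S.V) : S.o j k ≤ K := order_le S.hK j k

theorem α_unitVec (j : S.J) : S.α (unitVec j) = S.β j := by
  unfold α β; rw [kdot_unitVec, mul_comm]

theorem exp_α (k : S.V) : Complex.exp (Complex.I * kdot ρ k * S.τ) =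
    Complex.exp (Complex.I * (S.α k : ℂ)) := by
  unfold α; push_cast; rw [mul_assoc]

theorem exp_neg_α (k : S.V) : Complex.exp (-(Complex.I * kdot ρ k * S.τ)) =
    Complex.exp (-(Complex.I * (S.α k : ℂ))) := by
  unfold α; push_cast; rw [mul_assoc]

theorem y_eq_zero {j : S.J} {k : S.V} (hk : k ∈ setK K j) {m : ℕ} (hm : m < S.o j k) :
    S.y j k m = 0 := by
  rw [y, S.modulation.zero_of_lt j k hk m hm, mul_zero]

theorem fy_eq_zero {j : S.J} {k : S.V} {m : ℕ} (h : S.y j k m = 0) : S.fy j k m = 0 := by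
  rw [fy, h, mul_zero]

theorem F_eq_zero_of_lt {j : S.J} {k : S.V} {m : ℕ} (hm : m < S.o j k) : S.F j k m = 0 := by
  refine Finset.sum_eq_zero fun j₁ _ => Finset.sum_eq_zero fun k₁ hk₁ =>
    Finset.sum_eq_zero fun k₂ hk₂ => Finset.sum_eq_zero fun p hp => ?_
  rw [Finset.mem_filter] at hk₂
  have h1 := order_add_le S.hK (j := j) (j₁ := j₁) hk₂.2
  have h2 : p.1 + p.2 = m := by simpa using hp
  unfold o at hm
  rcases lt_or_ge p.1 (order K j₁ k₁) with h3 | h3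
  · rw [S.fy_eq_zero (S.y_eq_zero hk₁ h3), zero_mul]
  · rw [S.fy_eq_zero (S.y_eq_zero hk₂.1 (by unfold o; omega)), mul_zero]

/-- The exponent of `amp` is additive in `m` and in the orders, so the powers of `δ` in the original
system cancel and a plain convolution remains. Below the order `m(j,k)` both sides are zero, hence
no lower bound on `m` is needed. -/
theorem system {j : S.J} {k : S.V} (hk : k ∈ setK K j) {m : ℕ} (hm : m < 2 * K) :
    modOp (S.α k) (S.β j) S.h (S.y j k m) =
      C ((S.τ : ℂ) ^ 2 * (S.ψ (S.β j) : ℂ)) * S.F j k m := by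
  rcases lt_or_ge m (S.o j k) with ho | ho
  · rw [S.y_eq_zero hk ho, S.F_eq_zero_of_lt ho, map_zero, mul_zero]
  refine Polynomial.eq_of_infinite_eval_eq _ _ (Set.Infinite.mono ?_
    (Set.infinite_range_of_injective Complex.ofReal_injective))
  rintro _ ⟨x, rfl⟩
  have h1 := S.modulation.system j k hk m ho hm x
  rw [exp_α, exp_neg_α] at h1
  simp only [Set.mem_ofPred_eq, modOp, diffOp_eval, y, F, fy, eval_mul, eval_C, eval_finsetSum]
  have h2 := congrArg (fun w : ℂ => (S.amp j k m : ℂ) * w) h1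
  have e1 : ((x : ℂ) + (S.h : ℂ)) = ((x + S.ε ^ (ν / 2) * S.τ : ℝ) : ℂ) := by
    unfold h; push_cast; ring
  have e2 : ((x : ℂ) - (S.h : ℂ)) = ((x - S.ε ^ (ν / 2) * S.τ : ℝ) : ℂ) := by
    unfold h; push_cast; ring
  rw [e1, e2]
  unfold β at *
  refine Eq.trans ?_ (h2.trans ?_)
  · ring
  · rw [mul_left_comm]
    congr 1
    simp only [Finset.mul_sum]
    refine Finset.sum_congr rfl fun j₁ _ => Finset.sum_congr rfl fun k₁ _ =>
      Finset.sum_congr rfl fun k₂ _ => Finset.sum_congr rfl fun p hp => ?_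
    have h3 : p.1 + p.2 = m := by simpa using hp
    have h4 : S.amp j k m * √S.ε ^ (2 * ((order K j₁ k₁ : ℝ) + order K (j - j₁) k₂ -
        order K j k) * ν) = S.amp j₁ k₁ p.1 * S.amp (j - j₁) k₂ p.2 := by
      unfold amp o
      change S.δ ^ _ * S.δ ^ _ = _
      rw [← Real.rpow_add S.δ_pos, ← Real.rpow_add S.δ_pos, ← h3]
      congr 1
      push_cast
      ring
    rw [← mul_assoc, ← Complex.ofReal_mul, h4]
    push_cast
    ring

/-- At the order `m = e(j)` the scaling factor with exponent `m(1-2ν) + 2ν e(j)` is exactly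
`δ^(e(j))` and removes the normalization of the initial values. -/
theorem init_aux {j : S.J} {m : ℕ} (w : ℂ) :
    ((S.δ ^ ((m : ℝ) * (1 - 2 * ν) + 2 * ν * S.e j) : ℝ) : ℂ) *
      (if m = S.e j then ((√S.ε ^ (-(S.e j : ℝ)) : ℝ) : ℂ) * w else 0) =
      if m = S.e j then w else 0 := by
  split_ifs with h
  · rw [← mul_assoc, ← Complex.ofReal_mul]
    change ((S.δ ^ _ * S.δ ^ _ : ℝ) : ℂ) * w = w
    rw [← Real.rpow_add S.δ_pos, h, show (S.e j : ℝ) * (1 - 2 * ν) + 2 * ν * S.e j + -(S.e j : ℝ)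
      = 0 by ring, Real.rpow_zero]
    simp
  · simp

theorem amp_eq (j : S.J) (k : S.V) (m : ℕ) :
    S.amp j k m = S.δ ^ ((m : ℝ) * (1 - 2 * ν) + 2 * ν * S.e j) *
      √S.ε ^ (2 * ((order K j k : ℝ) - profile K (idx j)) * ν) := by
  change _ = _ * S.δ ^ _
  rw [← Real.rpow_add S.δ_pos, amp, o, e]
  congr 1
  ring

theorem init_position (j : S.J) {m : ℕ} (hm : m < 2 * K) :
    ∑ k ∈ setK K j, (S.y j k m).eval 0 = if m = S.e j then S.u₀ j else 0 := by
  rcases lt_or_ge m (S.e j) with he | he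
  · rw [if_neg (by omega)]
    refine Finset.sum_eq_zero fun k hk => ?_
    rw [S.y_eq_zero hk (he.trans_le (S.e_le_o j k)), eval_zero]
  have h1 := S.modulation.init_position j m he hm
  rw [← S.init_aux (S.u₀ j)]
  refine Eq.trans ?_ (congrArg (fun w : ℂ =>
    ((S.δ ^ ((m : ℝ) * (1 - 2 * ν) + 2 * ν * S.e j) : ℝ) : ℂ) * w) h1)
  rw [Finset.mul_sum]
  refine Finset.sum_congr rfl fun k _ => ?_
  rw [y, eval_mul, eval_C, S.amp_eq, Complex.ofReal_mul, mul_assoc]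

theorem init_velocity (j : S.J) {m : ℕ} (hm : m < 2 * K) :
    ∑ k ∈ setK K j, (Complex.exp (Complex.I * (S.α k : ℂ)) * (S.y j k m).eval ((S.h : ℝ) : ℂ) -
      Complex.exp (-(Complex.I * (S.α k : ℂ))) * (S.y j k m).eval ((-S.h : ℝ) : ℂ)) =
      if m = S.e j then 2 * (S.τ : ℂ) * (Real.sinc (S.β j) : ℂ) * S.v₀ j else 0 := by
  rcases lt_or_ge m (S.e j) with he | he
  · rw [if_neg (by omega)]
    refine Finset.sum_eq_zero fun k hk => ?_
    rw [S.y_eq_zero hk (he.trans_le (S.e_le_o j k))]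
    simp
  have h1 := S.modulation.init_velocity j m he hm
  rw [← S.init_aux (2 * (S.τ : ℂ) * (Real.sinc (S.β j) : ℂ) * S.v₀ j)]
  have h2 : (if m = S.e j then ((√S.ε ^ (-(S.e j : ℝ)) : ℝ) : ℂ) *
      (2 * (S.τ : ℂ) * (Real.sinc (S.β j) : ℂ) * S.v₀ j) else 0) =
      if m = profile K (idx j) then
          2 * (S.τ : ℂ) * (Real.sinc (S.τ * freq ρ (idx j)) : ℂ) *
            ((√S.ε ^ (-(profile K (idx j) : ℝ)) : ℝ) : ℂ) * S.v₀ j else 0 := by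
    unfold e β
    split_ifs <;> ring
  rw [h2]
  refine Eq.trans ?_ (congrArg (fun w : ℂ =>
    ((S.δ ^ ((m : ℝ) * (1 - 2 * ν) + 2 * ν * S.e j) : ℝ) : ℂ) * w) h1)
  rw [Finset.mul_sum]
  refine Finset.sum_congr rfl fun k _ => ?_
  rw [y, eval_mul, eval_C, eval_mul, eval_C, S.amp_eq, Complex.ofReal_mul, S.exp_α, S.exp_neg_α]
  unfold h
  ring

/-- The prefactors `δ^(m(j,k))` and `δ^((m - m(j,k))(1-2ν))` multiply to `amp`, so the modulation
function is the unweighted sum of the rescaled coefficients. -/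
theorem modFun_eq {j : S.J} {k : S.V} (hk : k ∈ setK K j) :
    modFun K S.ε ν S.z j k = ∑ m ∈ Finset.range (2 * K), S.y j k m := by
  have h1 : ∑ m ∈ Finset.range (2 * K), S.y j k m =
      ∑ m ∈ Finset.Ico (S.o j k) (2 * K), S.y j k m := by
    refine (Finset.sum_subset (fun m hm => ?_) fun m _ hm' => ?_).symm
    · rw [Finset.mem_Ico] at hm; exact Finset.mem_range.2 hm.2
    · refine S.y_eq_zero hk ?_
      simp only [Finset.mem_Ico, Finset.mem_range, not_and, not_lt] at *
      by_contra h
      have := hm' (by omega)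
      omega
  rw [h1, modFun, Finset.mul_sum]
  refine Finset.sum_congr rfl fun m _ => ?_
  rw [y, ← mul_assoc, ← C_mul, ← Complex.ofReal_mul]
  congr 3
  change S.δ ^ _ * S.δ ^ _ = _
  rw [← Real.rpow_natCast, ← Real.rpow_add S.δ_pos, amp, o]
  congr 1
  ring

end Setting

end TrigInt

namespace TrigInt
open Polynomial

/-- The multiplier factors into the two sines that the non-resonance condition bounds from below. -/
theorem two_cos_sub_two_cos (α β : ℝ) : |2 * Real.cos α - 2 * Real.cos β| =
    4 * (|Real.sin ((β + α) / 2)| * |Real.sin ((β - α) / 2)|) := by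
  have h := Real.cos_sub_cos α β
  rw [show (α - β) / 2 = -((β - α) / 2) by ring, Real.sin_neg, add_comm α β] at h
  have h1 : 2 * Real.cos α - 2 * Real.cos β =
      4 * (Real.sin ((β + α) / 2) * Real.sin ((β - α) / 2)) := by linarith
  rw [h1, abs_mul, abs_mul, abs_of_pos (by norm_num : (0 : ℝ) < 4)]

theorem abs_sin_add_le (x y : ℝ) : |Real.sin (x + y)| ≤ |Real.sin x| + |Real.sin y| := by
  rw [Real.sin_add]
  refine (abs_add_le _ _).trans (add_le_add ?_ ?_)
  · rw [abs_mul]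
    exact mul_le_of_le_one_right (abs_nonneg _) (Real.abs_cos_le_one _)
  · rw [abs_mul]
    exact mul_le_of_le_one_left (abs_nonneg _) (Real.abs_cos_le_one _)

theorem abs_sin_sub_le (x y : ℝ) : |Real.sin (x - y)| ≤ |Real.sin x| + |Real.sin y| := by
  have := abs_sin_add_le x (-y)
  rwa [Real.sin_neg, abs_neg, ← sub_eq_add_neg] at this

namespace Setting

variable {K : ℕ} {ν s γ ρ B : ℝ} (S : Setting K ν s γ ρ B)

/-! ### Consequences of the non-resonance condition -/

/-- The constant in the consequences of the non-resonance condition. -/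
def resConst (γ : ℝ) : ℝ := 1 / γ + 1 / γ ^ 2

theorem resConst_nonneg (S : Setting K ν s γ ρ B) : 0 ≤ resConst γ := by
  have := S.hγ
  unfold resConst; positivity

/-- `2 cos α - 2 cos β`. -/
def d (j : S.J) (k : S.V) : ℝ := 2 * Real.cos (S.α k) - 2 * Real.cos (S.β j)

theorem le_sin_plus {j : S.J} {k : S.V} (hk : k ∈ setK K j) (h : ¬ IsDiag j k) :
    γ * S.h ≤ |Real.sin ((S.β j + S.α k) / 2)| := by
  have h1 := (S.resonance j k ((mem_setK _ _).1 hk)).1 fun h' => h (Or.inr h')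
  refine le_trans (le_of_eq ?_) (h1.trans_eq (congrArg (fun x => |Real.sin x|) ?_))
  · unfold Setting.h; ring
  · unfold β α; ring

theorem le_sin_minus {j : S.J} {k : S.V} (hk : k ∈ setK K j) (h : ¬ IsDiag j k) :
    γ * S.h ≤ |Real.sin ((S.β j - S.α k) / 2)| := by
  have h1 := (S.resonance j k ((mem_setK _ _).1 hk)).2.1 fun h' => h (Or.inl h')
  refine le_trans (le_of_eq ?_) (h1.trans_eq (congrArg (fun x => |Real.sin x|) ?_))
  · unfold Setting.h; ring
  · unfold β α; ring

theorem le_sin_strong {j : S.J} {k : S.V} (hk : k ∈ setK K j) (h : ¬ IsDiag j k)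
    (hj : idx j ≤ K) : γ * S.τ ≤ |Real.sin ((S.β j + S.α k) / 2)| ∧
      γ * S.τ ≤ |Real.sin ((S.β j - S.α k) / 2)| := by
  have h1 := (S.resonance j k ((mem_setK _ _).1 hk)).2.2 (fun h' => h (Or.inl h'))
    (fun h' => h (Or.inr h')) hj
  unfold β α
  refine ⟨?_, ?_⟩
  · convert h1.1 using 3; ring
  · convert h1.2 using 3; ring

/-- The weak condition with the plus sign, tested at `k = ⟨j⟩`, where the half angle is `τ ω_j`
itself. -/
theorem h_le_sin (j : S.J) : S.h ≤ 1 / γ * |Real.sin (S.β j)| := by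
  have hγ := S.hγ
  have h1 := (S.resonance j (unitVec j) ((mem_setK _ _).1
    (mem_unitVec (by have := S.hK; omega) j).1)).1 (unitVec_ne_neg j)
  rw [kdot_unitVec, show S.τ * (freq ρ (idx j) + freq ρ (idx j)) / 2 = S.β j by
    unfold β; ring] at h1
  rw [one_div, inv_mul_eq_div, le_div_iff₀ hγ]
  refine le_trans (le_of_eq ?_) h1
  unfold h; ring

theorem sin_β_pos (j : S.J) : 0 < |Real.sin (S.β j)| := by
  have h1 := S.h_le_sin j
  have h2 := S.h_pos
  have h3 : 0 < 1 / γ := one_div_pos.2 S.hγ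
  by_contra h
  have h4 : |Real.sin (S.β j)| = 0 := le_antisymm (not_lt.1 h) (abs_nonneg _)
  rw [h4, mul_zero] at h1
  linarith

/-- The strong condition at `j = 0`, `k = 0`, combined with `|sin| ≤ 1`. All constants that involve
an upper bound of the step-size take it from here. -/
theorem τ_le : S.τ ≤ 1 / γ := by
  have hK := S.hK
  have h0 : idx (0 : S.J) = 0 := by unfold idx; simp
  have hk : InK K (0 : S.J) (0 : S.V) := Or.inl ⟨by simp [h0, mu]; omega, fun _ _ => rfl⟩
  have hu : unitVec (0 : S.J) ≠ 0 := by
    intro h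
    have := congrFun h 0
    simp [unitVec, h0] at this
  have h1 := ((S.resonance 0 0 hk).2.2 (fun h => hu h.symm)
    (fun h => hu (neg_eq_zero.1 h.symm)) (by rw [h0]; omega)).1
  rw [le_div_iff₀ S.hγ]
  linarith [Real.abs_sin_le_one (S.τ * (freq ρ (idx (0 : S.J)) + kdot ρ (0 : S.V)) / 2)]

theorem δ_rpow_le_one {x : ℝ} (hx : 0 ≤ x) : S.δ ^ x ≤ 1 :=
  Real.rpow_le_one S.δ_pos.le S.δ_le_one hx

theorem h_le_τ : S.h ≤ S.τ := by
  rw [S.h_eq]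
  exact mul_le_of_le_one_left S.hτ.le (S.δ_rpow_le_one S.hν)

theorem h_le : S.h ≤ 1 / γ := S.h_le_τ.trans S.τ_le

theorem sin_α_le (j : S.J) (k : S.V) : |Real.sin (S.α k)| ≤
    |Real.sin ((S.β j + S.α k) / 2)| + |Real.sin ((S.β j - S.α k) / 2)| := by
  convert abs_sin_sub_le ((S.β j + S.α k) / 2) ((S.β j - S.α k) / 2) using 3
  ring

theorem sin_β_le (j : S.J) (k : S.V) : |Real.sin (S.β j)| ≤
    |Real.sin ((S.β j + S.α k) / 2)| + |Real.sin ((S.β j - S.α k) / 2)| := by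
  convert abs_sin_add_le ((S.β j + S.α k) / 2) ((S.β j - S.α k) / 2) using 3
  ring

/-- Trades a sum of two sines for their product: each of `x t` and `y t` is at most `x y / γ`. It
serves with `t = h` for the weak and with `t = τ` for the strong condition. -/
theorem add_mul_le_d {x y t : ℝ} (hγ : 0 < γ) (hx : γ * t ≤ x) (hy : γ * t ≤ y)
    (ht : 0 < t) : (x + y) * t ≤ 1 / γ * (2 * (x * y)) := by
  have hx0 : 0 < x := (mul_pos hγ ht).trans_le hx
  have hy0 : 0 < y := (mul_pos hγ ht).trans_le hy
  rw [one_div, inv_mul_eq_div, le_div_iff₀ hγ]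
  nlinarith

theorem d_pos {j : S.J} {k : S.V} (hk : k ∈ setK K j) (h : ¬ IsDiag j k) : 0 < |S.d j k| := by
  unfold d
  rw [two_cos_sub_two_cos]
  have h0 := mul_pos S.hγ S.h_pos
  have h1 := h0.trans_le (S.le_sin_plus hk h)
  have h2 := h0.trans_le (S.le_sin_minus hk h)
  positivity

theorem sin_α_mul_h_le {j : S.J} {k : S.V} (hk : k ∈ setK K j) (h : ¬ IsDiag j k) :
    |Real.sin (S.α k)| * S.h ≤ resConst γ * |S.d j k| := by
  have h0 := S.h_pos
  have hγ := S.hγ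
  have h1 := add_mul_le_d hγ (S.le_sin_plus hk h) (S.le_sin_minus hk h) h0
  have h2 := mul_le_mul_of_nonneg_right (S.sin_α_le j k) h0.le
  have h3 := S.d_pos hk h
  have h4 : |S.d j k| = 4 * (|Real.sin ((S.β j + S.α k) / 2)| *
    |Real.sin ((S.β j - S.α k) / 2)|) := two_cos_sub_two_cos _ _
  have h5 : 0 < 1 / γ := by positivity
  have h6 : 0 < 1 / γ ^ 2 := by positivity
  unfold resConst
  nlinarith [mul_pos h5 h3, mul_pos h6 h3]

theorem h_sq_le {j : S.J} {k : S.V} (hk : k ∈ setK K j) (h : ¬ IsDiag j k) :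
    S.h ^ 2 ≤ resConst γ * |S.d j k| := by
  have h0 := S.h_pos
  have hγ := S.hγ
  have h1 := mul_le_mul (S.le_sin_plus hk h) (S.le_sin_minus hk h) (mul_pos hγ h0).le
    (abs_nonneg _)
  have h3 := S.d_pos hk h
  have h4 : |S.d j k| = 4 * (|Real.sin ((S.β j + S.α k) / 2)| *
    |Real.sin ((S.β j - S.α k) / 2)|) := two_cos_sub_two_cos _ _
  have h5 : 0 < 1 / γ := by positivity
  have h7 : S.h ^ 2 ≤ 1 / γ ^ 2 * |S.d j k| := by
    rw [one_div, inv_mul_eq_div, le_div_iff₀ (by positivity)]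
    nlinarith
  unfold resConst
  nlinarith [mul_pos h5 h3]

/-- The loss in the non-resonance condition for large `|j|`. -/
def loss (j : S.J) : ℝ := if K < idx j then S.δ ^ ν else 1

theorem loss_pos (j : S.J) : 0 < S.loss j := by
  unfold loss; split_ifs
  · exact Real.rpow_pos_of_pos S.δ_pos _
  · exact one_pos

/-- Both `α` and `β` are combinations of the half angles `(β ± α)/2`, so their sines are bounded by
the sum of the two sines in `d`. For `|j| ≤ K` the strong condition gives the full factor `τ`;
otherwise only `h = δ^ν τ` is available. -/
theorem loss_mul_τ_le {j : S.J} {k : S.V} (hk : k ∈ setK K j) (h : ¬ IsDiag j k) :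
    S.loss j * (S.τ * (|Real.sin (S.β j)| + |Real.sin (S.α k)|)) ≤ 1 / γ * |S.d j k| := by
  have hγ := S.hγ
  have h4 : |S.d j k| = 4 * (|Real.sin ((S.β j + S.α k) / 2)| *
    |Real.sin ((S.β j - S.α k) / 2)|) := two_cos_sub_two_cos _ _
  have h1 := S.sin_α_le j k
  have h2 := S.sin_β_le j k
  have h3 : |Real.sin (S.β j)| + |Real.sin (S.α k)| ≤
    2 * (|Real.sin ((S.β j + S.α k) / 2)| + |Real.sin ((S.β j - S.α k) / 2)|) := by linarith
  rw [h4]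
  unfold loss
  split_ifs with hj
  · rw [← mul_assoc, ← S.h_eq]
    have := add_mul_le_d hγ (S.le_sin_plus hk h) (S.le_sin_minus hk h) S.h_pos
    nlinarith [mul_le_mul_of_nonneg_left h3 S.h_pos.le]
  · obtain ⟨h5, h6⟩ := S.le_sin_strong hk h (by omega)
    have := add_mul_le_d hγ h5 h6 S.hτ
    nlinarith [mul_le_mul_of_nonneg_left h3 S.hτ.le]

theorem d_diag {j : S.J} {k : S.V} (h : IsDiag j k) : S.d j k = 0 := by
  unfold d
  rcases h with rfl | rfl
  · rw [S.α_unitVec, sub_self]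
  · rw [S.α_neg, S.α_unitVec, Real.cos_neg, sub_self]

theorem sin_α_diag {j : S.J} {k : S.V} (h : IsDiag j k) :
    |Real.sin (S.α k)| = |Real.sin (S.β j)| := by
  rcases h with rfl | rfl
  · rw [S.α_unitVec]
  · rw [S.α_neg, S.α_unitVec, Real.sin_neg, abs_neg]

theorem h_le_resConst (j : S.J) : S.h ≤ resConst γ * |Real.sin (S.β j)| := by
  have h1 := S.h_le_sin j
  have h2 := S.sin_β_pos j
  have h3 : 0 < 1 / γ ^ 2 := by have := S.hγ; positivity
  unfold resConst
  nlinarith [mul_pos h3 h2]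

/-! ### Degrees -/

theorem y_zero {j : S.J} {k : S.V} (hk : k ∈ setK K j) : S.y j k 0 = 0 :=
  S.y_eq_zero hk (order_pos S.hK j k)

/-- A product of orders `m₁ + m₂ = m`, both positive, has degree at most `m - 2`. Inversion keeps
the degree off the diagonal and raises it by one on the diagonal. -/
theorem natDegree_y_le (m : ℕ) : ∀ (j : S.J) (k : S.V), k ∈ setK K j → m < 2 * K →
    (S.y j k m).natDegree ≤ m - 1 := by
  induction m using Nat.strong_induction_on with
  | _ m ih =>
    intro j k hk hm
    have hF : (S.F j k m).natDegree ≤ m - 2 := by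
      refine natDegree_sum_le_of_forall_le _ _ fun j₁ _ =>
        natDegree_sum_le_of_forall_le _ _ fun k₁ hk₁ =>
        natDegree_sum_le_of_forall_le _ _ fun k₂ hk₂ =>
        natDegree_sum_le_of_forall_le _ _ fun p hp => ?_
      have hk₂' := (Finset.mem_filter.1 hk₂).1
      have h2 : p.1 + p.2 = m := by simpa using hp
      rcases Nat.eq_zero_or_pos p.1 with h3 | h3
      · rw [h3, S.fy_eq_zero (S.y_zero hk₁), zero_mul, natDegree_zero]; omega
      · rcases Nat.eq_zero_or_pos p.2 with h4 | h4
        · rw [h4, S.fy_eq_zero (S.y_zero hk₂'), mul_zero, natDegree_zero]; omega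
        · have h5 := (natDegree_C_mul_le (S.φ (S.β j₁) : ℂ) (S.y j₁ k₁ p.1)).trans
            (ih p.1 (by omega) _ _ hk₁ (by omega))
          have h6 := (natDegree_C_mul_le (S.φ (S.β (j - j₁)) : ℂ) (S.y (j - j₁) k₂ p.2)).trans
            (ih p.2 (by omega) _ _ hk₂' (by omega))
          refine natDegree_mul_le.trans ?_
          unfold fy
          omega
    have hG : (modOp (S.α k) (S.β j) S.h (S.y j k m)).natDegree ≤ m - 2 := by
      rw [S.system hk hm]
      exact (natDegree_C_mul_le _ _).trans hF
    by_cases hd : IsDiag j k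
    · have h1 := S.h_le_resConst j
      rw [← S.sin_α_diag hd] at h1
      -- For `m < 2` the truncated subtraction `m - 2` hides that the right-hand side is zero; the
      -- diagonal function is then constant, one degree better than the general argument gives.
      rcases lt_or_ge m 2 with h2 | h2
      · have hF0 : S.F j k m = 0 := by
          refine Finset.sum_eq_zero fun j₁ _ => Finset.sum_eq_zero fun k₁ hk₁ =>
            Finset.sum_eq_zero fun k₂ hk₂ => Finset.sum_eq_zero fun p hp => ?_
          have hk₂' := (Finset.mem_filter.1 hk₂).1
          have h3 : p.1 + p.2 = m := by simpa using hp
          rcases Nat.eq_zero_or_pos p.1 with h4 | h4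
          · rw [h4, S.fy_eq_zero (S.y_zero hk₁), zero_mul]
          · rw [show p.2 = 0 by omega, S.fy_eq_zero (S.y_zero hk₂'), mul_zero]
        have h5 := derivative_eq_zero_of_modOp S.resConst_nonneg S.h_pos (S.d_diag hd) h1
          (p := S.y j k m) (by rw [S.system hk hm, hF0, mul_zero])
        rw [derivative_eq_zero.1 h5]; omega
      · have := natDegree_le_succ_of_modOp S.resConst_nonneg S.h_pos (S.d_diag hd) h1 hG
        omega
    · have := natDegree_le_of_modOp S.resConst_nonneg S.h_pos.le (abs_pos.1 (S.d_pos hk hd))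
        (S.sin_α_mul_h_le hk hd) (S.h_sq_le hk hd) hG
      omega

theorem natDegree_y_le' {j : S.J} {k : S.V} (hk : k ∈ setK K j) {m : ℕ} (hm : m < 2 * K) :
    (S.y j k m).natDegree ≤ 2 * K := (S.natDegree_y_le m j k hk hm).trans (by omega)

/-! ### Solving the modulation system at one order -/

/-- The factor `1 + |sin α| / |sin β|`. -/
def Q (j : S.J) (k : S.V) : ℝ := 1 + |Real.sin (S.α k)| / |Real.sin (S.β j)|

theorem one_le_Q (j : S.J) (k : S.V) : 1 ≤ S.Q j k :=
  le_add_of_nonneg_right (div_nonneg (abs_nonneg _) (abs_nonneg _))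

theorem Q_pos (j : S.J) (k : S.V) : 0 < S.Q j k := one_pos.trans_le (S.one_le_Q j k)

theorem Q_diag {j : S.J} {k : S.V} (h : IsDiag j k) : S.Q j k = 2 := by
  rw [Q, S.sin_α_diag h, div_self (S.sin_β_pos j).ne']
  norm_num

theorem B_nonneg (S : Setting K ν s γ ρ B) : 0 ≤ B := (abs_nonneg _).trans (S.hφ 0)

/-- The relation `ψ = sinc · φ` produces the factor `sin(τω_j)/ω_j`: the denominator yields the
energy weight, and the sine cancels the one lost in inverting the diagonal equation. -/
theorem abs_τ_sq_ψ (j : S.J) : S.τ ^ 2 * S.ψ (S.β j) =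
    S.τ * Real.sin (S.β j) * S.φ (S.β j) / S.ω j := by
  rw [S.hψ, Real.sinc_of_ne_zero (S.β_pos j).ne', S.β_eq]
  have := (S.ω_pos j).ne'
  have := S.hτ.ne'
  field_simp

theorem norm_coupling_le (j : S.J) : ‖(S.τ : ℂ) ^ 2 * (S.ψ (S.β j) : ℂ)‖ * S.ω j ≤
    B * (S.τ * |Real.sin (S.β j)|) := by
  have h1 : (S.τ : ℂ) ^ 2 * (S.ψ (S.β j) : ℂ) = ((S.τ ^ 2 * S.ψ (S.β j) : ℝ) : ℂ) := by
    push_cast; ring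
  rw [h1, Complex.norm_real, Real.norm_eq_abs, S.abs_τ_sq_ψ, abs_div, abs_mul, abs_mul,
    abs_of_pos S.hτ, abs_of_pos (S.ω_pos j), div_mul_cancel₀ _ (S.ω_pos j).ne', mul_comm]
  exact mul_le_mul_of_nonneg_right (S.hφ _) (mul_nonneg S.hτ.le (abs_nonneg _))

/-- The constant in the bounds of the solution of the modulation system. -/
def solveConst (K : ℕ) (γ B : ℝ) : ℝ :=
  invConst (resConst γ) (1 / γ) (2 * K) * B * (1 + 1 / γ)

theorem solveConst_nonneg (S : Setting K ν s γ ρ B) : 0 ≤ solveConst K γ B := by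
  have h1 := S.hγ
  have h2 := invConst_nonneg (resConst_nonneg S) (by positivity : 0 ≤ 1 / γ) (2 * K)
  have h3 := S.B_nonneg
  unfold solveConst; positivity

/-- The factor `Q` costs nothing, because `Q |sin β| = |sin β| + |sin α|` and `loss_mul_τ_le`
controls both sines. It is carried along since almost-invariant energies and velocities contain the
quotient `sin α / sin β`. -/
theorem offDiag_bound {j : S.J} {k : S.V} (hk : k ∈ setK K j) (hd : ¬ IsDiag j k) {m : ℕ}
    (hm : m < 2 * K) : S.loss j * (S.ω j * S.Q j k * coeffNorm (S.y j k m)) ≤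
      solveConst K γ B * coeffNorm (S.F j k m) := by
  have hγ := S.hγ
  have h1 := coeffNorm_le_of_modOp S.resConst_nonneg S.h_pos.le S.h_le (abs_pos.1 (S.d_pos hk hd))
    (S.sin_α_mul_h_le hk hd) (S.h_sq_le hk hd) (2 * K) (S.y j k m) (S.natDegree_y_le' hk hm)
  rw [S.system hk hm, coeffNorm_C_mul] at h1
  change |S.d j k| * _ ≤ _ at h1
  set I := invConst (resConst γ) (1 / γ) (2 * K) with hI
  have hI0 : 0 ≤ I := invConst_nonneg (resConst_nonneg S) (by positivity : 0 ≤ 1 / γ) (2 * K)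
  have hF := coeffNorm_nonneg (S.F j k m)
  have hB := S.B_nonneg
  have hl := (S.loss_pos j).le
  have hQ := (S.Q_pos j k).le
  have hω := (S.ω_pos j).le
  have hsin := S.sin_β_pos j
  have hQs : S.Q j k * |Real.sin (S.β j)| = |Real.sin (S.β j)| + |Real.sin (S.α k)| := by
    rw [Q, add_mul, one_mul, div_mul_cancel₀ _ hsin.ne']
  have h2 : |S.d j k| * (S.loss j * (S.ω j * S.Q j k * coeffNorm (S.y j k m))) ≤
      |S.d j k| * (solveConst K γ B * coeffNorm (S.F j k m)) := by
    calc _ = S.loss j * S.ω j * S.Q j k * (|S.d j k| * coeffNorm (S.y j k m)) := by ring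
      _ ≤ S.loss j * S.ω j * S.Q j k * (I * (‖(S.τ : ℂ) ^ 2 * (S.ψ (S.β j) : ℂ)‖ *
          coeffNorm (S.F j k m))) := by gcongr
      _ = S.loss j * S.Q j k * I * coeffNorm (S.F j k m) *
          (‖(S.τ : ℂ) ^ 2 * (S.ψ (S.β j) : ℂ)‖ * S.ω j) := by ring
      _ ≤ S.loss j * S.Q j k * I * coeffNorm (S.F j k m) * (B * (S.τ * |Real.sin (S.β j)|)) := by
          exact mul_le_mul_of_nonneg_left (S.norm_coupling_le j) (by positivity)
      _ = I * B * coeffNorm (S.F j k m) *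
          (S.loss j * (S.τ * (S.Q j k * |Real.sin (S.β j)|))) := by ring
      _ ≤ I * B * coeffNorm (S.F j k m) * (1 / γ * |S.d j k|) := by
          rw [hQs]
          exact mul_le_mul_of_nonneg_left (S.loss_mul_τ_le hk hd) (by positivity)
      _ ≤ I * B * coeffNorm (S.F j k m) * ((1 + 1 / γ) * |S.d j k|) := by
          gcongr
          linarith
      _ = _ := by unfold solveConst; ring
  exact le_of_mul_le_mul_left h2 (S.d_pos hk hd)

/-- The operator controls `|sin β| h` times the derivative and the forcing is of size `τ |sin β|`;
the sines cancel and `h/τ = δ^ν` remains. -/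
theorem diag_bound {j : S.J} {k : S.V} (hd : IsDiag j k) {m : ℕ} (hm : m < 2 * K) :
    S.δ ^ ν * (S.ω j * coeffNorm (derivative (S.y j k m))) ≤
      solveConst K γ B * coeffNorm (S.F j k m) := by
  have hγ := S.hγ
  have hk : k ∈ setK K j := hd.mem S.hK
  have h0 := S.h_le_resConst j
  rw [← S.sin_α_diag hd] at h0
  have h1 := coeffNorm_derivative_le_of_modOp S.resConst_nonneg S.h_pos.le S.h_le (S.d_diag hd)
    h0 (2 * K) (S.y j k m) ((S.natDegree_y_le' hk hm).trans (by omega))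
  rw [S.system hk hm, coeffNorm_C_mul, S.sin_α_diag hd] at h1
  set I := invConst (resConst γ) (1 / γ) (2 * K) with hI
  have hI0 : 0 ≤ I := invConst_nonneg (resConst_nonneg S) (by positivity : 0 ≤ 1 / γ) (2 * K)
  have hF := coeffNorm_nonneg (S.F j k m)
  have hB := S.B_nonneg
  have hω := (S.ω_pos j).le
  have hsin := S.sin_β_pos j
  have hτ := S.hτ
  have h2 : (S.τ * |Real.sin (S.β j)|) *
      (S.δ ^ ν * (S.ω j * coeffNorm (derivative (S.y j k m)))) ≤
      (S.τ * |Real.sin (S.β j)|) * (solveConst K γ B * coeffNorm (S.F j k m)) := by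
    calc _ = S.ω j * (|Real.sin (S.β j)| * S.h * coeffNorm (derivative (S.y j k m))) := by
          rw [S.h_eq]; ring
      _ ≤ S.ω j * (I * (‖(S.τ : ℂ) ^ 2 * (S.ψ (S.β j) : ℂ)‖ * coeffNorm (S.F j k m))) := by
          gcongr
      _ = I * coeffNorm (S.F j k m) * (‖(S.τ : ℂ) ^ 2 * (S.ψ (S.β j) : ℂ)‖ * S.ω j) := by ring
      _ ≤ I * coeffNorm (S.F j k m) * (B * (S.τ * |Real.sin (S.β j)|)) := by
          exact mul_le_mul_of_nonneg_left (S.norm_coupling_le j) (by positivity)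
      _ = (S.τ * |Real.sin (S.β j)|) * (I * B * 1 * coeffNorm (S.F j k m)) := by ring
      _ ≤ (S.τ * |Real.sin (S.β j)|) * (I * B * (1 + 1 / γ) * coeffNorm (S.F j k m)) := by
          gcongr
          have : 0 < 1 / γ := by positivity
          linarith
  exact le_of_mul_le_mul_left h2 (by positivity)

end Setting

end TrigInt

/-! ### Majorants of the quadratic terms; diagonal coefficients from the initial data -/

namespace TrigInt
open Polynomial

/-- Fits the diagonal case, where the modulation system controls the derivative and the initial
conditions control the value at `0`. -/
theorem coeffNorm_le_eval_zero_add (p : ℂ[X]) :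
    coeffNorm p ≤ ‖p.eval 0‖ + coeffNorm (derivative p) := by
  rw [coeffNorm_derivative, coeffNorm_eq_sum_range (n := p.natDegree + 1) (by omega),
    Finset.sum_range_succ', Finset.sum_range_succ', ← coeff_zero_eq_eval_zero, add_comm]
  simp only [Nat.cast_zero, mul_zero, add_zero]
  refine add_le_add le_rfl (Finset.sum_le_sum fun i _ => ?_)
  refine le_mul_of_one_le_right (norm_nonneg _) ?_
  push_cast
  have : (0 : ℝ) ≤ i := by positivity
  linarith

namespace Setting

variable {K : ℕ} {ν s γ ρ B : ℝ} (S : Setting K ν s γ ρ B)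

open Classical in
/-- The off-diagonal part of `𝒦_j`. -/
def off (j : S.J) : Finset S.V := (setK K j).filter fun k => ¬ IsDiag j k

theorem mem_off {j : S.J} {k : S.V} : k ∈ S.off j ↔ k ∈ setK K j ∧ ¬ IsDiag j k := by
  simp [off]

theorem sum_setK_eq {β : Type*} [AddCommMonoid β] (j : S.J) (f : S.V → β) :
    ∑ k ∈ setK K j, f k = f (unitVec j) + f (-unitVec j) + ∑ k ∈ S.off j, f k := by
  classical
  rw [← Finset.sum_filter_add_sum_filter_not (setK K j) (fun k => IsDiag j k)]
  congr 1
  · have : (setK K j).filter (fun k => IsDiag j k) = {unitVec j, -unitVec j} := by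
      ext k
      simp only [Finset.mem_filter, Finset.mem_insert, Finset.mem_singleton]
      exact ⟨fun h => h.2, fun h => ⟨IsDiag.mem S.hK h, h⟩⟩
    rw [this, Finset.sum_pair (unitVec_ne_neg j)]

open Classical in
/-- The additional smallness of the right-hand side of the modulation system. -/
def gain (j : S.J) (k : S.V) : ℝ := if IsDiag j k ∨ K < idx j then S.δ ^ (2 * ν) else 1

theorem gain_pos (j : S.J) (k : S.V) : 0 < S.gain j k := by
  unfold gain; split_ifs
  · exact Real.rpow_pos_of_pos S.δ_pos _
  · exact one_pos

theorem δ_rpow_anti {x y : ℝ} (h : x ≤ y) : S.δ ^ y ≤ S.δ ^ x :=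
  Real.rpow_le_rpow_of_exponent_ge S.δ_pos S.δ_le_one h

/-- The additional order gained for `|j| > K` pays for the weaker small-denominator bound, since
`δ^(2ν) ≤ δ^ν`. -/
theorem gain_le_loss (j : S.J) (k : S.V) : S.gain j k ≤ S.loss j := by
  have hν := S.hν
  unfold gain loss
  split_ifs with h1 h2 h2
  · exact S.δ_rpow_anti (by linarith)
  · exact S.δ_rpow_le_one (by linarith)
  · exact absurd (Or.inr h2) h1
  · exact le_rfl

/-- Subadditivity of the orders in exponential form; one surplus order is worth `δ^(2ν)`. -/
theorem amp_mul_le {j j₁ : S.J} {k k₁ k₂ : S.V} (hk : k₁ + k₂ = k) {m m₁ m₂ : ℕ}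
    (hm : m₁ + m₂ = m) :
    S.amp j₁ k₁ m₁ * S.amp (j - j₁) k₂ m₂ ≤ S.amp j k m * S.gain j k := by
  have hν := S.hν
  have key : ∀ g : ℕ, S.o j k + g ≤ S.o j₁ k₁ + S.o (j - j₁) k₂ →
      S.amp j₁ k₁ m₁ * S.amp (j - j₁) k₂ m₂ ≤ S.amp j k m * S.δ ^ (2 * ν * g) := by
    intro g hg
    unfold amp
    rw [← Real.rpow_add S.δ_pos, ← Real.rpow_add S.δ_pos]
    refine S.δ_rpow_anti ?_
    have hg' : (S.o j k : ℝ) + g ≤ S.o j₁ k₁ + S.o (j - j₁) k₂ := by exact_mod_cast hg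
    rw [← hm]
    push_cast
    nlinarith
  unfold gain
  split_ifs with h
  · have h1 : S.o j k + 1 ≤ S.o j₁ k₁ + S.o (j - j₁) k₂ := by
      rcases h with h | h
      · exact order_lt_of_diag S.hK hk h
      · exact order_lt_of_idx S.hK j₁ k k₁ k₂ h
    have := key 1 h1
    rwa [Nat.cast_one, mul_one] at this
  · have h1 : S.o j k + 0 ≤ S.o j₁ k₁ + S.o (j - j₁) k₂ := order_add_le S.hK hk
    have := key 0 h1
    rwa [Nat.cast_zero, mul_zero, Real.rpow_zero] at this

/-- The rescaled norm of the right-hand side. -/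
def G (j : S.J) (k : S.V) (m : ℕ) : ℝ := coeffNorm (S.F j k m) / (S.amp j k m * S.gain j k)

theorem coeffNorm_fy_le (j : S.J) (k : S.V) (m : ℕ) :
    coeffNorm (S.fy j k m) ≤ B * coeffNorm (S.y j k m) := by
  rw [fy, coeffNorm_C_mul, Complex.norm_real, Real.norm_eq_abs]
  exact mul_le_mul_of_nonneg_right (S.hφ _) (coeffNorm_nonneg _)

/-- The right-hand side of the modulation system is bounded by convolutions of a majorant. -/
theorem sum_G_le {j : S.J} {T : Finset S.V} {m : ℕ} {a : S.J → S.V → ℕ → ℝ}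
    (ha : ∀ j k m, 0 ≤ a j k m)
    (H : ∀ j₁, ∀ k₁ ∈ setK K j₁, ∀ k₂ ∈ setK K (j - j₁), k₁ + k₂ ∈ T → ∀ m₁ m₂, m₁ + m₂ = m →
      coeffNorm (S.y j₁ k₁ m₁) * coeffNorm (S.y (j - j₁) k₂ m₂) ≤
        (S.amp j₁ k₁ m₁ * S.amp (j - j₁) k₂ m₂) * (a j₁ k₁ m₁ * a (j - j₁) k₂ m₂)) :
    ∑ k ∈ T, S.G j k m ≤ B ^ 2 * ∑ p ∈ Finset.HasAntidiagonal.antidiagonal m, ∑ j₁ : S.J,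
      (∑ k ∈ setK K j₁, a j₁ k p.1) * (∑ k ∈ setK K (j - j₁), a (j - j₁) k p.2) := by
  classical
  have hB := S.B_nonneg
  have h1 : ∀ k ∈ T, S.G j k m ≤ ∑ j₁ : S.J, ∑ k₁ ∈ setK K j₁,
      ∑ k₂ ∈ setK K (j - j₁) with k₁ + k₂ = k, ∑ p ∈ Finset.HasAntidiagonal.antidiagonal m,
        B ^ 2 * (a j₁ k₁ p.1 * a (j - j₁) k₂ p.2) := by
    intro k hkT
    rw [G, div_le_iff₀ (mul_pos (S.amp_pos j k m) (S.gain_pos j k))]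
    unfold F
    simp only [Finset.sum_mul]
    refine (coeffNorm_sum _ _).trans (Finset.sum_le_sum fun j₁ _ =>
      (coeffNorm_sum _ _).trans (Finset.sum_le_sum fun k₁ hk₁ =>
      (coeffNorm_sum _ _).trans (Finset.sum_le_sum fun k₂ hk₂ =>
      (coeffNorm_sum _ _).trans (Finset.sum_le_sum fun p hp => ?_))))
    rw [Finset.mem_filter] at hk₂
    have h2 : p.1 + p.2 = m := by simpa using hp
    have h3 := H j₁ k₁ hk₁ k₂ hk₂.1 (hk₂.2 ▸ hkT) p.1 p.2 h2
    have h4 := S.amp_mul_le (j := j) (j₁ := j₁) hk₂.2 h2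
    have h5 := mul_nonneg (ha j₁ k₁ p.1) (ha (j - j₁) k₂ p.2)
    calc _ ≤ coeffNorm (S.fy j₁ k₁ p.1) * coeffNorm (S.fy (j - j₁) k₂ p.2) := coeffNorm_mul _ _
      _ ≤ (B * coeffNorm (S.y j₁ k₁ p.1)) * (B * coeffNorm (S.y (j - j₁) k₂ p.2)) :=
          mul_le_mul (S.coeffNorm_fy_le _ _ _) (S.coeffNorm_fy_le _ _ _) (coeffNorm_nonneg _)
            (mul_nonneg hB (coeffNorm_nonneg _))
      _ = B ^ 2 * (coeffNorm (S.y j₁ k₁ p.1) * coeffNorm (S.y (j - j₁) k₂ p.2)) := by ring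
      _ ≤ B ^ 2 * ((S.amp j₁ k₁ p.1 * S.amp (j - j₁) k₂ p.2) *
          (a j₁ k₁ p.1 * a (j - j₁) k₂ p.2)) := by gcongr
      _ ≤ B ^ 2 * ((S.amp j k m * S.gain j k) * (a j₁ k₁ p.1 * a (j - j₁) k₂ p.2)) := by gcongr
      _ = _ := by ring
  refine (Finset.sum_le_sum h1).trans ?_
  rw [Finset.sum_comm, Finset.sum_comm (s := Finset.HasAntidiagonal.antidiagonal m),
    Finset.mul_sum]
  refine Finset.sum_le_sum fun j₁ _ => ?_
  rw [Finset.sum_comm]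
  -- A pair `(k₁, k₂)` feeds the single vector `k₁ + k₂`, so summing over `k ∈ T` removes the
  -- constraint and leaves full sums over both factors.
  have h6 : ∀ k₁ ∈ setK K j₁, ∑ k ∈ T, ∑ k₂ ∈ setK K (j - j₁) with k₁ + k₂ = k,
      ∑ p ∈ Finset.HasAntidiagonal.antidiagonal m, B ^ 2 * (a j₁ k₁ p.1 * a (j - j₁) k₂ p.2) ≤
      ∑ k₂ ∈ setK K (j - j₁), ∑ p ∈ Finset.HasAntidiagonal.antidiagonal m,
        B ^ 2 * (a j₁ k₁ p.1 * a (j - j₁) k₂ p.2) := by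
    intro k₁ _
    simp only [Finset.sum_filter]
    rw [Finset.sum_comm]
    refine Finset.sum_le_sum fun k₂ _ => ?_
    rw [Finset.sum_ite_eq T (k₁ + k₂)]
    split_ifs
    · exact le_rfl
    · exact Finset.sum_nonneg fun p _ => mul_nonneg (sq_nonneg _) (mul_nonneg (ha _ _ _) (ha _ _ _))
  refine (Finset.sum_le_sum h6).trans (le_of_eq ?_)
  rw [Finset.sum_congr rfl fun p _ => Finset.sum_mul_sum _ _ _ _]
  simp only [Finset.mul_sum]
  symm
  rw [Finset.sum_comm]
  refine Finset.sum_congr rfl fun k₁ _ => ?_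
  rw [Finset.sum_comm]

/-- The rescaled energy norm of a coefficient function. -/
def ny (j : S.J) (k : S.V) (m : ℕ) : ℝ := S.ω j * S.Q j k * coeffNorm (S.y j k m) / S.amp j k m

theorem ny_nonneg (j : S.J) (k : S.V) (m : ℕ) : 0 ≤ S.ny j k m :=
  div_nonneg (mul_nonneg (mul_pos (S.ω_pos j) (S.Q_pos j k)).le (coeffNorm_nonneg _))
    (S.amp_pos j k m).le

theorem ω_mul_coeffNorm_le (j : S.J) (k : S.V) (m : ℕ) :
    S.ω j * S.Q j k * coeffNorm (S.y j k m) = S.amp j k m * S.ny j k m := by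
  rw [ny, mul_div_cancel₀ _ (S.amp_pos j k m).ne']

theorem coeffNorm_y_le (j : S.J) (k : S.V) (m : ℕ) :
    coeffNorm (S.y j k m) ≤ S.amp j k m * (1 / √ρ * S.ny j k m) := by
  have hρ : 0 < √ρ := Real.sqrt_pos.2 S.hρ
  have h1 := S.ω_mul_coeffNorm_le j k m
  have h2 := S.sqrt_le_ω j
  have h3 := S.one_le_Q j k
  have h4 := coeffNorm_nonneg (S.y j k m)
  have h5 : √ρ * 1 ≤ S.ω j * S.Q j k := by
    have := S.ω_pos j
    gcongr
  have h6 : √ρ * coeffNorm (S.y j k m) ≤ S.amp j k m * S.ny j k m := by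
    rw [← h1]; nlinarith
  calc coeffNorm (S.y j k m) = 1 / √ρ * (√ρ * coeffNorm (S.y j k m)) := by field_simp
    _ ≤ 1 / √ρ * (S.amp j k m * S.ny j k m) := by gcongr
    _ = _ := by ring

theorem ny_off_le {j : S.J} {k : S.V} (hk : k ∈ S.off j) {m : ℕ} (hm : m < 2 * K) :
    S.ny j k m ≤ solveConst K γ B * S.G j k m := by
  rw [mem_off] at hk
  have h1 := S.offDiag_bound hk.1 hk.2 hm
  have h2 := S.gain_le_loss j k
  have h3 := S.gain_pos j k
  have h4 := S.amp_pos j k m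
  have h5 := mul_nonneg (mul_pos (S.ω_pos j) (S.Q_pos j k)).le (coeffNorm_nonneg (S.y j k m))
  rw [ny, G, ← mul_div_assoc, div_le_div_iff₀ h4 (mul_pos h4 h3)]
  have h6 := mul_le_mul_of_nonneg_right h2 h5
  nlinarith

/-- The rescaled energy norm of the derivative of a coefficient function. -/
def ny' (j : S.J) (k : S.V) (m : ℕ) : ℝ :=
  S.ω j * coeffNorm (derivative (S.y j k m)) / S.amp j k m

theorem ny'_nonneg (j : S.J) (k : S.V) (m : ℕ) : 0 ≤ S.ny' j k m :=
  div_nonneg (mul_nonneg (S.ω_pos j).le (coeffNorm_nonneg _)) (S.amp_pos j k m).le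

theorem ny'_diag_le {j : S.J} {k : S.V} (hd : IsDiag j k) {m : ℕ} (hm : m < 2 * K) :
    S.ny' j k m ≤ solveConst K γ B * S.G j k m := by
  have h1 := S.diag_bound hd hm
  have h2 : S.gain j k = S.δ ^ (2 * ν) := by unfold gain; rw [if_pos (Or.inl hd)]
  have h3 := S.gain_pos j k
  have h4 := S.amp_pos j k m
  have h5 := mul_nonneg (S.ω_pos j).le (coeffNorm_nonneg (derivative (S.y j k m)))
  rw [ny', G, ← mul_div_assoc, div_le_div_iff₀ h4 (mul_pos h4 h3)]
  have h7 : S.gain j k ≤ S.δ ^ ν := by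
    rw [h2]; exact S.δ_rpow_anti (by linarith [S.hν])
  have h6 := mul_le_mul_of_nonneg_right h7 h5
  nlinarith

theorem amp_anti {j : S.J} {k k' : S.V} (h : S.o j k ≤ S.o j k') (m : ℕ) :
    S.amp j k' m ≤ S.amp j k m := by
  unfold amp
  refine S.δ_rpow_anti ?_
  have h' : (S.o j k : ℝ) ≤ S.o j k' := by exact_mod_cast h
  nlinarith [S.hν]

/-- The constant in the bound of the diagonal functions. -/
def diagConst (K : ℕ) (γ : ℝ) : ℝ :=
  4 * (1 + evalConst 1 (1 / γ) (2 * K) * (2 * K + 1) * resConst γ)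

theorem diagConst_nonneg (S : Setting K ν s γ ρ B) : 0 ≤ diagConst K γ := by
  have h1 := S.hγ
  have h2 := evalConst_nonneg zero_le_one (by positivity : 0 ≤ 1 / γ) (2 * K)
  have h3 := resConst_nonneg S
  unfold diagConst; positivity

set_option maxHeartbeats 400000 in
/-- The diagonal coefficient functions in terms of the off-diagonal ones, the derivatives and the
initial values. -/
theorem diag_const_le (j : S.J) {m : ℕ} (hm : m < 2 * K) :
    S.ω j * (‖(S.y j (unitVec j) m).eval 0‖ + ‖(S.y j (-unitVec j) m).eval 0‖) /
        S.amp j (unitVec j) m ≤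
      diagConst K γ * (∑ k ∈ S.off j, S.ny j k m +
        (S.ny' j (unitVec j) m + S.ny' j (-unitVec j) m)) +
      (if m = S.e j then S.δ ^ (-(S.e j : ℝ)) * (S.ω j * ‖S.u₀ j‖ + ‖S.v₀ j‖) else 0) := by
  have hγ := S.hγ
  have hdiag₁ : IsDiag j (unitVec j) := Or.inl rfl
  have hdiag₂ : IsDiag j (-unitVec j) := Or.inr rfl
  have hmem₁ : unitVec j ∈ setK K j := hdiag₁.mem S.hK
  have hmem₂ : -unitVec j ∈ setK K j := hdiag₂.mem S.hK
  have hsin := S.sin_β_pos j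
  have hω := S.ω_pos j
  have hh := S.h_pos
  have hpos := S.init_position j hm
  have hvel := S.init_velocity j hm
  rw [S.sum_setK_eq] at hpos hvel
  set EC := evalConst 1 (1 / γ) (2 * K) with hEC
  have hEC0 : 0 ≤ EC := evalConst_nonneg zero_le_one (by positivity) _
  set U := if m = S.e j then S.u₀ j else 0 with hU
  set p := (S.y j (unitVec j) m).eval 0 with hp
  set q := (S.y j (-unitVec j) m).eval 0 with hq
  set D : S.V → ℂ := fun k => Complex.exp (Complex.I * (S.α k : ℂ)) *
    (S.y j k m).eval ((S.h : ℝ) : ℂ) - Complex.exp (-(Complex.I * (S.α k : ℂ))) *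
      (S.y j k m).eval ((-S.h : ℝ) : ℂ) with hD
  have hsub : ∀ k ∈ setK K j, ‖D k - 2 * Complex.I * (Real.sin (S.α k) : ℂ) *
      (S.y j k m).eval 0‖ ≤ 2 * (EC * S.h * coeffNorm (derivative (S.y j k m))) := by
    intro k hk
    have := norm_symm_diff_sub_le (S.natDegree_y_le' hk hm) (x := 0) (α := S.α k) le_rfl
      (by simp) hh.le S.h_le
    simpa [hD, hEC] using this
  have hle : ∀ k ∈ setK K j, ‖D k‖ ≤ 2 * (|Real.sin (S.α k)| + EC * (2 * K) * S.h) *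
      coeffNorm (S.y j k m) := by
    intro k hk
    have := norm_symm_diff_le (S.natDegree_y_le' hk hm) (x := 0) (α := S.α k) le_rfl
      (by simp) hh.le S.h_le
    simpa [hD, hEC] using this
  have hvel' : D (unitVec j) + D (-unitVec j) + ∑ k ∈ S.off j, D k =
      if m = S.e j then 2 * (S.τ : ℂ) * (Real.sinc (S.β j) : ℂ) * S.v₀ j else 0 := hvel
  clear hvel
  -- The initial position determines the sum of the two diagonal values.
  have hsum : ‖p + q‖ ≤ ‖U‖ + ∑ k ∈ S.off j, coeffNorm (S.y j k m) := by
    have h1 : p + q = U - ∑ k ∈ S.off j, (S.y j k m).eval 0 := by rw [← hpos]; ring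
    rw [h1]
    refine (norm_sub_le _ _).trans (add_le_add le_rfl ((norm_sum_le _ _).trans
      (Finset.sum_le_sum fun k hk => ?_)))
    have h2 := norm_eval_le (S.natDegree_y_le' ((S.mem_off).1 hk).1 hm) (x := 0) (R := 1) le_rfl
      (by simp)
    simpa using h2
  set Vv := if m = S.e j then 2 * (S.τ : ℂ) * (Real.sinc (S.β j) : ℂ) * S.v₀ j else 0 with hVv
  have hVn : S.ω j * ‖Vv‖ = 2 * |Real.sin (S.β j)| * ‖if m = S.e j then S.v₀ j else 0‖ := by
    rw [hVv]
    split_ifs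
    · rw [norm_mul, norm_mul, norm_mul, Complex.norm_real, Complex.norm_real, Real.norm_eq_abs,
        Real.norm_eq_abs, abs_of_pos S.hτ, Real.sinc_of_ne_zero (S.β_pos j).ne', abs_div,
        abs_of_pos (S.β_pos j), S.β_eq]
      have := S.hτ.ne'
      have := hω.ne'
      simp only [Complex.norm_ofNat]
      field_simp
    · simp
  -- The initial velocity determines their difference, up to the factor `sin β`: the diagonal angles
  -- are `±β` and their sines have opposite signs.
  have hdiff : 2 * |Real.sin (S.β j)| * ‖p - q‖ ≤ ‖Vv‖ +
      ∑ k ∈ S.off j, 2 * (|Real.sin (S.α k)| + EC * (2 * K) * S.h) * coeffNorm (S.y j k m) +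
      2 * (EC * S.h * (coeffNorm (derivative (S.y j (unitVec j) m)) +
        coeffNorm (derivative (S.y j (-unitVec j) m)))) := by
    have h1 := hsub _ hmem₁
    have h2 := hsub _ hmem₂
    rw [S.α_unitVec] at h1
    rw [S.α_neg, S.α_unitVec, Real.sin_neg] at h2
    have h3 : 2 * Complex.I * (Real.sin (S.β j) : ℂ) * (p - q) = Vv - ∑ k ∈ S.off j, D k -
        (D (unitVec j) - 2 * Complex.I * (Real.sin (S.β j) : ℂ) * p) -
        (D (-unitVec j) - 2 * Complex.I * ((-Real.sin (S.β j) : ℝ) : ℂ) * q) := by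
      rw [← hvel']
      push_cast
      ring
    have h4 : ‖2 * Complex.I * (Real.sin (S.β j) : ℂ) * (p - q)‖ =
        2 * |Real.sin (S.β j)| * ‖p - q‖ := by
      rw [norm_mul, norm_mul, norm_mul, Complex.norm_I, Complex.norm_real, Real.norm_eq_abs]
      simp
    rw [← h4, h3]
    have h5 : ‖∑ k ∈ S.off j, D k‖ ≤ ∑ k ∈ S.off j,
        2 * (|Real.sin (S.α k)| + EC * (2 * K) * S.h) * coeffNorm (S.y j k m) :=
      (norm_sum_le _ _).trans (Finset.sum_le_sum fun k hk => hle k ((S.mem_off).1 hk).1)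
    refine (norm_sub_le _ _).trans ?_
    have h6 := norm_sub_le (Vv - ∑ k ∈ S.off j, D k)
      (D (unitVec j) - 2 * Complex.I * (Real.sin (S.β j) : ℂ) * p)
    have h7 := norm_sub_le Vv (∑ k ∈ S.off j, D k)
    linarith
  set A := S.amp j (unitVec j) m with hA
  have hA0 : 0 < A := S.amp_pos _ _ _
  have hoA : ∀ k ∈ S.off j, S.amp j k m ≤ A := fun k _ =>
    S.amp_anti ((hdiag₁.order_eq).trans_le (S.e_le_o j k)) m
  have hrc := resConst_nonneg S
  have hny : ∀ k ∈ S.off j, S.ω j * S.Q j k * coeffNorm (S.y j k m) ≤ A * S.ny j k m := by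
    intro k hk
    rw [S.ω_mul_coeffNorm_le]
    exact mul_le_mul_of_nonneg_right (hoA k hk) (S.ny_nonneg j k m)
  have hny₁ : S.ω j * coeffNorm (derivative (S.y j (unitVec j) m)) =
      A * S.ny' j (unitVec j) m := by
    rw [ny', mul_div_cancel₀ _ hA0.ne']
  have hny₂ : S.ω j * coeffNorm (derivative (S.y j (-unitVec j) m)) =
      A * S.ny' j (-unitVec j) m := by
    have : S.amp j (-unitVec j) m = A := by
      rw [hA]; unfold amp o; rw [hdiag₁.order_eq, hdiag₂.order_eq]
    rw [ny', this, mul_div_cancel₀ _ hA0.ne']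
  have hn0 := S.ny'_nonneg j (unitVec j) m
  have hn1 := S.ny'_nonneg j (-unitVec j) m
  have hn01 := mul_nonneg hA0.le (add_nonneg hn0 hn1)
  have hn2 : 0 ≤ ∑ k ∈ S.off j, S.ny j k m := Finset.sum_nonneg fun k _ => S.ny_nonneg j k m
  have hωsum : S.ω j * ‖p + q‖ ≤ S.ω j * ‖U‖ + A * ∑ k ∈ S.off j, S.ny j k m := by
    refine (mul_le_mul_of_nonneg_left hsum hω.le).trans ?_
    rw [mul_add, Finset.mul_sum, Finset.mul_sum]
    refine add_le_add le_rfl (Finset.sum_le_sum fun k hk => le_trans ?_ (hny k hk))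
    rw [mul_assoc]
    exact mul_le_mul_of_nonneg_left (le_mul_of_one_le_left (coeffNorm_nonneg _) (S.one_le_Q j k))
      hω.le
  have hωdiff : S.ω j * ‖p - q‖ ≤ ‖if m = S.e j then S.v₀ j else 0‖ +
      (1 + EC * (2 * K) * resConst γ) * (A * ∑ k ∈ S.off j, S.ny j k m) +
      EC * resConst γ * (A * (S.ny' j (unitVec j) m + S.ny' j (-unitVec j) m)) := by
    -- Division by `sin β` is possible because `|sin α| ≤ Q |sin β|` and `h` is bounded by a
    -- multiple of `|sin β|`; the factor `Q` is already part of `ny`.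
    have h1 : ∀ k ∈ S.off j, S.ω j * (2 * (|Real.sin (S.α k)| + EC * (2 * K) * S.h) *
        coeffNorm (S.y j k m)) ≤ 2 * |Real.sin (S.β j)| *
          ((1 + EC * (2 * K) * resConst γ) * (A * S.ny j k m)) := by
      intro k hk
      have h2 : S.Q j k * |Real.sin (S.β j)| = |Real.sin (S.β j)| + |Real.sin (S.α k)| := by
        rw [Q, add_mul, one_mul, div_mul_cancel₀ _ hsin.ne']
      have h3 : |Real.sin (S.α k)| ≤ S.Q j k * |Real.sin (S.β j)| := by linarith
      have h4 : S.h ≤ resConst γ * (S.Q j k * |Real.sin (S.β j)|) :=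
        (S.h_le_resConst j).trans (mul_le_mul_of_nonneg_left
          (le_mul_of_one_le_left hsin.le (S.one_le_Q j k)) hrc)
      have h5 := coeffNorm_nonneg (S.y j k m)
      calc _ ≤ S.ω j * (2 * (S.Q j k * |Real.sin (S.β j)| + EC * (2 * K) *
            (resConst γ * (S.Q j k * |Real.sin (S.β j)|))) * coeffNorm (S.y j k m)) := by gcongr
        _ = 2 * |Real.sin (S.β j)| * ((1 + EC * (2 * K) * resConst γ) *
            (S.ω j * S.Q j k * coeffNorm (S.y j k m))) := by ring
        _ ≤ _ := by
            have := hny k hk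
            gcongr
    have h6 := mul_le_mul_of_nonneg_left hdiff hω.le
    rw [mul_add, mul_add, hVn] at h6
    have h7 : S.ω j * ∑ k ∈ S.off j, 2 * (|Real.sin (S.α k)| + EC * (2 * K) * S.h) *
        coeffNorm (S.y j k m) ≤ 2 * |Real.sin (S.β j)| *
          ((1 + EC * (2 * K) * resConst γ) * (A * ∑ k ∈ S.off j, S.ny j k m)) := by
      simp only [Finset.mul_sum]
      exact Finset.sum_le_sum h1
    have h8 : S.ω j * (2 * (EC * S.h * (coeffNorm (derivative (S.y j (unitVec j) m)) +
        coeffNorm (derivative (S.y j (-unitVec j) m))))) ≤ 2 * |Real.sin (S.β j)| *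
        (EC * resConst γ * (A * (S.ny' j (unitVec j) m + S.ny' j (-unitVec j) m))) := by
      calc _ = 2 * (EC * S.h * (A * (S.ny' j (unitVec j) m + S.ny' j (-unitVec j) m))) := by
            rw [mul_add A, ← hny₁, ← hny₂]; ring
        _ ≤ 2 * (EC * (resConst γ * |Real.sin (S.β j)|) *
            (A * (S.ny' j (unitVec j) m + S.ny' j (-unitVec j) m))) := by
            refine mul_le_mul_of_nonneg_left (mul_le_mul_of_nonneg_right
              (mul_le_mul_of_nonneg_left (S.h_le_resConst j) hEC0) hn01) zero_le_two
        _ = _ := by ring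
    have h9 : 2 * |Real.sin (S.β j)| * (S.ω j * ‖p - q‖) ≤ 2 * |Real.sin (S.β j)| *
        (‖if m = S.e j then S.v₀ j else 0‖ +
      (1 + EC * (2 * K) * resConst γ) * (A * ∑ k ∈ S.off j, S.ny j k m) +
      EC * resConst γ * (A * (S.ny' j (unitVec j) m + S.ny' j (-unitVec j) m))) := by
      rw [mul_add (2 * |Real.sin (S.β j)|), mul_add (2 * |Real.sin (S.β j)|)]
      linarith
    exact le_of_mul_le_mul_left h9 (by positivity)
  have hpq : ‖p‖ + ‖q‖ ≤ ‖p + q‖ + ‖p - q‖ := by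
    have h1 : ‖p + p‖ ≤ ‖p + q‖ + ‖p - q‖ := by
      have := norm_add_le (p + q) (p - q)
      rwa [show p + q + (p - q) = p + p by ring] at this
    have h2 : ‖q + q‖ ≤ ‖p + q‖ + ‖p - q‖ := by
      have := norm_sub_le (p + q) (p - q)
      rwa [show p + q - (p - q) = q + q by ring] at this
    rw [← two_mul, norm_mul, Complex.norm_ofNat] at h1 h2
    linarith
  have hinit : (S.ω j * ‖U‖ + ‖if m = S.e j then S.v₀ j else 0‖) =
      A * (if m = S.e j then S.δ ^ (-(S.e j : ℝ)) * (S.ω j * ‖S.u₀ j‖ + ‖S.v₀ j‖) else 0) := by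
    rw [hU]
    split_ifs with h
    · have : A * S.δ ^ (-(S.e j : ℝ)) = 1 := by
        rw [hA, amp, o, hdiag₁.order_eq, h, ← Real.rpow_add S.δ_pos]
        change S.δ ^ ((S.e j : ℝ) * (1 - 2 * ν) + 2 * ν * (S.e j : ℝ) + -(S.e j : ℝ)) = 1
        rw [show (S.e j : ℝ) * (1 - 2 * ν) + 2 * ν * (S.e j : ℝ) + -(S.e j : ℝ) = 0 by ring,
          Real.rpow_zero]
      rw [← mul_assoc, this, one_mul]
    · simp
  rw [div_le_iff₀ hA0]
  have hfin : S.ω j * (‖p‖ + ‖q‖) ≤ S.ω j * ‖p + q‖ + S.ω j * ‖p - q‖ := by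
    rw [← mul_add]; exact mul_le_mul_of_nonneg_left hpq hω.le
  have hc1 : 0 ≤ A * ∑ k ∈ S.off j, S.ny j k m := mul_nonneg hA0.le hn2
  have hc2 := hn01
  have hd0 : 0 ≤ EC * resConst γ := by positivity
  have hd1 : 0 ≤ EC * (2 * K) * resConst γ := by positivity
  have hd2 : 2 + EC * (2 * K) * resConst γ ≤ diagConst K γ := by
    unfold diagConst
    rw [← hEC]
    nlinarith
  have hd3 : EC * resConst γ ≤ diagConst K γ := by
    unfold diagConst
    rw [← hEC]
    nlinarith
  have hf1 := mul_le_mul_of_nonneg_right hd2 hc1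
  have hf2 := mul_le_mul_of_nonneg_right hd3 hc2
  calc _ ≤ _ := hfin
    _ ≤ (S.ω j * ‖U‖ + ‖if m = S.e j then S.v₀ j else 0‖) +
      diagConst K γ * (A * ∑ k ∈ S.off j, S.ny j k m) +
      diagConst K γ * (A * (S.ny' j (unitVec j) m + S.ny' j (-unitVec j) m)) := by linarith
    _ = _ := by rw [hinit]; ring

end Setting

end TrigInt

/-! ### Sums over residues and absolute values; a recursive convolution inequality -/

namespace TrigInt
open Polynomial

theorem sum_le_two_mul_sum_fin {M : ℕ} [NeZero M] {f : ZMod (2 * M) → ℝ} (hf : ∀ j, 0 ≤ f j)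
    (hneg : ∀ j, f (-j) = f j) :
    ∑ j, f j ≤ 2 * ∑ l : Fin (M + 1), f ((l : ℕ) : ZMod (2 * M)) := by
  classical
  rw [← Finset.sum_fiberwise (s := Finset.univ)
    (g := fun j : ZMod (2 * M) => (⟨idx j, Nat.lt_succ_of_le (idx_le j)⟩ : Fin (M + 1))),
    Finset.mul_sum]
  refine Finset.sum_le_sum fun l _ => ?_
  have h1 : (Finset.univ.filter fun j : ZMod (2 * M) =>
      (⟨idx j, Nat.lt_succ_of_le (idx_le j)⟩ : Fin (M + 1)) = l) ⊆
      {((l : ℕ) : ZMod (2 * M)), -((l : ℕ) : ZMod (2 * M))} := by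
    intro j hj
    rw [Finset.mem_filter] at hj
    have h2 : idx j = idx ((l : ℕ) : ZMod (2 * M)) := by
      rw [idx_natCast (Nat.le_of_lt_succ l.2), ← hj.2]
    rcases eq_or_eq_neg_of_idx_eq h2 with h | h <;> simp [h]
  refine (Finset.sum_le_sum_of_subset_of_nonneg h1 fun _ _ _ => hf _).trans ?_
  by_cases h : ((l : ℕ) : ZMod (2 * M)) = -((l : ℕ) : ZMod (2 * M))
  · rw [← h, Finset.pair_eq_singleton, Finset.sum_singleton]
    linarith [hf ((l : ℕ) : ZMod (2 * M))]
  · rw [Finset.sum_pair h, hneg]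
    linarith

theorem sum_fin_le_sum {M : ℕ} [NeZero M] {f : ZMod (2 * M) → ℝ} (hf : ∀ j, 0 ≤ f j) :
    ∑ l : Fin (M + 1), f ((l : ℕ) : ZMod (2 * M)) ≤ ∑ j, f j := by
  classical
  have hinj : Function.Injective fun l : Fin (M + 1) => ((l : ℕ) : ZMod (2 * M)) := by
    intro l l' h
    have := congrArg idx h
    simp only at this
    rw [idx_natCast (Nat.le_of_lt_succ l.2), idx_natCast (Nat.le_of_lt_succ l'.2)] at this
    exact Fin.ext this
  rw [← Finset.sum_image (s := Finset.univ) (g := fun l : Fin (M + 1) => ((l : ℕ) : ZMod (2 * M)))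
    (f := f) (fun i _ j _ h => hinj h)]
  exact Finset.sum_le_sum_of_subset_of_nonneg (Finset.subset_univ _) fun _ _ _ => hf _

/-- Bounds from a recursion with discrete convolutions. -/
theorem exists_wnorm_le_of_rec (s c D : ℝ) (n : ℕ) : ∃ C, 0 ≤ C ∧ ∀ (M : ℕ) [NeZero M],
    1 / 2 < s → ∀ f : ℕ → ZMod (2 * M) → ℝ, (∀ m j, 0 ≤ f m j) → (f 0 = fun _ => 0) →
    ∀ g : ZMod (2 * M) → ℝ, wnorm s g ≤ D →
    (∀ m < n, ∀ j, f m j ≤ |c| * ∑ p ∈ Finset.HasAntidiagonal.antidiagonal m, ∑ i,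
      f p.1 i * f p.2 (j - i) + g j) → ∀ m < n, wnorm s (f m) ≤ C := by
  suffices H : ∀ N : ℕ, ∃ C, 0 ≤ C ∧ ∀ (M : ℕ) [NeZero M],
      1 / 2 < s → ∀ f : ℕ → ZMod (2 * M) → ℝ, (∀ m j, 0 ≤ f m j) → (f 0 = fun _ => 0) →
      ∀ g : ZMod (2 * M) → ℝ, wnorm s g ≤ D →
      (∀ m < n, ∀ j, f m j ≤ |c| * ∑ p ∈ Finset.HasAntidiagonal.antidiagonal m, ∑ i,
        f p.1 i * f p.2 (j - i) + g j) → ∀ m ≤ N, m < n → wnorm s (f m) ≤ C by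
    obtain ⟨C, hC, h⟩ := H n
    exact ⟨C, hC, fun M _ hs f hf h0 g hg hrec m hm => h M hs f hf h0 g hg hrec m hm.le hm⟩
  intro N
  induction N with
  | zero =>
    refine ⟨0, le_rfl, fun M _ hs f hf h0 g hg hrec m hm _ => ?_⟩
    rw [Nat.le_zero.1 hm, h0, wnorm_zero]
  | succ N ih =>
    obtain ⟨C, hC, h⟩ := ih
    -- `N + 2` is the number of pairs with sum `N + 1`. The constant is fixed before `M`, `f` and
    -- `g`, which gives uniformity in them.
    refine ⟨max C (|c| * ((N + 2) * (convConst s * (C * C))) + |D|),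
      le_max_of_le_left hC, fun M _ hs f hf h0 g hg hrec m hm hmn => ?_⟩
    rcases Nat.lt_succ_iff_lt_or_eq.1 (Nat.lt_succ_of_le hm) with hm' | rfl
    · exact (h M hs f hf h0 g hg hrec m (by omega) hmn).trans (le_max_left _ _)
    refine le_trans ?_ (le_max_right _ _)
    have h1 : wnorm s (f (N + 1)) ≤ wnorm s (fun j => |c| *
        ∑ p ∈ Finset.HasAntidiagonal.antidiagonal (N + 1), ∑ i, f p.1 i * f p.2 (j - i) + g j) :=
      wnorm_mono fun j => by
        rw [abs_of_nonneg (hf _ _)]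
        exact hrec _ hmn j
    refine h1.trans ((wnorm_add_le s _ _).trans ?_)
    rw [wnorm_const_mul s (abs_nonneg c)]
    refine add_le_add (mul_le_mul_of_nonneg_left ?_ (abs_nonneg c)) (hg.trans (le_abs_self D))
    refine (wnorm_sum_le s _ _).trans ?_
    have h2 : ∀ p ∈ Finset.HasAntidiagonal.antidiagonal (N + 1),
        wnorm s (fun j => ∑ i, f p.1 i * f p.2 (j - i)) ≤ convConst s * (C * C) := by
      intro p hp
      have hp' : p.1 + p.2 = N + 1 := by simpa using hp
      refine (wnorm_conv_le hs _ _).trans (mul_le_mul_of_nonneg_left ?_ (convConst_nonneg s))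
      -- The pairs `(0, N + 1)` and `(N + 1, 0)` drop out because `f 0 = 0`; only strictly smaller
      -- orders are left.
      rcases Nat.eq_zero_or_pos p.1 with h3 | h3
      · rw [h3, h0, wnorm_zero, zero_mul]
        positivity
      · rcases Nat.eq_zero_or_pos p.2 with h4 | h4
        · rw [h4, h0, wnorm_zero, mul_zero]
          positivity
        · exact mul_le_mul (h M hs f hf h0 g hg hrec _ (by omega) (by omega))
            (h M hs f hf h0 g hg hrec _ (by omega) (by omega)) (wnorm_nonneg _ _) hC
    refine (Finset.sum_le_sum h2).trans (le_of_eq ?_)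
    rw [Finset.sum_const, Finset.Nat.card_antidiagonal, nsmul_eq_mul]
    push_cast
    ring

namespace Setting

variable {K : ℕ} {ν s γ ρ B : ℝ} (S : Setting K ν s γ ρ B)

/-! ### Bounds of the coefficient functions in terms of the initial values -/

/-- The rescaled norm at order `m`. -/
def Y (m : ℕ) (j : S.J) : ℝ := ∑ k ∈ setK K j, S.ny j k m

theorem Y_nonneg (m : ℕ) (j : S.J) : 0 ≤ S.Y m j := Finset.sum_nonneg fun _ _ => S.ny_nonneg _ _ _

theorem Y_zero (j : S.J) : S.Y 0 j = 0 :=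
  Finset.sum_eq_zero fun k hk => by rw [ny, S.y_zero hk, coeffNorm_zero, mul_zero, zero_div]

/-- The initial values in the energy norm. -/
def initVal (j : S.J) : ℝ := S.δ ^ (-(S.e j : ℝ)) * (S.ω j * ‖S.u₀ j‖ + ‖S.v₀ j‖)

theorem initVal_nonneg (j : S.J) : 0 ≤ S.initVal j :=
  mul_nonneg (Real.rpow_pos_of_pos S.δ_pos _).le
    (add_nonneg (mul_nonneg (S.ω_pos j).le (norm_nonneg _)) (norm_nonneg _))

theorem ny_diag_le (j : S.J) {k : S.V} (hd : IsDiag j k) (m : ℕ) :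
    S.ny j k m ≤ 2 * (S.ω j * ‖(S.y j k m).eval 0‖ / S.amp j (unitVec j) m + S.ny' j k m) := by
  have h1 : S.amp j k m = S.amp j (unitVec j) m := by
    unfold amp o; rw [hd.order_eq, IsDiag.order_eq (j := j) (k := unitVec j) (Or.inl rfl)]
  have h2 := S.amp_pos j (unitVec j) m
  rw [ny, ny', S.Q_diag hd, h1, ← add_div, ← mul_add, ← mul_div_assoc]
  have := mul_le_mul_of_nonneg_left (coeffNorm_le_eval_zero_add (S.y j k m)) (S.ω_pos j).le
  refine div_le_div_of_nonneg_right ?_ h2.le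
  linarith

theorem sum_G_le_Y {j : S.J} {T : Finset S.V} (m : ℕ) :
    ∑ k ∈ T, S.G j k m ≤ B ^ 2 / ρ * ∑ p ∈ Finset.HasAntidiagonal.antidiagonal m, ∑ j₁ : S.J,
      S.Y p.1 j₁ * S.Y p.2 (j - j₁) := by
  have hρ : 0 < √ρ := Real.sqrt_pos.2 S.hρ
  refine (S.sum_G_le (a := fun j k m => 1 / √ρ * S.ny j k m)
    (fun j k m => mul_nonneg (by positivity) (S.ny_nonneg j k m)) ?_).trans (le_of_eq ?_)
  · intro j₁ k₁ _ k₂ _ _ m₁ m₂ _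
    have h1 := mul_nonneg (one_div_pos.2 hρ).le (S.ny_nonneg j₁ k₁ m₁)
    refine (mul_le_mul (S.coeffNorm_y_le j₁ k₁ m₁) (S.coeffNorm_y_le (j - j₁) k₂ m₂)
      (coeffNorm_nonneg _) (mul_nonneg (S.amp_pos _ _ _).le h1)).trans_eq ?_
    ring
  · have h2 : (1 / √ρ) * (1 / √ρ) = 1 / ρ := by
      rw [div_mul_div_comm, one_mul, Real.mul_self_sqrt S.hρ.le]
    simp only [← Finset.mul_sum]
    change B ^ 2 * ∑ p ∈ Finset.HasAntidiagonal.antidiagonal m, ∑ j₁ : S.J,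
      (1 / √ρ * S.Y p.1 j₁) * (1 / √ρ * S.Y p.2 (j - j₁)) = _
    have h3 : ∀ (p : ℕ × ℕ) (j₁ : S.J), (1 / √ρ * S.Y p.1 j₁) * (1 / √ρ * S.Y p.2 (j - j₁)) =
        1 / ρ * (S.Y p.1 j₁ * S.Y p.2 (j - j₁)) := by
      intro p j₁; rw [← h2]; ring
    simp only [h3, ← Finset.mul_sum]
    ring

/-- The constant in the recursive bound. -/
def recConst (K : ℕ) (γ ρ B : ℝ) : ℝ :=
  (2 * diagConst K γ + 2) * (solveConst K γ B * (B ^ 2 / ρ))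

theorem recConst_nonneg (S : Setting K ν s γ ρ B) : 0 ≤ recConst K γ ρ B := by
  have h1 := diagConst_nonneg S
  have h2 := solveConst_nonneg S
  have h3 := S.hρ
  unfold recConst; positivity

/-- Off-diagonal functions and derivatives of diagonal ones are bounded by the quadratic term; the
diagonal values at `0` are bounded by these two and by the initial values. Adding up gives a
recursion over orders. -/
theorem Y_le {m : ℕ} (hm : m < 2 * K) (j : S.J) :
    S.Y m j ≤ recConst K γ ρ B * ∑ p ∈ Finset.HasAntidiagonal.antidiagonal m, ∑ j₁ : S.J,
      S.Y p.1 j₁ * S.Y p.2 (j - j₁) + 2 * S.initVal j := by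
  have h1 := S.ny_diag_le j (Or.inl rfl : IsDiag j (unitVec j)) m
  have h2 := S.ny_diag_le j (Or.inr rfl : IsDiag j (-unitVec j)) m
  have h3 := S.diag_const_le j hm
  rw [mul_add, add_div] at h3
  have h4 := S.ny'_diag_le (Or.inl rfl : IsDiag j (unitVec j)) hm
  have h5 := S.ny'_diag_le (Or.inr rfl : IsDiag j (-unitVec j)) hm
  have h6 : ∑ k ∈ S.off j, S.ny j k m ≤ solveConst K γ B * ∑ k ∈ S.off j, S.G j k m := by
    rw [Finset.mul_sum]
    exact Finset.sum_le_sum fun k hk => S.ny_off_le hk hm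
  have h7 := S.sum_setK_eq j (fun k => S.G j k m)
  have h8 := S.sum_G_le_Y (j := j) (T := setK K j) m
  have h9 : (if m = S.e j then S.δ ^ (-(S.e j : ℝ)) * (S.ω j * ‖S.u₀ j‖ + ‖S.v₀ j‖) else 0) ≤
      S.initVal j := by
    split_ifs
    · exact le_rfl
    · exact S.initVal_nonneg j
  have hd := diagConst_nonneg S
  have hs := solveConst_nonneg S
  have h10 : ∑ k ∈ S.off j, S.ny j k m + (S.ny' j (unitVec j) m + S.ny' j (-unitVec j) m) ≤
      solveConst K γ B * (B ^ 2 / ρ * ∑ p ∈ Finset.HasAntidiagonal.antidiagonal m, ∑ j₁ : S.J,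
        S.Y p.1 j₁ * S.Y p.2 (j - j₁)) := by
    refine le_trans ?_ (mul_le_mul_of_nonneg_left h8 hs)
    rw [h7]
    linarith
  have h11 := mul_le_mul_of_nonneg_left h10 (by positivity : 0 ≤ 2 * diagConst K γ + 2)
  have h12 : 0 ≤ ∑ k ∈ S.off j, S.ny j k m := Finset.sum_nonneg fun k _ => S.ny_nonneg j k m
  unfold recConst
  rw [Y, S.sum_setK_eq]
  linarith

/-- The bound of all coefficient functions. -/
theorem exists_wnorm_Y_le (K : ℕ) (ν s γ ρ B D : ℝ) : ∃ C, 0 ≤ C ∧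
    ∀ S : Setting K ν s γ ρ B, wnorm s S.initVal ≤ D → ∀ m < 2 * K, wnorm s (S.Y m) ≤ C := by
  obtain ⟨C, hC, h⟩ := exists_wnorm_le_of_rec s (recConst K γ ρ B) (2 * D) (2 * K)
  refine ⟨C, hC, fun S hS => h S.M S.hs S.Y S.Y_nonneg (funext S.Y_zero) (fun j => 2 * S.initVal j)
    ?_ fun m hm j => ?_⟩
  · rw [wnorm_const_mul s zero_le_two]
    linarith
  · rw [abs_of_nonneg (recConst_nonneg S)]
    exact S.Y_le hm j

theorem initVal_neg (j : S.J) : S.initVal (-j) = S.initVal j := by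
  unfold initVal
  rw [S.e_neg, S.ω_neg, S.hu₀, S.hv₀, RCLike.norm_conj, RCLike.norm_conj]

theorem idx_cast (l : Fin (S.M + 1)) : idx ((l : ℕ) : S.J) = l :=
  idx_natCast (Nat.le_of_lt_succ l.2)

theorem δ_neg_sq (n : ℕ) : (S.δ ^ (-(n : ℝ))) ^ 2 = S.ε ^ (-(n : ℝ)) := by
  rw [S.ε_rpow, ← Real.rpow_natCast, ← Real.rpow_mul S.δ_pos.le]
  congr 1
  push_cast
  ring

/-- The `8` is `2 · 4`: two residues `±j` for each absolute value, and `(x + w)² ≤ 4 (x²/2 + w²/2)`.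
-/
theorem wnorm_initVal_le {C₀ : ℝ}
    (h : weightedEnergy K ρ S.τ S.ε s S.φ S.ψ S.u₀ S.v₀ 0 ≤ C₀) :
    wnorm s S.initVal ≤ √(8 * C₀) := by
  refine Real.sqrt_le_sqrt ?_
  refine (sum_le_two_mul_sum_fin (fun j => mul_nonneg (weight_pos s _).le (sq_nonneg _))
    (fun j => by rw [idx_neg, S.initVal_neg])).trans ?_
  have h1 : ∀ l : Fin (S.M + 1), weight s (idx ((l : ℕ) : S.J)) *
      S.initVal ((l : ℕ) : S.J) ^ 2 ≤ 4 * (weight s l * S.ε ^ (-(profile K l : ℝ)) *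
        modeEnergy ρ S.τ S.φ S.ψ S.u₀ S.v₀ 0 ((l : ℕ) : S.J)) := by
    intro l
    rw [initVal, mul_pow, S.δ_neg_sq, e, S.idx_cast, modeEnergy, sol, vel, norm_mul,
      Complex.norm_real, Real.norm_eq_abs, abs_of_pos (freq_pos S.hρ _)]
    change _ * (_ * (S.ω _ * _ + _) ^ 2) ≤ 4 * (_ * (1 / 2 * (S.ω _ * _) ^ 2 + _))
    have h2 : 0 ≤ weight s (l : ℕ) * S.ε ^ (-(profile K l : ℝ)) :=
      mul_nonneg (weight_pos s _).le (Real.rpow_nonneg S.hε.le _)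
    set x := S.ω ((l : ℕ) : S.J) * ‖S.u₀ ((l : ℕ) : S.J)‖
    set w := ‖S.v₀ ((l : ℕ) : S.J)‖
    have h3 : (x + w) ^ 2 ≤ 4 * (1 / 2 * x ^ 2 + 1 / 2 * w ^ 2) := by nlinarith [sq_nonneg (x - w)]
    have := mul_le_mul_of_nonneg_left h3 h2
    linarith
  refine (mul_le_mul_of_nonneg_left (Finset.sum_le_sum fun l _ => h1 l) zero_le_two).trans ?_
  rw [← Finset.mul_sum]
  unfold weightedEnergy at h
  linarith

end Setting

end TrigInt

namespace TrigInt
open Polynomial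

/-- Complex conjugation of the coefficients. -/
def conjPoly (p : ℂ[X]) : ℂ[X] := p.map (starRingEnd ℂ)

theorem eval_conjPoly (p : ℂ[X]) (x : ℝ) :
    (conjPoly p).eval (x : ℂ) = (starRingEnd ℂ) (p.eval (x : ℂ)) := by
  unfold conjPoly
  conv_lhs => rw [← Complex.conj_ofReal x]
  rw [eval_map, eval₂_hom]

theorem conj_exp_I_mul (α : ℝ) : (starRingEnd ℂ) (Complex.exp (Complex.I * α)) =
    Complex.exp (-(Complex.I * α)) := by
  rw [← Complex.exp_conj, map_mul, Complex.conj_I, Complex.conj_ofReal, neg_mul]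

theorem conj_exp_neg_I_mul (α : ℝ) : (starRingEnd ℂ) (Complex.exp (-(Complex.I * α))) =
    Complex.exp (Complex.I * α) := by
  rw [← Complex.exp_conj, map_neg, map_mul, Complex.conj_I, Complex.conj_ofReal, neg_mul, neg_neg]

theorem conjPoly_modOp (α β h : ℝ) (p : ℂ[X]) :
    conjPoly (modOp α β h p) = modOp (-α) β h (conjPoly p) := by
  unfold conjPoly modOp diffOp
  simp only [LinearMap.add_apply, LinearMap.sub_apply, LinearMap.smul_apply, LinearMap.id_apply,
    Polynomial.map_add, Polynomial.map_sub, Polynomial.map_smul, map_taylor, conj_exp_I_mul,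
    conj_exp_neg_I_mul, map_neg, Complex.conj_ofReal, map_mul, Complex.ofReal_neg, mul_neg, neg_neg,
    map_ofNat]

namespace Setting

variable {K : ℕ} {ν s γ ρ B : ℝ} (S : Setting K ν s γ ρ B)

/-! ### Reality -/

theorem conj_aux {a b x y : ℂ} {σ : ℝ} (hσ : σ ≠ 0) (h1 : a + b = x + y)
    (h2 : 2 * Complex.I * (σ : ℂ) * (a - b) = 2 * Complex.I * (σ : ℂ) * (x - y)) :
    a = x ∧ b = y := by
  have h3 : a - b = x - y :=
    mul_left_cancel₀ (mul_ne_zero (mul_ne_zero two_ne_zero Complex.I_ne_zero)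
      (Complex.ofReal_ne_zero.2 hσ)) h2
  constructor
  · linear_combination (h1 + h3) / 2
  · linear_combination (h1 - h3) / 2

theorem conj_F (m : ℕ) (hm : m < 2 * K)
    (ih : ∀ m' < m, m' < 2 * K → ∀ (j : S.J) (k : S.V), k ∈ setK K j →
      conjPoly (S.y (-j) (-k) m') = S.y j k m') (j : S.J) (k : S.V) :
    conjPoly (S.F (-j) (-k) m) = S.F j k m := by
  unfold F conjPoly
  simp only [Polynomial.map_sum, Finset.sum_filter]
  rw [← Equiv.sum_comp (Equiv.neg S.J)]
  refine Finset.sum_congr rfl fun j₁ _ => ?_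
  simp only [Equiv.neg_apply]
  rw [sum_setK_neg]
  refine Finset.sum_congr rfl fun k₁ hk₁ => ?_
  have e : -j - -j₁ = -(j - j₁) := by ring
  rw [e, sum_setK_neg]
  refine Finset.sum_congr rfl fun k₂ hk₂ => ?_
  have e2 : (-k₁ + -k₂ = -k) ↔ (k₁ + k₂ = k) := by rw [← neg_add, neg_inj]
  simp only [e2]
  split_ifs with h
  · rw [Polynomial.map_sum]
    refine Finset.sum_congr rfl fun p hp => ?_
    have h2 : p.1 + p.2 = m := by simpa using hp
    have hfy : ∀ {j : S.J} {k : S.V} (_ : k ∈ setK K j) (n : ℕ), n < m →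
        (S.fy (-j) (-k) n).map (starRingEnd ℂ) = S.fy j k n := by
      intro j k hk n hn
      have := ih n hn (hn.trans hm) j k hk
      unfold conjPoly at this
      rw [fy, Polynomial.map_mul, this, map_C, Complex.conj_ofReal, S.β_neg, fy]
    rw [Polynomial.map_mul]
    rcases Nat.eq_zero_or_pos p.1 with h3 | h3
    · rw [h3, S.fy_eq_zero (S.y_zero hk₁), S.fy_eq_zero (S.y_zero (neg_mem_setK.2 hk₁))]
      simp
    · rcases Nat.eq_zero_or_pos p.2 with h4 | h4
      · rw [h4, S.fy_eq_zero (S.y_zero hk₂), S.fy_eq_zero (S.y_zero (neg_mem_setK.2 hk₂))]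
        simp
      · rw [hfy hk₁ p.1 (by omega), hfy hk₂ p.2 (by omega)]
  · simp

/-- The conjugate of the function at `(-j,-k)` solves the same system with the same initial data.
Off the diagonal the solution is unique; the two diagonal functions can differ by constants `a`,
`b`, and position and velocity at time `0` force `a + b = 0` and `sin β (a - b) = 0`. -/
theorem conj_y (m : ℕ) : m < 2 * K → ∀ (j : S.J) (k : S.V), k ∈ setK K j →
    conjPoly (S.y (-j) (-k) m) = S.y j k m := by
  induction m using Nat.strong_induction_on with
  | _ m ih =>
  intro hm
  have hsys : ∀ (j : S.J) (k : S.V), k ∈ setK K j →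
      modOp (S.α k) (S.β j) S.h (conjPoly (S.y (-j) (-k) m) - S.y j k m) = 0 := by
    intro j k hk
    have h1 := congrArg conjPoly (S.system (neg_mem_setK.2 hk) hm)
    rw [conjPoly_modOp, S.α_neg, neg_neg, S.β_neg] at h1
    rw [map_sub, h1, S.system hk hm, ← S.conj_F m hm ih j k]
    unfold conjPoly
    rw [Polynomial.map_mul, map_C, map_mul, map_pow, Complex.conj_ofReal, Complex.conj_ofReal,
      sub_self]
  have hoff : ∀ (j : S.J) (k : S.V), k ∈ S.off j →
      conjPoly (S.y (-j) (-k) m) = S.y j k m := by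
    intro j k hk
    obtain ⟨hk, hd⟩ := S.mem_off.1 hk
    exact sub_eq_zero.1 (eq_zero_of_modOp S.resConst_nonneg S.h_pos.le
      (abs_pos.1 (S.d_pos hk hd)) (S.sin_α_mul_h_le hk hd) (S.h_sq_le hk hd) (hsys j k hk))
  have hdiag : ∀ (j : S.J) (k : S.V), IsDiag j k → ∃ c : ℂ,
      conjPoly (S.y (-j) (-k) m) = S.y j k m + C c := by
    intro j k hd
    have h0 := S.h_le_resConst j
    rw [← S.sin_α_diag hd] at h0
    have h1 := derivative_eq_zero_of_modOp S.resConst_nonneg S.h_pos (S.d_diag hd) h0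
      (hsys j k (hd.mem S.hK))
    obtain ⟨c, hc⟩ := natDegree_eq_zero.1 (derivative_eq_zero.1 h1)
    exact ⟨c, by rw [hc]; ring⟩
  intro j k hk
  by_cases hd : IsDiag j k
  swap
  · exact hoff j k (S.mem_off.2 ⟨hk, hd⟩)
  obtain ⟨a, ha⟩ := hdiag j (unitVec j) (Or.inl rfl)
  obtain ⟨b, hb⟩ := hdiag j (-unitVec j) (Or.inr rfl)
  have hsin : Real.sin (S.β j) ≠ 0 := abs_pos.1 (S.sin_β_pos j)
  have hab : a = 0 ∧ b = 0 := by
    refine conj_aux hsin (x := 0) (y := 0) ?_ ?_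
    · have h1 := S.init_position j hm
      have h2 := congrArg (starRingEnd ℂ) (S.init_position (-j) hm)
      rw [sum_setK_neg, map_sum, S.e_neg, apply_ite (starRingEnd ℂ), S.hu₀, Complex.conj_conj,
        map_zero, ← h1] at h2
      have h3 : ∀ k ∈ setK K j, (starRingEnd ℂ) ((S.y (-j) (-k) m).eval 0) =
          (conjPoly (S.y (-j) (-k) m)).eval 0 := by
        intro k _
        have := eval_conjPoly (S.y (-j) (-k) m) 0
        rw [Complex.ofReal_zero] at this
        exact this.symm
      rw [Finset.sum_congr rfl h3, S.sum_setK_eq, S.sum_setK_eq, ha, hb,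
        Finset.sum_congr rfl fun k hk => by rw [hoff j k hk]] at h2
      simp only [eval_add, eval_C] at h2
      linear_combination h2
    · have h1 := S.init_velocity j hm
      have h2 := congrArg (starRingEnd ℂ) (S.init_velocity (-j) hm)
      rw [sum_setK_neg, map_sum, S.e_neg, apply_ite (starRingEnd ℂ), map_mul, S.hv₀,
        Complex.conj_conj, map_zero, S.β_neg] at h2
      simp only [map_mul, map_ofNat, Complex.conj_ofReal] at h2
      rw [← h1] at h2
      have h3 : ∀ k ∈ setK K j, (starRingEnd ℂ) (Complex.exp (Complex.I * (S.α (-k) : ℂ)) *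
          (S.y (-j) (-k) m).eval ((S.h : ℝ) : ℂ) - Complex.exp (-(Complex.I * (S.α (-k) : ℂ))) *
          (S.y (-j) (-k) m).eval ((-S.h : ℝ) : ℂ)) = Complex.exp (Complex.I * (S.α k : ℂ)) *
          (conjPoly (S.y (-j) (-k) m)).eval ((S.h : ℝ) : ℂ) -
            Complex.exp (-(Complex.I * (S.α k : ℂ))) *
          (conjPoly (S.y (-j) (-k) m)).eval ((-S.h : ℝ) : ℂ) := by
        intro k _
        rw [map_sub, map_mul, map_mul, conj_exp_I_mul, conj_exp_neg_I_mul, eval_conjPoly,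
          eval_conjPoly, S.α_neg]
        simp
      rw [Finset.sum_congr rfl h3, S.sum_setK_eq, S.sum_setK_eq, ha, hb,
        Finset.sum_congr rfl fun k hk => by rw [hoff j k hk]] at h2
      simp only [eval_add, eval_C] at h2
      rw [← exp_sub_exp_neg]
      rw [S.α_neg, S.α_unitVec] at h2
      push_cast at h2 ⊢
      simp only [mul_neg, neg_neg] at h2
      linear_combination h2
  rcases hd with rfl | rfl
  · rw [ha, hab.1, C_0, add_zero]
  · rw [hb, hab.2, C_0, add_zero]

/-- The modulation functions. -/
def Z (j : S.J) (k : S.V) : ℂ[X] := ∑ m ∈ Finset.range (2 * K), S.y j k m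

theorem conj_Z {j : S.J} {k : S.V} (hk : k ∈ setK K j) :
    conjPoly (S.Z (-j) (-k)) = S.Z j k := by
  unfold Z conjPoly
  rw [Polynomial.map_sum]
  exact Finset.sum_congr rfl fun m hm => S.conj_y m (Finset.mem_range.1 hm) j k hk

theorem eval_Z_neg {j : S.J} {k : S.V} (hk : k ∈ setK K j) (x : ℝ) :
    (S.Z (-j) (-k)).eval (x : ℂ) = (starRingEnd ℂ) ((S.Z j k).eval (x : ℂ)) := by
  rw [← S.conj_Z hk, eval_conjPoly, Complex.conj_conj]

/-! ### The almost-invariant energies -/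

/-- The contribution of `(j, k)` to the almost-invariant energies at `x = δ^ν t`. -/
def I (j : S.J) (k : S.V) (x : ℝ) : ℝ :=
  ((starRingEnd ℂ) ((S.Z j k).eval (x : ℂ)) * Complex.exp (Complex.I * (S.α k : ℂ)) *
    (S.Z j k).eval ((x + S.h : ℝ) : ℂ)).im / Real.sin (S.β j)

/-- Passing from `(j,k)` to `(-j,-k)` conjugates the product of modulation functions and changes the
sign of `k_l`. Only imaginary parts survive, so the energies are real. -/
theorem almostInv_eq (l : Fin (S.M + 1)) (t : ℝ) :
    almostInv K ρ S.τ S.ε ν S.z l t = ((1 / 2 * ∑ j : S.J, ∑ k ∈ setK K j,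
      (k l : ℝ) * freq ρ l * S.ω j * S.I j k (S.ε ^ (ν / 2) * t) : ℝ) : ℂ) := by
  set x := S.ε ^ (ν / 2) * t with hx
  set T : S.J → S.V → ℂ := fun j k => (starRingEnd ℂ) ((S.Z j k).eval (x : ℂ)) *
    Complex.exp (Complex.I * (S.α k : ℂ)) * (S.Z j k).eval ((x + S.h : ℝ) : ℂ) with hT
  set c : S.J → S.V → ℝ := fun j k => (k l : ℝ) * freq ρ l * S.ω j / Real.sin (S.β j) with hc
  have hcneg : ∀ j k, c (-j) (-k) = -c j k := by
    intro j k
    simp only [hc, S.ω_neg, S.β_neg, Pi.neg_apply, Int.cast_neg]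
    ring
  have hTneg : ∀ j, ∀ k ∈ setK K j, T (-j) (-k) = (starRingEnd ℂ) (T j k) := by
    intro j k hk
    simp only [hT]
    rw [S.eval_Z_neg hk, S.eval_Z_neg hk, S.α_neg, map_mul, map_mul, conj_exp_I_mul]
    simp
  have h1 : almostInv K ρ S.τ S.ε ν S.z l t =
      -(Complex.I / 2) * ∑ j : S.J, ∑ k ∈ setK K j, (c j k : ℂ) * T j k := by
    unfold almostInv
    congr 1
    refine Finset.sum_congr rfl fun j _ => Finset.sum_congr rfl fun k hk => ?_
    rw [S.modFun_eq hk, S.modFun_eq (neg_mem_setK.2 hk), S.exp_α]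
    change _ * (S.Z (-j) (-k)).eval _ * _ * (S.Z j k).eval _ = _
    rw [S.eval_Z_neg hk, ← hx, show S.ε ^ (ν / 2) * (t + S.τ) = x + S.h by rw [hx, h]; ring]
    have h2 : ((k l : ℂ) * (freq ρ l : ℂ) / ((S.τ : ℂ) *
        (Real.sinc (S.τ * freq ρ (idx j)) : ℂ))) = (c j k : ℂ) := by
      change _ / ((S.τ : ℂ) * (Real.sinc (S.β j) : ℂ)) = _
      have h3 : S.τ * Real.sinc (S.β j) = Real.sin (S.β j) / S.ω j := by
        rw [Real.sinc_of_ne_zero (S.β_pos j).ne', S.β_eq]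
        have := S.hτ.ne'
        have := (S.ω_pos j).ne'
        field_simp
      rw [← Complex.ofReal_mul, h3]
      simp only [hc]
      push_cast
      have := Complex.ofReal_ne_zero.2 (S.ω_pos j).ne'
      rw [div_div_eq_mul_div]
    rw [h2]
    simp only [hT]
    ring
  have h4 : ∑ j : S.J, ∑ k ∈ setK K j, (c j k : ℂ) * T j k =
      ∑ j : S.J, ∑ k ∈ setK K j, -((c j k : ℂ) * (starRingEnd ℂ) (T j k)) := by
    conv_lhs => rw [← Equiv.sum_comp (Equiv.neg S.J)]
    refine Finset.sum_congr rfl fun j _ => ?_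
    rw [Equiv.neg_apply, sum_setK_neg]
    refine Finset.sum_congr rfl fun k hk => ?_
    rw [hcneg, hTneg j k hk]
    push_cast
    ring
  have h5 : ∑ j : S.J, ∑ k ∈ setK K j, (c j k : ℂ) * T j k =
      1 / 2 * ∑ j : S.J, ∑ k ∈ setK K j, (c j k : ℂ) * (2 * Complex.I * ((T j k).im : ℂ)) := by
    have h6 : ∑ j : S.J, ∑ k ∈ setK K j, (c j k : ℂ) * (2 * Complex.I * ((T j k).im : ℂ)) =
        ∑ j : S.J, ∑ k ∈ setK K j, (c j k : ℂ) * T j k +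
        ∑ j : S.J, ∑ k ∈ setK K j, -((c j k : ℂ) * (starRingEnd ℂ) (T j k)) := by
      rw [← Finset.sum_add_distrib]
      refine Finset.sum_congr rfl fun j _ => ?_
      rw [← Finset.sum_add_distrib]
      refine Finset.sum_congr rfl fun k _ => ?_
      have := Complex.sub_conj (T j k)
      push_cast at this
      linear_combination (-(c j k : ℂ)) * this
    rw [h6, ← h4]
    ring
  rw [h1, h5]
  push_cast
  simp only [Finset.mul_sum]
  refine Finset.sum_congr rfl fun j _ => Finset.sum_congr rfl fun k _ => ?_
  change _ = 1 / 2 * ((k l : ℂ) * (freq ρ l : ℂ) * (S.ω j : ℂ) * ((S.I j k x : ℝ) : ℂ))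
  have h7 : (S.I j k x : ℝ) = (T j k).im / Real.sin (S.β j) := rfl
  rw [h7]
  simp only [hc]
  push_cast
  linear_combination (-(1 / 2) * ((k l : ℂ) * (freq ρ l : ℂ) * (S.ω j : ℂ) /
    Complex.sin (S.β j)) * ((T j k).im : ℂ)) * Complex.I_sq

end Setting

end TrigInt

namespace TrigInt
open Polynomial

namespace Setting

variable {K : ℕ} {ν s γ ρ B : ℝ} (S : Setting K ν s γ ρ B)

/-! ### Bounds of the modulation functions -/

theorem amp_le {j : S.J} {k : S.V} {m r : ℕ} (h : S.o j k + r ≤ m) :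
    S.amp j k m ≤ S.δ ^ ((S.o j k : ℝ) + r * (1 - 2 * ν)) := by
  unfold amp
  refine S.δ_rpow_anti ?_
  have h' : (S.o j k : ℝ) + r ≤ m := by exact_mod_cast h
  nlinarith [S.θ_pos]

theorem ny_eq_zero_of_y {j : S.J} {k : S.V} {m : ℕ} (h : S.y j k m = 0) : S.ny j k m = 0 := by
  rw [ny, h, coeffNorm_zero, mul_zero, zero_div]

theorem F_eq_zero {j : S.J} {k : S.V} {m : ℕ}
    (H : ∀ (j₁ : S.J) (k₁ k₂ : S.V), k₁ + k₂ = k → m < S.o j₁ k₁ + S.o (j - j₁) k₂) :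
    S.F j k m = 0 := by
  refine Finset.sum_eq_zero fun j₁ _ => Finset.sum_eq_zero fun k₁ hk₁ =>
    Finset.sum_eq_zero fun k₂ hk₂ => Finset.sum_eq_zero fun p hp => ?_
  rw [Finset.mem_filter] at hk₂
  have h1 := H j₁ k₁ k₂ hk₂.2
  have h2 : p.1 + p.2 = m := by simpa using hp
  rcases lt_or_ge p.1 (S.o j₁ k₁) with h3 | h3
  · rw [S.fy_eq_zero (S.y_eq_zero hk₁ h3), zero_mul]
  · rw [S.fy_eq_zero (S.y_eq_zero hk₂.1 (by omega)), mul_zero]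

theorem ny_off_eq_zero {j : S.J} {k : S.V} (hk : k ∈ S.off j) {m : ℕ} (hm : m < 2 * K)
    (hF : S.F j k m = 0) : S.ny j k m = 0 := by
  refine le_antisymm ((S.ny_off_le hk hm).trans_eq ?_) (S.ny_nonneg j k m)
  rw [G, hF, coeffNorm_zero, zero_div, mul_zero]

theorem derivative_y_diag_eq_zero {j : S.J} {k : S.V} (hd : IsDiag j k) {m : ℕ} (hm : m < 2 * K)
    (hF : S.F j k m = 0) : derivative (S.y j k m) = 0 := by
  have h1 := S.diag_bound hd hm
  rw [hF, coeffNorm_zero, mul_zero, ← mul_assoc] at h1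
  exact coeffNorm_eq_zero (nonpos_of_mul_nonpos_right h1
    (mul_pos (Real.rpow_pos_of_pos S.δ_pos _) (S.ω_pos j)))

theorem K_lt (S : Setting K ν s γ ρ B) : K < 2 * K := by have := S.hK; omega

/-- At the order `e(j)` the diagonal functions are constant. -/
theorem derivative_y_diag_of_le {j : S.J} {k : S.V} (hd : IsDiag j k) {m : ℕ} (hm : m ≤ S.e j) :
    derivative (S.y j k m) = 0 := by
  have h0 := S.e_le j
  have h1 := S.K_lt
  refine S.derivative_y_diag_eq_zero hd (by omega) (S.F_eq_zero fun j₁ k₁ k₂ h => ?_)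
  have := order_lt_of_diag S.hK (j := j) (j₁ := j₁) h hd
  rw [hd.order_eq] at this
  unfold o e at *
  omega

/-- If `k_l ≠ 0`, each product that feeds `k` has total order above `e(l)`. The right-hand side is
therefore zero through order `e(l)`, and off the diagonal the solution vanishes with it. -/
theorem y_off_eq_zero_of_order {j : S.J} {k : S.V} (hk : k ∈ S.off j) {l : Fin (S.M + 1)}
    (hl : k l ≠ 0) {m : ℕ} (hm : m ≤ profile K l) : S.ny j k m = 0 := by
  have h0 := profile_le S.hK l
  have h1 := S.K_lt
  refine S.ny_off_eq_zero hk (by omega) (S.F_eq_zero fun j₁ k₁ k₂ h => ?_)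
  have := profile_lt_order_add S.hK (j₁ := j₁) (j₂ := j - j₁) (k₁ := k₁) (k₂ := k₂) (l := l)
    (by rw [h]; exact hl)
  unfold o
  omega

/-- The sum of the rescaled norms over all orders. -/
def N (j : S.J) (k : S.V) : ℝ := ∑ m ∈ Finset.range (2 * K), S.ny j k m

theorem N_nonneg (j : S.J) (k : S.V) : 0 ≤ S.N j k := Finset.sum_nonneg fun _ _ => S.ny_nonneg _ _ _

/-- The sum of the rescaled norms over all orders and all `k`. -/
def Ytot (j : S.J) : ℝ := ∑ k ∈ setK K j, S.N j k

theorem Ytot_nonneg (j : S.J) : 0 ≤ S.Ytot j := Finset.sum_nonneg fun _ _ => S.N_nonneg _ _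

theorem N_le_Ytot {j : S.J} {k : S.V} (hk : k ∈ setK K j) : S.N j k ≤ S.Ytot j :=
  Finset.single_le_sum (f := fun k => S.N j k) (fun _ _ => S.N_nonneg _ _) hk

theorem Ytot_eq (j : S.J) : S.Ytot j = ∑ m ∈ Finset.range (2 * K), S.Y m j := by
  unfold Ytot N Y
  rw [Finset.sum_comm]

theorem wnorm_Ytot_le {C : ℝ} (h : ∀ m < 2 * K, wnorm s (S.Y m) ≤ C) :
    wnorm s S.Ytot ≤ 2 * K * C := by
  have h1 : S.Ytot = fun j => ∑ m ∈ Finset.range (2 * K), S.Y m j := funext S.Ytot_eq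
  rw [h1]
  refine (wnorm_sum_le s _ _).trans ((Finset.sum_le_sum fun m hm => h m (Finset.mem_range.1 hm)).trans
    (le_of_eq ?_))
  rw [Finset.sum_const, Finset.card_range, nsmul_eq_mul]
  push_cast; ring

theorem Z_le_sum (j : S.J) (k : S.V) : S.ω j * S.Q j k * coeffNorm (S.Z j k) ≤
    ∑ m ∈ Finset.range (2 * K), S.amp j k m * S.ny j k m := by
  have h0 := (mul_pos (S.ω_pos j) (S.Q_pos j k)).le
  refine (mul_le_mul_of_nonneg_left (coeffNorm_sum _ _) h0).trans ?_
  rw [Finset.mul_sum]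
  exact (Finset.sum_le_sum fun m _ => (S.ω_mul_coeffNorm_le j k m).le)

theorem Z_le_of {j : S.J} {k : S.V} {a : ℝ}
    (H : ∀ m < 2 * K, S.ny j k m = 0 ∨ S.amp j k m ≤ a) :
    S.ω j * S.Q j k * coeffNorm (S.Z j k) ≤ a * S.N j k := by
  refine (S.Z_le_sum j k).trans ?_
  unfold N
  rw [Finset.mul_sum]
  refine Finset.sum_le_sum fun m hm => ?_
  rcases H m (Finset.mem_range.1 hm) with h | h
  · rw [h, mul_zero, mul_zero]
  · exact mul_le_mul_of_nonneg_right h (S.ny_nonneg j k m)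

theorem Z_le {j : S.J} {k : S.V} (hk : k ∈ setK K j) :
    S.ω j * S.Q j k * coeffNorm (S.Z j k) ≤ S.δ ^ (S.o j k : ℝ) * S.N j k := by
  refine S.Z_le_of fun m _ => ?_
  rcases lt_or_ge m (S.o j k) with h | h
  · exact Or.inl (S.ny_eq_zero_of_y (S.y_eq_zero hk h))
  · right
    have := S.amp_le (r := 0) h
    simpa using this

/-- Compared with the diagonal functions of mode `l`, off-diagonal functions are smaller by
`δ^(1-2ν)`. If `m(j,k) = e(l)` the first nonzero order is `e(l) + 1`; if `m(j,k) > e(l)` a whole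
power of `δ` is available. -/
theorem Z_off_le {j : S.J} {k : S.V} (hk : k ∈ S.off j) {l : Fin (S.M + 1)} (hl : k l ≠ 0) :
    S.ω j * S.Q j k * coeffNorm (S.Z j k) ≤
      S.δ ^ ((profile K l : ℝ) + (1 - 2 * ν)) * S.N j k := by
  have hν := S.hν
  have h1 : profile K l ≤ S.o j k := profile_le_order_of_ne j hl
  refine S.Z_le_of fun m _ => ?_
  rcases lt_or_ge m (S.o j k) with h | h
  · exact Or.inl (S.ny_eq_zero_of_y (S.y_eq_zero (S.mem_off.1 hk).1 h))
  rcases le_or_gt m (profile K l) with h2 | h2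
  · exact Or.inl (S.y_off_eq_zero_of_order hk hl h2)
  right
  rcases h1.eq_or_lt with h3 | h3
  · refine (S.amp_le (r := 1) (by omega)).trans (S.δ_rpow_anti ?_)
    rw [h3]; simp
  · refine (S.amp_le (r := 0) h).trans (S.δ_rpow_anti ?_)
    have : (profile K l : ℝ) + 1 ≤ S.o j k := by exact_mod_cast h3
    push_cast
    linarith

theorem natDegree_Z_le {j : S.J} {k : S.V} (hk : k ∈ setK K j) :
    (S.Z j k).natDegree ≤ 2 * K :=
  natDegree_sum_le_of_forall_le _ _ fun _ hm => S.natDegree_y_le' hk (Finset.mem_range.1 hm)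

theorem derivative_Z_le_of {j : S.J} {k : S.V} (hk : k ∈ setK K j) {a : ℝ} (ha : 0 ≤ a)
    (H : ∀ m < 2 * K, derivative (S.y j k m) = 0 ∨ S.amp j k m ≤ a) :
    S.ω j * coeffNorm (derivative (S.Z j k)) ≤ 2 * K * (a * S.N j k) := by
  unfold Z
  rw [derivative_sum]
  refine (mul_le_mul_of_nonneg_left (coeffNorm_sum _ _) (S.ω_pos j).le).trans ?_
  unfold N
  rw [Finset.mul_sum, Finset.mul_sum, Finset.mul_sum]
  refine Finset.sum_le_sum fun m hm => ?_
  rw [Finset.mem_range] at hm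
  rcases H m hm with h | h
  · rw [h, coeffNorm_zero, mul_zero]
    have := S.ny_nonneg j k m
    positivity
  · have h1 := coeffNorm_derivative_le (S.natDegree_y_le' hk hm)
    have h2 : S.ω j * coeffNorm (S.y j k m) ≤ S.amp j k m * S.ny j k m := by
      rw [← S.ω_mul_coeffNorm_le, mul_assoc]
      exact mul_le_mul_of_nonneg_left (le_mul_of_one_le_left (coeffNorm_nonneg _) (S.one_le_Q j k))
        (S.ω_pos j).le
    have h3 := mul_le_mul_of_nonneg_right h (S.ny_nonneg j k m)
    calc _ ≤ S.ω j * ((2 * K : ℕ) * coeffNorm (S.y j k m)) :=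
          mul_le_mul_of_nonneg_left h1 (S.ω_pos j).le
      _ = 2 * K * (S.ω j * coeffNorm (S.y j k m)) := by push_cast; ring
      _ ≤ _ := by
        refine mul_le_mul_of_nonneg_left (h2.trans h3) (by positivity)

/-- The coefficient of order `e(j)` is constant, so the derivative starts one order later. -/
theorem derivative_Z_diag_le {j : S.J} {k : S.V} (hd : IsDiag j k) :
    S.ω j * coeffNorm (derivative (S.Z j k)) ≤
      2 * K * (S.δ ^ ((S.e j : ℝ) + (1 - 2 * ν)) * S.N j k) := by
  refine S.derivative_Z_le_of (hd.mem S.hK) (Real.rpow_pos_of_pos S.δ_pos _).le fun m _ => ?_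
  rcases le_or_gt m (S.e j) with h | h
  · exact Or.inl (S.derivative_y_diag_of_le hd h)
  · right
    have h1 : S.o j k = S.e j := hd.order_eq
    refine (S.amp_le (r := 1) (by omega)).trans (S.δ_rpow_anti ?_)
    rw [h1]; simp

/-! ### Almost-invariant energies and diagonal modulation functions -/

/-- The constant in the bounds of the contributions to the almost-invariant energies. -/
def invarConst (K : ℕ) (γ R : ℝ) : ℝ :=
  R ^ (2 * K) * R ^ (2 * K) + R ^ (2 * K) * evalConst R (1 / γ) (2 * K) * resConst γ * (2 * K)

theorem invarConst_nonneg (S : Setting K ν s γ ρ B) {R : ℝ} (hR : 1 ≤ R) :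
    0 ≤ invarConst K γ R := by
  have h1 := S.hγ
  have h2 := evalConst_nonneg (by linarith : 0 ≤ R) (by positivity : 0 ≤ 1 / γ) (2 * K)
  have h3 := resConst_nonneg S
  unfold invarConst; positivity

/-- Replacing `Z(x + h)` by `Z(x)` leaves exactly the main term `sin α |Z|² / sin β`. The error is
of first order in `h`, and the division by `sin β` is absorbed by `h_le_resConst`. -/
theorem I_sub_le {j : S.J} {k : S.V} (hk : k ∈ setK K j) {x R : ℝ} (hR : 1 ≤ R) (hx : |x| ≤ R) :
    |S.I j k x - Real.sin (S.α k) / Real.sin (S.β j) * ‖(S.Z j k).eval (x : ℂ)‖ ^ 2| ≤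
      R ^ (2 * K) * evalConst R (1 / γ) (2 * K) * resConst γ *
        (coeffNorm (S.Z j k) * coeffNorm (derivative (S.Z j k))) := by
  have hγ := S.hγ
  have hsin := S.sin_β_pos j
  have hx' : ‖(x : ℂ)‖ ≤ R := by simpa using hx
  have hn : ‖(S.h : ℂ)‖ = S.h := by simp [abs_of_pos S.h_pos]
  have h1 := norm_eval_add_sub_le (S.natDegree_Z_le hk) (h := S.h) (H := 1 / γ) hR hx'
    (by rw [hn]; exact S.h_le)
  have h2 := norm_eval_le (S.natDegree_Z_le hk) hR hx'
  rw [hn] at h1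
  set w := (S.Z j k).eval (x : ℂ) with hw
  set w' := (S.Z j k).eval ((x : ℂ) + S.h) with hw'
  have h3 : ((starRingEnd ℂ) w * Complex.exp (Complex.I * (S.α k : ℂ)) * w').im =
      Real.sin (S.α k) * ‖w‖ ^ 2 +
        ((starRingEnd ℂ) w * Complex.exp (Complex.I * (S.α k : ℂ)) * (w' - w)).im := by
    have h4 : (starRingEnd ℂ) w * Complex.exp (Complex.I * (S.α k : ℂ)) * w' =
        Complex.exp (Complex.I * (S.α k : ℂ)) * ((‖w‖ ^ 2 : ℝ) : ℂ) +
        (starRingEnd ℂ) w * Complex.exp (Complex.I * (S.α k : ℂ)) * (w' - w) := by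
      have := Complex.conj_mul' w
      push_cast
      linear_combination Complex.exp (Complex.I * (S.α k : ℂ)) * this
    have h5 : (Complex.exp (Complex.I * (S.α k : ℂ))).im = Real.sin (S.α k) := by
      rw [mul_comm, Complex.exp_ofReal_mul_I_im]
    rw [h4, Complex.add_im, Complex.im_mul_ofReal, h5]
  have h6 : S.I j k x - Real.sin (S.α k) / Real.sin (S.β j) * ‖w‖ ^ 2 =
      ((starRingEnd ℂ) w * Complex.exp (Complex.I * (S.α k : ℂ)) * (w' - w)).im /
        Real.sin (S.β j) := by
    unfold I
    rw [Complex.ofReal_add, ← hw, ← hw', h3]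
    ring
  rw [h6, abs_div, div_le_iff₀ hsin]
  refine (Complex.abs_im_le_norm _).trans ?_
  rw [norm_mul, norm_mul, norm_exp_I_mul, mul_one, RCLike.norm_conj]
  have hE := evalConst_nonneg (by linarith : 0 ≤ R) (by positivity : 0 ≤ 1 / γ) (2 * K)
  have hp := coeffNorm_nonneg (S.Z j k)
  have hp' := coeffNorm_nonneg (derivative (S.Z j k))
  have hR0 : 0 ≤ R ^ (2 * K) := by positivity
  calc _ ≤ (R ^ (2 * K) * coeffNorm (S.Z j k)) *
        (evalConst R (1 / γ) (2 * K) * S.h * coeffNorm (derivative (S.Z j k))) :=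
        mul_le_mul h2 h1 (norm_nonneg _) (by positivity)
    _ = R ^ (2 * K) * coeffNorm (S.Z j k) * evalConst R (1 / γ) (2 * K) *
        coeffNorm (derivative (S.Z j k)) * S.h := by ring
    _ ≤ R ^ (2 * K) * coeffNorm (S.Z j k) * evalConst R (1 / γ) (2 * K) *
        coeffNorm (derivative (S.Z j k)) * (resConst γ * |Real.sin (S.β j)|) :=
        mul_le_mul_of_nonneg_left (S.h_le_resConst j) (by positivity)
    _ = _ := by ring

theorem I_le {j : S.J} {k : S.V} (hk : k ∈ setK K j) {x R : ℝ} (hR : 1 ≤ R) (hx : |x| ≤ R) :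
    |S.I j k x| ≤ invarConst K γ R * (S.Q j k * coeffNorm (S.Z j k) ^ 2) := by
  have hγ := S.hγ
  have h1 := S.I_sub_le hk hR hx
  have hx' : ‖(x : ℂ)‖ ≤ R := by simpa using hx
  have h2 := norm_eval_le (S.natDegree_Z_le hk) hR hx'
  have h3 := coeffNorm_derivative_le (S.natDegree_Z_le hk)
  have hE := evalConst_nonneg (by linarith : 0 ≤ R) (by positivity : 0 ≤ 1 / γ) (2 * K)
  have hp := coeffNorm_nonneg (S.Z j k)
  have hr := resConst_nonneg S
  have hQ := S.one_le_Q j k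
  have hR0 : 0 ≤ R ^ (2 * K) := by positivity
  have h4 : |Real.sin (S.α k) / Real.sin (S.β j) * ‖(S.Z j k).eval (x : ℂ)‖ ^ 2| ≤
      S.Q j k * (R ^ (2 * K) * coeffNorm (S.Z j k)) ^ 2 := by
    rw [abs_mul, abs_div, abs_of_nonneg (sq_nonneg ‖(S.Z j k).eval (x : ℂ)‖)]
    refine mul_le_mul ?_ (pow_le_pow_left₀ (norm_nonneg _) h2 2) (by positivity) (S.Q_pos j k).le
    unfold Q; linarith
  have h5 : R ^ (2 * K) * evalConst R (1 / γ) (2 * K) * resConst γ *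
        (coeffNorm (S.Z j k) * coeffNorm (derivative (S.Z j k))) ≤
      S.Q j k * (R ^ (2 * K) * evalConst R (1 / γ) (2 * K) * resConst γ * (2 * K) *
        coeffNorm (S.Z j k) ^ 2) := by
    calc _ ≤ R ^ (2 * K) * evalConst R (1 / γ) (2 * K) * resConst γ *
        (coeffNorm (S.Z j k) * ((2 * K : ℕ) * coeffNorm (S.Z j k))) := by gcongr
      _ = 1 * (R ^ (2 * K) * evalConst R (1 / γ) (2 * K) * resConst γ * (2 * K) *
        coeffNorm (S.Z j k) ^ 2) := by push_cast; ring
      _ ≤ _ := by gcongr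
  have h6 := abs_sub_abs_le_abs_sub (S.I j k x)
    (Real.sin (S.α k) / Real.sin (S.β j) * ‖(S.Z j k).eval (x : ℂ)‖ ^ 2)
  unfold invarConst
  calc |S.I j k x| ≤ S.Q j k * (R ^ (2 * K) * coeffNorm (S.Z j k)) ^ 2 + S.Q j k *
        (R ^ (2 * K) * evalConst R (1 / γ) (2 * K) * resConst γ * (2 * K) *
        coeffNorm (S.Z j k) ^ 2) := by linarith
    _ = _ := by ring

/-- The diagonal contribution to the almost-invariant energies. -/
def diagEnergy (j : S.J) (x : ℝ) : ℝ :=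
  S.ω j ^ 2 * (‖(S.Z j (unitVec j)).eval (x : ℂ)‖ ^ 2 + ‖(S.Z j (-unitVec j)).eval (x : ℂ)‖ ^ 2)

/-- The products that bound the error of the diagonal contribution. -/
def diagErr (j : S.J) : ℝ :=
  S.ω j ^ 2 * (coeffNorm (S.Z j (unitVec j)) * coeffNorm (derivative (S.Z j (unitVec j))) +
    coeffNorm (S.Z j (-unitVec j)) * coeffNorm (derivative (S.Z j (-unitVec j))))

theorem abs_combine_le {a b x y p q c w : ℝ} (hw : 0 ≤ w) (h1 : |a - x| ≤ c * p)
    (h2 : |b + y| ≤ c * q) : |w * a - w * b - w * (x + y)| ≤ w * (c * (p + q)) := by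
  have e : w * a - w * b - w * (x + y) = w * ((a - x) - (b + y)) := by ring
  rw [e, abs_mul, abs_of_nonneg hw]
  refine mul_le_mul_of_nonneg_left ((abs_sub _ _).trans ?_) hw
  linarith

/-- For `k = ±⟨j⟩` the quotient `sin α / sin β` is `±1`, with the same sign as the coefficient of
the term, so both diagonal contributions enter positively. -/
theorem I_diag_sub_le (j : S.J) {x R : ℝ} (hR : 1 ≤ R) (hx : |x| ≤ R) :
    |S.ω j ^ 2 * S.I j (unitVec j) x - S.ω j ^ 2 * S.I j (-unitVec j) x - S.diagEnergy j x| ≤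
      invarConst K γ R * S.diagErr j := by
  have hγ := S.hγ
  have hd₁ : IsDiag j (unitVec j) := Or.inl rfl
  have hd₂ : IsDiag j (-unitVec j) := Or.inr rfl
  have hsin : Real.sin (S.β j) ≠ 0 := abs_pos.1 (S.sin_β_pos j)
  have hle : R ^ (2 * K) * evalConst R (1 / γ) (2 * K) * resConst γ ≤ invarConst K γ R := by
    have hE := evalConst_nonneg (by linarith : 0 ≤ R) (by positivity : 0 ≤ 1 / γ) (2 * K)
    have hr := resConst_nonneg S
    have hK : (1 : ℝ) ≤ 2 * K := by
      have := S.hK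
      exact_mod_cast (by omega : 1 ≤ 2 * K)
    have h3 : 0 ≤ R ^ (2 * K) * evalConst R (1 / γ) (2 * K) * resConst γ := by positivity
    have h4 : 0 ≤ R ^ (2 * K) * R ^ (2 * K) := by positivity
    unfold invarConst
    nlinarith
  have h1 := (S.I_sub_le (hd₁.mem S.hK) hR hx).trans (mul_le_mul_of_nonneg_right hle
    (mul_nonneg (coeffNorm_nonneg _) (coeffNorm_nonneg _)))
  have h2 := (S.I_sub_le (hd₂.mem S.hK) hR hx).trans (mul_le_mul_of_nonneg_right hle
    (mul_nonneg (coeffNorm_nonneg _) (coeffNorm_nonneg _)))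
  rw [S.α_unitVec, div_self hsin, one_mul] at h1
  rw [S.α_neg, S.α_unitVec, Real.sin_neg, neg_div, div_self hsin, neg_mul, one_mul,
    sub_neg_eq_add] at h2
  exact (abs_combine_le (sq_nonneg (S.ω j)) h1 h2).trans_eq (mul_left_comm _ _ _)

/-- The vectors `±⟨j⟩` contribute only to the energy with `l = |j|`, with coefficient `±ω_j²`; every
other vector is part of the error. -/
theorem almostInv_sub_le (l : Fin (S.M + 1)) {t R : ℝ} (hR : 1 ≤ R)
    (hx : |S.ε ^ (ν / 2) * t| ≤ R) :
    ‖almostInv K ρ S.τ S.ε ν S.z l t - ((1 / 2 * ∑ j : S.J, (if idx j = l then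
      S.diagEnergy j (S.ε ^ (ν / 2) * t) else 0) : ℝ) : ℂ)‖ ≤
      1 / 2 * (invarConst K γ R * ∑ j : S.J, ((if idx j = l then S.diagErr j else 0) +
        ∑ k ∈ S.off j, |(k l : ℝ)| * freq ρ l *
          (S.ω j * (S.Q j k * coeffNorm (S.Z j k) ^ 2)))) := by
  set x := S.ε ^ (ν / 2) * t
  rw [S.almostInv_eq, ← Complex.ofReal_sub, Complex.norm_real, Real.norm_eq_abs, ← mul_sub,
    abs_mul, abs_of_pos (by norm_num : (0 : ℝ) < 1 / 2), ← Finset.sum_sub_distrib]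
  refine mul_le_mul_of_nonneg_left ?_ (by norm_num)
  rw [Finset.mul_sum]
  refine (Finset.abs_sum_le_sum_abs _ _).trans (Finset.sum_le_sum fun j _ => ?_)
  rw [S.sum_setK_eq, add_sub_right_comm, mul_add]
  refine (abs_add_le _ _).trans (add_le_add ?_ ?_)
  · by_cases h : idx j = l
    · rw [if_pos h, if_pos h]
      have e1 : (unitVec j : S.V) l = 1 := by unfold unitVec; rw [if_pos h.symm]
      have e2 : freq ρ l = S.ω j := by unfold ω; rw [h]
      refine le_trans (le_of_eq (congrArg abs ?_)) (S.I_diag_sub_le j hR hx)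
      rw [Pi.neg_apply, e1, e2]
      generalize S.I j (unitVec j) x = a
      generalize S.I j (-unitVec j) x = b
      push_cast
      ring
    · rw [if_neg h, if_neg h]
      have e1 : (unitVec j : S.V) l = 0 := by unfold unitVec; rw [if_neg (Ne.symm h)]
      simp [e1]
  · rw [Finset.mul_sum]
    refine (Finset.abs_sum_le_sum_abs _ _).trans (Finset.sum_le_sum fun k hk => ?_)
    have h1 := S.I_le (S.mem_off.1 hk).1 hR hx
    have hω := S.ω_pos j
    have hf := freq_pos S.hρ (l : ℕ)
    rw [abs_mul, abs_mul, abs_mul, abs_of_pos hω, abs_of_pos hf]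
    calc _ ≤ |(k l : ℝ)| * freq ρ l * S.ω j *
          (invarConst K γ R * (S.Q j k * coeffNorm (S.Z j k) ^ 2)) :=
          mul_le_mul_of_nonneg_left h1 (by positivity)
      _ = _ := by ring

end Setting

end TrigInt

namespace TrigInt
open Polynomial

theorem sum_mul_ite_idx {M : ℕ} [NeZero M] (j : ZMod (2 * M)) (g : ℕ → ℝ) (a : ℝ) :
    ∑ l : Fin (M + 1), g l * (if idx j = l then a else 0) = g (idx j) * a := by
  rw [Finset.sum_eq_single (⟨idx j, Nat.lt_succ_of_le (idx_le j)⟩ : Fin (M + 1))]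
  · simp
  · intro l _ hl
    rw [if_neg fun h => hl (Fin.ext h.symm), mul_zero]
  · simp

theorem sum_sq_le_sq_sum {α : Type*} (t : Finset α) {f : α → ℝ} (hf : ∀ i ∈ t, 0 ≤ f i) :
    ∑ i ∈ t, f i ^ 2 ≤ (∑ i ∈ t, f i) ^ 2 := by
  rw [sq, Finset.sum_mul]
  refine Finset.sum_le_sum fun i hi => ?_
  rw [sq]
  exact mul_le_mul_of_nonneg_left (Finset.single_le_sum hf hi) (hf i hi)

namespace Setting

variable {K : ℕ} {ν s γ ρ B : ℝ} (S : Setting K ν s γ ρ B)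

/-! ### Comparison of the almost-invariant energies with the diagonal contributions -/

theorem ε_neg_eq (n : ℕ) : S.ε ^ (-(n : ℝ)) = S.δ ^ (-(2 * n : ℝ)) := by
  rw [S.ε_rpow]; congr 1; ring

theorem ε_neg_pos (n : ℕ) : 0 < S.ε ^ (-(n : ℝ)) := Real.rpow_pos_of_pos S.hε _

theorem ε_neg_mul_δ (n : ℕ) (x : ℝ) : S.ε ^ (-(n : ℝ)) * S.δ ^ (2 * (n : ℝ) + x) = S.δ ^ x := by
  rw [S.ε_neg_eq, ← Real.rpow_add S.δ_pos]; congr 1; ring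

theorem ω_coeffNorm_Z_diag_le {j : S.J} {k : S.V} (hd : IsDiag j k) :
    S.ω j * coeffNorm (S.Z j k) ≤ S.δ ^ (S.e j : ℝ) * S.Ytot j := by
  have h1 := S.Z_le (hd.mem S.hK)
  have ho : S.o j k = S.e j := hd.order_eq
  rw [ho] at h1
  refine le_trans ?_ (h1.trans (mul_le_mul_of_nonneg_left (S.N_le_Ytot (hd.mem S.hK))
    (Real.rpow_pos_of_pos S.δ_pos _).le))
  rw [mul_assoc]
  exact mul_le_mul_of_nonneg_left (le_mul_of_one_le_left (coeffNorm_nonneg _) (S.one_le_Q j k))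
    (S.ω_pos j).le

theorem diagErr_le (j : S.J) :
    S.ε ^ (-(S.e j : ℝ)) * S.diagErr j ≤ 4 * K * S.δ ^ (1 - 2 * ν) * S.Ytot j ^ 2 := by
  have hK : (0 : ℝ) ≤ K := Nat.cast_nonneg K
  have key : ∀ k : S.V, IsDiag j k → S.ω j ^ 2 * (coeffNorm (S.Z j k) *
      coeffNorm (derivative (S.Z j k))) ≤
      2 * K * (S.δ ^ (2 * (S.e j : ℝ) + (1 - 2 * ν)) * S.Ytot j ^ 2) := by
    intro k hd
    have h1 := S.ω_coeffNorm_Z_diag_le hd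
    have h2 := (S.derivative_Z_diag_le hd).trans (mul_le_mul_of_nonneg_left
      (mul_le_mul_of_nonneg_left (S.N_le_Ytot (hd.mem S.hK))
        (Real.rpow_pos_of_pos S.δ_pos _).le) (by positivity))
    have h3 := mul_le_mul h1 h2 (mul_nonneg (S.ω_pos j).le (coeffNorm_nonneg _))
      (mul_nonneg (Real.rpow_pos_of_pos S.δ_pos _).le (S.Ytot_nonneg j))
    have h4 : S.δ ^ (S.e j : ℝ) * S.δ ^ ((S.e j : ℝ) + (1 - 2 * ν)) =
        S.δ ^ (2 * (S.e j : ℝ) + (1 - 2 * ν)) := by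
      rw [← Real.rpow_add S.δ_pos]; congr 1; ring
    rw [← h4]
    generalize S.δ ^ (S.e j : ℝ) = a at *
    generalize S.δ ^ ((S.e j : ℝ) + (1 - 2 * ν)) = b at *
    calc _ = S.ω j * coeffNorm (S.Z j k) * (S.ω j * coeffNorm (derivative (S.Z j k))) := by ring
      _ ≤ _ := h3
      _ = _ := by ring
  have h1 := key _ (Or.inl rfl)
  have h2 := key _ (Or.inr rfl)
  have h3 : S.diagErr j ≤ 4 * K * (S.δ ^ (2 * (S.e j : ℝ) + (1 - 2 * ν)) * S.Ytot j ^ 2) := by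
    unfold diagErr
    rw [mul_add]
    exact (add_le_add h1 h2).trans_eq (by ring)
  refine (mul_le_mul_of_nonneg_left h3 (S.ε_neg_pos _).le).trans_eq ?_
  rw [← S.ε_neg_mul_δ (S.e j) (1 - 2 * ν)]
  ring

/-- The expression is quadratic in `Z`, so the square of `Z_off_le` cancels `ε^(-e(l)) = δ^(-2e(l))`
and leaves a factor `δ^(2(1-2ν))`, of which a single `δ^(1-2ν)` is kept. -/
theorem off_term_le {j : S.J} {k : S.V} (hk : k ∈ S.off j) (l : Fin (S.M + 1)) :
    S.ε ^ (-(profile K l : ℝ)) * (|(k l : ℝ)| * freq ρ l *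
      (S.ω j * (S.Q j k * coeffNorm (S.Z j k) ^ 2))) ≤
      |(k l : ℝ)| * freq ρ l * (S.δ ^ (1 - 2 * ν) * S.N j k ^ 2 / S.ω j) := by
  have hω := S.ω_pos j
  have hf := freq_pos S.hρ (l : ℕ)
  by_cases hl : k l = 0
  · simp [hl]
  have h1 := S.Z_off_le hk hl
  have hQ := S.one_le_Q j k
  have hp := coeffNorm_nonneg (S.Z j k)
  have h2 := pow_le_pow_left₀ (mul_nonneg (mul_pos hω (S.Q_pos j k)).le hp) h1 2
  have h3 : (S.δ ^ ((profile K l : ℝ) + (1 - 2 * ν))) ^ 2 ≤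
      S.δ ^ (2 * (profile K l : ℝ) + (1 - 2 * ν)) := by
    rw [← Real.rpow_natCast, ← Real.rpow_mul S.δ_pos.le]
    refine S.δ_rpow_anti ?_
    push_cast
    linarith [S.θ_pos]
  have h4 : S.ω j * (S.Q j k * coeffNorm (S.Z j k) ^ 2) ≤
      S.δ ^ (2 * (profile K l : ℝ) + (1 - 2 * ν)) * S.N j k ^ 2 / S.ω j := by
    rw [le_div_iff₀ hω]
    calc _ = S.ω j ^ 2 * (S.Q j k * 1) * coeffNorm (S.Z j k) ^ 2 := by ring
      _ ≤ S.ω j ^ 2 * (S.Q j k * S.Q j k) * coeffNorm (S.Z j k) ^ 2 := by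
        have := S.Q_pos j k
        gcongr
      _ = (S.ω j * S.Q j k * coeffNorm (S.Z j k)) ^ 2 := by ring
      _ ≤ _ := h2
      _ = (S.δ ^ ((profile K l : ℝ) + (1 - 2 * ν))) ^ 2 * S.N j k ^ 2 := by ring
      _ ≤ _ := mul_le_mul_of_nonneg_right h3 (sq_nonneg _)
  rw [← S.ε_neg_mul_δ (profile K l) (1 - 2 * ν)]
  calc _ ≤ S.ε ^ (-(profile K l : ℝ)) * (|(k l : ℝ)| * freq ρ l *
        (S.δ ^ (2 * (profile K l : ℝ) + (1 - 2 * ν)) * S.N j k ^ 2 / S.ω j)) :=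
        mul_le_mul_of_nonneg_left (mul_le_mul_of_nonneg_left h4 (by positivity))
          (S.ε_neg_pos _).le
    _ = _ := by ring

/-- The constant in the bound of the non-diagonal contributions. -/
def invarErrConst (K : ℕ) (s γ ρ R : ℝ) : ℝ :=
  1 / 2 * (invarConst K γ R * (4 * K + couplingConst K s ρ))

/-- The sum over `l` is carried out first, for fixed `(j,k)`: `sum_weight_freq_le` converts the
weights at `l` into the weight at `j`. The dependence on the crude bound is multiplied by
`δ^(1-2ν)`. -/
theorem sum_almostInv_sub_le {t R : ℝ} (hR : 1 ≤ R) (hx : |S.ε ^ (ν / 2) * t| ≤ R) :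
    ∑ l : Fin (S.M + 1), weight s l * S.ε ^ (-(profile K l : ℝ)) *
      ‖almostInv K ρ S.τ S.ε ν S.z l t - ((1 / 2 * ∑ j : S.J, (if idx j = l then
        S.diagEnergy j (S.ε ^ (ν / 2) * t) else 0) : ℝ) : ℂ)‖ ≤
      invarErrConst K s γ ρ R * (S.δ ^ (1 - 2 * ν) * wnorm s S.Ytot ^ 2) := by
  have hC := invarConst_nonneg S hR
  have hs : 0 ≤ s := by linarith [S.hs]
  have hc := couplingConst_nonneg K (s := s) S.hρ
  have hδ := (Real.rpow_pos_of_pos S.δ_pos (1 - 2 * ν)).le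
  have h1 : ∀ j : S.J, ∑ l : Fin (S.M + 1), weight s l * S.ε ^ (-(profile K l : ℝ)) *
      ((if idx j = l then S.diagErr j else 0) + ∑ k ∈ S.off j, |(k l : ℝ)| * freq ρ l *
          (S.ω j * (S.Q j k * coeffNorm (S.Z j k) ^ 2))) ≤
      (4 * K + couplingConst K s ρ) * (S.δ ^ (1 - 2 * ν) *
        (weight s (idx j) * S.Ytot j ^ 2)) := by
    intro j
    have hω := S.ω_pos j
    simp only [mul_add, Finset.sum_add_distrib]
    rw [add_mul]
    refine add_le_add ?_ ?_
    · rw [sum_mul_ite_idx j (fun l => weight s l * S.ε ^ (-(profile K l : ℝ))), mul_assoc]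
      refine (mul_le_mul_of_nonneg_left (S.diagErr_le j) (weight_pos s _).le).trans_eq ?_
      ring
    · simp only [Finset.mul_sum]
      rw [Finset.sum_comm]
      have h2 : ∀ k ∈ S.off j, ∑ l : Fin (S.M + 1), weight s l * S.ε ^ (-(profile K l : ℝ)) *
          (|(k l : ℝ)| * freq ρ l * (S.ω j * (S.Q j k * coeffNorm (S.Z j k) ^ 2))) ≤
          couplingConst K s ρ * (S.δ ^ (1 - 2 * ν) * (weight s (idx j) * S.N j k ^ 2)) := by
        intro k hk
        have h3 : ∀ l : Fin (S.M + 1), weight s l * S.ε ^ (-(profile K l : ℝ)) *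
            (|(k l : ℝ)| * freq ρ l * (S.ω j * (S.Q j k * coeffNorm (S.Z j k) ^ 2))) ≤
            (|(k l : ℝ)| * (freq ρ l * weight s l)) *
              (S.δ ^ (1 - 2 * ν) * S.N j k ^ 2 / S.ω j) := by
          intro l
          rw [mul_assoc]
          refine (mul_le_mul_of_nonneg_left (S.off_term_le hk l) (weight_pos s _).le).trans_eq ?_
          ring
        refine (Finset.sum_le_sum fun l _ => h3 l).trans ?_
        rw [← Finset.sum_mul]
        refine (mul_le_mul_of_nonneg_right (sum_weight_freq_le S.hK hs S.hρ
          (S.mem_off.1 hk).1) (by positivity)).trans_eq ?_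
        change _ * (S.ω j * _) * _ = _
        field_simp
      refine (Finset.sum_le_sum h2).trans ?_
      rw [← Finset.mul_sum, ← Finset.mul_sum, ← Finset.mul_sum]
      refine mul_le_mul_of_nonneg_left (mul_le_mul_of_nonneg_left (mul_le_mul_of_nonneg_left ?_
        (weight_pos s _).le) hδ) hc
      refine (sum_sq_le_sq_sum _ fun k _ => S.N_nonneg j k).trans
        (pow_le_pow_left₀ (Finset.sum_nonneg fun k _ => S.N_nonneg j k) ?_ 2)
      exact Finset.sum_le_sum_of_subset_of_nonneg (fun k hk => (S.mem_off.1 hk).1)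
        fun k _ _ => S.N_nonneg j k
  have h4 : ∀ l : Fin (S.M + 1), weight s l * S.ε ^ (-(profile K l : ℝ)) *
      ‖almostInv K ρ S.τ S.ε ν S.z l t - ((1 / 2 * ∑ j : S.J, (if idx j = l then
        S.diagEnergy j (S.ε ^ (ν / 2) * t) else 0) : ℝ) : ℂ)‖ ≤
      1 / 2 * invarConst K γ R * ∑ j : S.J, weight s l * S.ε ^ (-(profile K l : ℝ)) *
      ((if idx j = l then S.diagErr j else 0) + ∑ k ∈ S.off j, |(k l : ℝ)| * freq ρ l *
          (S.ω j * (S.Q j k * coeffNorm (S.Z j k) ^ 2))) := by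
    intro l
    refine (mul_le_mul_of_nonneg_left (S.almostInv_sub_le l hR hx)
      (mul_pos (weight_pos s _) (S.ε_neg_pos _)).le).trans_eq ?_
    rw [← Finset.mul_sum]
    ring
  refine (Finset.sum_le_sum fun l _ => h4 l).trans ?_
  rw [← Finset.mul_sum, Finset.sum_comm]
  refine (mul_le_mul_of_nonneg_left (Finset.sum_le_sum fun j _ => h1 j) (by positivity)).trans_eq ?_
  rw [← Finset.mul_sum, ← Finset.mul_sum, ← wnorm_sq]
  unfold invarErrConst
  ring

/-- The diagonal modulation functions at time `0`. -/
def diagVal (j : S.J) : ℝ := S.δ ^ (-(S.e j : ℝ)) *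
  (S.ω j * (‖(S.Z j (unitVec j)).eval 0‖ + ‖(S.Z j (-unitVec j)).eval 0‖))

/-- This is the step that exchanges `C₀` for `𝒞₀`. The `4` combines `(a + b)² ≤ 2 (a² + b²)` with
the factor `1/2` in the almost-invariant energies. -/
theorem wnorm_diagVal_sq_le {A₀ E : ℝ}
    (h : ∑ l : Fin (S.M + 1), weight s l * S.ε ^ (-(profile K l : ℝ)) *
          ‖almostInv K ρ S.τ S.ε ν S.z l 0‖ ≤ A₀)
    (hE : invarErrConst K s γ ρ 1 * (S.δ ^ (1 - 2 * ν) * wnorm s S.Ytot ^ 2) ≤ E) :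
    wnorm s S.diagVal ^ 2 ≤ 4 * (A₀ + E) := by
  have h1 := (S.sum_almostInv_sub_le (t := 0) le_rfl (by simp)).trans hE
  rw [mul_zero] at h1
  have h2 : ∀ l : Fin (S.M + 1), weight s l * S.ε ^ (-(profile K l : ℝ)) *
      (1 / 2 * ∑ j : S.J, (if idx j = l then S.diagEnergy j 0 else 0)) ≤
      weight s l * S.ε ^ (-(profile K l : ℝ)) * ‖almostInv K ρ S.τ S.ε ν S.z l 0‖ +
      weight s l * S.ε ^ (-(profile K l : ℝ)) * ‖almostInv K ρ S.τ S.ε ν S.z l 0 -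
        ((1 / 2 * ∑ j : S.J, (if idx j = l then S.diagEnergy j 0 else 0) : ℝ) : ℂ)‖ := by
    intro l
    rw [← mul_add]
    refine mul_le_mul_of_nonneg_left ?_ (mul_pos (weight_pos s _) (S.ε_neg_pos _)).le
    generalize 1 / 2 * ∑ j : S.J, (if idx j = l then S.diagEnergy j 0 else 0) = d
    generalize almostInv K ρ S.τ S.ε ν S.z l 0 = a
    have := norm_sub_norm_le (d : ℂ) a
    rw [Complex.norm_real, norm_sub_rev] at this
    linarith [Real.le_norm_self d]
  have h3 := Finset.sum_le_sum fun l (_ : l ∈ Finset.univ) => h2 l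
  rw [Finset.sum_add_distrib] at h3
  have h4 : ∑ l : Fin (S.M + 1), weight s l * S.ε ^ (-(profile K l : ℝ)) *
      (1 / 2 * ∑ j : S.J, (if idx j = l then S.diagEnergy j 0 else 0)) =
      1 / 2 * ∑ j : S.J, weight s (idx j) * S.ε ^ (-(S.e j : ℝ)) * S.diagEnergy j 0 := by
    have h5 : ∀ j : S.J, weight s (idx j) * S.ε ^ (-(S.e j : ℝ)) * S.diagEnergy j 0 =
        ∑ l : Fin (S.M + 1), weight s l * S.ε ^ (-(profile K l : ℝ)) *
          (if idx j = l then S.diagEnergy j 0 else 0) := fun j =>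
      (sum_mul_ite_idx j (fun l => weight s l * S.ε ^ (-(profile K l : ℝ))) _).symm
    rw [Finset.sum_congr rfl fun j _ => h5 j, Finset.sum_comm, Finset.mul_sum]
    refine Finset.sum_congr rfl fun l _ => ?_
    rw [← Finset.mul_sum]
    ring
  rw [h4] at h3
  have h6 : wnorm s S.diagVal ^ 2 ≤
      2 * ∑ j : S.J, weight s (idx j) * S.ε ^ (-(S.e j : ℝ)) * S.diagEnergy j 0 := by
    rw [wnorm_sq, Finset.mul_sum]
    refine Finset.sum_le_sum fun j _ => ?_
    rw [diagVal, mul_pow, S.δ_neg_sq, diagEnergy, Complex.ofReal_zero]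
    generalize ‖(S.Z j (unitVec j)).eval 0‖ = a
    generalize ‖(S.Z j (-unitVec j)).eval 0‖ = b
    have h7 : 0 ≤ weight s (idx j) * S.ε ^ (-(S.e j : ℝ)) * S.ω j ^ 2 :=
      mul_nonneg (mul_pos (weight_pos s _) (S.ε_neg_pos _)).le (sq_nonneg _)
    nlinarith [mul_nonneg h7 (sq_nonneg (a - b))]
  linarith

end Setting

end TrigInt

namespace TrigInt
open Polynomial

namespace Setting

variable {K : ℕ} {ν s γ ρ B : ℝ} (S : Setting K ν s γ ρ B)

/-! ### The leading coefficient functions -/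

/-- The leading coefficient functions of order `m`. -/
def lead (m : ℕ) (j : S.J) (k : S.V) : ℝ := if S.o j k = m then S.ny j k m else 0

theorem lead_nonneg (m : ℕ) (j : S.J) (k : S.V) : 0 ≤ S.lead m j k := by
  unfold lead; split_ifs
  exacts [S.ny_nonneg _ _ _, le_rfl]

/-- The sum of the leading coefficient functions of order `m`. -/
def Lead (m : ℕ) (j : S.J) : ℝ := ∑ k ∈ setK K j, S.lead m j k

theorem Lead_nonneg (m : ℕ) (j : S.J) : 0 ≤ S.Lead m j :=
  Finset.sum_nonneg fun _ _ => S.lead_nonneg _ _ _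

theorem Lead_zero (j : S.J) : S.Lead 0 j = 0 := by
  refine Finset.sum_eq_zero fun k _ => ?_
  have : S.o j k ≠ 0 := Nat.pos_iff_ne_zero.1 (order_pos S.hK j k)
  rw [lead, if_neg this]

/-- If `m(j,k) = m`, then `m ≤ m(j₁,k₁) + m(j₂,k₂) ≤ m₁ + m₂ = m` for every nonzero product, so
equality holds throughout. Leading functions are fed by leading functions alone, and the recursion
closes without the crude bound. -/
theorem sum_lead_off_le (m : ℕ) (hm : m < 2 * K) (j : S.J) :
    ∑ k ∈ S.off j, S.lead m j k ≤ solveConst K γ B * (B ^ 2 / ρ) *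
      ∑ p ∈ Finset.HasAntidiagonal.antidiagonal m, ∑ j₁ : S.J,
        S.Lead p.1 j₁ * S.Lead p.2 (j - j₁) := by
  classical
  have hρ : 0 < √ρ := Real.sqrt_pos.2 S.hρ
  have hs := solveConst_nonneg S
  have h1 : ∑ k ∈ S.off j, S.lead m j k =
      ∑ k ∈ (S.off j).filter (fun k => S.o j k = m), S.ny j k m := by
    rw [Finset.sum_filter]; rfl
  have h2 : ∑ k ∈ (S.off j).filter (fun k => S.o j k = m), S.ny j k m ≤
      solveConst K γ B * ∑ k ∈ (S.off j).filter (fun k => S.o j k = m), S.G j k m := by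
    rw [Finset.mul_sum]
    exact Finset.sum_le_sum fun k hk => S.ny_off_le (Finset.mem_filter.1 hk).1 hm
  rw [h1, mul_assoc]
  refine h2.trans (mul_le_mul_of_nonneg_left ?_ hs)
  refine (S.sum_G_le (a := fun j k m => 1 / √ρ * S.lead m j k)
    (fun j k m => mul_nonneg (by positivity) (S.lead_nonneg m j k)) ?_).trans (le_of_eq ?_)
  · intro j₁ k₁ hk₁ k₂ hk₂ hT m₁ m₂ hm₁₂
    have ho : S.o j (k₁ + k₂) = m := (Finset.mem_filter.1 hT).2
    have h3 : S.o j (k₁ + k₂) ≤ S.o j₁ k₁ + S.o (j - j₁) k₂ := order_add_le S.hK rfl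
    have hr : 0 ≤ S.amp j₁ k₁ m₁ * S.amp (j - j₁) k₂ m₂ *
        (1 / √ρ * S.lead m₁ j₁ k₁ * (1 / √ρ * S.lead m₂ (j - j₁) k₂)) :=
      mul_nonneg (mul_pos (S.amp_pos _ _ _) (S.amp_pos _ _ _)).le
        (mul_nonneg (mul_nonneg (by positivity) (S.lead_nonneg _ _ _))
          (mul_nonneg (by positivity) (S.lead_nonneg _ _ _)))
    rcases lt_or_ge m₁ (S.o j₁ k₁) with h4 | h4
    · rw [S.y_eq_zero hk₁ h4, coeffNorm_zero, zero_mul]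
      exact hr
    rcases lt_or_ge m₂ (S.o (j - j₁) k₂) with h5 | h5
    · rw [S.y_eq_zero hk₂ h5, coeffNorm_zero, mul_zero]
      exact hr
    have e1 : S.lead m₁ j₁ k₁ = S.ny j₁ k₁ m₁ := by rw [lead, if_pos (by omega)]
    have e2 : S.lead m₂ (j - j₁) k₂ = S.ny (j - j₁) k₂ m₂ := by rw [lead, if_pos (by omega)]
    rw [e1, e2]
    refine (mul_le_mul (S.coeffNorm_y_le j₁ k₁ m₁) (S.coeffNorm_y_le (j - j₁) k₂ m₂)
      (coeffNorm_nonneg _) (mul_nonneg (S.amp_pos _ _ _).le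
        (mul_nonneg (by positivity) (S.ny_nonneg _ _ _)))).trans_eq ?_
    ring
  · have h2 : (1 / √ρ) * (1 / √ρ) = 1 / ρ := by
      rw [div_mul_div_comm, one_mul, Real.mul_self_sqrt S.hρ.le]
    simp only [← Finset.mul_sum]
    change B ^ 2 * ∑ p ∈ Finset.HasAntidiagonal.antidiagonal m, ∑ j₁ : S.J,
      (1 / √ρ * S.Lead p.1 j₁) * (1 / √ρ * S.Lead p.2 (j - j₁)) = _
    have h3 : ∀ (p : ℕ × ℕ) (j₁ : S.J), (1 / √ρ * S.Lead p.1 j₁) * (1 / √ρ * S.Lead p.2 (j - j₁)) =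
        1 / ρ * (S.Lead p.1 j₁ * S.Lead p.2 (j - j₁)) := by
      intro p j₁; rw [← h2]; ring
    simp only [h3, ← Finset.mul_sum]
    ring

theorem ω_norm_y_le (j : S.J) (k : S.V) (hk : k ∈ setK K j) {m : ℕ} (hm : m < 2 * K) :
    S.ω j * ‖(S.y j k m).eval 0‖ ≤ S.amp j k m * S.ny j k m := by
  have h2 := norm_eval_le (S.natDegree_y_le' hk hm) (x := 0) (R := 1) le_rfl (by simp)
  rw [one_pow, one_mul] at h2
  rw [← S.ω_mul_coeffNorm_le, mul_assoc]
  exact mul_le_mul_of_nonneg_left (h2.trans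
    (le_mul_of_one_le_left (coeffNorm_nonneg _) (S.one_le_Q j k))) (S.ω_pos j).le

/-- The leading diagonal function is constant, and equals the full modulation function at `0` minus
higher orders, which are smaller by `δ^(1-2ν)`. The factor `2` is the value of `Q` on the diagonal.
-/
theorem lead_diag_le {j : S.J} {k : S.V} (hd : IsDiag j k) (m : ℕ) :
    S.lead m j k ≤ 2 * (S.δ ^ (-(S.e j : ℝ)) * (S.ω j * ‖(S.Z j k).eval 0‖)) +
      2 * (S.δ ^ (1 - 2 * ν) * S.N j k) := by
  have hδ : ∀ x : ℝ, 0 < S.δ ^ x := fun x => Real.rpow_pos_of_pos S.δ_pos _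
  have hr : 0 ≤ 2 * (S.δ ^ (-(S.e j : ℝ)) * (S.ω j * ‖(S.Z j k).eval 0‖)) +
      2 * (S.δ ^ (1 - 2 * ν) * S.N j k) :=
    add_nonneg (mul_nonneg zero_le_two (mul_nonneg (hδ _).le (mul_nonneg (S.ω_pos j).le
      (norm_nonneg _)))) (mul_nonneg zero_le_two (mul_nonneg (hδ _).le (S.N_nonneg j k)))
  have ho : S.o j k = S.e j := hd.order_eq
  have hk := hd.mem S.hK
  unfold lead
  split_ifs with h
  swap
  · exact hr
  have hme : m = S.e j := by omega
  subst hme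
  have heK : S.e j < 2 * K := (S.e_le j).trans_lt S.K_lt
  have hcoeff : coeffNorm (S.y j k (S.e j)) ≤ ‖(S.y j k (S.e j)).eval 0‖ := by
    refine (coeffNorm_le_eval_zero_add _).trans_eq ?_
    rw [S.derivative_y_diag_of_le hd le_rfl, coeffNorm_zero, add_zero]
  have hZ : (S.y j k (S.e j)).eval 0 = (S.Z j k).eval 0 -
      ∑ m ∈ (Finset.range (2 * K)).erase (S.e j), (S.y j k m).eval 0 := by
    unfold Z
    rw [eval_finsetSum, ← Finset.add_sum_erase _ _ (Finset.mem_range.2 heK)]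
    ring
  have hamp : S.amp j k (S.e j) = S.δ ^ (S.e j : ℝ) := by
    unfold amp; rw [ho]; congr 1; ring
  have hrest : S.ω j * ‖∑ m ∈ (Finset.range (2 * K)).erase (S.e j), (S.y j k m).eval 0‖ ≤
      S.δ ^ ((S.e j : ℝ) + (1 - 2 * ν)) * S.N j k := by
    refine (mul_le_mul_of_nonneg_left (norm_sum_le _ _) (S.ω_pos j).le).trans ?_
    unfold N
    rw [Finset.mul_sum, Finset.mul_sum]
    refine le_trans ?_ (Finset.sum_le_sum_of_subset_of_nonneg (Finset.erase_subset (S.e j) _)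
      fun m _ _ => mul_nonneg (hδ _).le (S.ny_nonneg j k m))
    refine Finset.sum_le_sum fun m hm => ?_
    rw [Finset.mem_erase, Finset.mem_range] at hm
    rcases lt_or_ge m (S.o j k) with h1 | h1
    · rw [S.y_eq_zero hk h1, eval_zero, norm_zero, mul_zero]
      exact mul_nonneg (hδ _).le (S.ny_nonneg j k m)
    · refine (S.ω_norm_y_le j k hk hm.2).trans
        (mul_le_mul_of_nonneg_right ?_ (S.ny_nonneg j k m))
      refine (S.amp_le (r := 1) (by omega)).trans_eq ?_
      rw [ho]; simp
  have h1 : S.ω j * ‖(S.y j k (S.e j)).eval 0‖ ≤ S.ω j * ‖(S.Z j k).eval 0‖ +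
      S.δ ^ ((S.e j : ℝ) + (1 - 2 * ν)) * S.N j k := by
    rw [hZ]
    refine (mul_le_mul_of_nonneg_left (norm_sub_le _ _) (S.ω_pos j).le).trans ?_
    rw [mul_add]
    exact add_le_add le_rfl hrest
  have h2 : S.ny j k (S.e j) = 2 * (S.δ ^ (-(S.e j : ℝ)) *
      (S.ω j * coeffNorm (S.y j k (S.e j)))) := by
    rw [ny, S.Q_diag hd, hamp, Real.rpow_neg S.δ_pos.le]
    ring
  rw [h2, ← mul_add]
  refine mul_le_mul_of_nonneg_left ?_ zero_le_two
  refine (mul_le_mul_of_nonneg_left ((mul_le_mul_of_nonneg_left hcoeff (S.ω_pos j).le).trans h1)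
    (hδ _).le).trans_eq ?_
  rw [mul_add, ← mul_assoc (S.δ ^ (-(S.e j : ℝ))) (S.δ ^ ((S.e j : ℝ) + (1 - 2 * ν))),
    ← Real.rpow_add S.δ_pos]
  congr 3
  ring_nf

theorem Lead_le {m : ℕ} (hm : m < 2 * K) (j : S.J) :
    S.Lead m j ≤ |solveConst K γ B * (B ^ 2 / ρ)| *
      ∑ p ∈ Finset.HasAntidiagonal.antidiagonal m, ∑ j₁ : S.J,
        S.Lead p.1 j₁ * S.Lead p.2 (j - j₁) +
      (2 * S.diagVal j + 2 * S.δ ^ (1 - 2 * ν) * S.Ytot j) := by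
  have h0 : 0 ≤ solveConst K γ B * (B ^ 2 / ρ) := by
    have h2 := solveConst_nonneg S
    have h3 := S.hρ
    positivity
  have h1 := S.sum_lead_off_le m hm j
  have h2 := S.lead_diag_le (Or.inl rfl : IsDiag j (unitVec j)) m
  have h3 := S.lead_diag_le (Or.inr rfl : IsDiag j (-unitVec j)) m
  have h4 : S.N j (unitVec j) + S.N j (-unitVec j) ≤ S.Ytot j := by
    unfold Ytot
    rw [S.sum_setK_eq]
    exact le_add_of_nonneg_right (Finset.sum_nonneg fun k _ => S.N_nonneg j k)
  have h5 := mul_le_mul_of_nonneg_left h4 (Real.rpow_pos_of_pos S.δ_pos (1 - 2 * ν)).le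
  rw [abs_of_nonneg h0, Lead, S.sum_setK_eq]
  unfold diagVal
  generalize S.lead m j (unitVec j) = a at *
  generalize S.lead m j (-unitVec j) = b at *
  generalize ‖(S.Z j (unitVec j)).eval 0‖ = c at *
  generalize ‖(S.Z j (-unitVec j)).eval 0‖ = d at *
  generalize S.N j (unitVec j) = n₁ at *
  generalize S.N j (-unitVec j) = n₂ at *
  linarith

/-- The bound of the leading coefficient functions. -/
theorem exists_wnorm_Lead_le (K : ℕ) (ν s γ ρ B D : ℝ) : ∃ C, 0 ≤ C ∧
    ∀ S : Setting K ν s γ ρ B, wnorm s S.diagVal ≤ D → S.δ ^ (1 - 2 * ν) * wnorm s S.Ytot ≤ 1 →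
      ∀ m < 2 * K, wnorm s (S.Lead m) ≤ C := by
  obtain ⟨C, hC, h⟩ := exists_wnorm_le_of_rec s (solveConst K γ B * (B ^ 2 / ρ)) (2 * D + 2) (2 * K)
  refine ⟨C, hC, fun S hS hY => h S.M S.hs S.Lead S.Lead_nonneg (funext S.Lead_zero)
    (fun j => 2 * S.diagVal j + 2 * S.δ ^ (1 - 2 * ν) * S.Ytot j) ?_ fun m hm j => S.Lead_le hm j⟩
  refine (wnorm_add_le s _ _).trans ?_
  have hδ := (Real.rpow_pos_of_pos S.δ_pos (1 - 2 * ν)).le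
  rw [wnorm_const_mul s zero_le_two, wnorm_const_mul s (by positivity)]
  linarith

end Setting

end TrigInt

namespace TrigInt
open Polynomial

theorem sum_range_antidiagonal (N : ℕ) (f : ℕ × ℕ → ℂ) :
    ∑ m ∈ Finset.range N, ∑ p ∈ Finset.HasAntidiagonal.antidiagonal m, f p =
      ∑ p ∈ Finset.range N ×ˢ Finset.range N with p.1 + p.2 < N, f p := by
  rw [Finset.sum_sigma']
  refine Finset.sum_bij' (fun x _ => x.2) (fun p _ => ⟨p.1 + p.2, p⟩) ?_ ?_ ?_ ?_ ?_
  · rintro ⟨m, p⟩ h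
    simp only [Finset.mem_sigma, Finset.mem_range, Finset.HasAntidiagonal.mem_antidiagonal] at h
    simp only [Finset.mem_filter, Finset.mem_product, Finset.mem_range]
    omega
  · intro p h
    simp only [Finset.mem_filter, Finset.mem_product, Finset.mem_range] at h
    simp only [Finset.mem_sigma, Finset.mem_range, Finset.HasAntidiagonal.mem_antidiagonal]
    exact ⟨h.2, trivial⟩
  · rintro ⟨m, p⟩ h
    simp only [Finset.mem_sigma, Finset.mem_range, Finset.HasAntidiagonal.mem_antidiagonal] at h
    obtain ⟨-, rfl⟩ := h
    rfl
  · intro p _; rfl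
  · intro p _; rfl

namespace Setting

variable {K : ℕ} {ν s γ ρ B : ℝ} (S : Setting K ν s γ ρ B)

/-! ### The modulated Fourier expansion -/

/-- The coefficient functions vanish outside of the pairs that are reached. -/
theorem y_support (m : ℕ) : ∀ (j : S.J) (k : S.V), k ∈ setK K j → m < 2 * K →
    S.y j k m ≠ 0 → Reached K j k m := by
  induction m using Nat.strong_induction_on with
  | _ m ih =>
  intro j k hk hm hy
  by_cases hd : IsDiag j k
  · refine reached_of_isDiag S.hK hd ?_
    by_contra h
    refine hy (S.y_eq_zero hk ?_)
    have : S.o j k = profile K (idx j) := hd.order_eq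
    omega
  by_contra hR
  refine hy ?_
  -- If both factors of a product were nonzero, they would be reached and so would `(j,k)`. For an
  -- unreached pair the right-hand side thus vanishes, and off the diagonal the solution does too.
  have hF : S.F j k m = 0 := by
    refine Finset.sum_eq_zero fun j₁ _ => Finset.sum_eq_zero fun k₁ hk₁ =>
      Finset.sum_eq_zero fun k₂ hk₂ => Finset.sum_eq_zero fun p hp => ?_
    rw [Finset.mem_filter] at hk₂
    have h2 : p.1 + p.2 = m := by simpa using hp
    by_cases h3 : S.y j₁ k₁ p.1 = 0
    · rw [S.fy_eq_zero h3, zero_mul]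
    by_cases h4 : S.y (j - j₁) k₂ p.2 = 0
    · rw [S.fy_eq_zero h4, mul_zero]
    exfalso
    have h5 : p.1 ≠ 0 := fun h => h3 (by rw [h]; exact S.y_zero hk₁)
    have h6 : p.2 ≠ 0 := fun h => h4 (by rw [h]; exact S.y_zero hk₂.1)
    have h7 := (ih p.1 (by omega) j₁ k₁ hk₁ (by omega) h3).add
      (ih p.2 (by omega) _ k₂ hk₂.1 (by omega) h4) (by omega)
    rw [add_sub_cancel, hk₂.2, h2] at h7
    exact hR h7
  have h1 := S.ny_off_eq_zero (S.mem_off.2 ⟨hk, hd⟩) hm hF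
  have h2 := S.coeffNorm_y_le j k m
  rw [h1, mul_zero, mul_zero] at h2
  exact coeffNorm_eq_zero h2

/-- The modulated Fourier expansion at time `nτ`. -/
def mfe (n : ℤ) (j : S.J) : ℂ := ∑ k ∈ setK K j,
  Complex.exp (Complex.I * ((S.α k * n : ℝ) : ℂ)) * (S.Z j k).eval ((n * S.h : ℝ) : ℂ)

/-- The nonlinearity in the modulation system, summed over all orders. -/
def trunc (n : ℤ) (j : S.J) : ℂ := ∑ k ∈ setK K j, Complex.exp (Complex.I * ((S.α k * n : ℝ) : ℂ)) *
  ∑ m ∈ Finset.range (2 * K), (S.F j k m).eval ((n * S.h : ℝ) : ℂ)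

theorem exp_α_add (k : S.V) (n : ℤ) : Complex.exp (Complex.I * ((S.α k * (n + 1 : ℤ) : ℝ) : ℂ)) =
    Complex.exp (Complex.I * ((S.α k * n : ℝ) : ℂ)) * Complex.exp (Complex.I * (S.α k : ℂ)) := by
  rw [← Complex.exp_add]; congr 1; push_cast; ring

theorem exp_α_sub (k : S.V) (n : ℤ) : Complex.exp (Complex.I * ((S.α k * (n - 1 : ℤ) : ℝ) : ℂ)) =
    Complex.exp (Complex.I * ((S.α k * n : ℝ) : ℂ)) * Complex.exp (-(Complex.I * (S.α k : ℂ))) := by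
  rw [← Complex.exp_add]; congr 1; push_cast; ring

theorem eval_Z_system {j : S.J} {k : S.V} (hk : k ∈ setK K j) (x : ℝ) :
    Complex.exp (Complex.I * (S.α k : ℂ)) * (S.Z j k).eval ((x + S.h : ℝ) : ℂ) -
      2 * (Real.cos (S.β j) : ℂ) * (S.Z j k).eval (x : ℂ) +
      Complex.exp (-(Complex.I * (S.α k : ℂ))) * (S.Z j k).eval ((x - S.h : ℝ) : ℂ) =
    (S.τ : ℂ) ^ 2 * (S.ψ (S.β j) : ℂ) *
      ∑ m ∈ Finset.range (2 * K), (S.F j k m).eval (x : ℂ) := by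
  have h1 : modOp (S.α k) (S.β j) S.h (S.Z j k) =
      ∑ m ∈ Finset.range (2 * K), C ((S.τ : ℂ) ^ 2 * (S.ψ (S.β j) : ℂ)) * S.F j k m := by
    unfold Z
    rw [map_sum]
    exact Finset.sum_congr rfl fun m hm => S.system hk (Finset.mem_range.1 hm)
  have h2 := congrArg (eval (x : ℂ)) h1
  rw [modOp, diffOp_eval, ← Finset.mul_sum, eval_mul, eval_C, eval_finsetSum] at h2
  rw [Complex.ofReal_add, Complex.ofReal_sub]
  exact h2

theorem mfe_system (n : ℤ) (j : S.J) :
    S.mfe (n + 1) j - 2 * (Real.cos (S.β j) : ℂ) * S.mfe n j + S.mfe (n - 1) j =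
      (S.τ : ℂ) ^ 2 * (S.ψ (S.β j) : ℂ) * S.trunc n j := by
  unfold mfe trunc
  rw [Finset.mul_sum, ← Finset.sum_sub_distrib, ← Finset.sum_add_distrib, Finset.mul_sum]
  refine Finset.sum_congr rfl fun k hk => ?_
  have h1 := S.eval_Z_system hk (n * S.h)
  rw [S.exp_α_add, S.exp_α_sub, show (((n + 1 : ℤ) : ℝ) * S.h) = n * S.h + S.h by push_cast; ring,
    show (((n - 1 : ℤ) : ℝ) * S.h) = n * S.h - S.h by push_cast; ring]
  linear_combination Complex.exp (Complex.I * ((S.α k * n : ℝ) : ℂ)) * h1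

theorem mfe_zero (j : S.J) : S.mfe 0 j = S.u₀ j := by
  have he : S.e j < 2 * K := (S.e_le j).trans_lt S.K_lt
  unfold mfe Z
  simp only [Int.cast_zero, mul_zero, zero_mul, Complex.ofReal_zero, Complex.exp_zero, one_mul,
    eval_finsetSum]
  rw [Finset.sum_comm, Finset.sum_congr rfl fun m hm => S.init_position j (Finset.mem_range.1 hm),
    Finset.sum_ite_eq' _ _ _, if_pos (Finset.mem_range.2 he)]

theorem mfe_one_sub (j : S.J) : S.mfe 1 j - S.mfe (-1) j =
    2 * (S.τ : ℂ) * (Real.sinc (S.β j) : ℂ) * S.v₀ j := by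
  have he : S.e j < 2 * K := (S.e_le j).trans_lt S.K_lt
  have h1 : S.mfe 1 j - S.mfe (-1) j = ∑ k ∈ setK K j, ∑ m ∈ Finset.range (2 * K),
      (Complex.exp (Complex.I * (S.α k : ℂ)) * (S.y j k m).eval ((S.h : ℝ) : ℂ) -
      Complex.exp (-(Complex.I * (S.α k : ℂ))) * (S.y j k m).eval ((-S.h : ℝ) : ℂ)) := by
    unfold mfe Z
    rw [← Finset.sum_sub_distrib]
    refine Finset.sum_congr rfl fun k _ => ?_
    rw [Finset.sum_sub_distrib, ← Finset.mul_sum, ← Finset.mul_sum, eval_finsetSum,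
      eval_finsetSum]
    simp
  rw [h1, Finset.sum_comm, Finset.sum_congr rfl fun m hm => S.init_velocity j
    (Finset.mem_range.1 hm), Finset.sum_ite_eq' _ _ _, if_pos (Finset.mem_range.2 he)]

/-- The terms in the filtered modulated Fourier expansion. -/
def w (n : ℤ) (j : S.J) (k : S.V) (m : ℕ) : ℂ :=
  Complex.exp (Complex.I * ((S.α k * n : ℝ) : ℂ)) * (S.fy j k m).eval ((n * S.h : ℝ) : ℂ)

theorem filter_mfe (n : ℤ) (j : S.J) : (S.φ (S.β j) : ℂ) * S.mfe n j =
    ∑ k ∈ setK K j, ∑ m ∈ Finset.range (2 * K), S.w n j k m := by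
  unfold mfe w Z fy
  rw [Finset.mul_sum]
  refine Finset.sum_congr rfl fun k _ => ?_
  rw [eval_finsetSum, Finset.mul_sum, Finset.mul_sum]
  refine Finset.sum_congr rfl fun m _ => ?_
  rw [eval_mul, eval_C]
  ring

theorem α_add (k₁ k₂ : S.V) : S.α (k₁ + k₂) = S.α k₁ + S.α k₂ := by
  unfold α kdot
  rw [← add_mul, ← Finset.sum_add_distrib]
  congr 1
  refine Finset.sum_congr rfl fun l _ => ?_
  rw [Pi.add_apply]; push_cast; ring

/-- The defect of the modulated Fourier expansion. -/
def defect (n : ℤ) (j : S.J) : ℂ := ∑ j₁ : S.J, ∑ k₁ ∈ setK K j₁, ∑ k₂ ∈ setK K (j - j₁),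
  ∑ p ∈ Finset.range (2 * K) ×ˢ Finset.range (2 * K) with ¬ p.1 + p.2 < 2 * K,
    S.w n j₁ k₁ p.1 * S.w n (j - j₁) k₂ p.2

/-- The restriction to `k₁ + k₂ ∈ 𝒦_j` removes nothing: for total order below `2K`, nonzero factors
are reached, reached pairs add, and their sum lies in `𝒦`. -/
theorem trunc_eq (n : ℤ) (j : S.J) : S.trunc n j =
    ∑ j₁ : S.J, ∑ k₁ ∈ setK K j₁, ∑ k₂ ∈ setK K (j - j₁),
      ∑ p ∈ Finset.range (2 * K) ×ˢ Finset.range (2 * K) with p.1 + p.2 < 2 * K,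
        S.w n j₁ k₁ p.1 * S.w n (j - j₁) k₂ p.2 := by
  have h1 : ∀ k ∈ setK K j, Complex.exp (Complex.I * ((S.α k * n : ℝ) : ℂ)) *
      ∑ m ∈ Finset.range (2 * K), (S.F j k m).eval ((n * S.h : ℝ) : ℂ) =
      ∑ j₁ : S.J, ∑ k₁ ∈ setK K j₁, ∑ k₂ ∈ setK K (j - j₁), if k₁ + k₂ = k then
        ∑ p ∈ Finset.range (2 * K) ×ˢ Finset.range (2 * K) with p.1 + p.2 < 2 * K,
          S.w n j₁ k₁ p.1 * S.w n (j - j₁) k₂ p.2 else 0 := by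
    intro k _
    unfold F
    simp only [eval_finsetSum]
    rw [Finset.sum_comm, Finset.mul_sum]
    refine Finset.sum_congr rfl fun j₁ _ => ?_
    rw [Finset.sum_comm, Finset.mul_sum]
    refine Finset.sum_congr rfl fun k₁ _ => ?_
    rw [Finset.sum_comm, Finset.mul_sum, Finset.sum_filter]
    refine Finset.sum_congr rfl fun k₂ _ => ?_
    split_ifs with h
    · rw [← sum_range_antidiagonal, Finset.mul_sum]
      refine Finset.sum_congr rfl fun m _ => ?_
      rw [Finset.mul_sum]
      refine Finset.sum_congr rfl fun p _ => ?_
      unfold w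
      rw [eval_mul, ← h, S.α_add, add_mul, Complex.ofReal_add, mul_add, Complex.exp_add]
      ring
    · rfl
  unfold trunc
  rw [Finset.sum_congr rfl h1, Finset.sum_comm]
  refine Finset.sum_congr rfl fun j₁ _ => ?_
  rw [Finset.sum_comm]
  refine Finset.sum_congr rfl fun k₁ hk₁ => ?_
  rw [Finset.sum_comm]
  refine Finset.sum_congr rfl fun k₂ hk₂ => ?_
  rw [Finset.sum_ite_eq]
  split_ifs with h
  · rfl
  symm
  refine Finset.sum_eq_zero fun p hp => ?_
  rw [Finset.mem_filter, Finset.mem_product, Finset.mem_range, Finset.mem_range] at hp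
  by_cases h3 : S.y j₁ k₁ p.1 = 0
  · rw [w, S.fy_eq_zero h3, eval_zero, mul_zero, zero_mul]
  by_cases h4 : S.y (j - j₁) k₂ p.2 = 0
  · rw [mul_comm, w, S.fy_eq_zero h4, eval_zero, mul_zero, zero_mul]
  exfalso
  have h7 := (S.y_support p.1 j₁ k₁ hk₁ hp.1.1 h3).add
    (S.y_support p.2 _ k₂ hk₂ hp.1.2 h4) hp.2
  rw [add_sub_cancel] at h7
  exact h ((mem_setK _ _).2 (h7.inK hp.2))

theorem nonlin_mfe (n : ℤ) (j : S.J) :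
    nonlin ρ S.τ S.φ (S.mfe n) j = S.trunc n j + S.defect n j := by
  rw [trunc_eq, defect, ← Finset.sum_add_distrib]
  unfold nonlin
  refine Finset.sum_congr rfl fun j₁ _ => ?_
  have h1 := S.filter_mfe n j₁
  have h2 := S.filter_mfe n (j - j₁)
  unfold β at h1 h2
  rw [h1, h2, Finset.sum_mul_sum, ← Finset.sum_add_distrib]
  refine Finset.sum_congr rfl fun k₁ _ => ?_
  rw [← Finset.sum_add_distrib]
  refine Finset.sum_congr rfl fun k₂ _ => ?_
  rw [Finset.sum_mul_sum, ← Finset.sum_product', Finset.sum_filter_add_sum_filter_not]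

theorem norm_w_le {n : ℤ} (hn : |(n : ℝ) * S.h| ≤ 1) {j : S.J} {k : S.V} (hk : k ∈ setK K j)
    {m : ℕ} (hm : m < 2 * K) :
    ‖S.w n j k m‖ ≤ B * (S.amp j k m * (1 / √ρ * S.ny j k m)) := by
  have h1 : (S.fy j k m).natDegree ≤ 2 * K :=
    (natDegree_C_mul_le _ _).trans (S.natDegree_y_le' hk hm)
  have h2 := norm_eval_le h1 (x := ((n * S.h : ℝ) : ℂ)) le_rfl (by simpa using hn)
  rw [one_pow, one_mul] at h2
  rw [w, norm_mul, norm_exp_I_mul, one_mul]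
  exact h2.trans ((S.coeffNorm_fy_le j k m).trans
    (mul_le_mul_of_nonneg_left (S.coeffNorm_y_le j k m) S.B_nonneg))

/-- Total order `≥ 2K` gives the exponent `2K(1-2ν) + 2ν e(j)`. Since `e(j) ≤ K`, this is at least
`e(j) + K(1-2ν)`: the first part is used by the rescaling and the second remains. -/
theorem norm_defect_le {n : ℤ} (hn : |(n : ℝ) * S.h| ≤ 1) (j : S.J) :
    S.δ ^ (-(S.e j : ℝ)) * ‖S.defect n j‖ ≤
      B ^ 2 / ρ * S.δ ^ (K * (1 - 2 * ν)) * ∑ j₁ : S.J, S.Ytot j₁ * S.Ytot (j - j₁) := by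
  have hρ : 0 < √ρ := Real.sqrt_pos.2 S.hρ
  have hB := S.B_nonneg
  have hδ : ∀ x : ℝ, 0 < S.δ ^ x := fun x => Real.rpow_pos_of_pos S.δ_pos x
  have h2 : (1 / √ρ) * (1 / √ρ) = 1 / ρ := by
    rw [div_mul_div_comm, one_mul, Real.mul_self_sqrt S.hρ.le]
  have h3 : ‖S.defect n j‖ ≤ ∑ j₁ : S.J, ∑ k₁ ∈ setK K j₁, ∑ k₂ ∈ setK K (j - j₁),
      ∑ p ∈ Finset.range (2 * K) ×ˢ Finset.range (2 * K),
        B ^ 2 / ρ * S.δ ^ ((S.e j : ℝ) + K * (1 - 2 * ν)) *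
          (S.ny j₁ k₁ p.1 * S.ny (j - j₁) k₂ p.2) := by
    unfold defect
    refine (norm_sum_le _ _).trans (Finset.sum_le_sum fun j₁ _ => (norm_sum_le _ _).trans
      (Finset.sum_le_sum fun k₁ hk₁ => (norm_sum_le _ _).trans
      (Finset.sum_le_sum fun k₂ hk₂ => (norm_sum_le _ _).trans ?_)))
    refine le_trans ?_ (Finset.sum_le_sum_of_subset_of_nonneg (Finset.filter_subset
      (fun p : ℕ × ℕ => ¬ p.1 + p.2 < 2 * K) _) fun p _ _ => mul_nonneg
        (mul_nonneg (div_nonneg (sq_nonneg _) S.hρ.le) (hδ _).le)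
        (mul_nonneg (S.ny_nonneg _ _ _) (S.ny_nonneg _ _ _)))
    refine Finset.sum_le_sum fun p hp => ?_
    rw [Finset.mem_filter, Finset.mem_product, Finset.mem_range, Finset.mem_range] at hp
    have h4 := S.norm_w_le hn hk₁ hp.1.1
    have h5 := S.norm_w_le hn hk₂ hp.1.2
    have hny := mul_nonneg (S.ny_nonneg j₁ k₁ p.1) (S.ny_nonneg (j - j₁) k₂ p.2)
    have h6 : S.amp j₁ k₁ p.1 * S.amp (j - j₁) k₂ p.2 ≤
        S.δ ^ ((S.e j : ℝ) + K * (1 - 2 * ν)) := by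
      unfold amp
      rw [← Real.rpow_add S.δ_pos]
      refine S.δ_rpow_anti ?_
      have h7 : S.o j (k₁ + k₂) ≤ S.o j₁ k₁ + S.o (j - j₁) k₂ := order_add_le S.hK rfl
      have h8 : (S.e j : ℝ) ≤ S.o j₁ k₁ + S.o (j - j₁) k₂ := by
        exact_mod_cast (S.e_le_o j (k₁ + k₂)).trans h7
      have h9 : (2 * K : ℝ) ≤ p.1 + p.2 := by exact_mod_cast not_lt.1 hp.2
      have h10 : (S.e j : ℝ) ≤ K := by exact_mod_cast S.e_le j
      nlinarith [S.θ_pos, S.hν]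
    rw [norm_mul]
    calc _ ≤ (B * (S.amp j₁ k₁ p.1 * (1 / √ρ * S.ny j₁ k₁ p.1))) *
          (B * (S.amp (j - j₁) k₂ p.2 * (1 / √ρ * S.ny (j - j₁) k₂ p.2))) :=
          mul_le_mul h4 h5 (norm_nonneg _) ((norm_nonneg _).trans h4)
      _ = B ^ 2 * (1 / √ρ * (1 / √ρ)) * (S.amp j₁ k₁ p.1 * S.amp (j - j₁) k₂ p.2) *
          (S.ny j₁ k₁ p.1 * S.ny (j - j₁) k₂ p.2) := by ring
      _ = B ^ 2 / ρ * (S.amp j₁ k₁ p.1 * S.amp (j - j₁) k₂ p.2) *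
          (S.ny j₁ k₁ p.1 * S.ny (j - j₁) k₂ p.2) := by rw [h2]; ring
      _ ≤ _ := mul_le_mul_of_nonneg_right (mul_le_mul_of_nonneg_left h6
          (div_nonneg (sq_nonneg _) S.hρ.le)) hny
  refine (mul_le_mul_of_nonneg_left h3 (hδ _).le).trans (le_of_eq ?_)
  have h4 : ∀ j₁ : S.J, ∑ k₁ ∈ setK K j₁, ∑ k₂ ∈ setK K (j - j₁),
      ∑ p ∈ Finset.range (2 * K) ×ˢ Finset.range (2 * K),
        B ^ 2 / ρ * S.δ ^ ((S.e j : ℝ) + K * (1 - 2 * ν)) *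
          (S.ny j₁ k₁ p.1 * S.ny (j - j₁) k₂ p.2) =
      B ^ 2 / ρ * S.δ ^ ((S.e j : ℝ) + K * (1 - 2 * ν)) * (S.Ytot j₁ * S.Ytot (j - j₁)) := by
    intro j₁
    simp only [← Finset.mul_sum]
    congr 1
    unfold Ytot N
    rw [Finset.sum_mul_sum]
    refine Finset.sum_congr rfl fun k₁ _ => Finset.sum_congr rfl fun k₂ _ => ?_
    rw [Finset.sum_mul_sum]; exact Finset.sum_product _ _ _
  rw [Finset.sum_congr rfl fun j₁ _ => h4 j₁, ← Finset.mul_sum, ← mul_assoc, ← mul_assoc,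
    mul_comm (S.δ ^ (-(S.e j : ℝ))), mul_assoc (B ^ 2 / ρ), ← Real.rpow_add S.δ_pos]
  congr 3
  ring_nf

theorem wnorm_defect_le {n : ℤ} (hn : |(n : ℝ) * S.h| ≤ 1) :
    wnorm s (fun j => S.δ ^ (-(S.e j : ℝ)) * ‖S.defect n j‖) ≤
      B ^ 2 / ρ * (convConst s * (wnorm s S.Ytot * wnorm s S.Ytot)) *
        S.δ ^ (K * (1 - 2 * ν)) := by
  have hδ : ∀ x : ℝ, 0 < S.δ ^ x := fun x => Real.rpow_pos_of_pos S.δ_pos x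
  have hc : 0 ≤ B ^ 2 / ρ * S.δ ^ (K * (1 - 2 * ν)) :=
    mul_nonneg (div_nonneg (sq_nonneg _) S.hρ.le) (hδ _).le
  have h1 : wnorm s (fun j => S.δ ^ (-(S.e j : ℝ)) * ‖S.defect n j‖) ≤
      wnorm s (fun j => B ^ 2 / ρ * S.δ ^ (K * (1 - 2 * ν)) *
        ∑ j₁ : S.J, S.Ytot j₁ * S.Ytot (j - j₁)) := wnorm_mono fun j => by
    rw [abs_of_nonneg (mul_nonneg (hδ _).le (norm_nonneg _))]
    exact S.norm_defect_le hn j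
  refine h1.trans ?_
  rw [wnorm_const_mul s hc]
  refine (mul_le_mul_of_nonneg_left (wnorm_conv_le S.hs _ _) hc).trans_eq ?_
  ring

end Setting

end TrigInt

/-! ### Energy norm of a pair and a discrete Gronwall inequality -/

namespace TrigInt
open Polynomial

/-- The Euclidean norm of a pair of complex numbers. -/
def pairNorm (x y : ℂ) : ℝ := √(‖x‖ ^ 2 + ‖y‖ ^ 2)

theorem pairNorm_nonneg (x y : ℂ) : 0 ≤ pairNorm x y := Real.sqrt_nonneg _

theorem pairNorm_sq (x y : ℂ) : pairNorm x y ^ 2 = ‖x‖ ^ 2 + ‖y‖ ^ 2 := Real.sq_sqrt (by positivity)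

theorem pairNorm_eq_norm (x y : ℂ) : pairNorm x y = ‖WithLp.toLp 2 ![x, y]‖ := by
  rw [EuclideanSpace.norm_eq, pairNorm]
  simp

theorem pairNorm_add_le (x y p q : ℂ) :
    pairNorm (x + p) (y + q) ≤ pairNorm x y + pairNorm p q := by
  simp only [pairNorm_eq_norm]
  refine le_trans (le_of_eq ?_) (norm_add_le _ _)
  congr 1
  ext i
  fin_cases i <;> simp

theorem pairNorm_le (x y : ℂ) : pairNorm x y ≤ ‖x‖ + ‖y‖ := by
  refine Real.sqrt_le_iff.2 ⟨by positivity, ?_⟩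
  nlinarith [mul_nonneg (norm_nonneg x) (norm_nonneg y)]

theorem le_pairNorm_left (x y : ℂ) : ‖x‖ ≤ pairNorm x y :=
  Real.le_sqrt_of_sq_le (le_add_of_nonneg_right (sq_nonneg _))

theorem pairNorm_rotate (x y : ℂ) (β : ℝ) :
    pairNorm ((Real.cos β : ℂ) * x + (Real.sin β : ℂ) * y)
      (-(Real.sin β : ℂ) * x + (Real.cos β : ℂ) * y) = pairNorm x y := by
  unfold pairNorm
  congr 1
  simp only [← Complex.normSq_eq_norm_sq, Complex.normSq_apply, Complex.add_re, Complex.add_im,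
    Complex.mul_re, Complex.mul_im, Complex.neg_re, Complex.neg_im, Complex.ofReal_re,
    Complex.ofReal_im]
  linear_combination (x.re ^ 2 + x.im ^ 2 + y.re ^ 2 + y.im ^ 2) * Real.cos_sq_add_sin_sq β

/-- A discrete Gronwall inequality. -/
theorem gronwall {E A R : ℕ → ℝ} {τ T b L U D : ℝ} (hτ : 0 < τ) (hT : τ ≤ T) (hb : 0 ≤ b)
    (hL : 0 ≤ L) (hU : 0 ≤ U) (hD : 0 ≤ D) (hE : ∀ n, 0 ≤ E n) (hA : ∀ n, 0 ≤ A n)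
    (h0 : E 0 = 0) (hAE : ∀ n, A n ≤ E n)
    (hstep : ∀ n : ℕ, E (n + 1) ≤ E n + τ * b * (R n + R (n + 1)))
    (hstep' : ∀ n : ℕ, A (n + 1) ≤ E n + τ * b * R n)
    (hR : ∀ n : ℕ, n * τ ≤ 1 → R n ≤ L * (2 * U * A n + A n ^ 2) + D)
    {L' c P : ℝ} (hL' : L' = L * (2 * U + 1)) (hc : c = 1 + T * b * (L' + 1))
    (hP : P = b * ((L' + 1) + (L' * c + 1))) (hsmall : c * Real.exp P * D ≤ 1) :
    ∀ n : ℕ, n * τ ≤ 1 → E n ≤ Real.exp P * D := by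
  have hT0 : 0 ≤ T := hτ.le.trans hT
  have hL'0 : 0 ≤ L' := by rw [hL']; positivity
  have hTb : 0 ≤ T * b * (L' + 1) := by positivity
  have hc1 : 1 ≤ c := by rw [hc]; linarith
  have hP0 : 0 ≤ P := by rw [hP]; positivity
  have hR' : ∀ n : ℕ, n * τ ≤ 1 → A n ≤ 1 → R n ≤ L' * A n + D := by
    intro n hn h1
    have h2 : A n ^ 2 ≤ A n := by nlinarith [hA n]
    have h3 := mul_le_mul_of_nonneg_left h2 hL
    rw [hL']
    linarith [hR n hn]
  have hexp : ∀ n : ℕ, n * τ ≤ 1 → (1 + τ * P) ^ n ≤ Real.exp P := by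
    intro n hn
    calc (1 + τ * P) ^ n ≤ (Real.exp (τ * P)) ^ n :=
          pow_le_pow_left₀ (by positivity) (by linarith [Real.add_one_le_exp (τ * P)]) n
      _ = Real.exp (n * τ * P) := by rw [← Real.exp_nat_mul]; ring_nf
      _ ≤ Real.exp P := Real.exp_le_exp.2 (mul_le_of_le_one_left hP0 hn)
  -- Adding `D` makes the inequality homogeneous: `E + D` grows by at most `1 + τ P` per step.
  -- Smallness keeps the position error below `1`, where the quadratic term is dominated by a linear
  -- one.
  have key : ∀ n : ℕ, n * τ ≤ 1 → E n + D ≤ (1 + τ * P) ^ n * D := by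
    intro n
    induction n with
    | zero => intro _; rw [h0]; simp
    | succ n ih =>
      intro hn
      have hn' : n * τ ≤ 1 := by push_cast at hn; linarith
      have h1 := ih hn'
      have h2 := mul_le_mul_of_nonneg_right (hexp n hn') hD
      have hED : 0 ≤ E n + D := add_nonneg (hE n) hD
      have h3 : c * (E n + D) ≤ 1 := by
        refine le_trans ?_ hsmall
        rw [mul_assoc]
        exact mul_le_mul_of_nonneg_left (h1.trans h2) (by linarith)
      have h4 : E n + D ≤ c * (E n + D) := le_mul_of_one_le_left hED hc1
      have h5 : R n ≤ (L' + 1) * (E n + D) := by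
        have h6 := hR' n hn' (by linarith [hAE n])
        have h7 := mul_le_mul_of_nonneg_left (hAE n) hL'0
        nlinarith [mul_nonneg hL'0 hD, hE n]
      -- The bound on `E (n + 1)` contains `R (n + 1)`, which depends on the new positions only.
      -- These are estimated beforehand from data at step `n`, so no implicit inequality has to be
      -- solved.
      have h6 : A (n + 1) ≤ c * (E n + D) := by
        have h7 := mul_le_mul_of_nonneg_left h5 (mul_nonneg hτ.le hb)
        have h8 : τ * b * ((L' + 1) * (E n + D)) ≤ T * b * ((L' + 1) * (E n + D)) := by gcongr
        rw [hc]
        linarith [hstep' n]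
      have h7 : R (n + 1) ≤ (L' * c + 1) * (E n + D) := by
        have h8 := hR' (n + 1) hn (h6.trans h3)
        have h9 := mul_le_mul_of_nonneg_left h6 hL'0
        linarith [hE n]
      have h8 := mul_le_mul_of_nonneg_left (add_le_add h5 h7) (mul_nonneg hτ.le hb)
      have h9 : 0 ≤ 1 + τ * P := by positivity
      calc E (n + 1) + D ≤ (1 + τ * P) * (E n + D) := by
            rw [hP]; linarith [hstep n]
        _ ≤ (1 + τ * P) * ((1 + τ * P) ^ n * D) := mul_le_mul_of_nonneg_left h1 h9
        _ = (1 + τ * P) ^ (n + 1) * D := by ring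
  intro n hn
  have h1 := key n hn
  have h2 := mul_le_mul_of_nonneg_right (hexp n hn) hD
  linarith

namespace Setting

variable {K : ℕ} {ν s γ ρ B : ℝ} (S : Setting K ν s γ ρ B)

/-! ### The error of the modulated Fourier expansion -/

/-- The numerical solution. -/
def u (n : ℕ) (j : S.J) : ℂ := sol ρ S.τ S.φ S.ψ S.u₀ S.v₀ n j

/-- The numerical velocity. -/
def v (n : ℕ) (j : S.J) : ℂ := vel ρ S.τ S.φ S.ψ S.u₀ S.v₀ n j

/-- The velocity of the modulated Fourier expansion. -/
def mfeVel (n : ℤ) (j : S.J) : ℂ :=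
  (S.mfe (n + 1) j - S.mfe (n - 1) j) / (2 * (S.τ : ℂ) * (Real.sinc (S.β j) : ℂ))

theorem τ_sinc (j : S.J) : S.τ * Real.sinc (S.β j) = Real.sin (S.β j) / S.ω j := by
  rw [Real.sinc_of_ne_zero (S.β_pos j).ne', S.β_eq]
  have := S.hτ.ne'
  have := (S.ω_pos j).ne'
  field_simp

theorem sin_β_ne (j : S.J) : Real.sin (S.β j) ≠ 0 := abs_pos.1 (S.sin_β_pos j)

theorem two_τ_sinc (j : S.J) : 2 * (S.τ : ℂ) * (Real.sinc (S.β j) : ℂ) =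
    2 * ((Real.sin (S.β j) : ℂ) / (S.ω j : ℂ)) := by
  have := S.τ_sinc j
  rw [mul_assoc, ← Complex.ofReal_mul, this]
  push_cast; rfl

theorem two_τ_sinc_ne (j : S.J) : 2 * (S.τ : ℂ) * (Real.sinc (S.β j) : ℂ) ≠ 0 := by
  rw [S.two_τ_sinc]
  exact mul_ne_zero two_ne_zero (div_ne_zero (Complex.ofReal_ne_zero.2 (S.sin_β_ne j))
    (Complex.ofReal_ne_zero.2 (S.ω_pos j).ne'))

theorem u_step (n : ℕ) (j : S.J) : S.u (n + 1) j = (Real.cos (S.β j) : ℂ) * S.u n j +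
    1 / 2 * (2 * (S.τ : ℂ) * (Real.sinc (S.β j) : ℂ)) * S.v n j +
    1 / 2 * ((S.τ : ℂ) ^ 2 * (S.ψ (S.β j) : ℂ)) * nonlin ρ S.τ S.φ (S.u n) j := by
  cases n with
  | zero =>
    change (Real.cos (S.β j) : ℂ) * S.u₀ j + (S.τ : ℂ) * (Real.sinc (S.β j) : ℂ) * S.v₀ j
      + 1 / 2 * (S.τ : ℂ) ^ 2 * (S.ψ (S.β j) : ℂ) * nonlin ρ S.τ S.φ S.u₀ j =
      (Real.cos (S.β j) : ℂ) * S.u₀ j + 1 / 2 * (2 * (S.τ : ℂ) * (Real.sinc (S.β j) : ℂ)) * S.v₀ j +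
      1 / 2 * ((S.τ : ℂ) ^ 2 * (S.ψ (S.β j) : ℂ)) * nonlin ρ S.τ S.φ S.u₀ j
    ring
  | succ n =>
    have h1 : S.v (n + 1) j = (S.u (n + 2) j - S.u n j) /
        (2 * (S.τ : ℂ) * (Real.sinc (S.β j) : ℂ)) := rfl
    have h2 : S.u (n + 2) j = 2 * (Real.cos (S.β j) : ℂ) * S.u (n + 1) j - S.u n j +
        (S.τ : ℂ) ^ 2 * (S.ψ (S.β j) : ℂ) * nonlin ρ S.τ S.φ (S.u (n + 1)) j := rfl
    rw [h1, mul_assoc (1 / 2), mul_div_cancel₀ _ (S.two_τ_sinc_ne j)]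
    linear_combination (1 / 2) * h2

theorem v_step (n : ℕ) (j : S.J) : 2 * (S.τ : ℂ) * (Real.sinc (S.β j) : ℂ) * S.v (n + 1) j =
    2 * (Real.cos (S.β j) : ℂ) * S.u (n + 1) j - 2 * S.u n j +
    (S.τ : ℂ) ^ 2 * (S.ψ (S.β j) : ℂ) * nonlin ρ S.τ S.φ (S.u (n + 1)) j := by
  have h1 : S.v (n + 1) j = (S.u (n + 2) j - S.u n j) /
      (2 * (S.τ : ℂ) * (Real.sinc (S.β j) : ℂ)) := rfl
  have h2 : S.u (n + 2) j = 2 * (Real.cos (S.β j) : ℂ) * S.u (n + 1) j - S.u n j +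
      (S.τ : ℂ) ^ 2 * (S.ψ (S.β j) : ℂ) * nonlin ρ S.τ S.φ (S.u (n + 1)) j := rfl
  rw [h1, mul_div_cancel₀ _ (S.two_τ_sinc_ne j)]
  linear_combination h2

theorem mfe_step (n : ℤ) (j : S.J) : S.mfe (n + 1) j = (Real.cos (S.β j) : ℂ) * S.mfe n j +
    1 / 2 * (2 * (S.τ : ℂ) * (Real.sinc (S.β j) : ℂ)) * S.mfeVel n j +
    1 / 2 * ((S.τ : ℂ) ^ 2 * (S.ψ (S.β j) : ℂ)) * S.trunc n j := by
  rw [mfeVel, mul_assoc (1 / 2), mul_div_cancel₀ _ (S.two_τ_sinc_ne j)]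
  linear_combination (1 / 2) * S.mfe_system n j

theorem mfeVel_step (n : ℤ) (j : S.J) :
    2 * (S.τ : ℂ) * (Real.sinc (S.β j) : ℂ) * S.mfeVel (n + 1) j =
    2 * (Real.cos (S.β j) : ℂ) * S.mfe (n + 1) j - 2 * S.mfe n j +
    (S.τ : ℂ) ^ 2 * (S.ψ (S.β j) : ℂ) * S.trunc (n + 1) j := by
  have h := S.mfe_system (n + 1) j
  rw [mfeVel, mul_div_cancel₀ _ (S.two_τ_sinc_ne j)]
  rw [add_sub_cancel_right] at h ⊢
  linear_combination h

/-- The error of the modulated Fourier expansion. -/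
def a (n : ℕ) (j : S.J) : ℂ := S.u n j - S.mfe n j

/-- The error of the velocity of the modulated Fourier expansion. -/
def b (n : ℕ) (j : S.J) : ℂ := S.v n j - S.mfeVel n j

/-- The error in the nonlinearity. -/
def r (n : ℕ) (j : S.J) : ℂ := nonlin ρ S.τ S.φ (S.u n) j - S.trunc n j

theorem a_zero (j : S.J) : S.a 0 j = 0 := by
  change S.u₀ j - S.mfe 0 j = 0
  rw [S.mfe_zero, sub_self]

theorem b_zero (j : S.J) : S.b 0 j = 0 := by
  change S.v₀ j - (S.mfe (0 + 1) j - S.mfe (0 - 1) j) / _ = 0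
  rw [zero_add, zero_sub, S.mfe_one_sub, mul_div_cancel_left₀ _ (S.two_τ_sinc_ne j), sub_self]

theorem coupling_eq (j : S.J) : (S.τ : ℂ) ^ 2 * (S.ψ (S.β j) : ℂ) =
    (S.τ : ℂ) * (S.φ (S.β j) : ℂ) * ((Real.sin (S.β j) : ℂ) / (S.ω j : ℂ)) := by
  have h := S.abs_τ_sq_ψ j
  rw [← Complex.ofReal_pow, ← Complex.ofReal_mul, h]
  push_cast; ring

/-- In the variables `(ω a, b)` the linear part of the method is the rotation by `τ ω_j`. Because `ψ
= sinc · φ`, the kick on the position carries `sin β`, which makes all factors bounded. -/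
theorem a_step (n : ℕ) (j : S.J) : (S.ω j : ℂ) * S.a (n + 1) j =
    ((Real.cos (S.β j) : ℂ) * ((S.ω j : ℂ) * S.a n j) + (Real.sin (S.β j) : ℂ) * S.b n j) +
    1 / 2 * ((S.τ : ℂ) * (S.φ (S.β j) : ℂ)) * ((Real.sin (S.β j) : ℂ) * S.r n j) := by
  have h1 := S.u_step n j
  have h2 := S.mfe_step n j
  have hω := Complex.ofReal_ne_zero.2 (S.ω_pos j).ne'
  rw [S.two_τ_sinc, S.coupling_eq] at h1 h2
  unfold a b r
  rw [h1, Nat.cast_succ, h2]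
  field_simp
  ring

/-- The recursion for the velocity contains a division by `sin β`; it is derived after
multiplication by `sin β`, the old position being recombined through `cos² + sin² = 1`. -/
theorem b_step (n : ℕ) (j : S.J) : S.b (n + 1) j =
    (-(Real.sin (S.β j) : ℂ) * ((S.ω j : ℂ) * S.a n j) + (Real.cos (S.β j) : ℂ) * S.b n j) +
    1 / 2 * ((S.τ : ℂ) * (S.φ (S.β j) : ℂ)) *
      ((Real.cos (S.β j) : ℂ) * S.r n j + S.r (n + 1) j) := by
  have h1 := S.v_step n j
  have h2 := S.mfeVel_step n j
  have h3 := S.a_step n j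
  have hω := Complex.ofReal_ne_zero.2 (S.ω_pos j).ne'
  have hsin := Complex.ofReal_ne_zero.2 (S.sin_β_ne j)
  have hcs : (Real.cos (S.β j) : ℂ) ^ 2 + (Real.sin (S.β j) : ℂ) ^ 2 = 1 := by
    rw [← Complex.ofReal_pow, ← Complex.ofReal_pow, ← Complex.ofReal_add, Real.cos_sq_add_sin_sq,
      Complex.ofReal_one]
  rw [S.two_τ_sinc, S.coupling_eq] at h1 h2
  have h4 : (Real.sin (S.β j) : ℂ) * S.b (n + 1) j =
      (Real.cos (S.β j) : ℂ) * ((S.ω j : ℂ) * S.a (n + 1) j) - (S.ω j : ℂ) * S.a n j +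
      1 / 2 * ((S.τ : ℂ) * (S.φ (S.β j) : ℂ)) * ((Real.sin (S.β j) : ℂ) * S.r (n + 1) j) := by
    unfold a b r
    rw [Nat.cast_succ]
    field_simp at h1 h2
    linear_combination (1 / 2) * h1 - (1 / 2) * h2
  rw [h3] at h4
  refine mul_left_cancel₀ hsin (h4.trans ?_)
  linear_combination ((S.ω j : ℂ) * S.a n j) * hcs

/-- The error in the energy norm. -/
def errE (n : ℕ) (j : S.J) : ℝ :=
  S.δ ^ (-(S.e j : ℝ)) * pairNorm ((S.ω j : ℂ) * S.a n j) (S.b n j)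

/-- The error in the positions. -/
def errA (n : ℕ) (j : S.J) : ℝ := S.δ ^ (-(S.e j : ℝ)) * (S.ω j * ‖S.a n j‖)

/-- The rescaled error in the nonlinearity. -/
def errR (n : ℕ) (j : S.J) : ℝ := S.δ ^ (-(S.e j : ℝ)) * ‖S.r n j‖

theorem δ_rpow_pos (x : ℝ) : 0 < S.δ ^ x := Real.rpow_pos_of_pos S.δ_pos x

theorem errE_nonneg (n : ℕ) (j : S.J) : 0 ≤ S.errE n j :=
  mul_nonneg (S.δ_rpow_pos _).le (pairNorm_nonneg _ _)

theorem errA_nonneg (n : ℕ) (j : S.J) : 0 ≤ S.errA n j :=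
  mul_nonneg (S.δ_rpow_pos _).le (mul_nonneg (S.ω_pos j).le (norm_nonneg _))

theorem errR_nonneg (n : ℕ) (j : S.J) : 0 ≤ S.errR n j :=
  mul_nonneg (S.δ_rpow_pos _).le (norm_nonneg _)

theorem norm_ω_mul (j : S.J) (x : ℂ) : ‖(S.ω j : ℂ) * x‖ = S.ω j * ‖x‖ := by
  rw [norm_mul, Complex.norm_real, Real.norm_eq_abs, abs_of_pos (S.ω_pos j)]

theorem errA_le_errE (n : ℕ) (j : S.J) : S.errA n j ≤ S.errE n j := by
  refine mul_le_mul_of_nonneg_left ?_ (S.δ_rpow_pos _).le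
  rw [← S.norm_ω_mul]
  exact le_pairNorm_left _ _

theorem norm_force_le (j : S.J) (c : ℝ) (hc : |c| ≤ 1) (x : ℂ) :
    ‖1 / 2 * ((S.τ : ℂ) * (S.φ (S.β j) : ℂ)) * ((c : ℂ) * x)‖ ≤ 1 / 2 * (S.τ * B) * ‖x‖ := by
  have hB := S.B_nonneg
  rw [norm_mul, norm_mul, norm_mul, norm_mul, Complex.norm_real, Complex.norm_real,
    Complex.norm_real, Real.norm_eq_abs, Real.norm_eq_abs, Real.norm_eq_abs, abs_of_pos S.hτ]
  have h1 : ‖(1 / 2 : ℂ)‖ = 1 / 2 := by simp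
  rw [h1]
  have h2 := mul_le_mul_of_nonneg_left (S.hφ (S.β j)) S.hτ.le
  have h3 : |c| * ‖x‖ ≤ ‖x‖ := mul_le_of_le_one_left (norm_nonneg _) hc
  exact mul_le_mul (mul_le_mul_of_nonneg_left h2 (by norm_num)) h3
    (mul_nonneg (abs_nonneg _) (norm_nonneg _)) (by have := S.hτ; positivity)

theorem errE_step (n : ℕ) (j : S.J) :
    S.errE (n + 1) j ≤ S.errE n j + S.τ * B * (S.errR n j + S.errR (n + 1) j) := by
  have h1 := S.norm_force_le j (Real.sin (S.β j)) (Real.abs_sin_le_one _) (S.r n j)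
  have h2 := S.norm_force_le j (Real.cos (S.β j)) (Real.abs_cos_le_one _) (S.r n j)
  have h3 := S.norm_force_le j 1 (by simp) (S.r (n + 1) j)
  rw [Complex.ofReal_one, one_mul] at h3
  have h0 : 0 ≤ S.τ * B := mul_nonneg S.hτ.le S.B_nonneg
  unfold errE errR
  rw [S.a_step, S.b_step]
  have h4 : pairNorm (((Real.cos (S.β j) : ℂ) * ((S.ω j : ℂ) * S.a n j) +
      (Real.sin (S.β j) : ℂ) * S.b n j) +
      1 / 2 * ((S.τ : ℂ) * (S.φ (S.β j) : ℂ)) * ((Real.sin (S.β j) : ℂ) * S.r n j))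
      ((-(Real.sin (S.β j) : ℂ) * ((S.ω j : ℂ) * S.a n j) + (Real.cos (S.β j) : ℂ) * S.b n j) +
      1 / 2 * ((S.τ : ℂ) * (S.φ (S.β j) : ℂ)) *
      ((Real.cos (S.β j) : ℂ) * S.r n j + S.r (n + 1) j)) ≤
      pairNorm ((S.ω j : ℂ) * S.a n j) (S.b n j) +
        S.τ * B * (‖S.r n j‖ + ‖S.r (n + 1) j‖) := by
    refine (pairNorm_add_le _ _ _ _).trans ?_
    rw [pairNorm_rotate]
    refine add_le_add le_rfl ((pairNorm_le _ _).trans ?_)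
    rw [mul_add (1 / 2 * ((S.τ : ℂ) * (S.φ (S.β j) : ℂ)))]
    have h5 := norm_add_le (1 / 2 * ((S.τ : ℂ) * (S.φ (S.β j) : ℂ)) *
      ((Real.cos (S.β j) : ℂ) * S.r n j)) (1 / 2 * ((S.τ : ℂ) * (S.φ (S.β j) : ℂ)) *
      S.r (n + 1) j)
    have h6 := mul_nonneg h0 (norm_nonneg (S.r (n + 1) j))
    linarith
  refine (mul_le_mul_of_nonneg_left h4 (S.δ_rpow_pos _).le).trans_eq ?_
  ring

theorem errA_step (n : ℕ) (j : S.J) :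
    S.errA (n + 1) j ≤ S.errE n j + S.τ * B * S.errR n j := by
  have h1 := S.norm_force_le j (Real.sin (S.β j)) (Real.abs_sin_le_one _) (S.r n j)
  have h0 : 0 ≤ S.τ * B := mul_nonneg S.hτ.le S.B_nonneg
  unfold errA errE errR
  rw [← S.norm_ω_mul, S.a_step]
  have h2 := le_pairNorm_left ((Real.cos (S.β j) : ℂ) * ((S.ω j : ℂ) * S.a n j) +
      (Real.sin (S.β j) : ℂ) * S.b n j)
      (-(Real.sin (S.β j) : ℂ) * ((S.ω j : ℂ) * S.a n j) + (Real.cos (S.β j) : ℂ) * S.b n j)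
  rw [pairNorm_rotate] at h2
  have h3 := norm_add_le ((Real.cos (S.β j) : ℂ) * ((S.ω j : ℂ) * S.a n j) +
      (Real.sin (S.β j) : ℂ) * S.b n j)
    (1 / 2 * ((S.τ : ℂ) * (S.φ (S.β j) : ℂ)) * ((Real.sin (S.β j) : ℂ) * S.r n j))
  have h4 := mul_nonneg h0 (norm_nonneg (S.r n j))
  have h5 : ‖((Real.cos (S.β j) : ℂ) * ((S.ω j : ℂ) * S.a n j) +
      (Real.sin (S.β j) : ℂ) * S.b n j) +
      1 / 2 * ((S.τ : ℂ) * (S.φ (S.β j) : ℂ)) * ((Real.sin (S.β j) : ℂ) * S.r n j)‖ ≤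
      pairNorm ((S.ω j : ℂ) * S.a n j) (S.b n j) + S.τ * B * ‖S.r n j‖ := by linarith
  refine (mul_le_mul_of_nonneg_left h5 (S.δ_rpow_pos _).le).trans_eq ?_
  ring

end Setting

end TrigInt

namespace TrigInt
open Polynomial

namespace Setting

variable {K : ℕ} {ν s γ ρ B : ℝ} (S : Setting K ν s γ ρ B)

/-! ### Bounds of the modulated Fourier expansion -/

/-- The leading coefficient function and the damped sum of all coefficient functions. -/
def P (j : S.J) (k : S.V) : ℝ := S.ny j k (S.o j k) + S.δ ^ (1 - 2 * ν) * S.N j k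

theorem P_nonneg (j : S.J) (k : S.V) : 0 ≤ S.P j k :=
  add_nonneg (S.ny_nonneg _ _ _) (mul_nonneg (S.δ_rpow_pos _).le (S.N_nonneg _ _))

/-- The majorant of the modulated Fourier expansion. -/
def Ptot (j : S.J) : ℝ := ∑ k ∈ setK K j, S.P j k

theorem Ptot_nonneg (j : S.J) : 0 ≤ S.Ptot j := Finset.sum_nonneg fun _ _ => S.P_nonneg _ _

theorem o_lt (j : S.J) (k : S.V) : S.o j k < 2 * K := (S.o_le j k).trans_lt S.K_lt

theorem Ptot_eq (j : S.J) : S.Ptot j =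
    ∑ m ∈ Finset.range (2 * K), S.Lead m j + S.δ ^ (1 - 2 * ν) * S.Ytot j := by
  unfold Ptot P Ytot Lead lead
  rw [Finset.sum_add_distrib, Finset.mul_sum, Finset.sum_comm]
  congr 1
  refine Finset.sum_congr rfl fun k _ => ?_
  rw [Finset.sum_ite_eq, if_pos (Finset.mem_range.2 (S.o_lt j k))]

theorem wnorm_Ptot_le {C : ℝ} (h : ∀ m < 2 * K, wnorm s (S.Lead m) ≤ C)
    (hY : S.δ ^ (1 - 2 * ν) * wnorm s S.Ytot ≤ 1) : wnorm s S.Ptot ≤ 2 * K * C + 1 := by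
  have h1 : S.Ptot = fun j => ∑ m ∈ Finset.range (2 * K), S.Lead m j +
    S.δ ^ (1 - 2 * ν) * S.Ytot j := funext S.Ptot_eq
  rw [h1]
  refine (wnorm_add_le s _ _).trans (add_le_add ?_ ?_)
  · refine (wnorm_sum_le s _ _).trans ((Finset.sum_le_sum fun m hm =>
      h m (Finset.mem_range.1 hm)).trans (le_of_eq ?_))
    rw [Finset.sum_const, Finset.card_range, nsmul_eq_mul]
    push_cast; ring
  · rwa [wnorm_const_mul s (S.δ_rpow_pos _).le]

theorem amp_order (j : S.J) (k : S.V) : S.amp j k (S.o j k) = S.δ ^ (S.o j k : ℝ) := by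
  unfold amp; congr 1; ring

/-- The order `m(j,k)` is kept as it is, and each later order is smaller by at least `δ^(1-2ν)`.
Thus only the leading functions need a bound that is free of `C₀`. -/
theorem Z_le_P {j : S.J} {k : S.V} (hk : k ∈ setK K j) :
    S.ω j * S.Q j k * coeffNorm (S.Z j k) ≤ S.δ ^ (S.o j k : ℝ) * S.P j k := by
  refine (S.Z_le_sum j k).trans ?_
  unfold P
  rw [← Finset.add_sum_erase _ _ (Finset.mem_range.2 (S.o_lt j k)), S.amp_order, mul_add]
  refine add_le_add le_rfl ?_
  rw [← mul_assoc, ← Real.rpow_add S.δ_pos]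
  unfold N
  rw [Finset.mul_sum]
  refine le_trans ?_ (Finset.sum_le_sum_of_subset_of_nonneg (Finset.erase_subset (S.o j k) _)
      fun m _ _ => mul_nonneg (S.δ_rpow_pos _).le (S.ny_nonneg j k m))
  refine Finset.sum_le_sum fun m hm => ?_
  rw [Finset.mem_erase] at hm
  rcases lt_or_ge m (S.o j k) with h | h
  · rw [S.ny_eq_zero_of_y (S.y_eq_zero hk h), mul_zero, mul_zero]
  · refine mul_le_mul_of_nonneg_right ((S.amp_le (r := 1) (by omega)).trans_eq ?_)
      (S.ny_nonneg j k m)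
    simp

theorem ω_coeffNorm_Z_le (j : S.J) (k : S.V) :
    S.ω j * coeffNorm (S.Z j k) ≤ S.ω j * S.Q j k * coeffNorm (S.Z j k) := by
  rw [mul_assoc]
  exact mul_le_mul_of_nonneg_left (le_mul_of_one_le_left (coeffNorm_nonneg _) (S.one_le_Q j k))
    (S.ω_pos j).le

theorem sum_Z_le (j : S.J) : ∑ k ∈ setK K j, S.ω j * S.Q j k * coeffNorm (S.Z j k) ≤
    S.δ ^ (S.e j : ℝ) * S.Ptot j := by
  unfold Ptot
  rw [Finset.mul_sum]
  refine Finset.sum_le_sum fun k hk => (S.Z_le_P hk).trans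
    (mul_le_mul_of_nonneg_right (S.δ_rpow_anti ?_) (S.P_nonneg j k))
  exact_mod_cast S.e_le_o j k

/-- The terms of the velocity of the modulated Fourier expansion. -/
def symmDiff (j : S.J) (k : S.V) (x : ℝ) : ℂ :=
  Complex.exp (Complex.I * (S.α k : ℂ)) * (S.Z j k).eval ((x + S.h : ℝ) : ℂ) -
    Complex.exp (-(Complex.I * (S.α k : ℂ))) * (S.Z j k).eval ((x - S.h : ℝ) : ℂ)

theorem mfeVel_eq (n : ℤ) (j : S.J) : S.mfeVel n j =
    (S.ω j : ℂ) / (2 * (Real.sin (S.β j) : ℂ)) * ∑ k ∈ setK K j,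
      Complex.exp (Complex.I * ((S.α k * n : ℝ) : ℂ)) * S.symmDiff j k (n * S.h) := by
  have h1 : S.mfe (n + 1) j - S.mfe (n - 1) j = ∑ k ∈ setK K j,
      Complex.exp (Complex.I * ((S.α k * n : ℝ) : ℂ)) * S.symmDiff j k (n * S.h) := by
    unfold mfe symmDiff
    rw [← Finset.sum_sub_distrib]
    refine Finset.sum_congr rfl fun k _ => ?_
    rw [S.exp_α_add, S.exp_α_sub,
      show (((n + 1 : ℤ) : ℝ) * S.h) = n * S.h + S.h by push_cast; ring,
      show (((n - 1 : ℤ) : ℝ) * S.h) = n * S.h - S.h by push_cast; ring]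
    ring
  have hω := Complex.ofReal_ne_zero.2 (S.ω_pos j).ne'
  have hsin := Complex.ofReal_ne_zero.2 (S.sin_β_ne j)
  rw [mfeVel, S.two_τ_sinc, h1]
  generalize ∑ k ∈ setK K j, Complex.exp (Complex.I * ((S.α k * n : ℝ) : ℂ)) *
    S.symmDiff j k (n * S.h) = d
  field_simp

/-- The constant in the bounds of the modulated Fourier expansion. -/
def mfeConst (K : ℕ) (γ : ℝ) : ℝ := 2 + evalConst 1 (1 / γ) (2 * K) * (2 * K) * resConst γ

theorem mfeConst_nonneg (S : Setting K ν s γ ρ B) : 0 ≤ mfeConst K γ := by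
  have h1 := S.hγ
  have h2 := evalConst_nonneg zero_le_one (by positivity : 0 ≤ 1 / γ) (2 * K)
  have h3 := resConst_nonneg S
  unfold mfeConst; positivity

theorem norm_vel_factor (j : S.J) : ‖(S.ω j : ℂ) / (2 * (Real.sin (S.β j) : ℂ))‖ =
    S.ω j / (2 * |Real.sin (S.β j)|) := by
  rw [norm_div, norm_mul, Complex.norm_real, Complex.norm_real, Real.norm_eq_abs, Real.norm_eq_abs,
    abs_of_pos (S.ω_pos j), Complex.norm_ofNat]

/-- `Q` carries the quotient `|sin α|/|sin β|`, so dividing by `sin β` does no harm. The constant is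
`mfeConst - 1`, which leaves `1` for the position part. -/
theorem symmDiff_le {j : S.J} {k : S.V} (hk : k ∈ setK K j) {x : ℝ} (hx : |x| ≤ 1) :
    S.ω j / (2 * |Real.sin (S.β j)|) * ‖S.symmDiff j k x‖ ≤
      (mfeConst K γ - 1) * (S.ω j * S.Q j k * coeffNorm (S.Z j k)) := by
  have hγ := S.hγ
  have hsin := S.sin_β_pos j
  have hω := S.ω_pos j
  have h1 := norm_symm_diff_le (S.natDegree_Z_le hk) (x := x) (h := S.h) (α := S.α k) (H := 1 / γ)
    le_rfl hx S.h_pos.le S.h_le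
  have hE := evalConst_nonneg zero_le_one (by positivity : 0 ≤ 1 / γ) (2 * K)
  have hr := resConst_nonneg S
  have hp := coeffNorm_nonneg (S.Z j k)
  have hQs : S.Q j k * |Real.sin (S.β j)| = |Real.sin (S.β j)| + |Real.sin (S.α k)| := by
    rw [Q, add_mul, one_mul, div_mul_cancel₀ _ hsin.ne']
  have h2 : |Real.sin (S.α k)| ≤ S.Q j k * |Real.sin (S.β j)| := by linarith
  have h3 : S.h ≤ resConst γ * (S.Q j k * |Real.sin (S.β j)|) :=
    (S.h_le_resConst j).trans (mul_le_mul_of_nonneg_left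
      (le_mul_of_one_le_left hsin.le (S.one_le_Q j k)) hr)
  have h4 : ‖S.symmDiff j k x‖ ≤ 2 * (S.Q j k * |Real.sin (S.β j)| +
      evalConst 1 (1 / γ) (2 * K) * (2 * K) * (resConst γ * (S.Q j k * |Real.sin (S.β j)|))) *
      coeffNorm (S.Z j k) := by
    refine h1.trans ?_
    rw [one_pow, one_mul]
    push_cast
    gcongr
  rw [div_mul_eq_mul_div, div_le_iff₀ (by positivity)]
  refine (mul_le_mul_of_nonneg_left h4 hω.le).trans_eq ?_
  unfold mfeConst
  ring

theorem mfe_energy_le {n : ℤ} (hn : |(n : ℝ) * S.h| ≤ 1) (j : S.J) :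
    pairNorm ((S.ω j : ℂ) * S.mfe n j) (S.mfeVel n j) ≤
      mfeConst K γ * (S.δ ^ (S.e j : ℝ) * S.Ptot j) := by
  have hc := mfeConst_nonneg S
  refine le_trans ?_ (mul_le_mul_of_nonneg_left (S.sum_Z_le j) hc)
  have h1 : ‖(S.ω j : ℂ) * S.mfe n j‖ ≤
      ∑ k ∈ setK K j, S.ω j * S.Q j k * coeffNorm (S.Z j k) := by
    rw [S.norm_ω_mul, mfe]
    refine (mul_le_mul_of_nonneg_left (norm_sum_le _ _) (S.ω_pos j).le).trans ?_
    rw [Finset.mul_sum]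
    refine Finset.sum_le_sum fun k hk => ?_
    rw [norm_mul, norm_exp_I_mul, one_mul]
    have h2 := norm_eval_le (S.natDegree_Z_le hk) (x := ((n * S.h : ℝ) : ℂ)) le_rfl
      (by simpa using hn)
    rw [one_pow, one_mul] at h2
    exact (mul_le_mul_of_nonneg_left h2 (S.ω_pos j).le).trans (S.ω_coeffNorm_Z_le j k)
  have h2 : ‖S.mfeVel n j‖ ≤ (mfeConst K γ - 1) *
      ∑ k ∈ setK K j, S.ω j * S.Q j k * coeffNorm (S.Z j k) := by
    rw [S.mfeVel_eq, norm_mul, S.norm_vel_factor]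
    refine (mul_le_mul_of_nonneg_left (norm_sum_le _ _) (div_nonneg (S.ω_pos j).le
      (mul_nonneg zero_le_two (abs_nonneg _)))).trans ?_
    rw [Finset.mul_sum, Finset.mul_sum]
    refine Finset.sum_le_sum fun k hk => ?_
    rw [norm_mul, norm_exp_I_mul, one_mul]
    exact S.symmDiff_le hk hn
  refine (pairNorm_le _ _).trans ?_
  linarith

theorem mfe_energy_scaled_le {n : ℤ} (hn : |(n : ℝ) * S.h| ≤ 1) (j : S.J) :
    S.δ ^ (-(S.e j : ℝ)) * pairNorm ((S.ω j : ℂ) * S.mfe n j) (S.mfeVel n j) ≤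
      mfeConst K γ * S.Ptot j := by
  refine (mul_le_mul_of_nonneg_left (S.mfe_energy_le hn j) (S.δ_rpow_pos _).le).trans_eq ?_
  rw [Real.rpow_neg S.δ_pos.le]
  have := (S.δ_rpow_pos (S.e j)).ne'
  field_simp

/-! ### The error of the nonlinearity -/

/-- Subadditivity `e(j) ≤ e(i) + e(l)` distributes the scaling over the two factors, and `1/ρ` comes
from `ω ≥ √ρ` used twice. -/
theorem scaled_mul_le (i l : S.J) (j : S.J) (hj : i + l = j) {x y X Y : ℝ}
    (hx : S.δ ^ (-(S.e i : ℝ)) * (S.ω i * x) ≤ X) (hy : S.δ ^ (-(S.e l : ℝ)) * (S.ω l * y) ≤ Y)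
    (hx0 : 0 ≤ x) (hy0 : 0 ≤ y) :
    S.δ ^ (-(S.e j : ℝ)) * (x * y) ≤ 1 / ρ * (X * Y) := by
  have hρ := S.hρ
  have h1 := S.sqrt_le_ω i
  have h2 := S.sqrt_le_ω l
  have hX : S.δ ^ (-(S.e i : ℝ)) * (√ρ * x) ≤ X :=
    (mul_le_mul_of_nonneg_left (mul_le_mul_of_nonneg_right h1 hx0) (S.δ_rpow_pos _).le).trans hx
  have hY : S.δ ^ (-(S.e l : ℝ)) * (√ρ * y) ≤ Y :=
    (mul_le_mul_of_nonneg_left (mul_le_mul_of_nonneg_right h2 hy0) (S.δ_rpow_pos _).le).trans hy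
  have h3 : S.δ ^ (-(S.e j : ℝ)) ≤ S.δ ^ (-(S.e i : ℝ)) * S.δ ^ (-(S.e l : ℝ)) := by
    rw [← Real.rpow_add S.δ_pos]
    refine S.δ_rpow_anti ?_
    have h4 : S.e j ≤ S.e i + S.e l := profile_le_add S.hK (by rw [← hj]; exact idx_add_le i l)
    have h5 : (S.e j : ℝ) ≤ S.e i + S.e l := by exact_mod_cast h4
    linarith
  have h6 := mul_le_mul hX hY (mul_nonneg (S.δ_rpow_pos _).le
    (mul_nonneg (Real.sqrt_nonneg _) hy0)) ((mul_nonneg (S.δ_rpow_pos _).le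
    (mul_nonneg (Real.sqrt_nonneg _) hx0)).trans hX)
  rw [one_div, inv_mul_eq_div, le_div_iff₀ hρ]
  calc _ ≤ S.δ ^ (-(S.e i : ℝ)) * S.δ ^ (-(S.e l : ℝ)) * (x * y) * ρ :=
        mul_le_mul_of_nonneg_right (mul_le_mul_of_nonneg_right h3 (mul_nonneg hx0 hy0)) hρ.le
    _ = S.δ ^ (-(S.e i : ℝ)) * S.δ ^ (-(S.e l : ℝ)) * (x * y) * (√ρ * √ρ) := by
        rw [Real.mul_self_sqrt hρ.le]
    _ = _ := by ring
    _ ≤ _ := h6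

/-- The rescaled modulated Fourier expansion. -/
def mfeVal (n : ℕ) (j : S.J) : ℝ := S.δ ^ (-(S.e j : ℝ)) * (S.ω j * ‖S.mfe n j‖)

theorem mfeVal_nonneg (n : ℕ) (j : S.J) : 0 ≤ S.mfeVal n j :=
  mul_nonneg (S.δ_rpow_pos _).le (mul_nonneg (S.ω_pos j).le (norm_nonneg _))

theorem norm_nonlin_sub_le (n : ℕ) (j : S.J) :
    S.δ ^ (-(S.e j : ℝ)) * ‖nonlin ρ S.τ S.φ (S.u n) j - nonlin ρ S.τ S.φ (S.mfe n) j‖ ≤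
      B ^ 2 / ρ * (∑ i : S.J, S.errA n i * S.mfeVal n (j - i) +
        ∑ i : S.J, S.mfeVal n i * S.errA n (j - i) + ∑ i : S.J, S.errA n i * S.errA n (j - i)) := by
  have hB := S.B_nonneg
  have h1 : nonlin ρ S.τ S.φ (S.u n) j - nonlin ρ S.τ S.φ (S.mfe n) j =
      ∑ i : S.J, ((S.φ (S.β i) : ℂ) * (S.φ (S.β (j - i)) : ℂ)) *
        (S.a n i * S.mfe n (j - i) + S.mfe n i * S.a n (j - i) + S.a n i * S.a n (j - i)) := by
    unfold nonlin
    rw [← Finset.sum_sub_distrib]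
    refine Finset.sum_congr rfl fun i _ => ?_
    unfold a β
    ring
  rw [h1, ← Finset.sum_add_distrib, ← Finset.sum_add_distrib, Finset.mul_sum]
  refine (mul_le_mul_of_nonneg_left (norm_sum_le _ _) (S.δ_rpow_pos _).le).trans ?_
  rw [Finset.mul_sum]
  refine Finset.sum_le_sum fun i _ => ?_
  have hi : i + (j - i) = j := add_sub_cancel i j
  have h2 := S.scaled_mul_le i (j - i) j hi (le_refl (S.errA n i)) (le_refl (S.mfeVal n (j - i)))
    (norm_nonneg _) (norm_nonneg _)
  have h3 := S.scaled_mul_le i (j - i) j hi (le_refl (S.mfeVal n i)) (le_refl (S.errA n (j - i)))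
    (norm_nonneg _) (norm_nonneg _)
  have h4 := S.scaled_mul_le i (j - i) j hi (le_refl (S.errA n i)) (le_refl (S.errA n (j - i)))
    (norm_nonneg _) (norm_nonneg _)
  have h5 : ‖(S.φ (S.β i) : ℂ) * (S.φ (S.β (j - i)) : ℂ)‖ ≤ B ^ 2 := by
    rw [norm_mul, Complex.norm_real, Complex.norm_real, sq]
    exact mul_le_mul (S.hφ _) (S.hφ _) (abs_nonneg _) hB
  have h6 : ‖S.a n i * S.mfe n (j - i) + S.mfe n i * S.a n (j - i) + S.a n i * S.a n (j - i)‖ ≤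
      ‖S.a n i‖ * ‖S.mfe n (j - i)‖ + ‖S.mfe n i‖ * ‖S.a n (j - i)‖ +
        ‖S.a n i‖ * ‖S.a n (j - i)‖ := by
    refine (norm_add₃_le).trans_eq ?_
    rw [norm_mul, norm_mul, norm_mul]
  rw [norm_mul]
  have h7 := mul_le_mul h5 h6 (norm_nonneg _) (sq_nonneg B)
  refine (mul_le_mul_of_nonneg_left h7 (S.δ_rpow_pos _).le).trans ?_
  have h8 := mul_le_mul_of_nonneg_left (add_le_add (add_le_add h2 h3) h4) (sq_nonneg B)
  calc _ = B ^ 2 * (S.δ ^ (-(S.e j : ℝ)) * (‖S.a n i‖ * ‖S.mfe n (j - i)‖) +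
        S.δ ^ (-(S.e j : ℝ)) * (‖S.mfe n i‖ * ‖S.a n (j - i)‖) +
        S.δ ^ (-(S.e j : ℝ)) * (‖S.a n i‖ * ‖S.a n (j - i)‖)) := by ring
    _ ≤ _ := h8
    _ = _ := by ring

/-- The Lipschitz constant of the nonlinearity. -/
def lipConst (s ρ B : ℝ) : ℝ := B ^ 2 / ρ * convConst s

theorem lipConst_nonneg (S : Setting K ν s γ ρ B) : 0 ≤ lipConst s ρ B :=
  mul_nonneg (div_nonneg (sq_nonneg _) S.hρ.le) (convConst_nonneg s)

theorem wnorm_errR_le {n : ℕ} (hn : |((n : ℤ) : ℝ) * S.h| ≤ 1) :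
    wnorm s (S.errR n) ≤ lipConst s ρ B * (2 * wnorm s (S.mfeVal n) * wnorm s (S.errA n) +
      wnorm s (S.errA n) ^ 2) +
      lipConst s ρ B * wnorm s S.Ytot ^ 2 * S.δ ^ (K * (1 - 2 * ν)) := by
  have hc : 0 ≤ B ^ 2 / ρ := div_nonneg (sq_nonneg _) S.hρ.le
  have h1 : ∀ j, |S.errR n j| ≤ B ^ 2 / ρ * (∑ i : S.J, S.errA n i * S.mfeVal n (j - i) +
        ∑ i : S.J, S.mfeVal n i * S.errA n (j - i) + ∑ i : S.J, S.errA n i * S.errA n (j - i)) +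
        S.δ ^ (-(S.e j : ℝ)) * ‖S.defect n j‖ := by
    intro j
    rw [abs_of_nonneg (S.errR_nonneg n j)]
    have h2 : S.r n j = (nonlin ρ S.τ S.φ (S.u n) j - nonlin ρ S.τ S.φ (S.mfe n) j) +
        S.defect n j := by
      unfold r
      rw [S.nonlin_mfe]
      ring
    have h3 := S.norm_nonlin_sub_le n j
    have h4 : S.errR n j ≤ S.δ ^ (-(S.e j : ℝ)) *
        (‖nonlin ρ S.τ S.φ (S.u n) j - nonlin ρ S.τ S.φ (S.mfe n) j‖ + ‖S.defect n j‖) := by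
      unfold errR
      rw [h2]
      exact mul_le_mul_of_nonneg_left (norm_add_le _ _) (S.δ_rpow_pos _).le
    rw [mul_add] at h4
    linarith
  refine (wnorm_mono h1).trans ((wnorm_add_le s _ _).trans (add_le_add ?_ ?_))
  · rw [wnorm_const_mul s hc]
    have h2 := wnorm_conv_le S.hs (S.errA n) (S.mfeVal n)
    have h3 := wnorm_conv_le S.hs (S.mfeVal n) (S.errA n)
    have h4 := wnorm_conv_le S.hs (S.errA n) (S.errA n)
    have h5 := wnorm_add_le s (fun j => ∑ i : S.J, S.errA n i * S.mfeVal n (j - i) +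
        ∑ i : S.J, S.mfeVal n i * S.errA n (j - i))
        (fun j => ∑ i : S.J, S.errA n i * S.errA n (j - i))
    have h6 := wnorm_add_le s (fun j => ∑ i : S.J, S.errA n i * S.mfeVal n (j - i))
        (fun j => ∑ i : S.J, S.mfeVal n i * S.errA n (j - i))
    unfold lipConst
    rw [mul_assoc]
    refine mul_le_mul_of_nonneg_left ?_ hc
    linarith
  · refine (S.wnorm_defect_le hn).trans_eq ?_
    unfold lipConst
    ring

/-- The factor `1 + T b (L' + 1)` in the discrete Gronwall inequality. -/
def stepFactor (s γ ρ B U : ℝ) : ℝ := 1 + 1 / γ * B * (lipConst s ρ B * (2 * U + 1) + 1)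

/-- The constant in the bound of the error of the modulated Fourier expansion. -/
def growthConst (s γ ρ B U : ℝ) : ℝ := Real.exp (B * ((lipConst s ρ B * (2 * U + 1) + 1) +
  (lipConst s ρ B * (2 * U + 1) * stepFactor s γ ρ B U + 1)))

theorem nh_le {n : ℕ} (hn : n * S.τ ≤ 1) : |((n : ℤ) : ℝ) * S.h| ≤ 1 := by
  have h1 := mul_nonneg (Nat.cast_nonneg (α := ℝ) n) S.h_pos.le
  rw [Int.cast_natCast, abs_of_nonneg h1]
  exact (mul_le_mul_of_nonneg_left S.h_le_τ (Nat.cast_nonneg n)).trans hn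

/-- The error of the modulated Fourier expansion. -/
theorem wnorm_errE_le {U : ℝ} (hU : mfeConst K γ * wnorm s S.Ptot ≤ U)
    (hsmall : stepFactor s γ ρ B U * growthConst s γ ρ B U *
      (lipConst s ρ B * wnorm s S.Ytot ^ 2 * S.δ ^ (K * (1 - 2 * ν))) ≤ 1) :
    ∀ n : ℕ, n * S.τ ≤ 1 → wnorm s (S.errE n) ≤ growthConst s γ ρ B U *
      (lipConst s ρ B * wnorm s S.Ytot ^ 2 * S.δ ^ (K * (1 - 2 * ν))) := by
  have hL := lipConst_nonneg S
  have hB := S.B_nonneg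
  have hc := mfeConst_nonneg S
  have hU0 : 0 ≤ U := (mul_nonneg hc (wnorm_nonneg _ _)).trans hU
  have hD : 0 ≤ lipConst s ρ B * wnorm s S.Ytot ^ 2 * S.δ ^ (K * (1 - 2 * ν)) :=
    mul_nonneg (mul_nonneg hL (sq_nonneg _)) (S.δ_rpow_pos _).le
  have hτB : 0 ≤ S.τ * B := mul_nonneg S.hτ.le hB
  refine gronwall (E := fun n => wnorm s (S.errE n)) (A := fun n => wnorm s (S.errA n))
    (R := fun n => wnorm s (S.errR n)) S.hτ S.τ_le hB hL hU0 hD (fun n => wnorm_nonneg _ _)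
    (fun n => wnorm_nonneg _ _) ?_ ?_ ?_ ?_ ?_ rfl rfl rfl hsmall
  · have : S.errE 0 = fun _ => 0 := by
      funext j
      unfold errE pairNorm
      rw [S.a_zero, S.b_zero]
      simp
    simp only [this, wnorm_zero]
  · intro n
    refine wnorm_mono fun j => ?_
    rw [abs_of_nonneg (S.errA_nonneg n j)]
    exact S.errA_le_errE n j
  · intro n
    refine (wnorm_mono (g := fun j => S.errE n j + S.τ * B * (S.errR n j + S.errR (n + 1) j))
      fun j => ?_).trans ?_
    · rw [abs_of_nonneg (S.errE_nonneg _ j)]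
      exact S.errE_step n j
    · refine (wnorm_add_le s _ _).trans (add_le_add le_rfl ?_)
      rw [wnorm_const_mul s hτB]
      exact mul_le_mul_of_nonneg_left (wnorm_add_le s _ _) hτB
  · intro n
    refine (wnorm_mono (g := fun j => S.errE n j + S.τ * B * S.errR n j) fun j => ?_).trans ?_
    · rw [abs_of_nonneg (S.errA_nonneg _ j)]
      exact S.errA_step n j
    · refine (wnorm_add_le s _ _).trans (add_le_add le_rfl ?_)
      rw [wnorm_const_mul s hτB]
  · intro n hn
    refine (S.wnorm_errR_le (S.nh_le hn)).trans (add_le_add (mul_le_mul_of_nonneg_left ?_ hL) le_rfl)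
    have h1 : wnorm s (S.mfeVal n) ≤ U := by
      refine le_trans ?_ hU
      rw [← wnorm_const_mul s hc]
      refine wnorm_mono fun j => ?_
      rw [abs_of_nonneg (S.mfeVal_nonneg n j)]
      refine le_trans ?_ (S.mfe_energy_scaled_le (S.nh_le hn) j)
      refine mul_le_mul_of_nonneg_left ?_ (S.δ_rpow_pos _).le
      rw [← S.norm_ω_mul]
      exact le_pairNorm_left _ _
    have h2 := wnorm_nonneg s (S.errA n)
    gcongr

end Setting

end TrigInt

namespace TrigInt
open Polynomial

namespace Setting

variable {K : ℕ} {ν s γ ρ B : ℝ} (S : Setting K ν s γ ρ B)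

/-! ### The bound of the mode energies -/

/-- The rescaled energy norm of the numerical solution. -/
def energyVal (n : ℕ) (j : S.J) : ℝ :=
  S.δ ^ (-(S.e j : ℝ)) * pairNorm ((S.ω j : ℂ) * S.u n j) (S.v n j)

theorem modeEnergy_eq (n : ℕ) (j : S.J) : modeEnergy ρ S.τ S.φ S.ψ S.u₀ S.v₀ n j =
    1 / 2 * pairNorm ((S.ω j : ℂ) * S.u n j) (S.v n j) ^ 2 := by
  rw [pairNorm_sq]
  unfold modeEnergy u v ω
  ring

theorem energyVal_le {n : ℕ} (hn : n * S.τ ≤ 1) (j : S.J) :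
    S.energyVal n j ≤ mfeConst K γ * S.Ptot j + S.errE n j := by
  have h1 := S.mfe_energy_scaled_le (S.nh_le hn) j
  have h2 := pairNorm_add_le ((S.ω j : ℂ) * S.mfe n j) (S.mfeVel n j)
    ((S.ω j : ℂ) * S.a n j) (S.b n j)
  have e1 : (S.ω j : ℂ) * S.mfe n j + (S.ω j : ℂ) * S.a n j = (S.ω j : ℂ) * S.u n j := by
    unfold a; ring
  have e2 : S.mfeVel n j + S.b n j = S.v n j := by unfold b; ring
  rw [e1, e2] at h2
  have h3 := mul_le_mul_of_nonneg_left h2 (S.δ_rpow_pos (-(S.e j : ℝ))).le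
  rw [mul_add] at h3
  exact h3.trans (add_le_add h1 le_rfl)

theorem weightedEnergy_le {U : ℝ} (hU : mfeConst K γ * wnorm s S.Ptot ≤ U) {n : ℕ}
    (hn : n * S.τ ≤ 1) (hE : wnorm s (S.errE n) ≤ 1) :
    weightedEnergy K ρ S.τ S.ε s S.φ S.ψ S.u₀ S.v₀ n ≤ 1 / 2 * (U + 1) ^ 2 := by
  have h0 : ∀ j, 0 ≤ S.energyVal n j := fun j =>
    mul_nonneg (S.δ_rpow_pos _).le (pairNorm_nonneg _ _)
  have h1 : wnorm s (S.energyVal n) ≤ U + 1 := by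
    refine (wnorm_mono (g := fun j => mfeConst K γ * S.Ptot j + S.errE n j) fun j => ?_).trans
      ((wnorm_add_le s _ _).trans (add_le_add ?_ hE))
    · rw [abs_of_nonneg (h0 j)]
      exact S.energyVal_le hn j
    · rwa [wnorm_const_mul s (mfeConst_nonneg S)]
  have h2 : weightedEnergy K ρ S.τ S.ε s S.φ S.ψ S.u₀ S.v₀ n ≤
      1 / 2 * wnorm s (S.energyVal n) ^ 2 := by
    rw [wnorm_sq, Finset.mul_sum]
    refine le_trans (le_of_eq ?_) (sum_fin_le_sum (f := fun j : S.J =>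
      1 / 2 * (weight s (idx j) * S.energyVal n j ^ 2)) fun j => by
        have := weight_pos s (idx j); positivity)
    unfold weightedEnergy
    refine Finset.sum_congr rfl fun l _ => ?_
    rw [S.modeEnergy_eq, energyVal, mul_pow, S.δ_neg_sq, e, S.idx_cast]
    ring
  refine h2.trans (mul_le_mul_of_nonneg_left (pow_le_pow_left₀ (wnorm_nonneg _ _) h1 2) (by norm_num))

/-! ### The first mode -/

theorem idx_of_e_eq_one {j : S.J} (h : S.e j = 1) : idx j = 1 := by
  have hK := S.hK
  unfold e profile at h
  split_ifs at h <;> omega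

theorem e_of_idx {j : S.J} (h : idx j = 1) : S.e j = 1 := by
  have hK := S.hK
  unfold e profile
  rw [h, if_neg (by norm_num), if_pos (by omega)]

theorem idx_one : idx (1 : S.J) = 1 := by
  have := idx_natCast (M := S.M) (l := 1) (by have := S.hK; have := S.hKM; omega)
  simpa using this

theorem natCast_ne_zero {c : ℕ} (h0 : 0 < c) (h : c < 6) : ((c : ℕ) : S.J) ≠ 0 := by
  intro h1
  have h2 := Nat.le_of_dvd h0 ((ZMod.natCast_eq_zero_iff c (2 * S.M)).1 h1)
  have := S.hK
  have := S.hKM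
  omega

/-- Two modes of index `±1` do not interact to a mode of index `±1`. -/
theorem not_idx_one {j j₁ : S.J} (h : idx j = 1) (h₁ : idx j₁ = 1) (h₂ : idx (j - j₁) = 1) :
    False := by
  have key : ∀ i : S.J, idx i = 1 → i = 1 ∨ i = -1 := fun i hi =>
    eq_or_eq_neg_of_idx_eq (hi.trans S.idx_one.symm)
  have h1 : (1 : S.J) ≠ 0 := by simpa using S.natCast_ne_zero (c := 1) (by norm_num) (by norm_num)
  have h3 : (3 : S.J) ≠ 0 := by simpa using S.natCast_ne_zero (c := 3) (by norm_num) (by norm_num)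
  have e := sub_add_cancel j j₁
  -- The eight sign patterns in `±1 ± 1 = ±1` lead to `1 = 0` or `3 = 0`, impossible modulo `2M ≥
  -- 6`.
  rcases key _ h with ha | ha <;> rcases key _ h₁ with hb | hb <;> rcases key _ h₂ with hc | hc <;>
    rw [hc, ha, hb] at e
  · exact h1 (by linear_combination e)
  · exact h1 (by linear_combination -e)
  · exact h1 (by linear_combination -e)
  · exact h3 (by linear_combination -e)
  · exact h3 (by linear_combination e)
  · exact h1 (by linear_combination e)
  · exact h1 (by linear_combination e)
  · exact h1 (by linear_combination -e)

theorem idx_of_o_eq_one {j : S.J} {k : S.V} (h : S.o j k = 1) : idx j = 1 := by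
  have h1 := S.e_le_o j k
  have h2 := S.e_pos j
  exact S.idx_of_e_eq_one (by omega)

theorem one_le_o (j : S.J) (k : S.V) : 1 ≤ S.o j k := order_pos S.hK j k

/-- Order `1` forces index `±1`, so two factors of order `1` would be two modes of index `±1`
producing a third. -/
theorem three_le_o_add {j : S.J} (hj : idx j = 1) (j₁ : S.J) (k₁ k₂ : S.V) :
    3 ≤ S.o j₁ k₁ + S.o (j - j₁) k₂ := by
  have h1 := S.one_le_o j₁ k₁
  have h2 := S.one_le_o (j - j₁) k₂
  by_contra h
  exact S.not_idx_one hj (S.idx_of_o_eq_one (by omega : S.o j₁ k₁ = 1))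
    (S.idx_of_o_eq_one (by omega : S.o (j - j₁) k₂ = 1))

theorem F_eq_zero_of_le_two {j : S.J} (hj : idx j = 1) (k : S.V) {m : ℕ} (hm : m ≤ 2) :
    S.F j k m = 0 :=
  S.F_eq_zero fun j₁ k₁ k₂ _ => by have := S.three_le_o_add hj j₁ k₁ k₂; omega

/-- At order `3` the two factors have orders summing to at least `3 = m₁ + m₂`, hence both are
leading and `C` is independent of `C₀`. The `4` counts the pairs with sum `3`. -/
theorem sum_G_three_le {j : S.J} (hj : idx j = 1) {C : ℝ}
    (hC : ∀ m < 2 * K, wnorm s (S.Lead m) ≤ C) :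
    ∑ k ∈ setK K j, S.G j k 3 ≤ 4 * (lipConst s ρ B * (C * C)) := by
  have hK := S.hK
  have hρ : 0 < √ρ := Real.sqrt_pos.2 S.hρ
  have h1 := S.sum_G_le (j := j) (T := setK K j) (m := 3)
    (a := fun j k m => 1 / √ρ * S.lead m j k)
    (fun j k m => mul_nonneg (by positivity) (S.lead_nonneg m j k)) (by
    intro j₁ k₁ hk₁ k₂ hk₂ _ m₁ m₂ hm₁₂
    have h3 := S.three_le_o_add hj j₁ k₁ k₂
    have hr : 0 ≤ S.amp j₁ k₁ m₁ * S.amp (j - j₁) k₂ m₂ *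
        (1 / √ρ * S.lead m₁ j₁ k₁ * (1 / √ρ * S.lead m₂ (j - j₁) k₂)) :=
      mul_nonneg (mul_pos (S.amp_pos _ _ _) (S.amp_pos _ _ _)).le
        (mul_nonneg (mul_nonneg (by positivity) (S.lead_nonneg _ _ _))
          (mul_nonneg (by positivity) (S.lead_nonneg _ _ _)))
    rcases lt_or_ge m₁ (S.o j₁ k₁) with h4 | h4
    · rw [S.y_eq_zero hk₁ h4, coeffNorm_zero, zero_mul]
      exact hr
    rcases lt_or_ge m₂ (S.o (j - j₁) k₂) with h5 | h5
    · rw [S.y_eq_zero hk₂ h5, coeffNorm_zero, mul_zero]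
      exact hr
    have e1 : S.lead m₁ j₁ k₁ = S.ny j₁ k₁ m₁ := by rw [lead, if_pos (by omega)]
    have e2 : S.lead m₂ (j - j₁) k₂ = S.ny (j - j₁) k₂ m₂ := by rw [lead, if_pos (by omega)]
    rw [e1, e2]
    refine (mul_le_mul (S.coeffNorm_y_le j₁ k₁ m₁) (S.coeffNorm_y_le (j - j₁) k₂ m₂)
      (coeffNorm_nonneg _) (mul_nonneg (S.amp_pos _ _ _).le
        (mul_nonneg (by positivity) (S.ny_nonneg _ _ _)))).trans_eq ?_
    ring)
  refine h1.trans ?_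
  have h2 : (1 / √ρ) * (1 / √ρ) = 1 / ρ := by
    rw [div_mul_div_comm, one_mul, Real.mul_self_sqrt S.hρ.le]
  simp only [← Finset.mul_sum]
  change B ^ 2 * ∑ p ∈ Finset.HasAntidiagonal.antidiagonal 3, ∑ j₁ : S.J,
    (1 / √ρ * S.Lead p.1 j₁) * (1 / √ρ * S.Lead p.2 (j - j₁)) ≤ _
  have h3 : ∀ (p : ℕ × ℕ) (j₁ : S.J), (1 / √ρ * S.Lead p.1 j₁) * (1 / √ρ * S.Lead p.2 (j - j₁)) =
      1 / ρ * (S.Lead p.1 j₁ * S.Lead p.2 (j - j₁)) := by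
    intro p j₁; rw [← h2]; ring
  simp only [h3, ← Finset.mul_sum]
  have h4 : ∀ p ∈ Finset.HasAntidiagonal.antidiagonal 3,
      ∑ j₁ : S.J, S.Lead p.1 j₁ * S.Lead p.2 (j - j₁) ≤ convConst s * (C * C) := by
    intro p hp
    have hp' : p.1 + p.2 = 3 := by simpa using hp
    have h5 := le_wnorm (by linarith [S.hs] : 0 ≤ s)
      (fun j => ∑ j₁ : S.J, S.Lead p.1 j₁ * S.Lead p.2 (j - j₁)) j
    refine (le_abs_self _).trans (h5.trans ((wnorm_conv_le S.hs _ _).trans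
      (mul_le_mul_of_nonneg_left ?_ (convConst_nonneg s))))
    exact mul_le_mul (hC _ (by omega)) (hC _ (by omega)) (wnorm_nonneg _ _)
      ((wnorm_nonneg _ _).trans (hC 0 (by omega)))
  have h6 := mul_le_mul_of_nonneg_left (mul_le_mul_of_nonneg_left (Finset.sum_le_sum h4)
    (one_div_pos.2 S.hρ).le) (sq_nonneg B)
  refine h6.trans (le_of_eq ?_)
  rw [Finset.sum_const, Finset.Nat.card_antidiagonal, nsmul_eq_mul]
  unfold lipConst
  push_cast
  ring

/-- The deviation of the modulated Fourier expansion from two harmonic oscillations. -/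
def residual (j : S.J) : ℝ := ∑ k ∈ S.off j, S.ω j * S.Q j k * coeffNorm (S.Z j k) +
  S.ω j * (coeffNorm (derivative (S.Z j (unitVec j))) +
    coeffNorm (derivative (S.Z j (-unitVec j))))

theorem residual_nonneg (j : S.J) : 0 ≤ S.residual j :=
  add_nonneg (Finset.sum_nonneg fun k _ => mul_nonneg (mul_pos (S.ω_pos j) (S.Q_pos j k)).le
    (coeffNorm_nonneg _)) (mul_nonneg (S.ω_pos j).le
      (add_nonneg (coeffNorm_nonneg _) (coeffNorm_nonneg _)))

theorem amp_three_le (j : S.J) (k : S.V) {m r : ℕ} (h : 1 + r ≤ m) :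
    S.amp j k m ≤ S.δ ^ (1 + r * (1 - 2 * ν)) := by
  unfold amp
  refine S.δ_rpow_anti ?_
  have h' : 1 + (r : ℝ) ≤ m := by exact_mod_cast h
  have h1 : (1 : ℝ) ≤ S.o j k := by exact_mod_cast S.one_le_o j k
  nlinarith [S.θ_pos, S.hν]

theorem amp_le_of_four_le (j : S.J) (k : S.V) {m : ℕ} (h : 4 ≤ m) :
    S.amp j k m ≤ S.δ ^ (1 + 2 * (1 - 2 * ν)) * S.δ ^ (1 - 2 * ν) := by
  refine (S.amp_three_le j k (r := 3) h).trans_eq ?_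
  rw [← Real.rpow_add S.δ_pos]
  congr 1
  push_cast
  ring

theorem amp_le_of_three_le (j : S.J) (k : S.V) {m : ℕ} (h : 3 ≤ m) :
    S.amp j k m ≤ S.δ ^ (1 + 2 * (1 - 2 * ν)) := by
  refine (S.amp_three_le j k (r := 2) h).trans_eq ?_
  congr 1

/-- Orders up to `2` vanish, order `3` is bounded through leading functions, and from order `4` on
an additional `δ^(1-2ν)` is available to absorb the crude bound. -/
theorem Z_off_first_le {j : S.J} (hj : idx j = 1) {k : S.V} (hk : k ∈ S.off j) :
    S.ω j * S.Q j k * coeffNorm (S.Z j k) ≤ S.δ ^ (1 + 2 * (1 - 2 * ν)) *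
      (solveConst K γ B * S.G j k 3 + 2 * K * (S.δ ^ (1 - 2 * ν) * S.N j k)) := by
  have hK := S.hK
  have h3K : 3 < 2 * K := by omega
  have hK1 : (1 : ℝ) ≤ 2 * K := by exact_mod_cast (by omega : 1 ≤ 2 * K)
  have hδ := fun x => (S.δ_rpow_pos x).le
  refine (S.Z_le_sum j k).trans ?_
  rw [← Finset.add_sum_erase _ _ (Finset.mem_range.2 h3K), mul_add]
  refine add_le_add ?_ ?_
  · exact mul_le_mul (S.amp_le_of_three_le j k le_rfl) (S.ny_off_le hk h3K) (S.ny_nonneg _ _ _)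
      (hδ _)
  · have h1 : ∑ m ∈ (Finset.range (2 * K)).erase 3, S.amp j k m * S.ny j k m ≤
        S.δ ^ (1 + 2 * (1 - 2 * ν)) * S.δ ^ (1 - 2 * ν) * S.N j k := by
      unfold N
      rw [Finset.mul_sum]
      refine le_trans ?_ (Finset.sum_le_sum_of_subset_of_nonneg (Finset.erase_subset 3 _)
        fun m _ _ => mul_nonneg (mul_nonneg (hδ _) (hδ _)) (S.ny_nonneg j k m))
      refine Finset.sum_le_sum fun m hm => ?_
      rw [Finset.mem_erase, Finset.mem_range] at hm
      rcases le_or_gt m 2 with h | h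
      · rw [S.ny_off_eq_zero hk hm.2 (S.F_eq_zero_of_le_two hj k h), mul_zero, mul_zero]
      · exact mul_le_mul_of_nonneg_right (S.amp_le_of_four_le j k (by omega)) (S.ny_nonneg j k m)
    refine h1.trans ?_
    rw [mul_assoc]
    exact mul_le_mul_of_nonneg_left (le_mul_of_one_le_left (mul_nonneg (hδ _) (S.N_nonneg j k)) hK1)
      (hδ _)

theorem derivative_Z_first_le {j : S.J} (hj : idx j = 1) {k : S.V} (hd : IsDiag j k) :
    S.ω j * coeffNorm (derivative (S.Z j k)) ≤ S.δ ^ (1 + 2 * (1 - 2 * ν)) *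
      (solveConst K γ B * S.G j k 3 + 2 * K * (S.δ ^ (1 - 2 * ν) * S.N j k)) := by
  have hK := S.hK
  have h3K : 3 < 2 * K := by omega
  have hk := hd.mem S.hK
  have hδ := fun x => (S.δ_rpow_pos x).le
  have h0 : S.ω j * coeffNorm (derivative (S.Z j k)) ≤
      ∑ m ∈ Finset.range (2 * K), S.ω j * coeffNorm (derivative (S.y j k m)) := by
    unfold Z
    rw [derivative_sum, ← Finset.mul_sum]
    exact mul_le_mul_of_nonneg_left (coeffNorm_sum _ _) (S.ω_pos j).le
  refine h0.trans ?_
  rw [← Finset.add_sum_erase _ _ (Finset.mem_range.2 h3K), mul_add]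
  refine add_le_add ?_ ?_
  · have h1 : S.ω j * coeffNorm (derivative (S.y j k 3)) = S.amp j k 3 * S.ny' j k 3 := by
      rw [ny', mul_div_cancel₀ _ (S.amp_pos j k 3).ne']
    rw [h1]
    exact mul_le_mul (S.amp_le_of_three_le j k le_rfl) (S.ny'_diag_le hd h3K) (S.ny'_nonneg _ _ _)
      (hδ _)
  · have h1 : S.δ ^ (1 + 2 * (1 - 2 * ν)) * (2 * K * (S.δ ^ (1 - 2 * ν) * S.N j k)) =
        ∑ m ∈ Finset.range (2 * K),
          2 * K * (S.δ ^ (1 + 2 * (1 - 2 * ν)) * S.δ ^ (1 - 2 * ν) * S.ny j k m) := by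
      unfold N
      rw [← Finset.mul_sum, ← Finset.mul_sum]
      ring
    rw [h1]
    refine le_trans ?_ (Finset.sum_le_sum_of_subset_of_nonneg (Finset.erase_subset 3 _)
      fun m _ _ => mul_nonneg (by positivity) (mul_nonneg (mul_nonneg (hδ _) (hδ _))
        (S.ny_nonneg j k m)))
    refine Finset.sum_le_sum fun m hm => ?_
    rw [Finset.mem_erase, Finset.mem_range] at hm
    rcases le_or_gt m 2 with h | h
    · rw [S.derivative_y_diag_eq_zero hd hm.2 (S.F_eq_zero_of_le_two hj k h), coeffNorm_zero,
        mul_zero]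
      exact mul_nonneg (by positivity) (mul_nonneg (mul_nonneg (hδ _) (hδ _)) (S.ny_nonneg j k m))
    · have h2 := coeffNorm_derivative_le (S.natDegree_y_le' hk hm.2)
      have h3 : S.ω j * coeffNorm (S.y j k m) ≤ S.amp j k m * S.ny j k m := by
        rw [← S.ω_mul_coeffNorm_le, mul_assoc]
        exact mul_le_mul_of_nonneg_left (le_mul_of_one_le_left (coeffNorm_nonneg _)
          (S.one_le_Q j k)) (S.ω_pos j).le
      have h4 := mul_le_mul_of_nonneg_right (S.amp_le_of_four_le j k (by omega : 4 ≤ m))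
        (S.ny_nonneg j k m)
      calc _ ≤ S.ω j * ((2 * K : ℕ) * coeffNorm (S.y j k m)) :=
            mul_le_mul_of_nonneg_left h2 (S.ω_pos j).le
        _ = 2 * K * (S.ω j * coeffNorm (S.y j k m)) := by push_cast; ring
        _ ≤ _ := mul_le_mul_of_nonneg_left (h3.trans h4) (by positivity)

theorem residual_first_le {j : S.J} (hj : idx j = 1) {W : ℝ}
    (hG : ∑ k ∈ setK K j, S.G j k 3 ≤ W) (hY : 2 * K * (S.δ ^ (1 - 2 * ν) * S.Ytot j) ≤ 1) :
    S.residual j ≤ S.δ ^ (1 + 2 * (1 - 2 * ν)) * (solveConst K γ B * W + 1) := by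
  have hs := solveConst_nonneg S
  have h1 := S.derivative_Z_first_le hj (Or.inl rfl : IsDiag j (unitVec j))
  have h2 := S.derivative_Z_first_le hj (Or.inr rfl : IsDiag j (-unitVec j))
  have h3 := Finset.sum_le_sum fun k (hk : k ∈ S.off j) => S.Z_off_first_le hj hk
  have h4 : S.residual j ≤ ∑ k ∈ setK K j, S.δ ^ (1 + 2 * (1 - 2 * ν)) *
      (solveConst K γ B * S.G j k 3 + 2 * K * (S.δ ^ (1 - 2 * ν) * S.N j k)) := by
    rw [S.sum_setK_eq, add_comm]
    unfold residual
    rw [mul_add]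
    exact add_le_add h3 (add_le_add h1 h2)
  refine h4.trans ?_
  rw [← Finset.mul_sum, Finset.sum_add_distrib, ← Finset.mul_sum, ← Finset.mul_sum,
    ← Finset.mul_sum]
  exact mul_le_mul_of_nonneg_left (add_le_add (mul_le_mul_of_nonneg_left hG hs) hY)
    (S.δ_rpow_pos _).le

end Setting

end TrigInt

namespace TrigInt
open Polynomial

theorem abs_half_sq_sub_le {a b c : ℝ} (hb : 0 ≤ b) (h1 : a ≤ b + c)
    (h2 : b ≤ a + c) (ha : 0 ≤ a) :
    |1 / 2 * a ^ 2 - 1 / 2 * b ^ 2| ≤ 1 / 2 * ((2 * b + c) * c) := by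
  have h : |a - b| ≤ c := abs_sub_le_iff.2 ⟨by linarith, by linarith⟩
  rw [show 1 / 2 * a ^ 2 - 1 / 2 * b ^ 2 = 1 / 2 * ((a + b) * (a - b)) by ring, abs_mul, abs_mul,
    abs_of_nonneg (by norm_num : (0 : ℝ) ≤ 1 / 2), abs_of_nonneg (add_nonneg ha hb)]
  exact mul_le_mul_of_nonneg_left (mul_le_mul (by linarith) h (abs_nonneg _) (by linarith))
    (by norm_num)

theorem pairNorm_neg (x y : ℂ) : pairNorm (-x) (-y) = pairNorm x y := by
  unfold pairNorm; rw [norm_neg, norm_neg]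

namespace Setting

variable {K : ℕ} {ν s γ ρ B : ℝ} (S : Setting K ν s γ ρ B)

/-! ### The two harmonic oscillations of a mode -/

/-- The oscillation of a mode with frequency vector `k`. -/
def osc (n : ℤ) (j : S.J) (k : S.V) : ℂ :=
  Complex.exp (Complex.I * ((S.α k * n : ℝ) : ℂ)) * (S.Z j k).eval ((n * S.h : ℝ) : ℂ)

theorem norm_osc (n : ℤ) (j : S.J) (k : S.V) :
    ‖S.osc n j k‖ = ‖(S.Z j k).eval ((n * S.h : ℝ) : ℂ)‖ := by
  rw [osc, norm_mul, norm_exp_I_mul, one_mul]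

theorem norm_osc_le {n : ℤ} (hn : |(n : ℝ) * S.h| ≤ 1) {j : S.J} {k : S.V} (hk : k ∈ setK K j) :
    S.ω j * ‖S.osc n j k‖ ≤ S.ω j * S.Q j k * coeffNorm (S.Z j k) := by
  have h2 := norm_eval_le (S.natDegree_Z_le hk) (x := ((n * S.h : ℝ) : ℂ)) le_rfl
    (by simpa using hn)
  rw [one_pow, one_mul] at h2
  rw [S.norm_osc]
  exact (mul_le_mul_of_nonneg_left h2 (S.ω_pos j).le).trans (S.ω_coeffNorm_Z_le j k)

/-- The position of the two oscillations with frequencies `±ω_j`. -/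
def oscPos (n : ℤ) (j : S.J) : ℂ :=
  (S.ω j : ℂ) * (S.osc n j (unitVec j) + S.osc n j (-unitVec j))

/-- The velocity of the two oscillations with frequencies `±ω_j`. -/
def oscVel (n : ℤ) (j : S.J) : ℂ :=
  (S.ω j : ℂ) * (Complex.I * (S.osc n j (unitVec j) - S.osc n j (-unitVec j)))

/-- By the parallelogram law the energy of the two oscillations with frequencies `±ω_j` contains no
mixed term. -/
theorem pairNorm_osc_sq (n : ℤ) (j : S.J) :
    pairNorm (S.oscPos n j) (S.oscVel n j) ^ 2 = 2 * S.diagEnergy j (n * S.h) := by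
  have h := parallelogram_law_with_norm ℝ (S.osc n j (unitVec j)) (S.osc n j (-unitVec j))
  have h1 := S.norm_osc n j (unitVec j)
  have h2 := S.norm_osc n j (-unitVec j)
  rw [pairNorm_sq, oscPos, oscVel, S.norm_ω_mul, S.norm_ω_mul, norm_mul, Complex.norm_I, one_mul,
    diagEnergy, ← h1, ← h2]
  generalize ‖S.osc n j (unitVec j)‖ = a at *
  generalize ‖S.osc n j (-unitVec j)‖ = b at *
  linear_combination (S.ω j) ^ 2 * h

theorem pairNorm_osc_le {n : ℤ} (hn : |(n : ℝ) * S.h| ≤ 1) (j : S.J) :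
    pairNorm (S.oscPos n j) (S.oscVel n j) ≤ 2 * (S.δ ^ (S.e j : ℝ) * S.Ptot j) := by
  have h1 := S.norm_osc_le hn (mem_unitVec (by linarith [S.hK] : 2 ≤ K) j).1
  have h2 := S.norm_osc_le hn (mem_unitVec (by linarith [S.hK] : 2 ≤ K) j).2
  have h3 := S.sum_Z_le j
  rw [S.sum_setK_eq] at h3
  have h4 : 0 ≤ ∑ k ∈ S.off j, S.ω j * S.Q j k * coeffNorm (S.Z j k) :=
    Finset.sum_nonneg fun k _ => mul_nonneg (mul_pos (S.ω_pos j) (S.Q_pos j k)).le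
      (coeffNorm_nonneg _)
  refine (pairNorm_le _ _).trans ?_
  have h5 := mul_le_mul_of_nonneg_left (norm_add_le (S.osc n j (unitVec j))
    (S.osc n j (-unitVec j))) (S.ω_pos j).le
  have h6 := mul_le_mul_of_nonneg_left (norm_sub_le (S.osc n j (unitVec j))
    (S.osc n j (-unitVec j))) (S.ω_pos j).le
  rw [oscPos, oscVel, S.norm_ω_mul, S.norm_ω_mul, norm_mul, Complex.norm_I, one_mul]
  generalize S.ω j * S.Q j (unitVec j) * coeffNorm (S.Z j (unitVec j)) = c at *
  generalize S.ω j * S.Q j (-unitVec j) * coeffNorm (S.Z j (-unitVec j)) = d at *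
  generalize S.osc n j (unitVec j) = a at *
  generalize S.osc n j (-unitVec j) = b at *
  rw [mul_add] at h5 h6
  linarith

theorem symmDiff_sub_le {j : S.J} {k : S.V} (hk : k ∈ setK K j) {x : ℝ} (hx : |x| ≤ 1) :
    S.ω j / (2 * |Real.sin (S.β j)|) * ‖S.symmDiff j k x -
        2 * Complex.I * (Real.sin (S.α k) : ℂ) * (S.Z j k).eval (x : ℂ)‖ ≤
      (mfeConst K γ - 1) * (S.ω j * coeffNorm (derivative (S.Z j k))) := by
  have hγ := S.hγ
  have hsin := S.sin_β_pos j
  have hω := S.ω_pos j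
  have h1 := norm_symm_diff_sub_le (S.natDegree_Z_le hk) (x := x) (h := S.h) (α := S.α k)
    (H := 1 / γ) le_rfl hx S.h_pos.le S.h_le
  have hE := evalConst_nonneg zero_le_one (by positivity : 0 ≤ 1 / γ) (2 * K)
  have hr := resConst_nonneg S
  have hp := coeffNorm_nonneg (derivative (S.Z j k))
  have hK1 : (1 : ℝ) ≤ 2 * K := by
    have := S.hK
    exact_mod_cast (by omega : 1 ≤ 2 * K)
  have h2 : evalConst 1 (1 / γ) (2 * K) * resConst γ ≤ mfeConst K γ - 1 := by
    have h3 : 0 ≤ evalConst 1 (1 / γ) (2 * K) * resConst γ := mul_nonneg hE hr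
    unfold mfeConst
    nlinarith
  refine le_trans ?_ (mul_le_mul_of_nonneg_right h2 (mul_nonneg hω.le hp))
  rw [div_mul_eq_mul_div, div_le_iff₀ (by positivity)]
  refine (mul_le_mul_of_nonneg_left h1 hω.le).trans ?_
  have h4 := mul_le_mul_of_nonneg_left (S.h_le_resConst j)
    (mul_nonneg (mul_nonneg hω.le hE) hp)
  linarith

/-- With frozen diagonal coefficients the symmetric difference at angle `±β` gives the velocity
factor `±i ω_j` exactly. What is left are derivatives of the diagonal functions and the off-diagonal
functions. -/
theorem osc_sub_le {n : ℤ} (hn : |(n : ℝ) * S.h| ≤ 1) (j : S.J) :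
    pairNorm ((S.ω j : ℂ) * S.mfe n j - S.oscPos n j) (S.mfeVel n j - S.oscVel n j) ≤
      mfeConst K γ * S.residual j := by
  have hω := (S.ω_pos j).le
  have hoff : 0 ≤ ∑ k ∈ S.off j, S.ω j * S.Q j k * coeffNorm (S.Z j k) :=
    Finset.sum_nonneg fun k _ => mul_nonneg (mul_pos (S.ω_pos j) (S.Q_pos j k)).le
      (coeffNorm_nonneg _)
  have h1 : ‖(S.ω j : ℂ) * S.mfe n j - S.oscPos n j‖ ≤
      ∑ k ∈ S.off j, S.ω j * S.Q j k * coeffNorm (S.Z j k) := by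
    have e1 : S.mfe n j = ∑ k ∈ setK K j, S.osc n j k := rfl
    rw [oscPos, ← mul_sub, S.norm_ω_mul, e1, S.sum_setK_eq, add_sub_cancel_left]
    refine (mul_le_mul_of_nonneg_left (norm_sum_le _ _) hω).trans ?_
    rw [Finset.mul_sum]
    exact Finset.sum_le_sum fun k hk => S.norm_osc_le hn (S.mem_off.1 hk).1
  have hsin := Complex.ofReal_ne_zero.2 (S.sin_β_ne j)
  have e2 : S.mfeVel n j - S.oscVel n j = (S.ω j : ℂ) / (2 * (Real.sin (S.β j) : ℂ)) *
      (Complex.exp (Complex.I * ((S.α (unitVec j) * n : ℝ) : ℂ)) *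
        (S.symmDiff j (unitVec j) (n * S.h) - 2 * Complex.I * (Real.sin (S.α (unitVec j)) : ℂ) *
          (S.Z j (unitVec j)).eval ((n * S.h : ℝ) : ℂ)) +
      Complex.exp (Complex.I * ((S.α (-unitVec j) * n : ℝ) : ℂ)) *
        (S.symmDiff j (-unitVec j) (n * S.h) - 2 * Complex.I * (Real.sin (S.α (-unitVec j)) : ℂ) *
          (S.Z j (-unitVec j)).eval ((n * S.h : ℝ) : ℂ)) +
      ∑ k ∈ S.off j, Complex.exp (Complex.I * ((S.α k * n : ℝ) : ℂ)) *
        S.symmDiff j k (n * S.h)) := by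
    have e3 : Real.sin (S.α (unitVec j)) = Real.sin (S.β j) := by rw [S.α_unitVec]
    have e4 : Real.sin (S.α (-unitVec j)) = -Real.sin (S.β j) := by
      rw [S.α_neg, S.α_unitVec, Real.sin_neg]
    rw [S.mfeVel_eq, S.sum_setK_eq, oscVel, osc, osc, e3, e4]
    generalize Complex.exp (Complex.I * ((S.α (unitVec j) * n : ℝ) : ℂ)) = a
    generalize Complex.exp (Complex.I * ((S.α (-unitVec j) * n : ℝ) : ℂ)) = b
    generalize (S.Z j (unitVec j)).eval ((n * S.h : ℝ) : ℂ) = c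
    generalize (S.Z j (-unitVec j)).eval ((n * S.h : ℝ) : ℂ) = d
    generalize ∑ k ∈ S.off j, Complex.exp (Complex.I * ((S.α k * n : ℝ) : ℂ)) *
      S.symmDiff j k (n * S.h) = d'
    push_cast at hsin ⊢
    field_simp
    ring
  have h2 : ‖S.mfeVel n j - S.oscVel n j‖ ≤ (mfeConst K γ - 1) * S.residual j := by
    have hd₁ := S.symmDiff_sub_le (mem_unitVec (by linarith [S.hK] : 2 ≤ K) j).1 hn
    have hd₂ := S.symmDiff_sub_le (mem_unitVec (by linarith [S.hK] : 2 ≤ K) j).2 hn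
    have hsum : S.ω j / (2 * |Real.sin (S.β j)|) *
        ‖∑ k ∈ S.off j, Complex.exp (Complex.I * ((S.α k * n : ℝ) : ℂ)) *
          S.symmDiff j k (n * S.h)‖ ≤
        (mfeConst K γ - 1) * ∑ k ∈ S.off j, S.ω j * S.Q j k * coeffNorm (S.Z j k) := by
      refine (mul_le_mul_of_nonneg_left (norm_sum_le _ _) (div_nonneg hω
        (mul_nonneg zero_le_two (abs_nonneg _)))).trans ?_
      rw [Finset.mul_sum, Finset.mul_sum]
      refine Finset.sum_le_sum fun k hk => ?_
      rw [norm_mul, norm_exp_I_mul, one_mul]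
      exact S.symmDiff_le (S.mem_off.1 hk).1 hn
    rw [e2, norm_mul, S.norm_vel_factor]
    refine (mul_le_mul_of_nonneg_left norm_add₃_le (div_nonneg hω
        (mul_nonneg zero_le_two (abs_nonneg _)))).trans ?_
    rw [norm_mul, norm_mul, norm_exp_I_mul, norm_exp_I_mul, one_mul, one_mul, mul_add, mul_add,
      residual]
    refine (add_le_add (add_le_add hd₁ hd₂) hsum).trans_eq ?_
    ring
  refine (pairNorm_le _ _).trans ((add_le_add h1 h2).trans ?_)
  have h3 : ∑ k ∈ S.off j, S.ω j * S.Q j k * coeffNorm (S.Z j k) ≤ S.residual j :=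
    le_add_of_nonneg_right (mul_nonneg hω (add_nonneg (coeffNorm_nonneg _) (coeffNorm_nonneg _)))
  linarith

/-! ### The energy in the first mode -/

theorem idx_eq_one_iff (j : S.J) : idx j = 1 ↔ j = 1 ∨ j = -1 := by
  constructor
  · intro h
    exact eq_or_eq_neg_of_idx_eq (h.trans S.idx_one.symm)
  · rintro (rfl | rfl)
    · exact S.idx_one
    · rw [idx_neg, S.idx_one]

theorem one_ne_neg_one : (1 : S.J) ≠ -1 := by
  intro h
  refine S.natCast_ne_zero (c := 2) (by norm_num) (by norm_num) ?_
  push_cast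
  linear_combination h

theorem sum_ite_idx_one (f : S.J → ℝ) :
    ∑ j : S.J, (if idx j = 1 then f j else 0) = f 1 + f (-1) := by
  simp only [S.idx_eq_one_iff]
  rw [← Finset.sum_filter, show (Finset.univ.filter fun j : S.J => j = 1 ∨ j = -1) = {1, -1} by
    ext; simp, Finset.sum_pair S.one_ne_neg_one]

/-- The conjugation symmetry interchanges the two squares. -/
theorem diagEnergy_neg (j : S.J) (x : ℝ) : S.diagEnergy (-j) x = S.diagEnergy j x := by
  have h1 := S.eval_Z_neg (mem_unitVec (by linarith [S.hK] : 2 ≤ K) j).1 x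
  have h2 := S.eval_Z_neg (mem_unitVec (by linarith [S.hK] : 2 ≤ K) j).2 x
  rw [neg_neg] at h2
  unfold diagEnergy
  rw [unitVec_neg, S.ω_neg, h1, h2, RCLike.norm_conj, RCLike.norm_conj, add_comm (_ ^ 2)]

/-- A difference of squares: the sum of the norms is of size `δ` and their difference of size
`δ^(1+2(1-2ν))`. -/
theorem modeEnergy_sub_le {j : S.J} (hj : idx j = 1) {n : ℕ} (hn : n * S.τ ≤ 1) {U e₀ : ℝ}
    (hU : S.Ptot j ≤ U)
    (he : S.errE n j + mfeConst K γ * (S.δ ^ (-1 : ℝ) * S.residual j) ≤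
      S.δ ^ (2 * (1 - 2 * ν)) * e₀) (he₀ : 0 ≤ e₀) :
    |modeEnergy ρ S.τ S.φ S.ψ S.u₀ S.v₀ n j - S.diagEnergy j ((n : ℤ) * S.h)| ≤
      S.δ ^ (2 + 2 * (1 - 2 * ν)) * (1 / 2 * (e₀ * (4 * U + e₀))) := by
  have he1 : S.e j = 1 := S.e_of_idx hj
  have hδ := fun x => (S.δ_rpow_pos x).le
  have hx := S.nh_le hn
  have h1 := S.osc_sub_le hx j
  have h2 := S.pairNorm_osc_le hx j
  rw [he1, Nat.cast_one, Real.rpow_one] at h2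
  have hE : pairNorm ((S.ω j : ℂ) * S.a n j) (S.b n j) = S.δ * S.errE n j := by
    rw [errE, he1, Nat.cast_one, Real.rpow_neg_one, mul_inv_cancel_left₀ S.δ_pos.ne']
  have hres : S.residual j = S.δ * (S.δ ^ (-1 : ℝ) * S.residual j) := by
    rw [Real.rpow_neg_one, mul_inv_cancel_left₀ S.δ_pos.ne']
  set c := S.δ * (S.δ ^ (2 * (1 - 2 * ν)) * e₀) with hc
  have hc0 : 0 ≤ c := mul_nonneg S.δ_pos.le (mul_nonneg (hδ _) he₀)
  have hpert : pairNorm ((S.ω j : ℂ) * S.u n j - S.oscPos n j) (S.v n j - S.oscVel n j) ≤ c := by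
    have h3 := pairNorm_add_le ((S.ω j : ℂ) * S.a n j) (S.b n j)
      ((S.ω j : ℂ) * S.mfe n j - S.oscPos n j) (S.mfeVel n j - S.oscVel n j)
    have e1 : (S.ω j : ℂ) * S.a n j + ((S.ω j : ℂ) * S.mfe n j - S.oscPos n j) =
      (S.ω j : ℂ) * S.u n j - S.oscPos n j := by unfold a; ring
    have e2 : S.b n j + (S.mfeVel n j - S.oscVel n j) = S.v n j - S.oscVel n j := by
      unfold b; ring
    rw [e1, e2, hE] at h3
    refine h3.trans ((add_le_add le_rfl h1).trans ?_)
    rw [hres, hc]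
    refine le_trans (le_of_eq ?_) (mul_le_mul_of_nonneg_left he S.δ_pos.le)
    ring
  have h4 := pairNorm_add_le (S.oscPos n j) (S.oscVel n j)
    ((S.ω j : ℂ) * S.u n j - S.oscPos n j) (S.v n j - S.oscVel n j)
  have h5 := pairNorm_add_le ((S.ω j : ℂ) * S.u n j) (S.v n j)
    (-((S.ω j : ℂ) * S.u n j - S.oscPos n j)) (-(S.v n j - S.oscVel n j))
  rw [pairNorm_neg] at h5
  rw [add_sub_cancel, add_sub_cancel] at h4
  rw [← sub_eq_add_neg, ← sub_eq_add_neg, sub_sub_cancel, sub_sub_cancel] at h5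
  have h6 := abs_half_sq_sub_le (pairNorm_nonneg _ _) (h4.trans (add_le_add le_rfl hpert))
    (h5.trans (add_le_add le_rfl hpert)) (pairNorm_nonneg _ _)
  rw [S.pairNorm_osc_sq, ← S.modeEnergy_eq, ← mul_assoc, one_div, inv_mul_cancel₀ two_ne_zero,
    one_mul, ← one_div] at h6
  refine h6.trans ?_
  have hU0 : 0 ≤ U := (S.Ptot_nonneg j).trans hU
  have h7 : 2 * pairNorm (S.oscPos n j) (S.oscVel n j) + c ≤ S.δ * (4 * U + e₀) := by
    have h8 := mul_le_mul_of_nonneg_left hU S.δ_pos.le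
    have h9 : S.δ ^ (2 * (1 - 2 * ν)) * e₀ ≤ 1 * e₀ :=
      mul_le_mul_of_nonneg_right (Real.rpow_le_one S.δ_pos.le S.δ_le_one
        (by linarith [S.θ_pos])) he₀
    have h10 := mul_le_mul_of_nonneg_left h9 S.δ_pos.le
    rw [hc]
    linarith
  refine (mul_le_mul_of_nonneg_left (mul_le_mul_of_nonneg_right h7 hc0) (by norm_num)).trans_eq ?_
  rw [hc, Real.rpow_add S.δ_pos]
  norm_num
  ring

theorem diagErr_le_residual (j : S.J) :
    S.diagErr j ≤ S.δ ^ (S.e j : ℝ) * S.Ptot j * S.residual j := by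
  have h3 := S.sum_Z_le j
  rw [S.sum_setK_eq] at h3
  have h4 : 0 ≤ ∑ k ∈ S.off j, S.ω j * S.Q j k * coeffNorm (S.Z j k) :=
    Finset.sum_nonneg fun k _ => mul_nonneg (mul_pos (S.ω_pos j) (S.Q_pos j k)).le
      (coeffNorm_nonneg _)
  have h1 := S.ω_coeffNorm_Z_le j (unitVec j)
  have h2 := S.ω_coeffNorm_Z_le j (-unitVec j)
  have h5 : S.ω j * (coeffNorm (derivative (S.Z j (unitVec j))) +
    coeffNorm (derivative (S.Z j (-unitVec j)))) ≤ S.residual j := le_add_of_nonneg_left h4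
  have ha := coeffNorm_nonneg (S.Z j (unitVec j))
  have hb := coeffNorm_nonneg (S.Z j (-unitVec j))
  have hc := coeffNorm_nonneg (derivative (S.Z j (unitVec j)))
  have hd := coeffNorm_nonneg (derivative (S.Z j (-unitVec j)))
  have hω := S.ω_pos j
  unfold diagErr
  generalize S.ω j * S.Q j (unitVec j) * coeffNorm (S.Z j (unitVec j)) = A at *
  generalize S.ω j * S.Q j (-unitVec j) * coeffNorm (S.Z j (-unitVec j)) = A' at *
  generalize coeffNorm (derivative (S.Z j (unitVec j))) = c at *
  generalize coeffNorm (derivative (S.Z j (-unitVec j))) = d at *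
  generalize coeffNorm (S.Z j (unitVec j)) = a at *
  generalize coeffNorm (S.Z j (-unitVec j)) = b at *
  have h6 : S.ω j * a + S.ω j * b ≤ S.δ ^ (S.e j : ℝ) * S.Ptot j := by linarith
  have h7 := mul_le_mul h6 h5 (by positivity) (mul_nonneg (S.δ_rpow_pos _).le (S.Ptot_nonneg j))
  refine le_trans ?_ h7
  have h8 := mul_nonneg ha hd
  have h9 := mul_nonneg hb hc
  nlinarith [mul_nonneg (sq_nonneg (S.ω j)) (add_nonneg h8 h9)]

/-- For order `1` the index is `±1`, and nothing appears before order `3`; otherwise the order is at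
least `2`. Either way the square is of size `δ^(2+2(1-2ν))`, as needed for the first
almost-invariant energy. -/
theorem Z_off_le_P {j : S.J} {k : S.V} (hk : k ∈ S.off j) :
    S.ω j * S.Q j k * coeffNorm (S.Z j k) ≤ S.δ ^ (1 + (1 - 2 * ν)) * S.P j k := by
  have hν := S.hν
  rcases (S.one_le_o j k).eq_or_lt with h | h
  · have hj := S.idx_of_o_eq_one h.symm
    refine (S.Z_le_of (a := S.δ ^ (1 + 2 * (1 - 2 * ν))) fun m hm => ?_).trans ?_
    · rcases le_or_gt m 2 with h2 | h2
      · exact Or.inl (S.ny_off_eq_zero hk hm (S.F_eq_zero_of_le_two hj k h2))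
      · exact Or.inr (S.amp_le_of_three_le j k h2)
    · rw [show 1 + 2 * (1 - 2 * ν) = (1 + (1 - 2 * ν)) + (1 - 2 * ν) by ring,
        Real.rpow_add S.δ_pos, mul_assoc]
      exact mul_le_mul_of_nonneg_left (le_add_of_nonneg_left (S.ny_nonneg _ _ _))
        (S.δ_rpow_pos _).le
  · refine (S.Z_le_P (S.mem_off.1 hk).1).trans
      (mul_le_mul_of_nonneg_right (S.δ_rpow_anti ?_) (S.P_nonneg j k))
    have : (2 : ℝ) ≤ S.o j k := by exact_mod_cast h
    linarith

theorem off_term_le_P (l : Fin (S.M + 1)) {j : S.J} {k : S.V} (hk : k ∈ S.off j) :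
    |(k l : ℝ)| * freq ρ l * (S.ω j * (S.Q j k * coeffNorm (S.Z j k) ^ 2)) ≤
      couplingConst K s ρ * S.δ ^ (2 + 2 * (1 - 2 * ν)) * (weight s (idx j) * S.P j k ^ 2) := by
  have hs : 0 ≤ s := by linarith [S.hs]
  have hω := S.ω_pos j
  have hZ := coeffNorm_nonneg (S.Z j k)
  have hQ := S.one_le_Q j k
  have hf := freq_pos S.hρ (l : ℕ)
  have hc := couplingConst_nonneg K (s := s) S.hρ
  have hw := (weight_pos s (idx j)).le
  have h1 := sum_weight_freq_le S.hK hs S.hρ (S.mem_off.1 hk).1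
  have h2 : |(k l : ℝ)| * freq ρ l ≤ couplingConst K s ρ * (S.ω j * weight s (idx j)) := by
    refine le_trans ?_ ((Finset.single_le_sum
      (f := fun l : Fin (S.M + 1) => |(k l : ℝ)| * (freq ρ l * weight s l))
      (fun i _ => mul_nonneg (abs_nonneg _)
        (mul_nonneg (freq_pos S.hρ _).le (weight_pos s _).le)) (Finset.mem_univ l)).trans h1)
    exact mul_le_mul_of_nonneg_left (le_mul_of_one_le_right hf.le (one_le_weight hs _))
      (abs_nonneg _)
  have h3 := pow_le_pow_left₀ (mul_nonneg (mul_nonneg hω.le (S.Q_pos j k).le) hZ)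
    (S.Z_off_le_P hk) 2
  have h4 : S.ω j * (S.ω j * (S.Q j k * coeffNorm (S.Z j k) ^ 2)) ≤
      (S.ω j * S.Q j k * coeffNorm (S.Z j k)) ^ 2 := by
    have h5 : 0 ≤ S.ω j ^ 2 * coeffNorm (S.Z j k) ^ 2 := by positivity
    have h6 : S.Q j k ≤ S.Q j k ^ 2 := by nlinarith
    nlinarith [mul_le_mul_of_nonneg_left h6 h5]
  have h7 := mul_le_mul_of_nonneg_left (h4.trans h3) (mul_nonneg hc hw)
  have h8 : 0 ≤ S.ω j * (S.Q j k * coeffNorm (S.Z j k) ^ 2) :=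
    mul_nonneg hω.le (mul_nonneg (S.Q_pos j k).le (sq_nonneg _))
  have h9 : (S.δ ^ (1 + (1 - 2 * ν))) ^ 2 = S.δ ^ (2 + 2 * (1 - 2 * ν)) := by
    rw [← Real.rpow_natCast, ← Real.rpow_mul S.δ_pos.le]
    congr 1; push_cast; ring
  rw [mul_pow, h9] at h7
  refine (mul_le_mul_of_nonneg_right h2 h8).trans ?_
  calc _ = couplingConst K s ρ * weight s (idx j) *
        (S.ω j * (S.ω j * (S.Q j k * coeffNorm (S.Z j k) ^ 2))) := by ring
    _ ≤ _ := h7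
    _ = _ := by ring

theorem sum_off_term_le (l : Fin (S.M + 1)) :
    ∑ j : S.J, ∑ k ∈ S.off j, |(k l : ℝ)| * freq ρ l *
      (S.ω j * (S.Q j k * coeffNorm (S.Z j k) ^ 2)) ≤
      couplingConst K s ρ * S.δ ^ (2 + 2 * (1 - 2 * ν)) * wnorm s S.Ptot ^ 2 := by
  have hc := couplingConst_nonneg K (s := s) S.hρ
  rw [wnorm_sq, Finset.mul_sum]
  refine Finset.sum_le_sum fun j _ => (Finset.sum_le_sum fun k hk => S.off_term_le_P l hk).trans ?_
  rw [← Finset.mul_sum, ← Finset.mul_sum]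
  refine mul_le_mul_of_nonneg_left (mul_le_mul_of_nonneg_left ?_ (weight_pos s _).le)
    (mul_nonneg hc (S.δ_rpow_pos _).le)
  refine (sum_sq_le_sq_sum _ fun k _ => S.P_nonneg j k).trans ?_
  refine pow_le_pow_left₀ (Finset.sum_nonneg fun k _ => S.P_nonneg j k) ?_ 2
  exact Finset.sum_le_sum_of_subset_of_nonneg (fun k hk => (S.mem_off.1 hk).1)
    fun k _ _ => S.P_nonneg j k

theorem almostInv_one_sub_le {l : Fin (S.M + 1)} (hl : (l : ℕ) = 1) {t : ℝ}
    (hx : |S.ε ^ (ν / 2) * t| ≤ 1) {U W : ℝ} (hU : wnorm s S.Ptot ≤ U)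
    (hW : ∀ j : S.J, idx j = 1 → S.residual j ≤ S.δ ^ (1 + 2 * (1 - 2 * ν)) * W) :
    ‖almostInv K ρ S.τ S.ε ν S.z l t - ((S.diagEnergy 1 (S.ε ^ (ν / 2) * t) : ℝ) : ℂ)‖ ≤
      S.δ ^ (2 + 2 * (1 - 2 * ν)) *
        (1 / 2 * (invarConst K γ 1 * (2 * U * W + couplingConst K s ρ * U ^ 2))) := by
  have hs : 0 ≤ s := by linarith [S.hs]
  have hI := invarConst_nonneg S le_rfl
  have hU0 : 0 ≤ U := (wnorm_nonneg _ _).trans hU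
  have h1 := S.almostInv_sub_le l le_rfl hx
  rw [hl, Finset.sum_add_distrib] at h1
  rw [S.sum_ite_idx_one (fun j => S.diagEnergy j (S.ε ^ (ν / 2) * t)), S.sum_ite_idx_one,
    S.diagEnergy_neg, ← two_mul, ← mul_assoc, one_div, inv_mul_cancel₀ two_ne_zero, one_mul,
    ← one_div] at h1
  refine h1.trans ?_
  have h2 := (S.sum_off_term_le l).trans (mul_le_mul_of_nonneg_left
    (pow_le_pow_left₀ (wnorm_nonneg _ _) hU 2)
    (mul_nonneg (couplingConst_nonneg K (s := s) S.hρ) (S.δ_rpow_pos _).le))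
  rw [hl] at h2
  have h3 : ∀ j : S.J, idx j = 1 → S.diagErr j ≤ S.δ ^ (2 + 2 * (1 - 2 * ν)) * (U * W) := by
    intro j hj
    have h4 := S.diagErr_le_residual j
    rw [S.e_of_idx hj, Nat.cast_one, Real.rpow_one] at h4
    have h5 : S.Ptot j ≤ U := (le_abs_self _).trans ((le_wnorm hs S.Ptot j).trans hU)
    have h6 := mul_le_mul (mul_le_mul_of_nonneg_left h5 S.δ_pos.le) (hW j hj) (S.residual_nonneg j)
      (mul_nonneg S.δ_pos.le hU0)
    have h7 : S.δ ^ (2 + 2 * (1 - 2 * ν)) = S.δ * S.δ ^ (1 + 2 * (1 - 2 * ν)) := by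
      rw [← Real.rpow_one_add' S.δ_pos.le (by linarith [S.θ_pos])]
      congr 1; ring
    refine h4.trans (h6.trans_eq ?_)
    rw [h7]
    ring
  have h4 := h3 1 S.idx_one
  have h5 := h3 (-1) (by rw [idx_neg, S.idx_one])
  have h6 := mul_le_mul_of_nonneg_left (mul_le_mul_of_nonneg_left (add_le_add (add_le_add h4 h5) h2)
    hI) (by norm_num : (0 : ℝ) ≤ 1 / 2)
  refine h6.trans_eq ?_
  ring

/-! ### The bounds with explicit constants -/

/-- The constant in the bound of the majorant of the modulated Fourier expansion. -/
def majorantConst (K : ℕ) (C : ℝ) : ℝ := 2 * K * C + 1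

/-- The constant in the bound of the deviation from harmonic oscillations in the first mode. -/
def residualConst (K : ℕ) (s γ ρ B C : ℝ) : ℝ :=
  solveConst K γ B * (4 * (lipConst s ρ B * (C * C))) + 1

/-- The constant in the bound of the mode energies. -/
def energyConst (K : ℕ) (γ C : ℝ) : ℝ := 1 / 2 * (mfeConst K γ * majorantConst K C + 1) ^ 2

/-- The constant in the bound of the deviation of the numerical solution in the first mode. -/
def deviationConst (K : ℕ) (s γ ρ B C : ℝ) : ℝ := 1 + mfeConst K γ * residualConst K s γ ρ B C

/-- The constant in the bound of the variation of the energy in the first mode. -/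
def variationConst (K : ℕ) (s γ ρ B C : ℝ) : ℝ :=
  1 / 2 * (deviationConst K s γ ρ B C * (4 * majorantConst K C + deviationConst K s γ ρ B C)) +
  1 / 2 * (invarConst K γ 1 * (2 * majorantConst K C * residualConst K s γ ρ B C +
    couplingConst K s ρ * majorantConst K C ^ 2))

/-- The constant in the bound of the error of the modulated Fourier expansion. -/
def errorConst (K : ℕ) (s γ ρ B C C' : ℝ) : ℝ :=
  growthConst s γ ρ B (mfeConst K γ * majorantConst K C) * (lipConst s ρ B * C' ^ 2)

theorem energy_bounds {C C' : ℝ} (hC : ∀ m < 2 * K, wnorm s (S.Lead m) ≤ C)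
    (hC' : wnorm s S.Ytot ≤ C') (h1 : 2 * K * C' * S.δ ^ (1 - 2 * ν) ≤ 1)
    (h2 : errorConst K s γ ρ B C C' * S.δ ^ (1 - 2 * ν) ≤ 1)
    (h3 : stepFactor s γ ρ B (mfeConst K γ * majorantConst K C) *
      errorConst K s γ ρ B C C' * S.δ ^ (1 - 2 * ν) ≤ 1) {l : Fin (S.M + 1)} (hl : (l : ℕ) = 1)
    {n : ℕ} (hn : n * S.τ ≤ 1) :
    weightedEnergy K ρ S.τ S.ε s S.φ S.ψ S.u₀ S.v₀ n ≤ energyConst K γ C ∧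
    S.ε ^ (-(profile K 1 : ℝ)) * ‖(modeEnergy ρ S.τ S.φ S.ψ S.u₀ S.v₀ n 1 : ℂ) -
      almostInv K ρ S.τ S.ε ν S.z l (n * S.τ)‖ ≤
        variationConst K s γ ρ B C * S.ε ^ (1 - 2 * ν) := by
  have hK := S.hK
  have hs : 0 ≤ s := by linarith [S.hs]
  have hθ := S.θ_pos
  have hd : 0 < S.δ ^ (1 - 2 * ν) := S.δ_rpow_pos _
  have hd1 : S.δ ^ (1 - 2 * ν) ≤ 1 := Real.rpow_le_one S.δ_pos.le S.δ_le_one hθ.le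
  have hd2 : 0 < S.δ ^ (2 * (1 - 2 * ν)) := S.δ_rpow_pos _
  have hm := mfeConst_nonneg S
  have hlip := lipConst_nonneg S
  have hsolve := solveConst_nonneg S
  have hY0 := wnorm_nonneg s S.Ytot
  have hC'0 : 0 ≤ C' := hY0.trans hC'
  have hK1 : (1 : ℝ) ≤ 2 * K := by exact_mod_cast (by omega : 1 ≤ 2 * K)
  have hYd : 2 * K * (S.δ ^ (1 - 2 * ν) * wnorm s S.Ytot) ≤ 1 := by
    refine le_trans ?_ h1
    have := mul_le_mul_of_nonneg_left hC' hd.le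
    nlinarith
  have hYd' : S.δ ^ (1 - 2 * ν) * wnorm s S.Ytot ≤ 1 :=
    (le_mul_of_one_le_left (mul_nonneg hd.le hY0) hK1).trans hYd
  have hP : wnorm s S.Ptot ≤ majorantConst K C := S.wnorm_Ptot_le hC hYd'
  have hU0 : 0 ≤ majorantConst K C := (wnorm_nonneg _ _).trans hP
  have hU := mul_le_mul_of_nonneg_left hP hm
  have hg : 0 ≤ growthConst s γ ρ B (mfeConst K γ * majorantConst K C) := (Real.exp_pos _).le
  have hst : 0 ≤ stepFactor s γ ρ B (mfeConst K γ * majorantConst K C) := by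
    have := S.hγ
    have := S.B_nonneg
    have := mul_nonneg hm hU0
    unfold stepFactor
    positivity
  -- Here `K ≥ 3` is needed: one factor `δ^(1-2ν)` absorbs the constant that depends on `C₀`, and
  -- the other two are the accuracy required in the first mode.
  have hpow : S.δ ^ (K * (1 - 2 * ν)) ≤ S.δ ^ (1 - 2 * ν) * S.δ ^ (2 * (1 - 2 * ν)) := by
    rw [← Real.rpow_add S.δ_pos]
    refine S.δ_rpow_anti ?_
    have h : (3 : ℝ) ≤ K := by exact_mod_cast hK
    nlinarith
  have herr : growthConst s γ ρ B (mfeConst K γ * majorantConst K C) *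
      (lipConst s ρ B * wnorm s S.Ytot ^ 2 * S.δ ^ (K * (1 - 2 * ν))) ≤
      errorConst K s γ ρ B C C' * S.δ ^ (1 - 2 * ν) * S.δ ^ (2 * (1 - 2 * ν)) := by
    have h4 := mul_le_mul (mul_le_mul_of_nonneg_left (pow_le_pow_left₀ hY0 hC' 2) hlip) hpow
      (S.δ_rpow_pos _).le (mul_nonneg hlip (sq_nonneg C'))
    refine (mul_le_mul_of_nonneg_left h4 hg).trans_eq ?_
    unfold errorConst
    ring
  have hd21 : S.δ ^ (2 * (1 - 2 * ν)) ≤ 1 :=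
    Real.rpow_le_one S.δ_pos.le S.δ_le_one (by linarith)
  have hE := S.wnorm_errE_le hU (by
    rw [mul_assoc]
    refine (mul_le_mul_of_nonneg_left herr hst).trans ?_
    have := mul_le_mul_of_nonneg_right h3 hd2.le
    linarith) n hn
  have hE2 : wnorm s (S.errE n) ≤ S.δ ^ (2 * (1 - 2 * ν)) := by
    refine hE.trans (herr.trans ?_)
    exact mul_le_of_le_one_left hd2.le h2
  refine ⟨S.weightedEnergy_le hU hn (hE2.trans hd21), ?_⟩
  have hW0 : 0 ≤ residualConst K s γ ρ B C := by
    unfold residualConst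
    have := mul_nonneg hlip (mul_self_nonneg C)
    positivity
  have hW : ∀ j : S.J, idx j = 1 →
      S.residual j ≤ S.δ ^ (1 + 2 * (1 - 2 * ν)) * residualConst K s γ ρ B C := by
    intro j hj
    refine S.residual_first_le hj (S.sum_G_three_le hj hC) (le_trans ?_ hYd)
    exact mul_le_mul_of_nonneg_left (mul_le_mul_of_nonneg_left ((le_abs_self _).trans
      (le_wnorm hs S.Ytot j)) hd.le) (by linarith)
  have hdev0 : 0 ≤ deviationConst K s γ ρ B C := by
    unfold deviationConst
    positivity
  have hmode := S.modeEnergy_sub_le S.idx_one hn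
    ((le_abs_self _).trans ((le_wnorm hs S.Ptot 1).trans hP)) (e₀ := deviationConst K s γ ρ B C) (by
      have h4 := (le_abs_self _).trans ((le_wnorm hs (S.errE n) 1).trans hE2)
      have h5 := mul_le_mul_of_nonneg_left (mul_le_mul_of_nonneg_left (hW 1 S.idx_one)
        (S.δ_rpow_pos (-1)).le) hm
      rw [← mul_assoc (S.δ ^ (-1 : ℝ)), ← Real.rpow_add S.δ_pos, neg_add_cancel_left] at h5
      unfold deviationConst
      linarith) hdev0
  have hx : S.ε ^ (ν / 2) * (n * S.τ) = ((n : ℤ) : ℝ) * S.h := by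
    unfold h; push_cast; ring
  have hinv := S.almostInv_one_sub_le hl (t := n * S.τ) (by rw [hx]; exact S.nh_le hn) hP hW
  rw [hx] at hinv
  have hnorm : ‖(modeEnergy ρ S.τ S.φ S.ψ S.u₀ S.v₀ n 1 : ℂ) -
      almostInv K ρ S.τ S.ε ν S.z l (n * S.τ)‖ ≤
      S.δ ^ (2 + 2 * (1 - 2 * ν)) * variationConst K s γ ρ B C := by
    have h4 := norm_sub_le_norm_sub_add_norm_sub
      (modeEnergy ρ S.τ S.φ S.ψ S.u₀ S.v₀ n 1 : ℂ) ((S.diagEnergy 1 (((n : ℤ) : ℝ) * S.h) : ℝ) : ℂ)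
      (almostInv K ρ S.τ S.ε ν S.z l (n * S.τ))
    rw [← Complex.ofReal_sub, Complex.norm_real, Real.norm_eq_abs, norm_sub_rev
      ((S.diagEnergy 1 (((n : ℤ) : ℝ) * S.h) : ℝ) : ℂ)] at h4
    refine h4.trans ((add_le_add hmode hinv).trans_eq ?_)
    unfold variationConst
    ring
  have he : profile K 1 = 1 := by
    unfold profile; rw [if_neg one_ne_zero, if_pos (by omega)]
  have h5 := S.ε_neg_mul_δ 1 (2 * (1 - 2 * ν))
  rw [Nat.cast_one, mul_one] at h5
  rw [he, S.ε_rpow (1 - 2 * ν), ← h5, Nat.cast_one]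
  refine (mul_le_mul_of_nonneg_left hnorm (Real.rpow_pos_of_pos S.hε _).le).trans_eq ?_
  ring

theorem exists_energy_bounds (K : ℕ) (ν s γ ρ B A₀ : ℝ) : ∃ A : ℝ, 0 < A ∧ ∀ C₀ : ℝ,
    ∃ η : ℝ, 0 < η ∧ η ≤ 1 ∧ ∀ S : Setting K ν s γ ρ B, S.ε ^ (1 - 2 * ν) ≤ η →
      weightedEnergy K ρ S.τ S.ε s S.φ S.ψ S.u₀ S.v₀ 0 ≤ C₀ →
      ∑ l : Fin (S.M + 1), weight s l * S.ε ^ (-(profile K l : ℝ)) *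
          ‖almostInv K ρ S.τ S.ε ν S.z l 0‖ ≤ A₀ →
      ∀ l : Fin (S.M + 1), (l : ℕ) = 1 → ∀ n : ℕ, n * S.τ ≤ 1 →
        weightedEnergy K ρ S.τ S.ε s S.φ S.ψ S.u₀ S.v₀ n ≤ A ∧
        S.ε ^ (-(profile K 1 : ℝ)) * ‖(modeEnergy ρ S.τ S.φ S.ψ S.u₀ S.v₀ n 1 : ℂ) -
          almostInv K ρ S.τ S.ε ν S.z l (n * S.τ)‖ ≤ A * S.ε ^ (1 - 2 * ν) := by
  -- `C` depends on the bound `A₀` alone and is chosen before `C₀`; the crude constant `C'` below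
  -- may depend on `C₀`. The `1` added to `A₀` leaves room for the comparison error.
  obtain ⟨C, hC0, hC⟩ := exists_wnorm_Lead_le K ν s γ ρ B √(4 * (A₀ + 1))
  refine ⟨|energyConst K γ C| + |variationConst K s γ ρ B C| + 1, by positivity, fun C₀ => ?_⟩
  obtain ⟨C', hC'0, hC'⟩ := exists_wnorm_Y_le K ν s γ ρ B √(8 * C₀)
  set T := 2 * K * C' with hT
  set a := |2 * K * T|
  set b := |errorConst K s γ ρ B C T|
  set c := |stepFactor s γ ρ B (mfeConst K γ * majorantConst K C) * errorConst K s γ ρ B C T|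
  set d := |(|invarErrConst K s γ ρ 1| * T ^ 2)|
  set X := a + b + c + d with hX
  have ha : 0 ≤ a := abs_nonneg _
  have hb : 0 ≤ b := abs_nonneg _
  have hc : 0 ≤ c := abs_nonneg _
  have hdd : 0 ≤ d := abs_nonneg _
  have hX0 : 0 ≤ X := by positivity
  have hX1 : 0 < 1 + X := by linarith
  -- The square appears because `ε^(1-2ν) = (δ^(1-2ν))²`. `X` collects every quantity containing the
  -- crude bound that has to be beaten by one factor `δ^(1-2ν)`.
  refine ⟨(1 / (1 + X)) ^ 2, by positivity, pow_le_one₀ (by positivity)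
    (by rw [div_le_one hX1]; linarith), fun S hη hE₀ hA₀ l hl n hn => ?_⟩
  have hδ : S.δ ^ (1 - 2 * ν) ≤ 1 / (1 + X) := by
    refine abs_le_of_sq_le_sq' (le_trans (le_of_eq ?_) hη) (by positivity) |>.2
    rw [S.ε_rpow, two_mul (1 - 2 * ν), Real.rpow_add S.δ_pos, sq]
  have hd0 : 0 < S.δ ^ (1 - 2 * ν) := S.δ_rpow_pos _
  have hsmall : ∀ x : ℝ, |x| ≤ X → x * S.δ ^ (1 - 2 * ν) ≤ 1 := by
    intro x hx
    calc x * S.δ ^ (1 - 2 * ν) ≤ (1 + X) * (1 / (1 + X)) :=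
          mul_le_mul (by linarith [le_abs_self x]) hδ hd0.le hX1.le
      _ = 1 := mul_one_div_cancel hX1.ne'
  have hY : wnorm s S.Ytot ≤ T := S.wnorm_Ytot_le (hC' S (S.wnorm_initVal_le hE₀))
  have hY0 := wnorm_nonneg s S.Ytot
  have h1 := hsmall (2 * K * T) (by change a ≤ X; linarith)
  have hYd : S.δ ^ (1 - 2 * ν) * wnorm s S.Ytot ≤ 1 := by
    have hK1 : (1 : ℝ) ≤ 2 * K := by
      have := S.hK
      exact_mod_cast (by omega : 1 ≤ 2 * K)
    have h4 := mul_le_mul_of_nonneg_left hY hd0.le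
    have h5 : S.δ ^ (1 - 2 * ν) * T ≤ 2 * K * (S.δ ^ (1 - 2 * ν) * T) :=
      le_mul_of_one_le_left (mul_nonneg hd0.le (hY0.trans hY)) hK1
    linarith
  have hdiag : wnorm s S.diagVal ≤ √(4 * (A₀ + 1)) := by
    refine Real.le_sqrt_of_sq_le (S.wnorm_diagVal_sq_le hA₀ ?_)
    have h4 := hsmall (|invarErrConst K s γ ρ 1| * T ^ 2) (by change d ≤ X; linarith)
    have h5 := mul_le_mul (le_abs_self (invarErrConst K s γ ρ 1)) (mul_le_mul_of_nonneg_left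
      (pow_le_pow_left₀ hY0 hY 2) hd0.le) (mul_nonneg hd0.le (sq_nonneg _)) (abs_nonneg _)
    linarith
  have hfin := S.energy_bounds (hC S hdiag hYd) hY h1
    (hsmall _ (by change b ≤ X; linarith)) (hsmall _ (by change c ≤ X; linarith)) hl hn
  have h6 := le_abs_self (energyConst K γ C)
  have h7 := le_abs_self (variationConst K s γ ρ B C)
  have h8 := abs_nonneg (energyConst K γ C)
  have h9 := abs_nonneg (variationConst K s γ ρ B C)
  exact ⟨hfin.1.trans (by linarith), hfin.2.trans (mul_le_mul_of_nonneg_right (by linarith)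
    (Real.rpow_pos_of_pos S.hε _).le)⟩

end Setting

end TrigInt

end

/-! ### The theorem -/

theorem theorem6 (K : ℕ) (hK : 3 ≤ K) (ν s γ ρ : ℝ) (hν : 0 ≤ ν) (hν' : ν < 1 / 2)
    (hs : 1 / 2 < s) (hγ : 0 < γ) (hγ' : γ ≤ 1) (hρ : 0 < ρ)
    (φ ψ : ℝ → ℝ) (hfilter : TrigInt.IsSymplecticFilter φ ψ) (A₀ : ℝ) :
    ∃ A : ℝ, 0 < A ∧ ∀ C₀ : ℝ, ∃ η : ℝ, 0 < η ∧
      ∀ (M : ℕ) [NeZero M] (τ ε : ℝ), K ≤ M → 0 < τ → 0 < ε → ε ^ (1 - 2 * ν) ≤ η →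
      TrigInt.NonResonant M K ρ τ ε ν γ →
      ∀ u₀ v₀ : ZMod (2 * M) → ℂ, TrigInt.IsRealValued u₀ → TrigInt.IsRealValued v₀ →
      TrigInt.weightedEnergy K ρ τ ε s φ ψ u₀ v₀ 0 ≤ C₀ →
      ∀ z : ZMod (2 * M) → (Fin (M + 1) → ℤ) → ℕ → Polynomial ℂ,
      TrigInt.IsModulation K ρ τ ε ν φ ψ u₀ v₀ z →
      (∀ n : ℕ, n * τ ≤ 1 →
        ∑ l : Fin (M + 1), TrigInt.weight s l * ε ^ (-(TrigInt.profile K l : ℝ)) *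
          ‖TrigInt.almostInv K ρ τ ε ν z l (n * τ)‖ ≤ A₀) →
      ∀ n : ℕ, n * τ ≤ 1 →
        TrigInt.weightedEnergy K ρ τ ε s φ ψ u₀ v₀ n ≤ A ∧
        ε ^ (-(TrigInt.profile K 1 : ℝ)) *
          ‖(TrigInt.modeEnergy ρ τ φ ψ u₀ v₀ n 1 : ℂ) -
            TrigInt.almostInv K ρ τ ε ν z 1 (n * τ)‖ ≤ A * ε ^ (1 - 2 * ν) := by
  obtain ⟨B, hB⟩ := hfilter.bounded_phi
  obtain ⟨A, hA, h⟩ := TrigInt.Setting.exists_energy_bounds K ν s γ ρ B A₀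
  refine ⟨A, hA, fun C₀ => ?_⟩
  obtain ⟨η, hη, hη1, h⟩ := h C₀
  refine ⟨η, hη, ?_⟩
  intro M _ τ ε hKM hτ hε hεη hres u₀ v₀ hu₀ hv₀ hE₀ z hz hinv n hn
  -- Follows from `ε^(1-2ν) ≤ η ≤ 1`, as the exponent is positive.
  have hε1 : ε ≤ 1 := by
    by_contra hlt
    exact absurd (Real.one_lt_rpow (not_le.1 hlt) (by linarith : 0 < 1 - 2 * ν))
      (not_lt.2 (hεη.trans hη1))
  have h0 := hinv 0 (by simp)
  rw [Nat.cast_zero, zero_mul] at h0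
  have hl : ((1 : Fin (M + 1)) : ℕ) = 1 := by
    rw [Fin.val_one', Nat.mod_eq_of_lt (by omega)]
  exact h ⟨M, ‹_›, τ, ε, φ, ψ, u₀, v₀, z, hK, hν, hν', hs, hγ, hρ, hKM, hτ, hε, hε1, hB,
    hfilter.symplectic, hres, hu₀, hv₀, hz⟩ hεη hE₀ h0 1 hl n hn
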